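/- Let $n\ge 3$ and $\ell=\lfloor n/2\rfloor$. A dominant $SO(n)$-weight is a tuple $\mu\in\mathbb Z^\ell$ with $\mu_1\ge\cdots\ge\mu_{\ell-1}\ge|\mu_\ell|$ if $n$ is even and $\mu_1\ge\cdots\ge\mu_\ell\ge 0$ if $n$ is odd; $V(\mu)$ is the irreducible (complex) $SO(n)$-module with highest weight $\mu$, and also the bundle associated to it on an oriented Riemannian $n$-manifold. For $w\in\mathbb R$, $V[w|\mu]$ denotes the corresponding bundle on an oriented conformal $n$-manifold, of density weight $w$: in a metric of the conformal class its sections are sections of $V(\mu)$, and under $g\mapsto\Omega^2g$ (with orthonormal frames rescaled by $\Omega^{-1}$) their components are multiplied by $\Omega^w$. Let $\mathsf P=\frac1{n-2}\bigl(\mathrm{Ric}-\frac{\mathrm{Scal}}{2(n-1)}g\bigr)$ be the Schouten tensor, $\nabla$ the Levi-Civita connection, $e_i$ the $i$-th standard basis vector of $\mathbb Z^\ell$, and $\tilde\lambda_i=\lambda_i+\frac{n-2i}2$. Theorem. Let $\lambda\in\mathbb Z^\ell$ and $1\le i\le\ell$ be such that $\lambda+2e_i$ and $\lambda-2e_i$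 are dominant $SO(n)$-weights. Then, for either choice of sign, $V(\lambda\mp2e_i)$ occurs exactly once in $(\otimes^4\mathbb R^n)\otimes V(\lambda\pm2e_i)$, and, with $\mathrm{Proj}_{V(\lambda\mp2e_i)}$ the $SO(n)$-equivariant projection onto it, the operator $$\mathrm{Proj}_{V(\lambda\mp2e_i)}\bigl(\nabla_a\nabla_b\nabla_c\nabla_d+10\,\mathsf P_{ab}\nabla_c\nabla_d+10(\nabla_a\mathsf P_{bc})\nabla_d+3(\nabla_a\nabla_b\mathsf P_{cd})+9\,\mathsf P_{ab}\mathsf P_{cd}\bigr)\big|_{V(\lambda\pm2e_i)}$$ is a differential operator of order exactly four which is conformally invariant $$V[\mp\tilde\lambda_i+2-\tfrac n2\,|\,\lambda\pm2e_i]\to V[\mp\tilde\lambda_i-2-\tfrac n2\,|\,\lambda\mp2e_i],$$ that is, all metrics in the conformal class define the same operator between these bundles. In particular, in dimension $4$, if $\lambda_1\ge|\lambda_2|+2$, this formula gives conformally invariant fourth-order operators $V[\mp(\lambda_1+1)\,|\,\lambda_1\pm2,\lambda_2]\to V[\mp(\lambda_1+1)-4\,|\,\lambda_1\mp2,\lambda_2]$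 and $V[\mp\lambda_2\,|\,\lambda_1,\lambda_2\pm2]\to V[\mp\lambda_2-4\,|\,\lambda_1,\lambda_2\mp2]$; and, as the special case $\lambda=(2,0)$, conformally invariant fourth-order operators $V[0\,|\,2,\pm2]\to V[-4\,|\,2,\mp2]$ (on self-dual and anti-self-dual Weyl tensor densities). -/

import Mathlib

open scoped Manifold ContDiff

universe u v

noncomputable section

namespace ConformalOp

/-! ### The group `SO(n)`, its Lie algebra, and its representations -/

/-- The special orthogonal group `SO(n)`. -/
abbrev SO (n : ℕ) : Type := Matrix.specialOrthogonalGroup (Fin n) ℝ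

/-- The Lie algebra `𝔰𝔬(n)` of skew-symmetric real matrices. -/
def so (n : ℕ) : Submodule ℝ (Matrix (Fin n) (Fin n) ℝ) where
  carrier := {X | X.transpose = -X}
  add_mem' {X Y} hX hY := by
    rw [Set.mem_ofPred_eq] at *
    rw [Matrix.transpose_add, hX, hY, neg_add]
  zero_mem' := by simp
  smul_mem' c X hX := by
    rw [Set.mem_ofPred_eq] at *
    rw [Matrix.transpose_smul, hX, smul_neg]

theorem exp_mem_SO {n : ℕ} (X : Matrix (Fin n) (Fin n) ℝ) (hX : X.transpose = -X) :
    NormedSpace.exp X ∈ Matrix.specialOrthogonalGroup (Fin n) ℝ := by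
  have h1 : NormedSpace.exp X * (NormedSpace.exp X).transpose = 1 := by
    rw [← Matrix.exp_transpose, hX, ← Matrix.exp_add_of_commute _ _ (Commute.neg_right (Commute.refl X))]
    simp
  have h2 : (NormedSpace.exp X).det * (NormedSpace.exp X).det = 1 := by
    have := congrArg Matrix.det h1
    rwa [Matrix.det_mul, Matrix.det_transpose, Matrix.det_one] at this
  have h3 : 0 ≤ (NormedSpace.exp X).det := by
    have : X = (1 / 2 : ℝ) • X + (1 / 2 : ℝ) • X := by
      rw [← add_smul]; norm_num
    rw [this, Matrix.exp_add_of_commute _ _ rfl, Matrix.det_mul]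
    exact mul_self_nonneg _
  rw [Matrix.mem_specialOrthogonalGroup_iff, Matrix.mem_orthogonalGroup_iff]
  refine ⟨h1, ?_⟩
  nlinarith

/-- The exponential map `𝔰𝔬(n) → SO(n)`. -/
def soExp {n : ℕ} (X : so n) : SO n :=
  ⟨NormedSpace.exp X.1, exp_mem_SO X.1 X.2⟩

/-- The differential `dρ(X) v = d/dt ρ(exp tX) v |_{t = 0}` of a representation of `SO(n)`. -/
def infAction {n : ℕ} {V : Type v} [NormedAddCommGroup V] [NormedSpace ℂ V]
    (ρ : Representation ℂ (SO n) V) (X : so n) (v : V) : V :=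
  deriv (fun t : ℝ => ρ (soExp (t • X)) v) 0

/-- The infinitesimal rotation in the `j`-th coordinate plane (with coordinates `2j`, `2j + 1`,
counted from zero), `j = 0, …, ⌊n/2⌋ - 1`.  These span a Cartan subalgebra of `𝔰𝔬(n)`. -/
def cartan (n : ℕ) (j : Fin (n / 2)) : so n :=
  have h : 2 * (j : ℕ) + 1 < n := by have := j.isLt; omega
  let k : Fin n := ⟨2 * (j : ℕ), Nat.lt_of_succ_lt h⟩
  let l : Fin n := ⟨2 * (j : ℕ) + 1, h⟩
  ⟨Matrix.single l k 1 - Matrix.single k l 1, by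
    change Matrix.transpose _ = _
    rw [Matrix.transpose_sub, Matrix.transpose_single,
      Matrix.transpose_single, neg_sub]⟩

/-- `lam` is a weight of `ρ`: there is a nonzero `v` with `dρ(H_j) v = i lam_j v` for all `j`. -/
def IsWeight {n : ℕ} {V : Type v} [NormedAddCommGroup V] [NormedSpace ℂ V]
    (ρ : Representation ℂ (SO n) V) (lam : Fin (n / 2) → ℤ) : Prop :=
  ∃ v : V, v ≠ 0 ∧ ∀ j, infAction ρ (cartan n j) v = (Complex.I * (lam j : ℂ)) • v

/-- `lam` is the highest weight of `ρ`, for the lexicographic order on weights (whose positive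
roots are `e_i ± e_j` for `i < j` and, if `n` is odd, `e_i`). -/
def IsHighestWeight {n : ℕ} {V : Type v} [NormedAddCommGroup V] [NormedSpace ℂ V]
    (ρ : Representation ℂ (SO n) V) (lam : Fin (n / 2) → ℤ) : Prop :=
  IsWeight ρ lam ∧ ∀ mu : Fin (n / 2) → ℤ, IsWeight ρ mu → toLex mu ≤ toLex lam

/-- The dominant `SO(n)`-weights: `lam_1 ≥ ⋯ ≥ |lam_ℓ|` for even `n = 2ℓ` and
`lam_1 ≥ ⋯ ≥ lam_ℓ ≥ 0` for odd `n = 2ℓ + 1`. -/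
def IsDominant (n : ℕ) (lam : Fin (n / 2) → ℤ) : Prop :=
  (∀ i j, i < j → |lam j| ≤ lam i) ∧ (Odd n → ∀ i, 0 ≤ lam i)

/-- The `i`-th entry of `lam + ρ_{𝔰𝔬(n)}`, where `ρ_{𝔰𝔬(n)} = ((n-2)/2, (n-4)/2, …)`
(the index `i` is counted from zero). -/
def rhoShift (n : ℕ) (lam : Fin (n / 2) → ℤ) (i : Fin (n / 2)) : ℝ :=
  (lam i : ℝ) + ((n : ℝ) - 2 * ((i : ℕ) + 1)) / 2

/-- An irreducible finite-dimensional continuous complex representation of `SO(n)` with highest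
weight `lam`; it is unique up to isomorphism, and is the `SO(n)`-module `V(lam)`. -/
structure Irrep (n : ℕ) (lam : Fin (n / 2) → ℤ) where
  /-- the underlying vector space -/
  carrier : Type v
  [normedAddCommGroup : NormedAddCommGroup carrier]
  [normedSpace : NormedSpace ℂ carrier]
  [finiteDimensional : FiniteDimensional ℂ carrier]
  /-- the action of `SO(n)` -/
  rep : Representation ℂ (SO n) carrier
  continuous_rep : ∀ v, Continuous fun A => rep A v
  irreducible : rep.IsIrreducible
  highestWeight : IsHighestWeight rep lam

attribute [instance] Irrep.normedAddCommGroup Irrep.normedSpace Irrep.finiteDimensional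

/-- The action of `A ∈ SO(n)` on `(⊗⁴ E) ⊗ V`, where `E = ℝⁿ ≅ (ℝⁿ)*` is the defining
representation and an element of `(⊗⁴ E) ⊗ V` is given by its components `T_{abcd} ∈ V`. -/
def tensorAction {n : ℕ} {lam : Fin (n / 2) → ℤ} (V : Irrep.{v} n lam) (A : SO n)
    (T : (Fin 4 → Fin n) → V.carrier) : (Fin 4 → Fin n) → V.carrier :=
  fun J => ∑ K : Fin 4 → Fin n, (∏ s, A.1 (J s) (K s)) • V.rep A (T K)

/-- The space of `SO(n)`-equivariant linear maps `(⊗⁴ E) ⊗ V → W`. -/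
def equivariantMaps {n : ℕ} {lam mu : Fin (n / 2) → ℤ} (V : Irrep.{v} n lam)
    (W : Irrep.{v} n mu) :
    Submodule ℂ (((Fin 4 → Fin n) → V.carrier) →ₗ[ℂ] W.carrier) where
  carrier := {p | ∀ A T, p (tensorAction V A T) = W.rep A (p T)}
  add_mem' hp hq A T := by simp [hp A T, hq A T]
  zero_mem' A T := by simp
  smul_mem' c p hp A T := by simp [hp A T]

/-! ### Metrics, frames, and the Levi-Civita connection -/

section Geometry

variable {n : ℕ} {M : Type u} [TopologicalSpace M] [ChartedSpace (EuclideanSpace ℝ (Fin n)) M]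
  [IsManifold (𝓡 n) ∞ M]

variable (n M) in
/-- Smooth Riemannian metrics on `M`. -/
abbrev Metric : Type u :=
  Bundle.ContMDiffRiemannianMetric (𝓡 n) ∞ (EuclideanSpace ℝ (Fin n))
    (fun x : M => TangentSpace (𝓡 n) x)

/-- `g` belongs to the conformal class of `g₀`: `g = Ω² g₀` with `Ω` smooth and positive. -/
def IsConformalTo (g₀ g : Metric n M) : Prop :=
  ∃ Om : M → ℝ, ContMDiff (𝓡 n) 𝓘(ℝ, ℝ) ∞ Om ∧ (∀ x, 0 < Om x) ∧
    ∀ x (a b : TangentSpace (𝓡 n) x), g.inner x a b = Om x ^ 2 * g₀.inner x a b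

/-- The vector fields `e_1, …, e_n` are smooth on `U`. -/
def IsSmoothOn (e : Fin n → ∀ x : M, TangentSpace (𝓡 n) x) (U : Set M) : Prop :=
  ∀ i, ContMDiffOn (𝓡 n) (𝓡 n).tangent ∞ (fun x => (⟨x, e i x⟩ : TangentBundle (𝓡 n) M)) U

/-- `u_1, …, u_n` is a basis of `T_x M` defining the orientation `o`. -/
def IsPositiveBasis {x : M} (o : Orientation ℝ (TangentSpace (𝓡 n) x) (Fin n))
    (u : Fin n → TangentSpace (𝓡 n) x) : Prop :=
  ∃ b : Module.Basis (Fin n) ℝ (TangentSpace (𝓡 n) x), (∀ i, b i = u i) ∧ b.orientation = o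

variable (n M) in
/-- An orientation of the manifold `M`: an orientation of every tangent space, such that there are
smooth positively oriented frames near every point. -/
structure ManifoldOrientation where
  /-- the orientation of the tangent space at `x` -/
  orient : ∀ x : M, Orientation ℝ (TangentSpace (𝓡 n) x) (Fin n)
  exists_frame : ∀ x : M, ∃ U : Set M, IsOpen U ∧ x ∈ U ∧
    ∃ e : Fin n → ∀ y : M, TangentSpace (𝓡 n) y,
      IsSmoothOn e U ∧ ∀ y ∈ U, IsPositiveBasis (orient y) (fun i => e i y)

/-- `u` is an oriented conformal frame at `x`: a positive basis of `T_x M` that is orthonormal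
up to a scale. -/
def IsConfFrame (g : Metric n M) (o : ManifoldOrientation n M) (x : M)
    (u : Fin n → TangentSpace (𝓡 n) x) : Prop :=
  IsPositiveBasis (o.orient x) u ∧
    ∃ r : ℝ, 0 < r ∧ ∀ i j, g.inner x (u i) (u j) = if i = j then r ^ 2 else 0

/-- `e` is a smooth oriented `g`-orthonormal frame on `U`. -/
def IsOrthoFrameOn (g : Metric n M) (o : ManifoldOrientation n M)
    (e : Fin n → ∀ x : M, TangentSpace (𝓡 n) x) (U : Set M) : Prop :=
  IsSmoothOn e U ∧ ∀ x ∈ U, IsPositiveBasis (o.orient x) (fun i => e i x) ∧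
    ∀ i j, g.inner x (e i x) (e j x) = if i = j then 1 else 0

/-- The Levi-Civita connection coefficients `Γ_{abc} = g(∇_{e_a} e_b, e_c)` in an orthonormal
frame, by the Koszul formula. -/
def conn (g : Metric n M) (e : Fin n → ∀ x : M, TangentSpace (𝓡 n) x) (x : M)
    (a b c : Fin n) : ℝ :=
  (g.inner x (VectorField.mlieBracket (𝓡 n) (e a) (e b) x) (e c x)
    - g.inner x (VectorField.mlieBracket (𝓡 n) (e b) (e c) x) (e a x)
    + g.inner x (VectorField.mlieBracket (𝓡 n) (e c) (e a) x) (e b x)) / 2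

theorem conn_skew (g : Metric n M) (e : Fin n → ∀ x : M, TangentSpace (𝓡 n) x) (x : M)
    (a b c : Fin n) : conn g e x a c b = - conn g e x a b c := by
  unfold conn
  rw [VectorField.mlieBracket_swap_apply (V := e a) (W := e c),
    VectorField.mlieBracket_swap_apply (V := e c) (W := e b),
    VectorField.mlieBracket_swap_apply (V := e b) (W := e a)]
  simp only [map_neg, neg_apply]
  ring

/-- The connection matrix `ω(e_a) ∈ 𝔰𝔬(n)`, with `∇_{e_a} e_b = ∑_c ω(e_a)_{cb} e_c`. -/
def connMatrix (g : Metric n M) (e : Fin n → ∀ x : M, TangentSpace (𝓡 n) x) (x : M)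
    (a : Fin n) : so n :=
  ⟨Matrix.of fun c b => conn g e x a b c, by
    change Matrix.transpose _ = _
    ext i j
    simp [conn_skew g e x a j i]⟩

/-- The covariant derivative, in an orthonormal frame, of a `k`-tensor with values in the vector
bundle associated to an `SO(n)`-module `V` with infinitesimal action `L`:
`(∇T)_{a b…c} = e_a(T_{b…c}) + L(ω(e_a)) T_{b…c} - ∑_d (Γ_{abd} T_{d…c} + ⋯ + Γ_{acd} T_{b…d})`.
The index of the new derivative comes first. -/
def nabla {V : Type v} [NormedAddCommGroup V] [NormedSpace ℝ V] (g : Metric n M)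
    (e : Fin n → ∀ x : M, TangentSpace (𝓡 n) x) (L : so n → V → V) {k : ℕ}
    (T : M → (Fin k → Fin n) → V) : M → (Fin (k + 1) → Fin n) → V :=
  fun x J =>
    mvfderiv (𝓡 n) (fun y => T y (Fin.tail J)) x (e (J 0) x)
      + L (connMatrix g e x (J 0)) (T x (Fin.tail J))
      - ∑ s : Fin k, ∑ d : Fin n,
          conn g e x (J 0) (J s.succ) d • T x (Function.update (Fin.tail J) s d)

/-- The components `g(R(e_a, e_b) e_c, e_d)` of the Riemann curvature tensor
`R(X, Y) Z = ∇_X ∇_Y Z - ∇_Y ∇_X Z - ∇_{[X, Y]} Z` in an orthonormal frame. -/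
def curvature (g : Metric n M) (e : Fin n → ∀ x : M, TangentSpace (𝓡 n) x) (x : M)
    (a b c d : Fin n) : ℝ :=
  mvfderiv (𝓡 n) (fun y => conn g e y b c d) x (e a x)
    - mvfderiv (𝓡 n) (fun y => conn g e y a c d) x (e b x)
    + ∑ k, (conn g e x b c k * conn g e x a k d - conn g e x a c k * conn g e x b k d)
    - ∑ k, (conn g e x a b k - conn g e x b a k) * conn g e x k c d

/-- The Ricci tensor (positive on round spheres). -/
def ricci (g : Metric n M) (e : Fin n → ∀ x : M, TangentSpace (𝓡 n) x) (x : M)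
    (b c : Fin n) : ℝ :=
  ∑ a, curvature g e x a b c a

/-- The Schouten tensor `P = (Ric - Scal / (2 (n - 1)) g) / (n - 2)`, as a 2-tensor. -/
def schouten (g : Metric n M) (e : Fin n → ∀ x : M, TangentSpace (𝓡 n) x) (x : M)
    (J : Fin 2 → Fin n) : ℝ :=
  (ricci g e x (J 0) (J 1)
    - (∑ c, ricci g e x c c) / (2 * ((n : ℝ) - 1)) * (if J 0 = J 1 then 1 else 0)) / ((n : ℝ) - 2)

/-- The `(⊗⁴ E) ⊗ V`-valued expression
`(∇_a∇_b∇_c∇_d + 10 P_{ab}∇_c∇_d + 10 (∇_a P_{bc})∇_d + 3 (∇_a∇_b P_{cd}) + 9 P_{ab}P_{cd}) f`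
in an orthonormal frame, for a section of the bundle associated to `V` that is represented in the
frame by the `V`-valued function `f`. -/
def fourthOrder {lam : Fin (n / 2) → ℤ} (V : Irrep.{v} n lam) (g : Metric n M)
    (e : Fin n → ∀ x : M, TangentSpace (𝓡 n) x) (f : M → V.carrier) (x : M)
    (J : Fin 4 → Fin n) : V.carrier :=
  let D0 : M → (Fin 0 → Fin n) → V.carrier := fun y _ => f y
  let D1 := nabla g e (infAction V.rep) D0
  let D2 := nabla g e (infAction V.rep) D1
  let D3 := nabla g e (infAction V.rep) D2
  let D4 := nabla g e (infAction V.rep) D3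
  let P0 : M → (Fin 2 → Fin n) → ℝ := schouten g e
  let P1 := nabla g e (fun _ _ => 0) P0
  let P2 := nabla g e (fun _ _ => 0) P1
  D4 x J
    + (10 * P0 x ![J 0, J 1]) • D2 x ![J 2, J 3]
    + (10 * P1 x ![J 0, J 1, J 2]) • D1 x ![J 3]
    + (3 * P2 x J) • f x
    + (9 * P0 x ![J 0, J 1] * P0 x ![J 2, J 3]) • f x

/-! ### Sections of weighted bundles, and conformal invariance -/

/-- The space of smooth sections of the bundle `V[w | lam]` over the oriented conformal manifold
`(M, [g₀])`.  This bundle is associated to the bundle of oriented conformal frames, with structure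
group `CO(n) = ℝ₊ × SO(n)`, so a section is a function `φ` that assigns to every such frame `u` at
`x` an element of `V(lam)`, with `φ(r u A) = r^{-w} A⁻¹ φ(u)` for `r > 0` and `A ∈ SO(n)`
(so the components of a section of density weight `w` are multiplied by `Ω^w` under
`g ↦ Ω² g`).  For definiteness `φ` is extended by zero to tuples that are not such frames. -/
def weightedSections (g₀ : Metric n M) (o : ManifoldOrientation n M) (w : ℝ)
    {lam : Fin (n / 2) → ℤ} (V : Irrep.{v} n lam) :
    Submodule ℂ (∀ x : M, (Fin n → TangentSpace (𝓡 n) x) → V.carrier) where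
  carrier := {φ |
    (∀ x u, ¬ IsConfFrame g₀ o x u → φ x u = 0) ∧
    (∀ x u u', IsConfFrame g₀ o x u → ∀ (r : ℝ) (A : SO n), 0 < r →
      (∀ j, u' j = r • ∑ i, A.1 i j • u i) → φ x u' = r ^ (-w) • V.rep A⁻¹ (φ x u)) ∧
    (∀ (U : Set M) (e : Fin n → ∀ x : M, TangentSpace (𝓡 n) x), IsOpen U → IsSmoothOn e U →
      (∀ x ∈ U, IsConfFrame g₀ o x (fun i => e i x)) →
      ContMDiffOn (𝓡 n) 𝓘(ℝ, V.carrier) ∞ (fun x => φ x (fun i => e i x)) U)}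
  add_mem' := by
    rintro φ ψ ⟨h1, h2, h3⟩ ⟨k1, k2, k3⟩
    refine ⟨fun x u hu => ?_, fun x u u' hu r A hr h => ?_, fun U e hU he hc => ?_⟩
    · simp [h1 x u hu, k1 x u hu]
    · simp [h2 x u u' hu r A hr h, k2 x u u' hu r A hr h]
    · exact (h3 U e hU he hc).add (k3 U e hU he hc)
  zero_mem' := by
    refine ⟨fun x u hu => rfl, fun x u u' hu r A hr h => by simp, fun U e hU he hc => ?_⟩
    exact contMDiffOn_const
  smul_mem' := by
    rintro c φ ⟨h1, h2, h3⟩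
    refine ⟨fun x u hu => ?_, fun x u u' hu r A hr h => ?_, fun U e hU he hc => ?_⟩
    · simp [h1 x u hu]
    · change c • φ x u' = r ^ (-w) • V.rep A⁻¹ (c • φ x u)
      rw [h2 x u u' hu r A hr h, map_smul, smul_comm]
    · have hc' : ContMDiffOn (𝓡 n) 𝓘(ℝ, V.carrier →L[ℝ] V.carrier) ∞
          (fun _ : M => c • ContinuousLinearMap.id ℝ V.carrier) U := contMDiffOn_const
      exact hc'.clm_apply (h3 U e hU he hc)

/-- The compression by `p` of the fourth-order expression is a conformally invariant differential
operator `V[w | lam] → V[w' | mu]`: there is exactly one operator between the spaces of sections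
that, for *every* metric `g` in the conformal class of `g₀`, is given by the expression formed with
the Levi-Civita connection and the Schouten tensor of `g`, in every oriented `g`-orthonormal
frame. -/
def IsInvariantOperator (g₀ : Metric n M) (o : ManifoldOrientation n M)
    {lam mu : Fin (n / 2) → ℤ} (V : Irrep.{v} n lam) (W : Irrep.{v} n mu) (w w' : ℝ)
    (p : ((Fin 4 → Fin n) → V.carrier) →ₗ[ℂ] W.carrier) : Prop :=
  ∃! D : weightedSections g₀ o w V →ₗ[ℂ] weightedSections g₀ o w' W,
    ∀ g : Metric n M, IsConformalTo g₀ g →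
    ∀ (U : Set M) (e : Fin n → ∀ x : M, TangentSpace (𝓡 n) x), IsOpen U →
      IsOrthoFrameOn g o e U →
    ∀ (φ : weightedSections g₀ o w V), ∀ x ∈ U,
      (D φ).1 x (fun i => e i x) = p (fourthOrder V g e (fun y => φ.1 y (fun i => e i y)) x)

end Geometry

/-- `Proj_{V(mu)}` and the operator formed with it.  The `SO(n)`-equivariant maps
`(⊗⁴ E) ⊗ V(lam) → V(mu)` form a one-dimensional space, so that the projection onto `V(mu)` makes
sense and is unique up to a scalar factor; the compression by a nonzero such map has nonzero
principal symbol, so it has order exactly four; and on every oriented conformal `n`-manifold it is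
a conformally invariant operator `V[w | lam] → V[w' | mu]`. -/
def CompressionIsInvariant {n : ℕ} {lam mu : Fin (n / 2) → ℤ} (V : Irrep.{v} n lam)
    (W : Irrep.{v} n mu) (w w' : ℝ) : Prop :=
  Module.finrank ℂ (equivariantMaps V W) = 1 ∧
  (∀ p ∈ equivariantMaps V W, p ≠ 0 →
    ∃ (xi : Fin n → ℝ) (v : V.carrier), p (fun J => (∏ s, xi (J s)) • v) ≠ 0) ∧
  ∀ (M : Type u) [TopologicalSpace M] [ChartedSpace (EuclideanSpace ℝ (Fin n)) M]
    [IsManifold (𝓡 n) ∞ M] (g₀ : Metric n M) (o : ManifoldOrientation n M),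
    ∀ p ∈ equivariantMaps V W, IsInvariantOperator g₀ o V W w w' p

end ConformalOp

end

/-! Let `p : (⊗⁴ℝⁿ) ⊗ V → W` be equivariant, where the highest weights of `V` and `W` differ by four
times one weight `γ = ±e_i` of `ℝⁿ`, and let `w` be the density weight on `V`.

Algebra. Since `W` sits at an extreme position, `p` is determined by one number. Compose `p` with a
functional on `W` that sees only the highest weight. Lowering operators can be shifted from one
tensor factor to the others at no cost, and comparison of weights leaves only the value on `b_γ ⊗
b_γ ⊗ b_γ ⊗ b_γ ⊗ v`, with `v` a highest weight vector (`eq_zero_of_topTensor`). So the multiplicity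
is at most one, and every invariant endomorphism `τ` of the source satisfies `p ∘ τ = const · p`,
with the constant read off on that tensor. Permutations of the indices act trivially, traces are
killed because `b_γ` is null, and the coupling of an index with the `𝔰𝔬(n)`-action on `V` acts as a
scalar `c`, which turns out to be `3 - w` (`exists_isTopProjection`). Existence comes from explicit
highest weight vectors in tensor products with `ℝⁿ` (`IsHWV.exists_consT`), used four times,
together with averaging over the group. The symbol is nonzero because the null vector `b_γ` is
reached from real covectors by polynomial continuation.

Geometry. Work modulo the subspaces of tensors of each degree that `ker p` absorbs
(`IsTensorIdeal`): indices become symmetric, the metric becomes zero, the coupling becomes `c`. For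
`g' = Ω² g` and `Y = d log Ω`, the derivative of a `k`-tensor `Ω^s T` becomes `Ω^(s-1) (∇ + (s + c -
k) Y) T`, and the Schouten tensor becomes `Ω^(-2) (P - ∇Y + Y Y)`. As `w + c = 3`, successive
derivatives carry the shifts `3, 1, -1, -3`. By the Leibniz rule the operator of the theorem is `∇⁴
+ 3 P∇² + 4 ∇P∇ + 3 ∇²P + 9 PP`, and `quartic_operator_identity` states that this expression does
not change when `∇` and `P` are replaced by their shifted versions: all terms containing `Y` cancel.
This is conformal invariance (`IsTensorIdeal.quartic_rescaling`).

Foundations. Continuous representations are smooth and `SO(n)` is generated by exponentials, so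
invariance can be tested on the Lie algebra. The frame expressions transform tensorially under
changes of orthonormal frames; for the curvature this is deduced from the Ricci identity. Hence the
local formulas define one global operator, and uniqueness follows since orthonormal frames exist
near every point. -/

noncomputable section

namespace ConformalOp

/-! ### Continuous representations of `SO(n)` extend to smooth functions of the matrix entries -/

/-- Square arrays of reals, with their sup norm. -/
abbrev Mat (n : ℕ) : Type := Fin n → Fin n → ℝ

/-- The array of entries of a matrix. -/
def ent {n : ℕ} (A : Matrix (Fin n) (Fin n) ℝ) : Mat n := fun i j => A i j

theorem SO.mul_transpose {n : ℕ} (A : SO n) : A.1 * A.1.transpose = 1 := by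
  have := (Matrix.mem_specialOrthogonalGroup_iff.1 A.2).1
  exact (Matrix.mem_orthogonalGroup_iff (A := A.1)).1 this

theorem SO.transpose_mul {n : ℕ} (A : SO n) : A.1.transpose * A.1 = 1 := by
  rw [mul_eq_one_comm]; exact SO.mul_transpose A

theorem SO.coe_inv {n : ℕ} (A : SO n) : (A⁻¹ : SO n).1 = A.1.transpose := by
  have h1 : (A⁻¹ : SO n).1 * A.1 = 1 := congrArg Subtype.val (inv_mul_cancel A)
  calc (A⁻¹ : SO n).1 = (A⁻¹ : SO n).1 * (A.1 * A.1.transpose) := by rw [SO.mul_transpose, mul_one]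
    _ = _ := by rw [← mul_assoc, h1, one_mul]

theorem SO.row_sq {n : ℕ} (A : SO n) (i : Fin n) : ∑ j, A.1 i j ^ 2 = 1 := by
  have := congrFun (congrFun (SO.mul_transpose A) i) i
  simpa [Matrix.mul_apply, sq] using this

theorem SO.entry_sq_le {n : ℕ} (A : SO n) (i j : Fin n) : A.1 i j ^ 2 ≤ 1 := by
  rw [← SO.row_sq A i]
  exact Finset.single_le_sum (f := fun j => A.1 i j ^ 2) (fun _ _ => sq_nonneg _) (Finset.mem_univ j)

theorem SO.abs_entry_le {n : ℕ} (A : SO n) (i j : Fin n) : |A.1 i j| ≤ 1 :=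
  abs_le_one_iff_mul_self_le_one.2 (by have := SO.entry_sq_le A i j; nlinarith)

instance SO.isTopologicalGroup (n : ℕ) : IsTopologicalGroup (SO n) where
  continuous_inv := by
    refine Continuous.subtype_mk (f := fun A : SO n => (A⁻¹ : SO n).1) ?_ _
    simp_rw [SO.coe_inv]
    exact continuous_subtype_val.matrix_transpose

theorem SO.continuous_entry {n : ℕ} (i j : Fin n) : Continuous fun A : SO n => ent A.1 i j :=
  continuous_subtype_val.matrix_elem i j

instance SO.compactSpace (n : ℕ) : CompactSpace (SO n) := by
  refine isCompact_iff_compactSpace 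
    (s := ((Matrix.specialOrthogonalGroup (Fin n) ℝ : Submonoid _) : Set (Matrix (Fin n) (Fin n) ℝ))).1 ?_
  have hK : IsCompact {B : Fin n → Fin n → ℝ | ∀ i j, B i j ∈ Set.Icc (-1 : ℝ) 1} := by
    have := isCompact_univ_pi fun _ : Fin n =>
      isCompact_univ_pi fun _ : Fin n => isCompact_Icc (a := (-1 : ℝ)) (b := 1)
    convert this using 1
    ext B
    exact ⟨fun h i _ j _ => h i j, fun h i j => h i trivial j trivial⟩
  have hK' : IsCompact {B : Matrix (Fin n) (Fin n) ℝ | ∀ i j, B i j ∈ Set.Icc (-1 : ℝ) 1} := hK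
  refine hK'.of_isClosed_subset ?_ ?_
  · have : (Matrix.specialOrthogonalGroup (Fin n) ℝ : Set (Matrix (Fin n) (Fin n) ℝ)) =
        {B | B * B.transpose = 1} ∩ {B | B.det = 1} := by
      ext B
      simp only [SetLike.mem_coe, Matrix.mem_specialOrthogonalGroup_iff, Set.mem_inter_iff,
        Matrix.mem_orthogonalGroup_iff]
      rfl
    rw [this]
    refine IsClosed.inter (isClosed_eq (by fun_prop) continuous_const) (isClosed_eq ?_ continuous_const)
    exact continuous_id.matrix_det
  · intro B hB i j
    exact abs_le.1 (SO.abs_entry_le ⟨B, hB⟩ i j)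

instance SO.metrizable (n : ℕ) : TopologicalSpace.MetrizableSpace (SO n) := by
  have : TopologicalSpace.MetrizableSpace (Matrix (Fin n) (Fin n) ℝ) :=
    inferInstanceAs (TopologicalSpace.MetrizableSpace (Fin n → Fin n → ℝ))
  exact Topology.IsEmbedding.subtypeVal.metrizableSpace

instance SO.measurableSpace (n : ℕ) : MeasurableSpace (SO n) := borel _
instance SO.borelSpace (n : ℕ) : BorelSpace (SO n) := ⟨rfl⟩

/-- A Haar measure on `SO(n)`. -/
def SO.haar (n : ℕ) : MeasureTheory.Measure (SO n) := MeasureTheory.Measure.haar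

instance (n : ℕ) : (SO.haar n).IsHaarMeasure :=
  inferInstanceAs (MeasureTheory.Measure.IsHaarMeasure MeasureTheory.Measure.haar)

theorem SO.integrable {n : ℕ} {F : Type*} [NormedAddCommGroup F] {f : SO n → F}
    (hf : Continuous f) : MeasureTheory.Integrable f (SO.haar n) := by
  have := hf.continuousOn.integrableOn_compact (μ := SO.haar n) isCompact_univ
  simpa using this

/-- The integrand is polynomial in `B`, so no differentiation under the integral is needed: one
factor of the power is expanded, its coefficients `B i j` leave the integral, and the entries of `A`
are absorbed into the weight. The induction on `m` therefore has to run over all continuous `h`. -/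
theorem contDiff_integral_pow {n : ℕ} {F : Type*} [NormedAddCommGroup F] [NormedSpace ℝ F]
    (c : ℝ) (m : ℕ) : ∀ h : SO n → F, Continuous h →
    ContDiff ℝ ∞ fun B : Mat n =>
      ∫ A, (∑ i, ∑ j, B i j * ent A.1 i j + c) ^ m • h A ∂(SO.haar n) := by
  have hcont : ∀ (B : Mat n), Continuous fun A : SO n => (∑ i, ∑ j, B i j * ent A.1 i j + c) := by
    intro B
    refine (continuous_finsetSum _ fun i _ => continuous_finsetSum _ fun j _ => ?_).add continuous_const
    exact continuous_const.mul (SO.continuous_entry i j)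
  induction m with
  | zero => intro h hh; simpa using contDiff_const
  | succ m ih =>
    intro h hh
    have hint : ∀ (B : Mat n) (k : SO n → F), Continuous k → MeasureTheory.Integrable
        (fun A : SO n => (∑ i, ∑ j, B i j * ent A.1 i j + c) ^ m • k A) (SO.haar n) :=
      fun B k hk => SO.integrable (((hcont B).pow m).smul hk)
    have key : ∀ B : Mat n, ∫ A, (∑ i, ∑ j, B i j * ent A.1 i j + c) ^ (m + 1) • h A ∂(SO.haar n) =
        (∑ i, ∑ j, B i j • ∫ A, (∑ i, ∑ j, B i j * ent A.1 i j + c) ^ m • (ent A.1 i j • h A) ∂(SO.haar n))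
        + ∫ A, (∑ i, ∑ j, B i j * ent A.1 i j + c) ^ m • (c • h A) ∂(SO.haar n) := by
      intro B
      have hi : ∀ i j, Continuous fun A : SO n => ent A.1 i j • h A := fun i j =>
        (SO.continuous_entry i j).smul hh
      simp_rw [← MeasureTheory.integral_smul]
      have e1 : ∀ i, ∑ j, ∫ A, B i j • (∑ i, ∑ j, B i j * ent A.1 i j + c) ^ m • (ent A.1 i j • h A)
          ∂(SO.haar n) = ∫ A, ∑ j, B i j • (∑ i, ∑ j, B i j * ent A.1 i j + c) ^ m •
            (ent A.1 i j • h A) ∂(SO.haar n) := fun i =>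
        (MeasureTheory.integral_finsetSum _ fun j _ => (hint B _ (hi i j)).smul (B i j)).symm
      have hsum : ∀ i, MeasureTheory.Integrable (fun A : SO n => ∑ j, B i j •
          (∑ i, ∑ j, B i j * ent A.1 i j + c) ^ m • (ent A.1 i j • h A)) (SO.haar n) := fun i =>
        MeasureTheory.integrable_finsetSum _ fun j _ => (hint B _ (hi i j)).smul (B i j)
      rw [Finset.sum_congr rfl fun i _ => e1 i,
        ← MeasureTheory.integral_finsetSum _ fun i _ => hsum i,
        ← MeasureTheory.integral_add]
      · congr 1
        ext A
        rw [pow_succ, mul_smul, add_smul, smul_add, Finset.sum_smul, Finset.smul_sum]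
        congr 1
        refine Finset.sum_congr rfl fun i _ => ?_
        rw [Finset.sum_smul, Finset.smul_sum]
        refine Finset.sum_congr rfl fun j _ => ?_
        simp only [smul_smul]
        congr 1
        ring
      · exact MeasureTheory.integrable_finsetSum _ fun i _ => hsum i
      · exact hint B _ (continuous_const.smul hh)
    simp_rw [key]
    refine ContDiff.add (ContDiff.sum fun i _ => ContDiff.sum fun j _ => ?_) (ih _ (hh.const_smul c))
    refine ContDiff.smul ?_ (ih _ ((SO.continuous_entry i j).smul hh))
    fun_prop

/-- Entries are at most one, so trace `n` forces a unit diagonal, and rows of unit length then have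
no other entries. Thus the trace peaks only at the identity. -/
theorem SO.trace_lt {n : ℕ} (A : SO n) (hA : A ≠ 1) : ∑ i, ent A.1 i i < n := by
  by_contra hcon
  push Not at hcon
  have hle : ∀ i, ent A.1 i i ≤ 1 := fun i => (abs_le.1 (SO.abs_entry_le A i i)).2
  have hdiag : ∀ i, ent A.1 i i = 1 := by
    by_contra hne
    push Not at hne
    obtain ⟨i, hi⟩ := hne
    have : ∑ i, ent A.1 i i < ∑ i : Fin n, (1 : ℝ) :=
      Finset.sum_lt_sum (fun i _ => hle i) ⟨i, Finset.mem_univ _, lt_of_le_of_ne (hle i) hi⟩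
    simp at this
    linarith
  apply hA
  ext i j
  by_cases hij : i = j
  · subst hij; rw [show A.1 i i = 1 from hdiag i]; simp
  · have h1 : ∑ j, ent A.1 i j ^ 2 = 1 := SO.row_sq A i
    rw [← Finset.add_sum_erase _ _ (Finset.mem_univ i), hdiag i] at h1
    have h2 : ∑ j ∈ Finset.univ.erase i, ent A.1 i j ^ 2 = 0 := by linarith
    rw [Finset.sum_eq_zero_iff_of_nonneg (fun _ _ => sq_nonneg _)] at h2
    have := h2 j (by simp [Ne.symm hij])
    have h3 : ent A.1 i j = 0 := by simpa using this
    replace h3 : A.1 i j = 0 := h3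
    rw [h3]; simp [hij]

/-- A continuous representation of `SO(n)` is the restriction of a smooth function of the
matrix entries. -/
theorem exists_contDiff_extension {n : ℕ} {V : Type v} [NormedAddCommGroup V] [NormedSpace ℂ V]
    [FiniteDimensional ℂ V] (ρ : Representation ℂ (SO n) V)
    (hρ : ∀ v, Continuous fun A => ρ A v) :
    ∃ R : Mat n → V →L[ℝ] V, ContDiff ℝ ∞ R ∧ ∀ (A : SO n) (v : V), R (ent A.1) v = ρ A v := by
  let h : SO n → V →L[ℝ] V := fun A => LinearMap.toContinuousLinearMap ((ρ A).restrictScalars ℝ)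
  have hh : Continuous h := continuous_clm_apply.2 fun v => hρ v
  have hmul : ∀ A B, h (A * B) = h A * h B := by
    intro A B; ext v; simp [h]
  have hone : h 1 = 1 := by ext v; simp [h]
  -- Convolution of the representation with powers of `tr(Bᵀ A) + n + 1`. The shift by `n + 1` makes
  -- the base positive at `B = 1`, because traces are at least `-n`.
  let G : ℕ → Mat n → V →L[ℝ] V := fun m B =>
    ∫ A, (∑ i, ∑ j, B i j * ent A.1 i j + (n + 1)) ^ m • h A ∂(SO.haar n)
  have hG : ∀ m, ContDiff ℝ ∞ (G m) := fun m => contDiff_integral_pow _ m h hh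
  have htr : ∀ A : SO n, ∑ i, ∑ j, ent (1 : SO n).1 i j * ent A.1 i j = ∑ i, ent A.1 i i := by
    intro A
    simp [ent, Matrix.one_apply]
  -- By left invariance of Haar measure and `tr(Bᵀ B A) = tr A`, on the group `G m` is the
  -- representation times the value of `G m` at the identity.
  have hequi : ∀ m (B : SO n), G m (ent B.1) = h B * G m (ent (1 : SO n).1) := by
    intro m B
    have h1 : h B * G m (ent (1 : SO n).1) =
        ∫ A, h B * ((∑ i, ent A.1 i i + (n + 1)) ^ m • h A) ∂(SO.haar n) := by
      simp only [G, htr]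
      refine ((ContinuousLinearMap.mul ℝ (V →L[ℝ] V) (h B)).integral_comp_comm ?_).symm
      refine SO.integrable ?_
      exact Continuous.smul (((continuous_finsetSum _ fun i _ => SO.continuous_entry i i).add
        continuous_const).pow m) hh
    change ∫ A, _ ∂(SO.haar n) = _
    rw [h1, ← MeasureTheory.integral_mul_left_eq_self
      (μ := SO.haar n) (fun A => (∑ i, ∑ j, ent B.1 i j * ent A.1 i j + (n + 1 : ℝ)) ^ m • h A) B]
    congr 1
    ext1 A
    rw [hmul, mul_smul_comm]
    congr 3
    have : B.1.transpose * (B * A).1 = A.1 := by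
      change B.1.transpose * (B.1 * A.1) = A.1
      rw [← mul_assoc, SO.transpose_mul, one_mul]
    calc ∑ i, ∑ j, ent B.1 i j * ent (B * A).1 i j = Matrix.trace (B.1.transpose * (B * A).1) := by
          simp only [Matrix.trace, Matrix.diag, Matrix.mul_apply, Matrix.transpose_apply, ent]
          rw [Finset.sum_comm]
      _ = _ := by rw [this]; rfl
  -- Normalised powers of a peak function form an approximate identity at `1`, so for large `m` the
  -- value of `G m` at the identity is invertible and can be divided out.
  have hpeak : Filter.Tendsto (fun m : ℕ => (∫ A in Set.univ, (∑ i, ent A.1 i i + (n + 1 : ℝ)) ^ m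
      ∂(SO.haar n))⁻¹ • ∫ A in Set.univ, (∑ i, ent A.1 i i + (n + 1 : ℝ)) ^ m • h A ∂(SO.haar n))
      Filter.atTop (nhds (h 1)) := by
    have hlow : ∀ A : SO n, (-n : ℝ) ≤ ∑ i, ent A.1 i i := by
      intro A
      have : ∑ i : Fin n, (-1 : ℝ) ≤ ∑ i, ent A.1 i i :=
        Finset.sum_le_sum fun i _ => (abs_le.1 (SO.abs_entry_le A i i)).1
      simpa using this
    refine tendsto_setIntegral_pow_smul_of_unique_maximum_of_isCompact_of_continuousOn
      isCompact_univ (c := fun A : SO n => ∑ i, ent A.1 i i + (n + 1 : ℝ)) ?_ ?_ ?_ ?_ ?_ hh.continuousOn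
    · exact ((continuous_finsetSum _ fun i _ => SO.continuous_entry i i).add
        continuous_const).continuousOn
    · intro A _ hA
      have := SO.trace_lt A hA
      have h1 : ∑ i, ent (1 : SO n).1 i i = n := by simp [ent]
      simp only [h1]
      linarith
    · intro A _
      have := hlow A
      linarith
    · have := hlow 1
      linarith
    · simp
  rw [hone] at hpeak
  have hopen : IsOpen {x : V →L[ℝ] V | IsUnit x} := Units.isOpen
  obtain ⟨m, hm⟩ := (hpeak.eventually (hopen.mem_nhds isUnit_one)).exists
  simp only [MeasureTheory.Measure.restrict_univ] at hm
  have hm' : IsUnit (G m (ent (1 : SO n).1)) := by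
    simp only [G, htr]
    set a := ∫ A : SO n, (∑ i, ent A.1 i i + (n + 1 : ℝ)) ^ m ∂(SO.haar n)
    -- If the normalising integral were zero, its inverse would be the default value zero and `hm`
    -- would make zero a unit; in the zero ring every element is a unit.
    by_cases ha : a = 0
    · rw [ha] at hm
      simp only [inv_zero, zero_smul] at hm
      have hsub : Subsingleton (V →L[ℝ] V) := isUnit_zero_iff.1 hm |> fun h01 =>
        subsingleton_of_zero_eq_one h01
      exact isUnit_of_subsingleton _
    · have := (IsUnit.mk0 a ha)
      obtain ⟨u, hu⟩ := this
      have h2 := hm.smul u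
      rwa [Units.smul_def, hu, smul_smul, mul_inv_cancel₀ ha, one_smul] at h2
  obtain ⟨P, hP⟩ := hm'
  refine ⟨fun B => G m B * (P⁻¹ : (V →L[ℝ] V)ˣ), (hG m).mul contDiff_const, fun A v => ?_⟩
  change (G m (ent A.1) * _) v = _
  rw [hequi, ← hP, mul_assoc, Units.mul_inv, mul_one]
  rfl

/-! ### `SO(n)` is generated by exponentials -/

/-- The reflection in the hyperplane orthogonal to a vector `v`. -/
def reflMatrix {n : ℕ} (v : Fin n → ℝ) : Matrix (Fin n) (Fin n) ℝ :=
  1 - (2 / (v ⬝ᵥ v)) • Matrix.vecMulVec v v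

theorem reflMatrix_smul {n : ℕ} (v : Fin n → ℝ) (c : ℝ) (hc : c ≠ 0) :
    reflMatrix (c • v) = reflMatrix v := by
  unfold reflMatrix
  congr 1
  simp only [dotProduct_smul, smul_dotProduct, Matrix.smul_vecMulVec, Matrix.vecMulVec_smul, smul_smul,
    smul_eq_mul]
  congr 1
  by_cases h : v ⬝ᵥ v = 0
  · simp [h]
  · field_simp

theorem det_reflMatrix {n : ℕ} (v : Fin n → ℝ) (hv : v ≠ 0) : (reflMatrix v).det = -1 := by
  have h : v ⬝ᵥ v ≠ 0 := by rwa [Ne, dotProduct_self_eq_zero]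
  have : reflMatrix v = 1 + Matrix.vecMulVec (-(2 / (v ⬝ᵥ v)) • v) v := by
    rw [reflMatrix, Matrix.smul_vecMulVec, neg_smul, sub_eq_add_neg]
  rw [this, Matrix.vecMulVec_eq Unit, Matrix.det_one_add_replicateCol_mul_replicateRow]
  simp only [dotProduct_smul, smul_eq_mul]
  field_simp
  norm_num

theorem reflMatrix_mul_self {n : ℕ} (v : Fin n → ℝ) (hv : v ⬝ᵥ v = 1) :
    reflMatrix v * reflMatrix v = 1 := by
  simp only [reflMatrix, hv, sub_mul, mul_sub, one_mul, mul_one, Matrix.smul_mul, Matrix.mul_smul,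
    Matrix.vecMulVec_mul_vecMulVec, one_smul, smul_smul]
  module

section
attribute [local instance] Matrix.linftyOpNormedRing Matrix.linftyOpNormedAlgebra

theorem hasDerivAt_matrix_exp {n : ℕ} (X : Matrix (Fin n) (Fin n) ℝ) (t : ℝ) :
    HasDerivAt (fun s : ℝ => NormedSpace.exp (s • X)) (X * NormedSpace.exp (t • X)) t :=
  hasDerivAt_exp_smul_const' X t

/-- The exponential is differentiated in an operator norm, whereas representations are extended to
sup-normed arrays; the linear identification carries derivatives across. -/
theorem hasDerivAt_ent {n : ℕ} {f : ℝ → Matrix (Fin n) (Fin n) ℝ} {f' : Matrix (Fin n) (Fin n) ℝ}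
    {t : ℝ} (h : HasDerivAt f f' t) : HasDerivAt (fun s => ent (f s)) (ent f') t := by
  let T : Matrix (Fin n) (Fin n) ℝ →ₗ[ℝ] Mat n :=
    { toFun := ent, map_add' := fun _ _ => rfl, map_smul' := fun _ _ => rfl }
  exact (LinearMap.toContinuousLinearMap T).hasFDerivAt.comp_hasDerivAt t h

theorem hasDerivAt_ent_exp {n : ℕ} (X : Matrix (Fin n) (Fin n) ℝ) (t : ℝ) :
    HasDerivAt (fun s : ℝ => ent (NormedSpace.exp (s • X))) (ent (X * NormedSpace.exp (t • X))) t :=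
  hasDerivAt_ent (hasDerivAt_matrix_exp X t)

theorem hasDerivAt_ent_conj {n : ℕ} (X Y : Matrix (Fin n) (Fin n) ℝ) :
    HasDerivAt (fun s : ℝ => ent (NormedSpace.exp (s • X) * Y * NormedSpace.exp (s • (-X))))
      (ent (X * Y - Y * X)) 0 := by
  have h := ((hasDerivAt_matrix_exp X 0).mul_const Y).mul (hasDerivAt_matrix_exp (-X) 0)
  have := hasDerivAt_ent h
  simpa [sub_eq_add_neg] using this

/-- Uniqueness for a linear differential equation: `exp (-tX) f t` has zero derivative. -/
theorem eq_exp_mul_of_hasDerivAt {n : ℕ} (X : Matrix (Fin n) (Fin n) ℝ)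
    (f : ℝ → Matrix (Fin n) (Fin n) ℝ) (hf : ∀ t, HasDerivAt f (X * f t) t) (t : ℝ) :
    f t = NormedSpace.exp (t • X) * f 0 := by
  have hd : ∀ s, HasDerivAt (fun s => NormedSpace.exp (s • (-X)) * f s) 0 s := by
    intro s
    have h := (hasDerivAt_exp_smul_const (-X) s).mul (hf s)
    exact h.congr_deriv (by rw [mul_assoc, neg_mul, mul_neg, neg_add_cancel])
  have hc := is_const_of_deriv_eq_zero (fun s => (hd s).differentiableAt) (fun s => (hd s).deriv) t 0
  simp only [zero_smul, NormedSpace.exp_zero, one_mul] at hc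
  rw [← hc, ← mul_assoc, ← Matrix.exp_add_of_commute]
  · simp
  · exact ((Commute.refl X).neg_right.smul_left t).smul_right t

/-- Two reflections compose to a rotation by twice the angle between their vectors. As a function of
the angle, the moving reflection solves `f' = X f` with `X = 2 (b aᵀ - a bᵀ)`, and at angle zero it
cancels against the fixed one. -/
theorem reflMatrix_rotation {n : ℕ} (a b : Fin n → ℝ) (ha : a ⬝ᵥ a = 1) (hb : b ⬝ᵥ b = 1)
    (hab : a ⬝ᵥ b = 0) (t : ℝ) :
    reflMatrix (Real.cos t • a + Real.sin t • b) * reflMatrix a =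
      NormedSpace.exp (t • (2 : ℝ) • (Matrix.vecMulVec b a - Matrix.vecMulVec a b)) := by
  have hba : b ⬝ᵥ a = 0 := by rw [dotProduct_comm, hab]
  have hn : ∀ t : ℝ, (Real.cos t • a + Real.sin t • b) ⬝ᵥ (Real.cos t • a + Real.sin t • b) = 1 := by
    intro t
    simp only [add_dotProduct, dotProduct_add, smul_dotProduct, dotProduct_smul, ha, hb, hab, hba,
      smul_eq_mul]
    have := Real.cos_sq_add_sin_sq t
    linear_combination this
  set P := Matrix.vecMulVec a a
  set Q := Matrix.vecMulVec b b
  set S := Matrix.vecMulVec a b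
  set T := Matrix.vecMulVec b a
  have hform : ∀ t : ℝ, reflMatrix (Real.cos t • a + Real.sin t • b) =
      1 - ((2 * Real.cos t ^ 2) • P + (2 * (Real.cos t * Real.sin t)) • (S + T)
        + (2 * Real.sin t ^ 2) • Q) := by
    intro t
    rw [reflMatrix, hn]
    simp only [Matrix.add_vecMulVec, Matrix.vecMulVec_add, Matrix.smul_vecMulVec, Matrix.vecMulVec_smul]
    simp only [P, Q, S, T]
    module
  have hd : ∀ t, HasDerivAt (fun t => reflMatrix (Real.cos t • a + Real.sin t • b))
      (((2 : ℝ) • (T - S)) * reflMatrix (Real.cos t • a + Real.sin t • b)) t := by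
    intro t
    have h1 : HasDerivAt (fun t => 2 * Real.cos t ^ 2) (2 * (2 * Real.cos t * (-Real.sin t))) t := by
      simpa using ((Real.hasDerivAt_cos t).pow 2).const_mul 2
    have h2 : HasDerivAt (fun t => 2 * Real.sin t ^ 2) (2 * (2 * Real.sin t * Real.cos t)) t := by
      simpa using ((Real.hasDerivAt_sin t).pow 2).const_mul 2
    have h3 : HasDerivAt (fun t => 2 * (Real.cos t * Real.sin t))
        (2 - 4 * Real.sin t ^ 2) t :=
      (((Real.hasDerivAt_cos t).mul (Real.hasDerivAt_sin t)).const_mul 2).congr_deriv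
        (by linear_combination 2 * Real.sin_sq_add_cos_sq t)
    have h := (((h1.smul_const P).add (h3.smul_const (S + T))).add (h2.smul_const Q)).const_sub 1
    have hfun : (fun t => reflMatrix (Real.cos t • a + Real.sin t • b)) = _ := funext hform
    rw [hfun, hform t]
    refine h.congr_deriv ?_
    have e1 : S * S = 0 := by simp [S, Matrix.vecMulVec_mul_vecMulVec, hba]
    have e2 : S * T = P := by simp [S, T, P, Matrix.vecMulVec_mul_vecMulVec, hb]
    have e3 : T * S = Q := by simp [S, T, Q, Matrix.vecMulVec_mul_vecMulVec, ha]
    have e4 : T * T = 0 := by simp [T, Matrix.vecMulVec_mul_vecMulVec, hab]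
    have e5 : S * P = 0 := by simp [S, P, Matrix.vecMulVec_mul_vecMulVec, hba]
    have e6 : S * Q = S := by simp [S, Q, Matrix.vecMulVec_mul_vecMulVec, hb]
    have e7 : T * P = T := by simp [T, P, Matrix.vecMulVec_mul_vecMulVec, ha]
    have e8 : T * Q = 0 := by simp [T, Q, Matrix.vecMulVec_mul_vecMulVec, hab]
    simp only [mul_sub, mul_one, mul_add, Matrix.smul_mul, Matrix.mul_smul, sub_mul, e1, e2, e3,
      e4, e5, e6, e7, e8]
    have hcs := Real.sin_sq_add_cos_sq t
    have hc : Real.cos t ^ 2 = 1 - Real.sin t ^ 2 := by linarith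
    simp only [hc]
    module
  have h := eq_exp_mul_of_hasDerivAt _ _ hd t
  rw [h, mul_assoc]
  simp only [Real.cos_zero, Real.sin_zero, one_smul, zero_smul, add_zero]
  rw [reflMatrix_mul_self a ha, mul_one]

end

/-- The subgroup of `SO(n)` generated by the exponentials. -/
def expSubgroup (n : ℕ) : Subgroup (SO n) := Subgroup.closure (Set.range soExp)

/-- After normalisation, either the vectors agree up to sign and the product is the identity, or
Gram–Schmidt completes the second one to an orthonormal basis of their plane and the product is a
rotation of it, hence an exponential. The angle is the arccosine of the inner product. -/
theorem reflMatrix_mul_mem {n : ℕ} (u v : Fin n → ℝ) (hu : u ≠ 0) (hv : v ≠ 0) :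
    ∃ g ∈ expSubgroup n, g.1 = reflMatrix u * reflMatrix v := by
  have norm : ∀ w : Fin n → ℝ, w ≠ 0 → ∃ w', reflMatrix w' = reflMatrix w ∧ w' ⬝ᵥ w' = 1 := by
    intro w hw
    have h : 0 < w ⬝ᵥ w := lt_of_le_of_ne (Finset.sum_nonneg fun i _ => mul_self_nonneg (w i))
      (by rw [Ne, eq_comm, dotProduct_self_eq_zero]; exact hw)
    have hs := Real.sqrt_pos.2 h
    refine ⟨(Real.sqrt (w ⬝ᵥ w))⁻¹ • w, reflMatrix_smul _ _ (inv_ne_zero hs.ne'), ?_⟩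
    simp only [smul_dotProduct, dotProduct_smul, smul_eq_mul]
    have := Real.mul_self_sqrt h.le
    field_simp
    rw [sq, this]
  obtain ⟨u', hu', hu1⟩ := norm u hu
  obtain ⟨a, ha', ha⟩ := norm v hv
  rw [← hu', ← ha']
  by_cases hua : u' = a
  · exact ⟨1, one_mem _, by rw [hua, reflMatrix_mul_self a ha]; rfl⟩
  by_cases hua' : u' = -a
  · refine ⟨1, one_mem _, ?_⟩
    rw [hua', ← neg_one_smul ℝ a, reflMatrix_smul _ _ (by norm_num), reflMatrix_mul_self a ha]; rfl
  set c := u' ⬝ᵥ a with hc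
  have hca : a ⬝ᵥ u' = c := by rw [dotProduct_comm]
  have hw : (u' - c • a) ⬝ᵥ (u' - c • a) = 1 - c ^ 2 := by
    simp only [sub_dotProduct, dotProduct_sub, smul_dotProduct, dotProduct_smul, hu1, ha, ← hc, hca,
      smul_eq_mul]
    ring
  have h1c : 0 < 1 - c ^ 2 := by
    rw [← hw]
    refine lt_of_le_of_ne (Finset.sum_nonneg fun i _ => mul_self_nonneg _) ?_
    rw [Ne, eq_comm, dotProduct_self_eq_zero, sub_eq_zero]
    intro h
    have h2 : c * c = 1 := by
      have := hu1
      rw [h] at this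
      simpa [ha] using this
    rcases mul_self_eq_one_iff.1 h2 with h3 | h3
    · exact hua (by rw [h, h3, one_smul])
    · exact hua' (by rw [h, h3, neg_one_smul])
  have hs := Real.sqrt_pos.2 h1c
  set b := (Real.sqrt (1 - c ^ 2))⁻¹ • (u' - c • a) with hb
  have hbb : b ⬝ᵥ b = 1 := by
    simp only [hb, smul_dotProduct, dotProduct_smul, smul_eq_mul, hw]
    calc _ = (Real.sqrt (1 - c ^ 2))⁻¹ * ((Real.sqrt (1 - c ^ 2))⁻¹ *
          (Real.sqrt (1 - c ^ 2) * Real.sqrt (1 - c ^ 2))) := by rw [Real.mul_self_sqrt h1c.le]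
      _ = 1 := by field_simp
  have hab : a ⬝ᵥ b = 0 := by
    simp only [hb, dotProduct_smul, dotProduct_sub, hca, ha, smul_eq_mul]
    ring
  have hrot : u' = Real.cos (Real.arccos c) • a + Real.sin (Real.arccos c) • b := by
    rw [Real.cos_arccos (by nlinarith) (by nlinarith), Real.sin_arccos, hb, smul_smul,
      mul_inv_cancel₀ hs.ne', one_smul]
    abel
  have hX : (Real.arccos c • (2 : ℝ) • (Matrix.vecMulVec b a - Matrix.vecMulVec a b)) ∈ so n := by
    refine (so n).smul_mem _ ((so n).smul_mem _ ?_)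
    change Matrix.transpose _ = _
    rw [Matrix.transpose_sub, Matrix.transpose_vecMulVec, Matrix.transpose_vecMulVec, neg_sub]
  refine ⟨soExp ⟨_, hX⟩, Subgroup.subset_closure ⟨_, rfl⟩, ?_⟩
  rw [hrot, reflMatrix_rotation a b ha hbb hab]
  rfl

/-- Cartan–Dieudonné: an orthogonal matrix is a product of reflections. Determinant one makes their
number even, so they can be grouped in pairs, each of which lies in the subgroup. -/
theorem expSubgroup_eq_top (n : ℕ) : expSubgroup n = ⊤ := by
  rw [Subgroup.eq_top_iff']
  intro A
  -- products of reflections of even length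
  have key : ∀ k : ℕ, ∀ l : List (Fin n → ℝ), (∀ v ∈ l, v ≠ 0) → l.length = 2 * k →
      ∃ g ∈ expSubgroup n, g.1 = (l.map reflMatrix).prod := by
    intro k
    induction k with
    | zero =>
      intro l _ hl
      have : l = [] := List.length_eq_zero_iff.1 (by simpa using hl)
      exact ⟨1, one_mem _, by simp [this]⟩
    | succ k ih =>
      intro l hl hlen
      match l, hl, hlen with
      | u :: v :: l, hl, hlen =>
        obtain ⟨g, hg, hg'⟩ := reflMatrix_mul_mem u v (hl u (by simp)) (hl v (by simp))
        obtain ⟨g2, hg2, hg2'⟩ := ih l (fun w hw => hl w (by simp [hw])) (by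
          simp only [List.length_cons] at hlen; omega)
        refine ⟨g * g2, mul_mem hg hg2, ?_⟩
        change g.1 * g2.1 = _
        rw [hg', hg2']
        simp [mul_assoc]
  have hprod : ∃ l : List (Fin n → ℝ), (∀ v ∈ l, v ≠ 0) ∧ A.1 = (l.map reflMatrix).prod := by
    have hnorm : ∀ (B : SO n) x, ‖Matrix.toEuclideanLin B.1 x‖ = ‖x‖ := by
      intro B x
      rw [← sq_eq_sq₀ (norm_nonneg _) (norm_nonneg _), ← real_inner_self_eq_norm_sq,
        ← real_inner_self_eq_norm_sq]
      simp only [EuclideanSpace.inner_eq_star_dotProduct, Matrix.ofLp_toLpLin, Matrix.toLin'_apply, star_trivial]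
      rw [Matrix.dotProduct_mulVec, ← Matrix.mulVec_transpose, Matrix.mulVec_mulVec,
        SO.transpose_mul, Matrix.one_mulVec]
    let φ : EuclideanSpace ℝ (Fin n) ≃ₗᵢ[ℝ] EuclideanSpace ℝ (Fin n) :=
      LinearIsometryEquiv.mk (LinearEquiv.ofLinearMap (Matrix.toEuclideanLin A.1)
        (Matrix.toEuclideanLin A.1.transpose)
        (by rw [← Matrix.toLpLin_mul_same, SO.mul_transpose, Matrix.toLpLin_one])
        (by rw [← Matrix.toLpLin_mul_same, SO.transpose_mul, Matrix.toLpLin_one])) (hnorm A)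
    obtain ⟨l, -, hl⟩ := φ.reflections_generate_dim
    have hrefl : ∀ v : EuclideanSpace ℝ (Fin n), v ≠ 0 → ∀ x,
        ((ℝ ∙ v)ᗮ).reflection x = Matrix.toEuclideanLin (reflMatrix v.ofLp) x := by
      intro v hv x
      rw [Submodule.reflection_orthogonal_apply, Submodule.reflection_singleton_apply]
      ext i
      have h1 : v.ofLp ⬝ᵥ v.ofLp = ‖v‖ ^ 2 := by
        rw [← real_inner_self_eq_norm_sq, EuclideanSpace.inner_eq_star_dotProduct, star_trivial]
      have h2 : inner ℝ v x = v.ofLp ⬝ᵥ x.ofLp := by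
        rw [EuclideanSpace.inner_eq_star_dotProduct, star_trivial, dotProduct_comm]
      rw [Matrix.ofLp_toLpLin, Matrix.toLin'_apply, reflMatrix, Matrix.sub_mulVec, Matrix.one_mulVec,
        Matrix.smul_mulVec, Matrix.vecMulVec_mulVec, h1, h2]
      simp
      ring
    have hlist : ∀ l : List (EuclideanSpace ℝ (Fin n)), ∃ l' : List (Fin n → ℝ), (∀ v ∈ l', v ≠ 0) ∧
        ∀ x, (l.map fun v => ((ℝ ∙ v)ᗮ).reflection).prod x =
          Matrix.toEuclideanLin (l'.map reflMatrix).prod x := by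
      intro l
      induction l with
      | nil => exact ⟨[], by simp, fun x => by simp⟩
      | cons v l ih =>
        obtain ⟨l', hl', h⟩ := ih
        -- The list of reflections may contain zero vectors. They give the identity and are dropped,
        -- since a reflection has determinant `-1` only for a nonzero vector.
        by_cases hv : v = 0
        · refine ⟨l', hl', fun x => ?_⟩
          rw [List.map_cons, List.prod_cons, LinearIsometryEquiv.coe_mul, Function.comp_apply, h, hv]
          simp only [Submodule.span_zero_singleton, Submodule.bot_orthogonal_eq_top]
          exact Submodule.reflection_mem_subspace_eq_self Submodule.mem_top
        · refine ⟨v.ofLp :: l', ?_, fun x => ?_⟩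
          · intro w hw
            rcases List.mem_cons.1 hw with rfl | hw
            · simpa using hv
            · exact hl' w hw
          · rw [List.map_cons, List.prod_cons, LinearIsometryEquiv.coe_mul, Function.comp_apply, h,
              hrefl v hv, List.map_cons, List.prod_cons, Matrix.toLpLin_mul_same]
            rfl
    obtain ⟨l', hl', h⟩ := hlist l
    refine ⟨l', hl', Matrix.toEuclideanLin.injective (LinearMap.ext fun x => ?_)⟩
    rw [← h, ← hl]
    rfl
  obtain ⟨l, hl, hA⟩ := hprod
  have hdet : ∀ l : List (Fin n → ℝ), (∀ v ∈ l, v ≠ 0) →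
      (l.map reflMatrix).prod.det = (-1) ^ l.length := by
    intro l
    induction l with
    | nil => simp
    | cons v l ih =>
      intro h
      simp only [List.map_cons, List.prod_cons, Matrix.det_mul, List.length_cons, pow_succ]
      rw [ih fun w hw => h w (by simp [hw]), det_reflMatrix v (h v (by simp))]
      ring
  have h1 : A.1.det = 1 := (Matrix.mem_specialOrthogonalGroup_iff.1 A.2).2
  rw [hA, hdet l hl, neg_one_pow_eq_one_iff_even (by norm_num)] at h1
  obtain ⟨k, hk⟩ := h1
  obtain ⟨g, hg, hg'⟩ := key k l hl (by omega)
  have : A = g := Subtype.ext (hA.trans hg'.symm)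
  exact this ▸ hg

/-! ### Smooth representations and their differentials -/

section SmoothRep

variable {n : ℕ} {U : Type*} [NormedAddCommGroup U] [NormedSpace ℝ U]

/-- The restriction of the smooth function `R` to `SO(n)` is a representation. -/
structure IsSmoothRep (R : Mat n → U →L[ℝ] U) : Prop where
  contDiff : ContDiff ℝ ∞ R
  map_one : R (ent (1 : SO n).1) = 1
  map_mul : ∀ A B : SO n, R (ent (A * B).1) = R (ent A.1) * R (ent B.1)

/-- The entries of a matrix, as a linear map. -/
def entL (n : ℕ) : Matrix (Fin n) (Fin n) ℝ →ₗ[ℝ] Mat n where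
  toFun := ent
  map_add' _ _ := rfl
  map_smul' _ _ := rfl

/-- The differential at the identity. -/
def infMap (R : Mat n → U →L[ℝ] U) : Matrix (Fin n) (Fin n) ℝ →ₗ[ℝ] (U →L[ℝ] U) :=
  (fderiv ℝ R (ent (1 : SO n).1)).toLinearMap ∘ₗ entL n

theorem soExp_zero : soExp (0 : so n) = 1 := by
  apply Subtype.ext
  change NormedSpace.exp (0 : Matrix (Fin n) (Fin n) ℝ) = 1
  exact NormedSpace.exp_zero

theorem soExp_smul_add (X : so n) (s t : ℝ) :
    soExp ((s + t) • X) = soExp (s • X) * soExp (t • X) := by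
  apply Subtype.ext
  change NormedSpace.exp ((s + t) • X.1) = NormedSpace.exp (s • X.1) * NormedSpace.exp (t • X.1)
  rw [add_smul, Matrix.exp_add_of_commute]
  exact ((Commute.refl X.1).smul_left s).smul_right t

theorem soExp_neg (X : so n) : soExp (-X) = (soExp X)⁻¹ := by
  rw [eq_inv_iff_mul_eq_one]
  have := soExp_smul_add X (-1) 1
  have e1 : (-1 : ℝ) • X = -X := Subtype.ext (neg_one_smul ℝ X.1)
  have e2 : (1 : ℝ) • X = X := Subtype.ext (one_smul ℝ X.1)
  rw [neg_add_cancel, zero_smul, soExp_zero, e1, e2] at this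
  exact this.symm

theorem hasDerivAt_ent_soExp (X : so n) :
    HasDerivAt (fun t : ℝ => ent (soExp (t • X)).1) (ent X.1) 0 := by
  have := hasDerivAt_ent_exp X.1 0
  simp only [zero_smul, NormedSpace.exp_zero, mul_one] at this
  exact this

variable {R : Mat n → U →L[ℝ] U}

theorem IsSmoothRep.hasDerivAt_comp (hR : IsSmoothRep R) {c : ℝ → Mat n} {c' : Mat n} {t : ℝ}
    (hc : HasDerivAt c c' t) (h1 : c t = ent (1 : SO n).1) :
    HasDerivAt (fun t => R (c t)) (fderiv ℝ R (ent (1 : SO n).1) c') t := by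
  have hd : DifferentiableAt ℝ R (c t) := hR.contDiff.differentiable (by simp) _
  have := hd.hasFDerivAt.comp_hasDerivAt t hc
  rwa [h1] at this

theorem IsSmoothRep.hasDerivAt_soExp (hR : IsSmoothRep R) (X : so n) :
    HasDerivAt (fun t : ℝ => R (ent (soExp (t • X)).1)) (infMap R X.1) 0 :=
  hR.hasDerivAt_comp (hasDerivAt_ent_soExp X) (by simp [soExp_zero])

theorem IsSmoothRep.map_mul_inv (hR : IsSmoothRep R) (A : SO n) :
    R (ent A.1) * R (ent (A⁻¹).1) = 1 := by
  rw [← hR.map_mul, mul_inv_cancel, hR.map_one]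

theorem IsSmoothRep.hasDerivAt_soExp' (hR : IsSmoothRep R) (X : so n) (t : ℝ) :
    HasDerivAt (fun t : ℝ => R (ent (soExp (t • X)).1))
      (infMap R X.1 * R (ent (soExp (t • X)).1)) t := by
  have h0 : HasDerivAt (fun s : ℝ => R (ent (soExp (s • X)).1)) (infMap R X.1) (t - t) := by
    rw [sub_self]; exact hR.hasDerivAt_soExp X
  have h1 := (h0.comp_sub_const t t).mul_const (R (ent (soExp (t • X)).1))
  refine h1.congr_of_eventuallyEq (.of_forall fun s => ?_)
  simp only []
  rw [← hR.map_mul, ← soExp_smul_add, sub_add_cancel]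

/-- Conjugation by `A ∈ SO(n)` on `𝔰𝔬(n)`. -/
def soConj (A : SO n) (X : so n) : so n :=
  ⟨A.1 * X.1 * A.1.transpose, by
    have hX : X.1.transpose = -X.1 := X.2
    change Matrix.transpose _ = _
    rw [Matrix.transpose_mul, Matrix.transpose_mul, hX, Matrix.transpose_transpose]
    simp [mul_assoc]⟩

theorem soExp_conj (A : SO n) (X : so n) : soExp (soConj A X) = A * soExp X * A⁻¹ := by
  apply Subtype.ext
  change NormedSpace.exp (A.1 * X.1 * A.1.transpose) = A.1 * NormedSpace.exp X.1 * (A⁻¹ : SO n).1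
  have hinv : A.1.transpose = A.1⁻¹ := (Matrix.inv_eq_right_inv (SO.mul_transpose A)).symm
  rw [SO.coe_inv, hinv, Matrix.exp_conj]
  exact (Matrix.isUnit_iff_isUnit_det _).2 (by
    rw [(Matrix.mem_specialOrthogonalGroup_iff.1 A.2).2]; exact isUnit_one)

theorem soConj_smul (A : SO n) (t : ℝ) (X : so n) : soConj A (t • X) = t • soConj A X := by
  apply Subtype.ext
  change A.1 * (t • X.1) * A.1.transpose = t • (A.1 * X.1 * A.1.transpose)
  rw [Matrix.mul_smul, Matrix.smul_mul]

theorem IsSmoothRep.conj (hR : IsSmoothRep R) (A : SO n) (X : so n) :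
    R (ent A.1) * infMap R X.1 * R (ent (A⁻¹).1) = infMap R (soConj A X).1 := by
  have h1 := ((hR.hasDerivAt_soExp X).const_mul (R (ent A.1))).mul_const (R (ent (A⁻¹).1))
  refine h1.unique ((hR.hasDerivAt_soExp (soConj A X)).congr_of_eventuallyEq
    (.of_forall fun t => ?_))
  simp only []
  rw [← soConj_smul, soExp_conj, hR.map_mul, hR.map_mul]

/-- This is the derivative at zero of `IsSmoothRep.conj` along the one-parameter group of `X`. -/
theorem IsSmoothRep.bracket (hR : IsSmoothRep R) (X Y : so n) :
    infMap R X.1 * infMap R Y.1 - infMap R Y.1 * infMap R X.1 =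
      infMap R (X.1 * Y.1 - Y.1 * X.1) := by
  have h1 := ((hR.hasDerivAt_soExp X).mul_const (infMap R Y.1)).mul (hR.hasDerivAt_soExp (-X))
  have h2 : HasDerivAt (fun t : ℝ => infMap R (soConj (soExp (t • X)) Y).1)
      (infMap R (X.1 * Y.1 - Y.1 * X.1)) 0 := by
    have h := hasDerivAt_ent_conj X.1 Y.1
    have h' := (fderiv ℝ R (ent (1 : SO n).1)).hasFDerivAt.comp_hasDerivAt 0 h
    refine h'.congr_of_eventuallyEq (.of_forall fun t => ?_)
    change fderiv ℝ R _ (ent (NormedSpace.exp (t • X.1) * Y.1 *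
      (NormedSpace.exp (t • X.1)).transpose)) = _
    rw [← Matrix.exp_transpose, Matrix.transpose_smul, show X.1.transpose = -X.1 from X.2]
    rfl
  have h3 := h1.unique (h2.congr_of_eventuallyEq (.of_forall fun t => ?_))
  · rw [← h3]
    simp only [zero_smul, soExp_zero, hR.map_one, mul_one, one_mul]
    have : infMap R (-X : so n).1 = - infMap R X.1 := by
      rw [← map_neg]; rfl
    rw [this, mul_neg, sub_eq_add_neg]
  · change R _ * _ * R (ent (soExp (t • -X)).1) = infMap R (soConj _ Y).1
    rw [← hR.conj, smul_neg, soExp_neg]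

/-- A subspace stable under `𝔰𝔬(n)` is stable under `SO(n)`. -/
theorem IsSmoothRep.stable_of_infMap [FiniteDimensional ℝ U] (hR : IsSmoothRep R)
    (N : Submodule ℝ U) (hN : ∀ (X : so n), ∀ u ∈ N, infMap R X.1 u ∈ N) (A : SO n) :
    ∀ u ∈ N, R (ent A.1) u ∈ N := by
  have hcomplete : CompleteSpace U := FiniteDimensional.complete ℝ U
  -- Along one-parameter groups a representation is the exponential of its differential, again by
  -- uniqueness for a linear differential equation.
  have hexp : ∀ (X : so n) (t : ℝ), R (ent (soExp (t • X)).1) = NormedSpace.exp (t • infMap R X.1) := by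
    intro X t
    have hd : ∀ s, HasDerivAt (fun s : ℝ => NormedSpace.exp (s • (-infMap R X.1)) *
        R (ent (soExp (s • X)).1)) 0 s := by
      intro s
      have h := (hasDerivAt_exp_smul_const (-infMap R X.1) s).mul (hR.hasDerivAt_soExp' X s)
      exact h.congr_deriv (by rw [mul_assoc, neg_mul, mul_neg, neg_add_cancel])
    have hc := is_const_of_deriv_eq_zero (fun s => (hd s).differentiableAt)
      (fun s => (hd s).deriv) t 0
    simp only [zero_smul, NormedSpace.exp_zero, one_mul, soExp_zero, hR.map_one] at hc
    let _ : NormedAlgebra ℚ (U →L[ℝ] U) := NormedAlgebra.restrictScalars ℚ ℝ _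
    have h2 : NormedSpace.exp (t • infMap R X.1) * NormedSpace.exp (t • -infMap R X.1) = 1 := by
      rw [← NormedSpace.exp_add_of_commute]
      · simp
      · exact ((Commute.refl _).neg_right.smul_left t).smul_right t
    calc R (ent (soExp (t • X)).1) = NormedSpace.exp (t • infMap R X.1) *
          (NormedSpace.exp (t • -infMap R X.1) * R (ent (soExp (t • X)).1)) := by
          rw [← mul_assoc, h2, one_mul]
      _ = _ := by rw [hc, mul_one]
  have hpow : ∀ (X : so n) (k : ℕ), ∀ u ∈ N, (infMap R X.1 ^ k) u ∈ N := by
    intro X k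
    induction k with
    | zero => intro u hu; simpa using hu
    | succ k ih => intro u hu; rw [pow_succ']; exact hN X _ (ih u hu)
  -- Stability under `A` and `A⁻¹` together defines a subgroup. It contains all exponentials, as
  -- partial sums of the exponential series preserve `N` and finite-dimensional subspaces are
  -- closed; and the exponentials generate.
  let H : Subgroup (SO n) :=
    { carrier := {A | (∀ u ∈ N, R (ent A.1) u ∈ N) ∧ ∀ u ∈ N, R (ent (A⁻¹).1) u ∈ N}
      one_mem' := ⟨fun u hu => by rw [hR.map_one]; exact hu,
        fun u hu => by rw [inv_one, hR.map_one]; exact hu⟩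
      mul_mem' := by
        rintro A B ⟨hA, hA'⟩ ⟨hB, hB'⟩
        refine ⟨fun u hu => ?_, fun u hu => ?_⟩
        · rw [hR.map_mul]; exact hA _ (hB u hu)
        · rw [mul_inv_rev, hR.map_mul]; exact hB' _ (hA' u hu)
      inv_mem' := by
        rintro A ⟨hA, hA'⟩
        exact ⟨hA', by rwa [inv_inv]⟩ }
  have hsub : ∀ X : so n, ∀ u ∈ N, R (ent (soExp X).1) u ∈ N := by
    intro X u hu
    have h1 := hexp X 1
    rw [one_smul, one_smul] at h1
    rw [h1]
    have hs := NormedSpace.exp_series_hasSum_exp' (𝕂 := ℝ) (infMap R X.1)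
    have hs' := (ContinuousLinearMap.apply ℝ U u).hasSum hs
    refine (Submodule.closed_of_finiteDimensional N).mem_of_tendsto hs' (.of_forall fun s => ?_)
    refine N.sum_mem fun k _ => ?_
    simp only [map_smul]
    exact N.smul_mem _ (hpow X k u hu)
  have htop : expSubgroup n ≤ H := by
    rw [expSubgroup, Subgroup.closure_le]
    rintro _ ⟨X, rfl⟩
    exact ⟨hsub X, by rw [← soExp_neg]; exact hsub (-X)⟩
  rw [expSubgroup_eq_top] at htop
  exact (htop (Subgroup.mem_top A)).1

/-! ### Tensor powers -/

/-- The action of a matrix on `(⊗ᵏ ℝⁿ) ⊗ U`. -/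
def tens (k : ℕ) (R : Mat n → U →L[ℝ] U) (B : Mat n) :
    ((Fin k → Fin n) → U) →L[ℝ] ((Fin k → Fin n) → U) :=
  ContinuousLinearMap.pi fun J => ∑ K : Fin k → Fin n,
    (∏ s, B (J s) (K s)) • (R B).comp (ContinuousLinearMap.proj K)

theorem tens_apply (k : ℕ) (R : Mat n → U →L[ℝ] U) (B : Mat n) (T : (Fin k → Fin n) → U)
    (J : Fin k → Fin n) : tens k R B T J = ∑ K, (∏ s, B (J s) (K s)) • R B (T K) := by
  simp [tens]

theorem prod_one_apply {k : ℕ} (J K : Fin k → Fin n) :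
    ∏ s, ent (1 : SO n).1 (J s) (K s) = if J = K then 1 else 0 := by
  have : ∀ s, ent (1 : SO n).1 (J s) (K s) = if J s = K s then 1 else 0 := by
    intro s; simp [ent, Matrix.one_apply]
  simp only [this]
  rw [Finset.prod_ite_zero]
  simp [funext_iff]

theorem sum_prod_mul {k : ℕ} (A B : SO n) (J L : Fin k → Fin n) :
    ∑ K : Fin k → Fin n, (∏ s, ent A.1 (J s) (K s)) * ∏ s, ent B.1 (K s) (L s) =
      ∏ s, ent (A * B).1 (J s) (L s) := by
  simp_rw [← Finset.prod_mul_distrib]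
  have := (Finset.prod_univ_sum (fun _ : Fin k => (Finset.univ : Finset (Fin n)))
    (fun s j => ent A.1 (J s) j * ent B.1 j (L s))).symm
  rw [Fintype.piFinset_univ] at this
  rw [this]
  rfl

theorem IsSmoothRep.tens [FiniteDimensional ℝ U] (hR : IsSmoothRep R) (k : ℕ) :
    IsSmoothRep (tens k R) where
  contDiff := by
    rw [contDiff_clm_apply_iff]
    intro T
    rw [contDiff_pi]
    intro J
    simp_rw [tens_apply]
    refine ContDiff.sum fun K _ => ContDiff.smul ?_ (hR.contDiff.clm_apply contDiff_const)
    exact contDiff_prod fun s _ => by fun_prop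
  map_one := by
    ext T J
    simp_rw [tens_apply, prod_one_apply, hR.map_one]
    simp
  map_mul A B := by
    ext T J
    simp_rw [mul_apply_eq_comp, tens_apply, map_sum, map_smul, hR.map_mul,
      Finset.smul_sum, smul_smul]
    rw [Finset.sum_comm]
    refine Finset.sum_congr rfl fun L _ => ?_
    rw [← Finset.sum_smul, sum_prod_mul]
    rfl

/-- The product rule at the identity: all factors but one become Kronecker deltas, so only
multi-indices that differ from `J` in at most one slot survive. -/
theorem infMap_tens [FiniteDimensional ℝ U] (hR : IsSmoothRep R) (k : ℕ) (X : so n)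
    (T : (Fin k → Fin n) → U) (J : Fin k → Fin n) :
    infMap (ConformalOp.tens k R) X.1 T J = infMap R X.1 (T J) +
      ∑ s, ∑ d, X.1 (J s) d • T (Function.update J s d) := by
  have h1 : HasDerivAt (fun t : ℝ => ConformalOp.tens k R (ent (soExp (t • X)).1) T J)
      (infMap (ConformalOp.tens k R) X.1 T J) 0 := by
    have h := ((hR.tens k).hasDerivAt_soExp X).clm_apply (hasDerivAt_const (0 : ℝ) T)
    simp only [map_zero, add_zero] at h
    exact (hasDerivAt_pi.1 h) J
  refine h1.unique ?_
  simp_rw [tens_apply]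
  have hentry : ∀ a b, HasDerivAt (fun t : ℝ => ent (soExp (t • X)).1 a b) (ent X.1 a b) 0 :=
    fun a b => hasDerivAt_pi.1 (hasDerivAt_pi.1 (hasDerivAt_ent_soExp X) a) b
  have hprod : ∀ K : Fin k → Fin n, HasDerivAt
      (fun t : ℝ => ∏ s, ent (soExp (t • X)).1 (J s) (K s))
      (∑ s, (∏ s' ∈ Finset.univ.erase s, ent (1 : SO n).1 (J s') (K s')) * ent X.1 (J s) (K s)) 0 := by
    intro K
    have h := HasDerivAt.fun_finsetProd (u := Finset.univ)
      (f := fun s (t : ℝ) => ent (soExp (t • X)).1 (J s) (K s)) (x := (0 : ℝ))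
      (f' := fun s => ent X.1 (J s) (K s)) (fun s _ => hentry (J s) (K s))
    simpa only [zero_smul, soExp_zero, smul_eq_mul] using h
  have h2 : HasDerivAt (fun t : ℝ => ∑ K, (∏ s, ent (soExp (t • X)).1 (J s) (K s)) •
      R (ent (soExp (t • X)).1) (T K)) (∑ K, ((∏ s, ent (1 : SO n).1 (J s) (K s)) •
        infMap R X.1 (T K) + (∑ s, (∏ s' ∈ Finset.univ.erase s, ent (1 : SO n).1 (J s') (K s')) *
          ent X.1 (J s) (K s)) • T K)) 0 := by
    refine HasDerivAt.fun_sum fun K _ => ?_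
    have h := (hprod K).smul ((hR.hasDerivAt_soExp X).clm_apply (hasDerivAt_const (0 : ℝ) (T K)))
    simp only [zero_smul, soExp_zero, map_zero, add_zero, hR.map_one, one_apply_eq_self] at h
    exact h
  refine h2.congr_deriv ?_
  rw [Finset.sum_add_distrib]
  congr 1
  · simp_rw [prod_one_apply]
    simp
  · simp_rw [Finset.sum_smul]
    rw [Finset.sum_comm]
    refine Finset.sum_congr rfl fun s _ => ?_
    have hz : ∀ K : Fin k → Fin n, ∏ s' ∈ Finset.univ.erase s, ent (1 : SO n).1 (J s') (K s') =
        if K = Function.update J s (K s) then 1 else 0 := by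
      intro K
      have : ∀ s', ent (1 : SO n).1 (J s') (K s') = if J s' = K s' then 1 else 0 := by
        intro s'; simp [ent, Matrix.one_apply]
      simp only [this]
      rw [Finset.prod_ite_zero]
      simp only [Finset.mem_erase, Finset.mem_univ, and_true, Finset.prod_const_one]
      congr 1
      rw [eq_iff_iff, funext_iff]
      refine forall_congr' fun s' => ?_
      by_cases h : s' = s
      · subst h; simp
      · simp [h, eq_comm]
    simp_rw [hz]
    refine (Finset.sum_of_injOn (fun d => Function.update J s d) ?_ (by simp) ?_ ?_).symm
    · intro a _ b _ hab
      have := congrFun hab s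
      simpa using this
    · intro K _ hK
      rw [if_neg, zero_mul, zero_smul]
      intro h
      exact hK ⟨K s, by simp, h.symm⟩
    · intro d _
      simp
      rfl

end SmoothRep

/-! ### Continuous complex representations as smooth representations -/

section ComplexRep

variable {n : ℕ} {V : Type v} [NormedAddCommGroup V] [NormedSpace ℂ V]
  [FiniteDimensional ℂ V] (ρ : Representation ℂ (SO n) V)

theorem exists_isSmoothRep (hρ : ∀ v, Continuous fun A => ρ A v) :
    ∃ R : Mat n → V →L[ℝ] V, IsSmoothRep R ∧ (∀ (A : SO n) (v : V), R (ent A.1) v = ρ A v) ∧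
      ∀ (X : so n) (v : V), infAction ρ X v = infMap R X.1 v := by
  obtain ⟨R, hR, h⟩ := exists_contDiff_extension ρ hρ
  have hs : IsSmoothRep R :=
    { contDiff := hR
      map_one := by ext v; rw [h]; simp
      map_mul := fun A B => by ext v; rw [h, mul_apply_eq_comp, h, h, map_mul, Module.End.mul_apply] }
  refine ⟨R, hs, h, fun X v => ?_⟩
  have h1 := (hs.hasDerivAt_soExp X).clm_apply (hasDerivAt_const (0 : ℝ) v)
  simp only [map_zero, add_zero] at h1
  rw [← h1.deriv, infAction]
  simp_rw [h]

end ComplexRep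

/-! ### The complexified Lie algebra action -/

/-- The operators `Λ(a, b)` representing `a bᵀ - b aᵀ` for complex vectors `a`, `b`. -/
structure IsSoAction {n : ℕ} {Z : Type*} [AddCommGroup Z] [Module ℂ Z]
    (Λ : (Fin n → ℂ) →ₗ[ℂ] (Fin n → ℂ) →ₗ[ℂ] Module.End ℂ Z) : Prop where
  skew : ∀ a b, Λ b a = - Λ a b
  bracket : ∀ a b c d, Λ a b * Λ c d - Λ c d * Λ a b =
    (b ⬝ᵥ c) • Λ a d - (a ⬝ᵥ c) • Λ b d - (b ⬝ᵥ d) • Λ a c + (a ⬝ᵥ d) • Λ b c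

theorem pi_single_induction {n : ℕ} {P : (Fin n → ℂ) → Prop} (h0 : ∀ i, P (Pi.single i 1))
    (hadd : ∀ a b, P a → P b → P (a + b)) (hsmul : ∀ (c : ℂ) a, P a → P (c • a))
    (hz : P 0) (a : Fin n → ℂ) : P a := by
  have ha : a = ∑ i, a i • (Pi.single i 1 : Fin n → ℂ) := by
    ext j; simp [Finset.sum_apply, Pi.single_apply]
  rw [ha]
  exact Finset.sum_induction _ P hadd hz fun i _ => hsmul _ _ (h0 i)

/-- `e_i e_jᵀ - e_j e_iᵀ`. -/
def wedge {n : ℕ} (i j : Fin n) : so n :=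
  ⟨Matrix.single i j 1 - Matrix.single j i 1, by
    change Matrix.transpose _ = _
    rw [Matrix.transpose_sub, Matrix.transpose_single, Matrix.transpose_single, neg_sub]⟩

theorem wedge_val {n : ℕ} (i j : Fin n) :
    (wedge i j).1 = Matrix.single i j (1 : ℝ) - Matrix.single j i 1 := rfl

/-- Every unordered pair of indices is counted twice, whence the factor one half. -/
theorem so_eq_sum {n : ℕ} (X : so n) :
    X.1 = (1 / 2 : ℝ) • ∑ i, ∑ j, ent X.1 i j • (wedge i j).1 := by
  have hX : X.1.transpose = -X.1 := X.2
  have h1 : ∑ i, ∑ j, ent X.1 i j • (Matrix.single i j (1 : ℝ)) = X.1 := by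
    conv_rhs => rw [Matrix.matrix_eq_sum_single X.1]
    refine Finset.sum_congr rfl fun i _ => Finset.sum_congr rfl fun j _ => ?_
    rw [Matrix.smul_single, smul_eq_mul, mul_one]; rfl
  have h2 : ∑ i, ∑ j, ent X.1 i j • (Matrix.single j i (1 : ℝ)) = -X.1 := by
    rw [← hX]
    conv_rhs => rw [← h1]
    rw [Matrix.transpose_sum]
    refine Finset.sum_congr rfl fun i _ => ?_
    rw [Matrix.transpose_sum]
    refine Finset.sum_congr rfl fun j _ => ?_
    rw [Matrix.transpose_smul, Matrix.transpose_single]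
  simp_rw [wedge_val, smul_sub, Finset.sum_sub_distrib, h1, h2]
  module

theorem eq_of_add_eq_add {Z : Type*} [AddCommGroup Z] {x y x' y' l r : Z} (h : x = y) (h' : x' = y')
    (hl : l = x + x') (hr : y + y' = r) : l = r := by
  rw [hl, h, h', hr]

section CRep

variable {n : ℕ} {V : Type v} [NormedAddCommGroup V] [NormedSpace ℂ V] [FiniteDimensional ℂ V]

/-- A continuous representation of `SO(n)`. -/
abbrev ContRep (n : ℕ) (V : Type v) [NormedAddCommGroup V] [NormedSpace ℂ V] : Type v :=
  {ρ : Representation ℂ (SO n) V // ∀ v, Continuous fun A => ρ A v}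

variable (ρ : ContRep n V)

/-- A smooth extension of a continuous representation. -/
def ContRep.ext : Mat n → V →L[ℝ] V := (exists_isSmoothRep ρ.1 ρ.2).choose

theorem ContRep.isSmoothRep : IsSmoothRep ρ.ext := (exists_isSmoothRep ρ.1 ρ.2).choose_spec.1

theorem ContRep.ext_apply (A : SO n) (v : V) : ρ.ext (ent A.1) v = ρ.1 A v :=
  (exists_isSmoothRep ρ.1 ρ.2).choose_spec.2.1 A v

theorem ContRep.infAction_eq (X : so n) (v : V) : infAction ρ.1 X v = infMap ρ.ext X.1 v :=
  (exists_isSmoothRep ρ.1 ρ.2).choose_spec.2.2 X v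

/-- The smooth extension is only real-linear off the group, but its differential on `𝔰𝔬(n)` is
computed along curves inside `SO(n)`, where the operators are complex-linear. -/
theorem ContRep.infMap_smul (X : so n) (c : ℂ) (v : V) :
    infMap ρ.ext X.1 (c • v) = c • infMap ρ.ext X.1 v := by
  have h1 := (ρ.isSmoothRep.hasDerivAt_soExp X).clm_apply (hasDerivAt_const (0 : ℝ) (c • v))
  have h2 := ((ρ.isSmoothRep.hasDerivAt_soExp X).clm_apply (hasDerivAt_const (0 : ℝ) v)).const_smul c
  simp only [map_zero, add_zero] at h1 h2
  refine h1.unique (h2.congr_of_eventuallyEq (.of_forall fun t => ?_))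
  simp only [Pi.smul_apply]
  rw [ρ.ext_apply, ρ.ext_apply, map_smul]

/-- The operator representing `e_i e_jᵀ - e_j e_iᵀ`. -/
def ContRep.gen (i j : Fin n) : Module.End ℂ V where
  toFun := infMap ρ.ext (wedge i j).1
  map_add' := map_add _
  map_smul' := ρ.infMap_smul (wedge i j)

theorem ContRep.gen_apply (i j : Fin n) (v : V) : ρ.gen i j v = infMap ρ.ext (wedge i j).1 v := rfl

theorem ContRep.gen_skew (i j : Fin n) : ρ.gen j i = - ρ.gen i j := by
  ext v
  have : (wedge j i).1 = - (wedge i j).1 := by rw [wedge_val, wedge_val, neg_sub]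
  rw [LinearMap.neg_apply, ρ.gen_apply, ρ.gen_apply, this, map_neg]
  rfl

theorem ContRep.gen_bracket (i j k l : Fin n) :
    ρ.gen i j * ρ.gen k l - ρ.gen k l * ρ.gen i j =
      (if j = k then (1 : ℂ) else 0) • ρ.gen i l - (if i = k then (1 : ℂ) else 0) • ρ.gen j l
      - (if j = l then (1 : ℂ) else 0) • ρ.gen i k + (if i = l then (1 : ℂ) else 0) • ρ.gen j k := by
  have hb := ρ.isSmoothRep.bracket (wedge i j) (wedge k l)
  have hm : (wedge i j).1 * (wedge k l).1 - (wedge k l).1 * (wedge i j).1 =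
      (if j = k then (1 : ℝ) else 0) • (wedge i l).1 - (if i = k then (1 : ℝ) else 0) • (wedge j l).1
      - (if j = l then (1 : ℝ) else 0) • (wedge i k).1
      + (if i = l then (1 : ℝ) else 0) • (wedge j k).1 := by
    have hs : ∀ a b c d : Fin n, Matrix.single a b (1 : ℝ) * Matrix.single c d 1 =
        (if b = c then (1 : ℝ) else 0) • Matrix.single a d 1 := by
      intro a b c d
      by_cases h : b = c
      · subst h; simp
      · simp [h]
    simp only [wedge_val, sub_mul, mul_sub, hs]
    simp only [eq_comm (a := k) (b := i), eq_comm (a := k) (b := j), eq_comm (a := l) (b := i),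
      eq_comm (a := l) (b := j)]
    module
  rw [hm] at hb
  ext v
  have := congrArg (fun f : V →L[ℝ] V => f v) hb
  simp only [map_sub, map_add, map_smul] at this
  have hsm : ∀ (c : Prop) [Decidable c] (w : V), (if c then (1 : ℝ) else 0) • w =
      (if c then (1 : ℂ) else 0) • w := by intro c _ w; split_ifs <;> simp
  change infMap ρ.ext (wedge i j).1 (infMap ρ.ext (wedge k l).1 v) -
    infMap ρ.ext (wedge k l).1 (infMap ρ.ext (wedge i j).1 v) = _
  refine this.trans ?_
  simp only [_root_.add_apply, _root_.sub_apply, _root_.smul_apply, hsm]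
  rfl

/-- The operators `Λ(a, b)`. -/
def ContRep.lam : (Fin n → ℂ) →ₗ[ℂ] (Fin n → ℂ) →ₗ[ℂ] Module.End ℂ V :=
  LinearMap.mk₂ ℂ (fun a b => ∑ i, ∑ j, (a i * b j) • ρ.gen i j)
    (fun a a' b => by simp only [Pi.add_apply, add_mul, add_smul, Finset.sum_add_distrib])
    (fun c a b => by simp only [Pi.smul_apply, smul_eq_mul, mul_assoc, mul_smul, Finset.smul_sum])
    (fun a b b' => by simp only [Pi.add_apply, mul_add, add_smul, Finset.sum_add_distrib])
    (fun c a b => by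
      simp only [Pi.smul_apply, smul_eq_mul, Finset.smul_sum, smul_smul]
      refine Finset.sum_congr rfl fun i _ => Finset.sum_congr rfl fun j _ => ?_
      congr 1; ring)

theorem ContRep.lam_apply (a b : Fin n → ℂ) :
    ρ.lam a b = ∑ i, ∑ j, (a i * b j) • ρ.gen i j := rfl

theorem ContRep.lam_single (i j : Fin n) :
    ρ.lam (Pi.single i 1) (Pi.single j 1) = ρ.gen i j := by
  rw [ρ.lam_apply, Finset.sum_eq_single i, Finset.sum_eq_single j]
  · simp
  · intro k _ hk; simp [hk]
  · simp
  · intro k _ hk; simp [hk]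
  · simp

/-- The bracket relation is linear in each of its four vectors, so it reduces to basis vectors,
where it is `ContRep.gen_bracket`. -/
theorem ContRep.isSoAction : IsSoAction ρ.lam where
  skew a b := by
    simp only [ρ.lam_apply]
    rw [Finset.sum_comm, ← Finset.sum_neg_distrib]
    refine Finset.sum_congr rfl fun i _ => ?_
    rw [← Finset.sum_neg_distrib]
    refine Finset.sum_congr rfl fun j _ => ?_
    rw [ρ.gen_skew i j, smul_neg, mul_comm]
  bracket a b c d := by
    refine pi_single_induction (P := fun a => ρ.lam a b * ρ.lam c d - ρ.lam c d * ρ.lam a b =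
      (b ⬝ᵥ c) • ρ.lam a d - (a ⬝ᵥ c) • ρ.lam b d - (b ⬝ᵥ d) • ρ.lam a c + (a ⬝ᵥ d) • ρ.lam b c)
      (fun i => ?_) (fun a a' h h' => ?_) (fun x a h => ?_) (by simp) a
    · refine pi_single_induction (P := fun b => ρ.lam (Pi.single i 1) b * ρ.lam c d
        - ρ.lam c d * ρ.lam (Pi.single i 1) b =
        (b ⬝ᵥ c) • ρ.lam (Pi.single i 1) d - ((Pi.single i 1 : Fin n → ℂ) ⬝ᵥ c) • ρ.lam b d
        - (b ⬝ᵥ d) • ρ.lam (Pi.single i 1) c + ((Pi.single i 1 : Fin n → ℂ) ⬝ᵥ d) • ρ.lam b c)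
        (fun j => ?_) (fun a a' h h' => ?_) (fun x a h => ?_) (by simp) b
      · refine pi_single_induction (P := fun c => ρ.lam (Pi.single i 1) (Pi.single j 1) * ρ.lam c d
          - ρ.lam c d * ρ.lam (Pi.single i 1) (Pi.single j 1) =
          ((Pi.single j 1 : Fin n → ℂ) ⬝ᵥ c) • ρ.lam (Pi.single i 1) d
          - ((Pi.single i 1 : Fin n → ℂ) ⬝ᵥ c) • ρ.lam (Pi.single j 1) d
          - ((Pi.single j 1 : Fin n → ℂ) ⬝ᵥ d) • ρ.lam (Pi.single i 1) c
          + ((Pi.single i 1 : Fin n → ℂ) ⬝ᵥ d) • ρ.lam (Pi.single j 1) c)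
          (fun k => ?_) (fun a a' h h' => ?_) (fun x a h => ?_) (by simp) c
        · refine pi_single_induction (P := fun d => ρ.lam (Pi.single i 1) (Pi.single j 1)
            * ρ.lam (Pi.single k 1) d - ρ.lam (Pi.single k 1) d * ρ.lam (Pi.single i 1) (Pi.single j 1)
            = ((Pi.single j 1 : Fin n → ℂ) ⬝ᵥ Pi.single k 1) • ρ.lam (Pi.single i 1) d
            - ((Pi.single i 1 : Fin n → ℂ) ⬝ᵥ Pi.single k 1) • ρ.lam (Pi.single j 1) d
            - ((Pi.single j 1 : Fin n → ℂ) ⬝ᵥ d) • ρ.lam (Pi.single i 1) (Pi.single k 1)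
            + ((Pi.single i 1 : Fin n → ℂ) ⬝ᵥ d) • ρ.lam (Pi.single j 1) (Pi.single k 1))
            (fun l => ?_) (fun a a' h h' => ?_) (fun x a h => ?_) (by simp) d
          · simp only [ρ.lam_single, ρ.gen_bracket, single_dotProduct, one_mul, Pi.single_apply]
          · simp only [map_add, mul_add, add_mul, dotProduct_add, add_smul, smul_add]
            exact eq_of_add_eq_add h h' (by abel) (by module)
          · simp only [map_smul, mul_smul_comm, smul_mul_assoc, dotProduct_smul, smul_eq_mul,
              ← smul_sub, h]
            module
        · simp only [map_add, LinearMap.add_apply, mul_add, add_mul, dotProduct_add, add_smul, smul_add]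
          exact eq_of_add_eq_add h h' (by abel) (by module)
        · simp only [map_smul, LinearMap.smul_apply, mul_smul_comm, smul_mul_assoc, dotProduct_smul,
            smul_eq_mul, ← smul_sub, h]
          module
      · simp only [map_add, LinearMap.add_apply, mul_add, add_mul, add_dotProduct, add_smul, smul_add]
        exact eq_of_add_eq_add h h' (by abel) (by module)
      · simp only [map_smul, LinearMap.smul_apply, mul_smul_comm, smul_mul_assoc, smul_dotProduct,
          smul_eq_mul, ← smul_sub, h]
        module
    · simp only [map_add, LinearMap.add_apply, mul_add, add_mul, add_dotProduct, add_smul, smul_add]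
      exact eq_of_add_eq_add h h' (by abel) (by module)
    · simp only [map_smul, LinearMap.smul_apply, mul_smul_comm, smul_mul_assoc, smul_dotProduct,
        smul_eq_mul, ← smul_sub, h]
      module

theorem ContRep.infMap_eq_sum (X : so n) (v : V) :
    infMap ρ.ext X.1 v = (1 / 2 : ℝ) • ∑ i, ∑ j, ent X.1 i j • ρ.gen i j v := by
  conv_lhs => rw [so_eq_sum X]
  simp only [map_smul, map_sum, _root_.smul_apply, sum_apply]
  rfl

/-- A complex subspace stable under the operators `Λ(a, b)` is stable under `SO(n)`. -/
theorem ContRep.stable_of_gen (N : Submodule ℂ V) (hN : ∀ i j, ∀ v ∈ N, ρ.gen i j v ∈ N)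
    (A : SO n) : ∀ v ∈ N, ρ.1 A v ∈ N := by
  intro v hv
  rw [← ρ.ext_apply]
  refine ρ.isSmoothRep.stable_of_infMap (N.restrictScalars ℝ) (fun X u hu => ?_) A v hv
  rw [ρ.infMap_eq_sum]
  exact Submodule.smul_mem _ _ (Submodule.sum_mem _ fun i _ => Submodule.sum_mem _ fun j _ =>
    Submodule.smul_mem _ _ (hN i j u hu))

variable {W : Type*} [NormedAddCommGroup W] [NormedSpace ℂ W] [FiniteDimensional ℂ W]

theorem gen_comm_of_equivariant (σ : ContRep n W) (q : V →ₗ[ℂ] W)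
    (hq : ∀ A v, q (ρ.1 A v) = σ.1 A (q v)) (i j : Fin n) (v : V) :
    q (ρ.gen i j v) = σ.gen i j (q v) := by
  have h1 := (ρ.isSmoothRep.hasDerivAt_soExp (wedge i j)).clm_apply (hasDerivAt_const (0 : ℝ) v)
  have h2 := (σ.isSmoothRep.hasDerivAt_soExp (wedge i j)).clm_apply (hasDerivAt_const (0 : ℝ) (q v))
  simp only [map_zero, add_zero] at h1 h2
  let q' : V →L[ℝ] W := LinearMap.toContinuousLinearMap (q.restrictScalars ℝ)
  have h3 := q'.hasFDerivAt.comp_hasDerivAt 0 h1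
  refine (h3.congr_of_eventuallyEq (.of_forall fun t => ?_)).unique h2 |>.trans rfl
  simp only [ρ.ext_apply, σ.ext_apply, Function.comp_apply]
  exact (hq _ _).symm

theorem lam_comm_of_equivariant (σ : ContRep n W) (q : V →ₗ[ℂ] W)
    (hq : ∀ A v, q (ρ.1 A v) = σ.1 A (q v)) (a b : Fin n → ℂ) (v : V) :
    q (ρ.lam a b v) = σ.lam a b (q v) := by
  simp only [ρ.lam_apply, σ.lam_apply, LinearMap.sum_apply, LinearMap.smul_apply, map_sum, map_smul,
    gen_comm_of_equivariant ρ σ q hq]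

/-- The representation on `(⊗ᵏ ℝⁿ) ⊗ V`. -/
def ContRep.tensor (k : ℕ) : ContRep n ((Fin k → Fin n) → V) :=
  ⟨{ toFun := fun A =>
      { toFun := tens k ρ.ext (ent A.1)
        map_add' := map_add _
        map_smul' := fun c T => by
          ext J
          simp only [tens_apply, Pi.smul_apply, RingHom.id_apply, ρ.ext_apply, map_smul]
          rw [Finset.smul_sum]
          exact Finset.sum_congr rfl fun K _ => smul_comm _ _ _ }
     map_one' := by
      refine LinearMap.ext fun T => ?_
      change tens k ρ.ext (ent (1 : SO n).1) T = T
      rw [(ρ.isSmoothRep.tens k).map_one]; rfl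
     map_mul' := fun A B => by
      refine LinearMap.ext fun T => ?_
      change tens k ρ.ext (ent (A * B).1) T = _
      rw [(ρ.isSmoothRep.tens k).map_mul]; rfl }, fun T => by
    change Continuous fun A : SO n => tens k ρ.ext (ent A.1) T
    have h1 : Continuous fun B : Mat n => tens k ρ.ext B T :=
      (ρ.isSmoothRep.tens k).contDiff.continuous.clm_apply continuous_const
    refine h1.comp (continuous_pi fun i => continuous_pi fun j => SO.continuous_entry i j)⟩

theorem ContRep.tensor_apply (k : ℕ) (A : SO n) (T : (Fin k → Fin n) → V) (J : Fin k → Fin n) :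
    (ρ.tensor k).1 A T J = ∑ K, (∏ s, ent A.1 (J s) (K s)) • ρ.1 A (T K) := by
  change tens k ρ.ext (ent A.1) T J = _
  simp only [tens_apply, ρ.ext_apply]

theorem ContRep.tensor_gen (k : ℕ) (i j : Fin n) (T : (Fin k → Fin n) → V) (J : Fin k → Fin n) :
    (ρ.tensor k).gen i j T J = ρ.gen i j (T J) +
      ∑ s, ∑ d, ((if J s = i then (1 : ℂ) else 0) * (if d = j then 1 else 0)
        - (if J s = j then 1 else 0) * (if d = i then 1 else 0)) • T (Function.update J s d) := by
  -- The extension chosen for the tensor representation need not be `tens k ρ.ext`; the two agree on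
  -- the group, hence have the same differential on `𝔰𝔬(n)`.
  have h : (ρ.tensor k).gen i j T = infMap (tens k ρ.ext) (wedge i j).1 T := by
    rw [ContRep.gen_apply]
    have h1 := ((ρ.tensor k).isSmoothRep.hasDerivAt_soExp (wedge i j)).clm_apply
      (hasDerivAt_const (0 : ℝ) T)
    have h2 := ((ρ.isSmoothRep.tens k).hasDerivAt_soExp (wedge i j)).clm_apply
      (hasDerivAt_const (0 : ℝ) T)
    simp only [map_zero, add_zero] at h1 h2
    refine h1.unique (h2.congr_of_eventuallyEq (.of_forall fun t => ?_))
    simp only [ContRep.ext_apply]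
    rfl
  rw [h, infMap_tens ρ.isSmoothRep]
  congr 1
  refine Finset.sum_congr rfl fun s _ => Finset.sum_congr rfl fun d _ => ?_
  have h3 : ((wedge i j).1 (J s) d : ℝ) = (if J s = i then (1 : ℝ) else 0) * (if d = j then 1 else 0)
      - (if J s = j then 1 else 0) * (if d = i then 1 else 0) := by
    rw [wedge_val]
    simp only [Matrix.sub_apply, Matrix.single_apply]
    simp only [eq_comm (a := i), eq_comm (a := j), ite_and]
    split_ifs <;> simp
  rw [h3, ← Complex.coe_smul]
  congr 1
  split_ifs <;> simp

theorem ContRep.tensor_lam (k : ℕ) (a b : Fin n → ℂ) (T : (Fin k → Fin n) → V)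
    (J : Fin k → Fin n) : (ρ.tensor k).lam a b T J = ρ.lam a b (T J) +
      ∑ s, ∑ d, (a (J s) * b d - b (J s) * a d) • T (Function.update J s d) := by
  refine pi_single_induction (P := fun a => (ρ.tensor k).lam a b T J = ρ.lam a b (T J) +
      ∑ s, ∑ d, (a (J s) * b d - b (J s) * a d) • T (Function.update J s d))
      (fun i => ?_) (fun a a' h h' => ?_) (fun x a h => ?_) (by simp) a
  · refine pi_single_induction (P := fun b => (ρ.tensor k).lam (Pi.single i 1) b T J =
      ρ.lam (Pi.single i 1) b (T J) + ∑ s, ∑ d, ((Pi.single i 1 : Fin n → ℂ) (J s) * b d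
        - b (J s) * (Pi.single i 1 : Fin n → ℂ) d) • T (Function.update J s d))
      (fun j => ?_) (fun a a' h h' => ?_) (fun x a h => ?_) (by simp) b
    · rw [ContRep.lam_single, ContRep.lam_single, ρ.tensor_gen]
      simp only [Pi.single_apply]
    · simp only [map_add, LinearMap.add_apply, Pi.add_apply, h, h', mul_add, add_mul]
      rw [add_add_add_comm, ← Finset.sum_add_distrib]
      congr 1
      refine Finset.sum_congr rfl fun s _ => ?_
      rw [← Finset.sum_add_distrib]
      refine Finset.sum_congr rfl fun d _ => ?_
      rw [← add_smul]; congr 1; ring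
    · simp only [map_smul, LinearMap.smul_apply, Pi.smul_apply, h, smul_eq_mul, smul_add,
        Finset.smul_sum, smul_smul]
      congr 1
      refine Finset.sum_congr rfl fun s _ => Finset.sum_congr rfl fun d _ => ?_
      congr 1; ring
  · simp only [map_add, LinearMap.add_apply, Pi.add_apply, h, h', mul_add, add_mul]
    rw [add_add_add_comm, ← Finset.sum_add_distrib]
    congr 1
    refine Finset.sum_congr rfl fun s _ => ?_
    rw [← Finset.sum_add_distrib]
    refine Finset.sum_congr rfl fun d _ => ?_
    rw [← add_smul]; congr 1; ring
  · simp only [map_smul, LinearMap.smul_apply, Pi.smul_apply, h, smul_eq_mul, smul_add,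
      Finset.smul_sum, smul_smul]
    congr 1
    refine Finset.sum_congr rfl fun s _ => Finset.sum_congr rfl fun d _ => ?_
    congr 1; ring

end CRep

/-! ### Weight vectors of the defining representation -/

section WeightBasis

variable {n : ℕ}

/-- The index of the weight vector dual to the one with index `α`. -/
def dualIdx (α : Fin n) : Fin n :=
  if α.1 % 2 = 0 then (if h : α.1 + 1 < n then ⟨α.1 + 1, h⟩ else α) else ⟨α.1 - 1, by omega⟩

/-- The height of the weight with index `α`. -/
def ht (α : Fin n) : ℤ :=
  if α.1 % 2 = 0 then (if α.1 + 1 < n then (n / 2 : ℕ) - (α.1 / 2 : ℕ) else 0)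
  else (α.1 / 2 : ℕ) - (n / 2 : ℕ)

theorem dualIdx_val (α : Fin n) : (dualIdx α).1 =
    if α.1 % 2 = 0 then (if α.1 + 1 < n then α.1 + 1 else α.1) else α.1 - 1 := by
  unfold dualIdx
  split_ifs <;> rfl

theorem dualIdx_dualIdx (α : Fin n) : dualIdx (dualIdx α) = α := by
  apply Fin.ext
  have := α.2
  simp only [dualIdx_val]
  split_ifs <;> omega

theorem ht_dualIdx (α : Fin n) : ht (dualIdx α) = - ht α := by
  have := α.2
  simp only [ht, dualIdx_val]
  split_ifs <;> omega

/-- The weights of the defining representation are simple and the height separates them. In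
particular opposite heights force dual indices, so questions about weights become integer
arithmetic. -/
theorem ht_injective : Function.Injective (ht (n := n)) := by
  intro α β h
  apply Fin.ext
  have := α.2
  have := β.2
  simp only [ht] at h
  split_ifs at h <;> omega

/-- The weight vectors of the defining representation of `SO(n)`. -/
def wb (α : Fin n) : Fin n → ℂ :=
  if α.1 % 2 = 0 then
    -- Each coordinate plane carries two conjugate null vectors, scaled so that they pair to one
    -- with each other. For odd `n` the last basis vector has weight zero and is its own dual.
    (if α.1 + 1 < n then
      ((Real.sqrt 2 : ℝ) : ℂ)⁻¹ • (Pi.single α 1 - Complex.I • Pi.single (dualIdx α) 1)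
    else Pi.single α 1)
  else ((Real.sqrt 2 : ℝ) : ℂ)⁻¹ • (Pi.single (dualIdx α) 1 + Complex.I • Pi.single α 1)

theorem sqrt_two_inv_mul : ((Real.sqrt 2 : ℝ) : ℂ)⁻¹ * ((Real.sqrt 2 : ℝ) : ℂ)⁻¹ = 1 / 2 := by
  rw [← mul_inv, ← Complex.ofReal_mul, Real.mul_self_sqrt (by norm_num)]
  norm_num

theorem dualIdx_eq_iff (α β : Fin n) : dualIdx α = β ↔ α = dualIdx β :=
  ⟨fun h => by rw [← h, dualIdx_dualIdx], fun h => by rw [h, dualIdx_dualIdx]⟩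

theorem wb_cases (α : Fin n) :
    (α.1 % 2 = 0 ∧ (dualIdx α).1 = α.1 + 1 ∧ wb α = ((Real.sqrt 2 : ℝ) : ℂ)⁻¹ •
      (Pi.single α 1 - Complex.I • Pi.single (dualIdx α) 1)) ∨
    (α.1 % 2 = 0 ∧ (dualIdx α).1 = α.1 ∧ n = α.1 + 1 ∧ wb α = Pi.single α 1) ∨
    (α.1 % 2 = 1 ∧ α.1 = (dualIdx α).1 + 1 ∧ wb α = ((Real.sqrt 2 : ℝ) : ℂ)⁻¹ •
      (Pi.single (dualIdx α) 1 + Complex.I • Pi.single α 1)) := by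
  have ha := α.2
  rw [dualIdx_val, wb]
  by_cases p1 : α.1 % 2 = 0
  · by_cases q1 : α.1 + 1 < n
    · left; simp [p1, q1]
    · right; left; simp only [p1, q1, if_true, if_false, true_and, and_true]; omega
  · right; right; simp only [p1, if_false, and_true]; omega

theorem wb_dot (α β : Fin n) : wb α ⬝ᵥ wb β = if β = dualIdx α then 1 else 0 := by
  have hI : Complex.I * Complex.I = -1 := Complex.I_mul_I
  have h2 := sqrt_two_inv_mul
  have ha := α.2
  have hb := β.2
  set c := ((Real.sqrt 2 : ℝ) : ℂ)⁻¹
  rcases wb_cases α with ⟨p1, d1, e1⟩ | ⟨p1, d1, q1, e1⟩ | ⟨p1, d1, e1⟩ <;>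
  rcases wb_cases β with ⟨p2, d2, e2⟩ | ⟨p2, d2, q2, e2⟩ | ⟨p2, d2, e2⟩ <;>
    rw [e1, e2] <;>
    simp only [smul_dotProduct, dotProduct_smul, sub_dotProduct,
      dotProduct_sub, add_dotProduct, dotProduct_add, single_dotProduct, Pi.single_apply, one_mul,
      smul_eq_mul, Fin.ext_iff] <;>
    split_ifs <;> first
      | omega
      | ring1
      | linear_combination 2 * h2 - c * c * hI
      | linear_combination c * c * hI

/-- Completeness is the orthogonality relation `wb_dot` with the matrix product reversed: a
one-sided inverse of a square matrix is two-sided. -/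
theorem wb_complete (i j : Fin n) : ∑ α, wb α i * wb (dualIdx α) j = if i = j then 1 else 0 := by
  let B : Matrix (Fin n) (Fin n) ℂ := Matrix.of fun α i => wb α i
  let D : Matrix (Fin n) (Fin n) ℂ := Matrix.of fun i α => wb (dualIdx α) i
  have h : B * D = 1 := by
    ext α β
    rw [Matrix.mul_apply]
    have := wb_dot α (dualIdx β)
    rw [Matrix.one_apply]
    simp only [dualIdx_eq_iff, dualIdx_dualIdx] at this
    simp only [eq_comm (a := α)]
    exact this
  rw [mul_eq_one_comm] at h
  have := congrFun (congrFun h j) i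
  rw [Matrix.mul_apply, Matrix.one_apply] at this
  simp only [eq_comm (a := i)]
  rw [← this]
  exact Finset.sum_congr rfl fun α _ => mul_comm _ _

theorem eq_sum_wb (a : Fin n → ℂ) : a = ∑ α, (a ⬝ᵥ wb (dualIdx α)) • wb α := by
  ext i
  simp only [Finset.sum_apply, Pi.smul_apply, smul_eq_mul, dotProduct, Finset.sum_mul]
  rw [Finset.sum_comm]
  have : ∀ j, ∑ α, a j * wb (dualIdx α) j * wb α i = a j * if i = j then 1 else 0 := by
    intro j
    rw [← wb_complete, Finset.mul_sum]
    exact Finset.sum_congr rfl fun α _ => by ring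
  simp [this]

/-- The pairing of the weight with index `γ` with the coroot direction `α`. -/
def wtp (α γ : Fin n) : ℤ := (if γ = α then 1 else 0) - (if γ = dualIdx α then 1 else 0)

/-- Only `γ` and its dual contribute, and both the height and the pairing change sign under duality.
Consequently `heightOp` measures twice the height. -/
theorem sum_ht_mul_wtp (γ : Fin n) : ∑ α, ht α * wtp α γ = 2 * ht γ := by
  have h1 : ∀ α, ht α * wtp α γ = (if α = γ then ht γ else 0) + (if α = dualIdx γ then ht γ else 0) := by
    intro α
    unfold wtp
    have : γ = dualIdx α ↔ α = dualIdx γ := by rw [← dualIdx_eq_iff, eq_comm]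
    simp only [this, eq_comm (a := γ)]
    split_ifs with h h' h'
    · subst h
      have h3 := congrArg ht h'
      rw [ht_dualIdx] at h3
      linarith
    · subst h; ring
    · subst h'; rw [ht_dualIdx]; ring
    · ring
  simp_rw [h1]
  rw [Finset.sum_add_distrib]
  simp
  ring

end WeightBasis

/-! ### Highest weight vectors -/

section HighestWeight

variable {n : ℕ} {Z : Type*} [AddCommGroup Z] [Module ℂ Z]
  {Λ : (Fin n → ℂ) →ₗ[ℂ] (Fin n → ℂ) →ₗ[ℂ] Module.End ℂ Z}

theorem IsSoAction.bracket_wb (hΛ : IsSoAction Λ) (α β γ δ : Fin n) (z : Z) :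
    Λ (wb α) (wb β) (Λ (wb γ) (wb δ) z) = Λ (wb γ) (wb δ) (Λ (wb α) (wb β) z)
      + ((if γ = dualIdx β then (1 : ℂ) else 0) • Λ (wb α) (wb δ) z
      - (if γ = dualIdx α then (1 : ℂ) else 0) • Λ (wb β) (wb δ) z
      - (if δ = dualIdx β then (1 : ℂ) else 0) • Λ (wb α) (wb γ) z
      + (if δ = dualIdx α then (1 : ℂ) else 0) • Λ (wb β) (wb γ) z) := by
  have h := congrArg (fun f : Module.End ℂ Z => f z) (hΛ.bracket (wb α) (wb β) (wb γ) (wb δ))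
  simp only [wb_dot, LinearMap.sub_apply, LinearMap.add_apply, LinearMap.smul_apply,
    Module.End.mul_apply] at h
  rw [← h]; abel

theorem IsSoAction.skew_apply (hΛ : IsSoAction Λ) (a b : Fin n → ℂ) (z : Z) :
    Λ b a z = - Λ a b z := by rw [hΛ.skew a b]; rfl

theorem IsSoAction.self_apply (hΛ : IsSoAction Λ) (a : Fin n → ℂ) (z : Z) : Λ a a z = 0 := by
  have h := hΛ.skew_apply a a z
  have h2 : (2 : ℂ) • Λ a a z = 0 := by rw [two_smul]; nth_rewrite 1 [h]; simp
  simpa using h2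

/-- Each term of the bracket carries a Kronecker delta that restores the original pair of indices.
So `Λ(b_γ, b_δ)` shifts Cartan eigenvalues by the sum of the two weights. -/
theorem IsSoAction.cartan_bracket (hΛ : IsSoAction Λ) (α γ δ : Fin n) (z : Z) :
    Λ (wb α) (wb (dualIdx α)) (Λ (wb γ) (wb δ) z) =
      Λ (wb γ) (wb δ) (Λ (wb α) (wb (dualIdx α)) z)
        + (((wtp α γ + wtp α δ : ℤ)) : ℂ) • Λ (wb γ) (wb δ) z := by
  rw [hΛ.bracket_wb]
  congr 1
  rw [dualIdx_dualIdx]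
  unfold wtp
  have e1 : (if γ = α then (1 : ℂ) else 0) • Λ (wb α) (wb δ) z =
      (if γ = α then (1 : ℂ) else 0) • Λ (wb γ) (wb δ) z := by
    split_ifs with h
    · rw [h]
    · simp
  have e2 : (if γ = dualIdx α then (1 : ℂ) else 0) • Λ (wb (dualIdx α)) (wb δ) z =
      (if γ = dualIdx α then (1 : ℂ) else 0) • Λ (wb γ) (wb δ) z := by
    split_ifs with h
    · rw [h]
    · simp
  have e3 : (if δ = α then (1 : ℂ) else 0) • Λ (wb α) (wb γ) z =
      (if δ = α then (1 : ℂ) else 0) • - Λ (wb γ) (wb δ) z := by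
    split_ifs with h
    · rw [h, hΛ.skew_apply (wb γ)]
    · simp
  have e4 : (if δ = dualIdx α then (1 : ℂ) else 0) • Λ (wb (dualIdx α)) (wb γ) z =
      (if δ = dualIdx α then (1 : ℂ) else 0) • - Λ (wb γ) (wb δ) z := by
    split_ifs with h
    · rw [h, hΛ.skew_apply (wb γ)]
    · simp
  rw [e1, e2, e3, e4]
  push_cast
  module

/-- `v` is a highest weight vector of weight `m`. -/
structure IsHWV (Λ : (Fin n → ℂ) →ₗ[ℂ] (Fin n → ℂ) →ₗ[ℂ] Module.End ℂ Z) (m : Fin n → ℤ)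
    (v : Z) : Prop where
  ne_zero : v ≠ 0
  raise : ∀ α β, 0 < ht α + ht β → Λ (wb α) (wb β) v = 0
  cartan : ∀ α, Λ (wb α) (wb (dualIdx α)) v = (m α : ℂ) • v

/-- Successive application of operators `Λ(b_α, b_β)`. -/
def word (Λ : (Fin n → ℂ) →ₗ[ℂ] (Fin n → ℂ) →ₗ[ℂ] Module.End ℂ Z) (v : Z)
    (l : List (Fin n × Fin n)) : Z :=
  l.foldr (fun p w => Λ (wb p.1) (wb p.2) w) v

/-- A list of lowering operators. -/
def IsLowering (l : List (Fin n × Fin n)) : Prop := ∀ p ∈ l, ht p.1 + ht p.2 < 0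

/-- The span of the vectors obtained from `v` by lowering operators. -/
def cyclic (Λ : (Fin n → ℂ) →ₗ[ℂ] (Fin n → ℂ) →ₗ[ℂ] Module.End ℂ Z) (v : Z) : Submodule ℂ Z :=
  Submodule.span ℂ {w | ∃ l, IsLowering l ∧ w = word Λ v l}

/-- The span of the vectors obtained from `v` by at least one lowering operator. -/
def cyclicLow (Λ : (Fin n → ℂ) →ₗ[ℂ] (Fin n → ℂ) →ₗ[ℂ] Module.End ℂ Z) (v : Z) : Submodule ℂ Z :=
  Submodule.span ℂ {w | ∃ l, IsLowering l ∧ l ≠ [] ∧ w = word Λ v l}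

theorem mem_cyclic (v : Z) : v ∈ cyclic Λ v :=
  Submodule.subset_span ⟨[], by simp [IsLowering], rfl⟩

theorem lower_mem_cyclicLow (v : Z) {α β : Fin n} (h : ht α + ht β < 0) {w : Z}
    (hw : w ∈ cyclic Λ v) : Λ (wb α) (wb β) w ∈ cyclicLow Λ v := by
  refine Submodule.span_induction (p := fun w _ => Λ (wb α) (wb β) w ∈ cyclicLow Λ v)
    ?_ (by simp) (fun x y _ _ hx hy => ?_) (fun c x _ hx => ?_) hw
  · rintro _ ⟨l, hl, rfl⟩
    refine Submodule.subset_span ⟨(α, β) :: l, ?_, by simp, rfl⟩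
    intro p hp
    rcases List.mem_cons.1 hp with rfl | hp
    · exact h
    · exact hl p hp
  · rw [map_add]; exact Submodule.add_mem _ hx hy
  · rw [map_smul]; exact Submodule.smul_mem _ _ hx

theorem cyclicLow_le (v : Z) : cyclicLow Λ v ≤ cyclic Λ v :=
  Submodule.span_mono fun _ ⟨l, hl, _, h⟩ => ⟨l, hl, h⟩

theorem cyclic_eq (v : Z) {z : Z} (hz : z ∈ cyclic Λ v) :
    ∃ c : ℂ, ∃ s ∈ cyclicLow Λ v, z = c • v + s := by
  refine Submodule.span_induction (p := fun z _ => ∃ c : ℂ, ∃ s ∈ cyclicLow Λ v, z = c • v + s)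
    ?_ ⟨0, 0, Submodule.zero_mem _, by simp⟩ ?_ ?_ hz
  · rintro _ ⟨l, hl, rfl⟩
    by_cases h : l = []
    · exact ⟨1, 0, Submodule.zero_mem _, by simp [h, word]⟩
    · exact ⟨0, _, Submodule.subset_span ⟨l, hl, h, rfl⟩, by simp⟩
  · rintro x y _ _ ⟨c, s, hs, rfl⟩ ⟨d, t, ht, rfl⟩
    exact ⟨c + d, s + t, Submodule.add_mem _ hs ht, by module⟩
  · rintro a x _ ⟨c, s, hs, rfl⟩
    exact ⟨a * c, a • s, Submodule.smul_mem _ _ hs, by module⟩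

variable {m : Fin n → ℤ} {v : Z}

/-- Induction on the word: commuting an arbitrary operator past the outermost lowering operator
leaves single operators acting on the shorter word. On `v` itself an operator of positive height
gives zero, one of height zero is a Cartan element, and one of negative height lowers. -/
theorem IsHWV.word_mem (hΛ : IsSoAction Λ) (hv : IsHWV Λ m v) (l : List (Fin n × Fin n))
    (hl : IsLowering l) : ∀ α β, Λ (wb α) (wb β) (word Λ v l) ∈ cyclic Λ v := by
  induction l with
  | nil =>
    intro α β
    rcases lt_trichotomy (ht α + ht β) 0 with h | h | h
    · exact cyclicLow_le _ (lower_mem_cyclicLow v h (mem_cyclic v))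
    · have : β = dualIdx α := ht_injective (by rw [ht_dualIdx]; omega)
      subst this
      change Λ _ _ v ∈ _
      rw [hv.cartan]
      exact Submodule.smul_mem _ _ (mem_cyclic v)
    · change Λ _ _ v ∈ _
      rw [hv.raise _ _ h]
      exact Submodule.zero_mem _
  | cons p l ih =>
    intro α β
    have hp : ht p.1 + ht p.2 < 0 := hl p (by simp)
    have ih' := ih fun q hq => hl q (by simp [hq])
    change Λ _ _ (Λ (wb p.1) (wb p.2) (word Λ v l)) ∈ _
    rw [hΛ.bracket_wb]
    exact Submodule.add_mem _ (cyclicLow_le _ (lower_mem_cyclicLow v hp (ih' α β)))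
      (Submodule.add_mem _ (Submodule.sub_mem _ (Submodule.sub_mem _
        (Submodule.smul_mem _ _ (ih' _ _)) (Submodule.smul_mem _ _ (ih' _ _)))
        (Submodule.smul_mem _ _ (ih' _ _))) (Submodule.smul_mem _ _ (ih' _ _)))

theorem IsHWV.cyclic_stable (hΛ : IsSoAction Λ) (hv : IsHWV Λ m v) (a b : Fin n → ℂ) {z : Z}
    (hz : z ∈ cyclic Λ v) : Λ a b z ∈ cyclic Λ v := by
  refine Submodule.span_induction (p := fun z _ => Λ a b z ∈ cyclic Λ v)
    ?_ (by simp) (fun x y _ _ hx hy => ?_) (fun c x _ hx => ?_) hz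
  · rintro _ ⟨l, hl, rfl⟩
    rw [eq_sum_wb a, eq_sum_wb b]
    simp only [map_sum, map_smul, LinearMap.sum_apply, LinearMap.smul_apply]
    exact Submodule.sum_mem _ fun α _ => Submodule.smul_mem _ _ (Submodule.sum_mem _ fun β _ =>
      Submodule.smul_mem _ _ (hv.word_mem hΛ l hl _ _))
  · rw [map_add]; exact Submodule.add_mem _ hx hy
  · rw [map_smul]; exact Submodule.smul_mem _ _ hx

theorem IsHWV.cartan_word (hΛ : IsSoAction Λ) (hv : IsHWV Λ m v) (l : List (Fin n × Fin n))
    (α : Fin n) : Λ (wb α) (wb (dualIdx α)) (word Λ v l) =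
      ((m α + (l.map fun p => wtp α p.1 + wtp α p.2).sum : ℤ) : ℂ) • word Λ v l := by
  induction l with
  | nil => simpa [word] using hv.cartan α
  | cons p l ih =>
    change Λ _ _ (Λ (wb p.1) (wb p.2) (word Λ v l)) = _ • Λ (wb p.1) (wb p.2) (word Λ v l)
    rw [hΛ.cartan_bracket, ih, map_smul, ← add_smul]
    congr 1
    simp only [List.map_cons, List.sum_cons]
    push_cast
    ring

/-- The Cartan element that grades by height. -/
def heightOp (Λ : (Fin n → ℂ) →ₗ[ℂ] (Fin n → ℂ) →ₗ[ℂ] Module.End ℂ Z) : Module.End ℂ Z :=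
  ∑ α, (ht α : ℂ) • Λ (wb α) (wb (dualIdx α))

theorem IsHWV.heightOp_word (hΛ : IsSoAction Λ) (hv : IsHWV Λ m v) (l : List (Fin n × Fin n)) :
    heightOp Λ (word Λ v l) = ((∑ α, ht α * m α +
      2 * (l.map fun p => ht p.1 + ht p.2).sum : ℤ) : ℂ) • word Λ v l := by
  simp only [heightOp, LinearMap.sum_apply, LinearMap.smul_apply, hv.cartan_word hΛ, smul_smul]
  rw [← Finset.sum_smul]
  congr 1
  have h : ∑ α, ht α * (m α + (l.map fun p => wtp α p.1 + wtp α p.2).sum) =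
      ∑ α, ht α * m α + 2 * (l.map fun p => ht p.1 + ht p.2).sum := by
    simp_rw [mul_add]
    rw [Finset.sum_add_distrib]
    congr 1
    induction l with
    | nil => simp
    | cons p l ih =>
      simp only [List.map_cons, List.sum_cons, mul_add, Finset.sum_add_distrib, sum_ht_mul_wtp]
      rw [ih]
  rw [← h]
  push_cast
  rfl

theorem IsLowering.sum_neg {l : List (Fin n × Fin n)} (hl : IsLowering l) (hne : l ≠ []) :
    (l.map fun p => ht p.1 + ht p.2).sum < 0 := by
  induction l with
  | nil => exact absurd rfl hne
  | cons p l ih =>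
    rw [List.map_cons, List.sum_cons]
    have hp : ht p.1 + ht p.2 < 0 := hl p (by simp)
    by_cases h : l = []
    · subst h; simpa using hp
    · have := ih (fun q hq => hl q (by simp [hq])) h
      omega

/-- The highest weight vectors span the top eigenspace of the height operator. -/
theorem IsHWV.eq_zero_of_heightOp (hΛ : IsSoAction Λ) (hv : IsHWV Λ m v) {z : Z}
    (hz : z ∈ cyclicLow Λ v)
    (h : heightOp Λ z = ((∑ α, ht α * m α : ℤ) : ℂ) • z) : z = 0 := by
  -- Nonempty lowering words are eigenvectors for eigenvalues strictly below the top one, and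
  -- eigenspaces for different eigenvalues are independent.
  have hind := (heightOp Λ).eigenspaces_iSupIndep
  have hd := hind ((∑ α, ht α * m α : ℤ) : ℂ)
  rw [Submodule.disjoint_def] at hd
  refine hd z (Module.End.mem_eigenspace_iff.2 h) ?_
  refine (Submodule.span_le.2 ?_ : cyclicLow Λ v ≤ _) hz
  rintro _ ⟨l, hl, hne, rfl⟩
  have hs := hl.sum_neg hne
  refine Submodule.mem_iSup_of_mem ((∑ α, ht α * m α +
      2 * (l.map fun p => ht p.1 + ht p.2).sum : ℤ) : ℂ) (Submodule.mem_iSup_of_mem ?_ ?_)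
  · intro h
    have := Int.cast_injective (α := ℂ) h
    omega
  · exact Module.End.mem_eigenspace_iff.2 (hv.heightOp_word hΛ l)

theorem IsHWV.notMem_cyclicLow (hΛ : IsSoAction Λ) (hv : IsHWV Λ m v) : v ∉ cyclicLow Λ v := by
  intro h
  refine hv.ne_zero (hv.eq_zero_of_heightOp hΛ h ?_)
  simpa [word] using hv.heightOp_word hΛ []

/-- The lowest weight functional dual to a cyclic highest weight vector. -/
theorem IsHWV.exists_functional (hΛ : IsSoAction Λ) (hv : IsHWV Λ m v) (htop : cyclic Λ v = ⊤) :
    ∃ w : Z →ₗ[ℂ] ℂ, w v = 1 ∧ (∀ α β, ht α + ht β < 0 → ∀ z, w (Λ (wb α) (wb β) z) = 0) ∧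
      ∀ α z, w (Λ (wb α) (wb (dualIdx α)) z) = (m α : ℂ) * w z := by
  -- A functional that kills everything strictly below `v` and is then normalised at `v`; by
  -- cyclicity it reads off the coefficient of `v`.
  obtain ⟨f, hf, hle⟩ := Submodule.exists_le_ker_of_notMem (hv.notMem_cyclicLow hΛ)
  have hlow : ∀ s ∈ cyclicLow Λ v, f s = 0 := fun s hs => hle hs
  refine ⟨(f v)⁻¹ • f, by simp [hf], fun α β h z => ?_, fun α z => ?_⟩
  · have hz : z ∈ cyclic Λ v := htop ▸ Submodule.mem_top
    simp [hlow _ (lower_mem_cyclicLow v h hz)]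
  · obtain ⟨c, s, hs, rfl⟩ := cyclic_eq v (z := z) (htop ▸ Submodule.mem_top : z ∈ cyclic Λ v)
    have hs' : Λ (wb α) (wb (dualIdx α)) s ∈ cyclicLow Λ v := by
      refine Submodule.span_induction (p := fun s _ => Λ (wb α) (wb (dualIdx α)) s ∈ cyclicLow Λ v)
        ?_ (by simp) (fun x y _ _ hx hy => ?_) (fun c x _ hx => ?_) hs
      · rintro _ ⟨l, hl, hne, rfl⟩
        rw [hv.cartan_word hΛ]
        exact Submodule.smul_mem _ _ (Submodule.subset_span ⟨l, hl, hne, rfl⟩)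
      · rw [map_add]; exact Submodule.add_mem _ hx hy
      · rw [map_smul]; exact Submodule.smul_mem _ _ hx
    simp only [map_add, map_smul, hv.cartan, LinearMap.smul_apply, hlow _ hs, hlow _ hs', smul_eq_mul]
    ring

end HighestWeight

/-! ### Irreducible representations -/

section IrrepHW

variable {n : ℕ} {lam : Fin (n / 2) → ℤ}

/-- The values of a weight on the Cartan elements `Λ(b_α, b_α*)`. -/
def wval (lam : Fin (n / 2) → ℤ) (α : Fin n) : ℤ :=
  if h : α.1 / 2 < n / 2 then (if α.1 % 2 = 0 then lam ⟨α.1 / 2, h⟩ else - lam ⟨α.1 / 2, h⟩) else 0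

/-- The index of the weight `e_j`. -/
def posIdx (j : Fin (n / 2)) : Fin n := ⟨2 * j.1, by have := j.2; omega⟩

theorem ht_posIdx (j : Fin (n / 2)) : ht (posIdx j) = (n / 2 : ℕ) - (j.1 : ℤ) := by
  have hj := j.2
  rw [ht, if_pos (by simp [posIdx]), if_pos (by simp only [posIdx]; omega)]
  simp [posIdx]

theorem wtp_posIdx (j : Fin (n / 2)) (γ : Fin n) : wtp (posIdx j) γ =
    (if ht γ = (n / 2 : ℕ) - (j.1 : ℤ) then 1 else 0) -
      (if ht γ = -((n / 2 : ℕ) - (j.1 : ℤ)) then 1 else 0) := by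
  rw [wtp, ← ht_posIdx, ← ht_dualIdx]
  simp only [ht_injective.eq_iff]

theorem exists_eq_posIdx {α : Fin n} (h : 0 < ht α) : ∃ j, α = posIdx j := by
  have hα := α.2
  simp only [ht] at h
  refine ⟨⟨α.1 / 2, by split_ifs at h <;> omega⟩, Fin.ext ?_⟩
  simp only [posIdx]
  split_ifs at h <;> omega

/-- A raising operator increases the first coordinate of the weight that it changes. This turns
maximality for the lexicographic order into annihilation by all raising operators. -/
theorem exists_wtp_pos {α β : Fin n} (h : 0 < ht α + ht β) :
    ∃ j : Fin (n / 2), 0 < wtp (posIdx j) α + wtp (posIdx j) β ∧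
      ∀ i, i < j → wtp (posIdx i) α + wtp (posIdx i) β = 0 := by
  wlog hab : ht β ≤ ht α generalizing α β
  · obtain ⟨j, h1, h2⟩ := this (α := β) (β := α) (by omega) (by omega)
    exact ⟨j, by omega, fun i hi => by have := h2 i hi; omega⟩
  obtain ⟨j, rfl⟩ := exists_eq_posIdx (α := α) (by omega)
  have hj := j.2
  have hh := ht_posIdx j
  refine ⟨j, ?_, fun i hi => ?_⟩
  · rw [wtp_posIdx, wtp_posIdx]
    split_ifs <;> omega
  · have hi' : i.1 < j.1 := hi
    rw [wtp_posIdx, wtp_posIdx]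
    split_ifs <;> omega

/-- The continuous representation underlying an irreducible representation. -/
def Irrep.cont (V : Irrep.{v} n lam) : ContRep n V.carrier := ⟨V.rep, V.continuous_rep⟩

/-- For `b = (e_k - i e_l)/√2` and `b* = (e_k + i e_l)/√2` one finds `Λ(b, b*) = -i Λ(e_l, e_k)`,
while `cartan n j` is `e_l ∧ e_k`. So a weight, defined with a factor `i`, is the tuple of
eigenvalues of the operators `Λ(b, b*)`. -/
theorem ContRep.cartan_eq {V : Type v} [NormedAddCommGroup V] [NormedSpace ℂ V]
    [FiniteDimensional ℂ V] (ρ : ContRep n V) (j : Fin (n / 2)) (v : V) :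
    infAction ρ.1 (cartan n j) v =
      Complex.I • ρ.lam (wb (posIdx j)) (wb (dualIdx (posIdx j))) v := by
  have hj := j.2
  have h1 : cartan n j = wedge (dualIdx (posIdx j)) (posIdx j) := by
    apply Subtype.ext
    have : dualIdx (posIdx j) = ⟨2 * j.1 + 1, by omega⟩ := by
      apply Fin.ext
      rw [dualIdx_val, if_pos (by simp [posIdx]), if_pos (by simp only [posIdx]; omega)]
      rfl
    rw [this]
    rfl
  rw [ρ.infAction_eq, h1, ← ρ.gen_apply]
  have e1 : wb (posIdx j) = ((Real.sqrt 2 : ℝ) : ℂ)⁻¹ • (Pi.single (posIdx j) 1 -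
      Complex.I • Pi.single (dualIdx (posIdx j)) 1) := by
    rw [wb, if_pos (by simp [posIdx]), if_pos (by simp only [posIdx]; omega)]
  have e2 : wb (dualIdx (posIdx j)) = ((Real.sqrt 2 : ℝ) : ℂ)⁻¹ • (Pi.single (posIdx j) 1 +
      Complex.I • Pi.single (dualIdx (posIdx j)) 1) := by
    rw [wb, if_neg, dualIdx_dualIdx]
    rw [dualIdx_val, if_pos (by simp [posIdx]), if_pos (by simp only [posIdx]; omega)]
    simp only [posIdx]
    omega
  rw [e1, e2]
  simp only [map_smul, map_sub, map_add, LinearMap.sub_apply, LinearMap.add_apply,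
    LinearMap.smul_apply, ρ.lam_single, smul_smul]
  have hs : ∀ i, ρ.gen i i v = 0 := by
    intro i
    rw [← ρ.lam_single]
    exact ρ.isSoAction.self_apply _ _
  rw [hs, hs, ρ.gen_skew (dualIdx (posIdx j)) (posIdx j), LinearMap.neg_apply]
  have hI := Complex.I_mul_I
  have h2 := sqrt_two_inv_mul
  set c := ((Real.sqrt 2 : ℝ) : ℂ)⁻¹
  set x := (ρ.gen (dualIdx (posIdx j)) (posIdx j)) v
  have h3 : Complex.I * (c * c) * Complex.I = -1 / 2 := by rw [h2]; linear_combination (1 / 2) * hI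
  simp only [smul_add, smul_sub, smul_neg, smul_smul, smul_zero, sub_zero, ← mul_assoc] at *
  rw [show x = (1 : ℂ) • x by rw [one_smul]]
  simp only [smul_smul, ← neg_smul, ← add_smul, zero_sub]
  congr 1
  linear_combination 2 * h3

/-- The highest weight vector of an irreducible representation. -/
theorem Irrep.exists_isHWV (V : Irrep.{v} n lam) : ∃ v, IsHWV V.cont.lam (wval lam) v := by
  obtain ⟨⟨v, hv0, hv⟩, hmax⟩ := V.highestWeight
  have hΛ := V.cont.isSoAction
  have hpos : ∀ j, V.cont.lam (wb (posIdx j)) (wb (dualIdx (posIdx j))) v = (lam j : ℂ) • v := by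
    intro j
    have h1 := (V.cont.cartan_eq j v).symm.trans (hv j)
    rw [mul_smul] at h1
    exact smul_right_injective _ Complex.I_ne_zero h1
  refine ⟨v, hv0, fun α β h => ?_, fun α => ?_⟩
  -- A nonzero image would be a weight vector for a weight lexicographically above the highest one.
  · by_contra hne
    set w := V.cont.lam (wb α) (wb β) v with hw
    let mu : Fin (n / 2) → ℤ := fun j => lam j + (wtp (posIdx j) α + wtp (posIdx j) β)
    have hmu : IsWeight V.rep mu := by
      refine ⟨w, hne, fun j => ?_⟩
      refine (V.cont.cartan_eq j w).trans ?_
      rw [hw, hΛ.cartan_bracket, hpos, map_smul, ← add_smul, mul_smul]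
      simp only [mu]
      push_cast
      rfl
    have hle := hmax mu hmu
    refine absurd hle (not_le.2 ?_)
    have hex := exists_wtp_pos h
    obtain ⟨j, hj, hj'⟩ := hex
    refine ⟨j, fun i hi => ?_, ?_⟩
    · simp [mu, hj' i hi]
    · simp [mu, hj]
  · by_cases h : α.1 / 2 < n / 2
    · by_cases hp : α.1 % 2 = 0
      · have : α = posIdx ⟨α.1 / 2, h⟩ := by apply Fin.ext; simp only [posIdx]; omega
        have h2 := hpos ⟨α.1 / 2, h⟩
        rw [← this] at h2
        rw [h2, wval, dif_pos h, if_pos hp]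
      · have : dualIdx α = posIdx ⟨α.1 / 2, h⟩ := by
          apply Fin.ext; rw [dualIdx_val, if_neg hp]; simp only [posIdx]; omega
        have h2 := hpos ⟨α.1 / 2, h⟩
        rw [← this, dualIdx_dualIdx] at h2
        rw [hΛ.skew_apply, h2, wval, dif_pos h, if_neg hp]
        push_cast
        rw [neg_smul]
    · have : dualIdx α = α := by
        apply Fin.ext
        have := α.2
        rw [dualIdx_val]
        split_ifs <;> omega
      rw [this, hΛ.self_apply, wval, dif_neg h]
      simp

theorem Irrep.eq_top_of_stable (V : Irrep.{v} n lam) (N : Submodule ℂ V.carrier)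
    (hN : ∀ (A : SO n), ∀ v ∈ N, V.rep A v ∈ N) (hne : N ≠ ⊥) : N = ⊤ := by
  have hirr : IsSimpleOrder (Subrepresentation V.rep) := V.irreducible
  let S : Subrepresentation V.rep := ⟨N, fun A v hv => hN A v hv⟩
  rcases hirr.eq_bot_or_eq_top S with h | h
  · exact absurd (congrArg Subrepresentation.toSubmodule h) hne
  · exact congrArg Subrepresentation.toSubmodule h

theorem Irrep.cyclic_eq_top (V : Irrep.{v} n lam) {v : V.carrier}
    (hv : IsHWV V.cont.lam (wval lam) v) : cyclic V.cont.lam v = ⊤ := by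
  refine V.eq_top_of_stable _ (fun A => V.cont.stable_of_gen _ (fun i j w hw => ?_) A) ?_
  · rw [← V.cont.lam_single]
    exact hv.cyclic_stable V.cont.isSoAction _ _ hw
  · intro h
    have := mem_cyclic (Λ := V.cont.lam) v
    rw [h] at this
    exact hv.ne_zero ((Submodule.mem_bot ℂ).1 this)

end IrrepHW

/-! ### Pure tensors -/

section PureTensor

variable {n : ℕ} {V : Type v} [NormedAddCommGroup V] [NormedSpace ℂ V] {k : ℕ}

/-- The pure tensor `f_1 ⊗ ⋯ ⊗ f_k ⊗ x`. -/
def pureT (f : Fin k → Fin n → ℂ) (x : V) : (Fin k → Fin n) → V := fun K => (∏ s, f s (K s)) • x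

theorem pureT_zero (f : Fin k → Fin n → ℂ) : pureT f (0 : V) = 0 := by
  ext K; simp [pureT]

theorem pureT_add (f : Fin k → Fin n → ℂ) (x y : V) : pureT f (x + y) = pureT f x + pureT f y := by
  ext K; simp [pureT]

theorem pureT_smul (f : Fin k → Fin n → ℂ) (c : ℂ) (x : V) : pureT f (c • x) = c • pureT f x := by
  ext K; simp only [pureT, Pi.smul_apply]; rw [smul_comm]

theorem prod_update_right (f : Fin k → Fin n → ℂ) (s : Fin k) (d : Fin n) (K : Fin k → Fin n) :
    ∏ t, f t (Function.update K s d t) = f s d * ∏ t ∈ Finset.univ \ {s}, f t (K t) := by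
  rw [← Finset.prod_update_of_mem (Finset.mem_univ s)]
  refine Finset.prod_congr rfl fun t _ => ?_
  by_cases h : t = s
  · subst h; simp
  · simp [h]

theorem prod_update_left (f : Fin k → Fin n → ℂ) (s : Fin k) (a : Fin n → ℂ) (K : Fin k → Fin n) :
    ∏ t, Function.update f s a t (K t) = a (K s) * ∏ t ∈ Finset.univ \ {s}, f t (K t) := by
  rw [← Finset.prod_update_of_mem (Finset.mem_univ s)]
  refine Finset.prod_congr rfl fun t _ => ?_
  by_cases h : t = s
  · subst h; simp
  · simp [h]

theorem ContRep.lam_pureT [FiniteDimensional ℂ V] (ρ : ContRep n V) (a b : Fin n → ℂ) (f : Fin k → Fin n → ℂ) (x : V) :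
    (ρ.tensor k).lam a b (pureT f x) = pureT f (ρ.lam a b x) +
      ∑ s, ((b ⬝ᵥ f s) • pureT (Function.update f s a) x
        - (a ⬝ᵥ f s) • pureT (Function.update f s b) x) := by
  ext K
  rw [ρ.tensor_lam]
  simp only [Pi.add_apply, Finset.sum_apply, Pi.sub_apply, Pi.smul_apply, pureT, map_smul,
    prod_update_right, prod_update_left]
  congr 1
  refine Finset.sum_congr rfl fun s _ => ?_
  simp only [smul_smul, dotProduct, ← sub_smul, Finset.sum_mul]
  rw [← Finset.sum_sub_distrib, Finset.sum_smul]
  refine Finset.sum_congr rfl fun d _ => ?_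
  congr 1; ring

theorem eq_sum_pureT (T : (Fin k → Fin n) → V) : T = ∑ J : Fin k → Fin n,
    pureT (fun s => wb (J s)) (∑ K, (∏ s, wb (dualIdx (J s)) (K s)) • T K) := by
  ext L
  simp only [Finset.sum_apply, pureT, Finset.smul_sum, smul_smul]
  rw [Finset.sum_comm]
  simp only [← Finset.sum_smul, ← Finset.prod_mul_distrib]
  have h : ∀ K : Fin k → Fin n, ∑ J : Fin k → Fin n,
      ∏ s, (wb (J s) (L s) * wb (dualIdx (J s)) (K s)) = if L = K then 1 else 0 := by
    intro K
    rw [← Fintype.prod_sum (fun s α => wb α (L s) * wb (dualIdx α) (K s))]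
    simp only [wb_complete]
    rw [Finset.prod_ite_zero]
    simp [funext_iff]
  simp [h]

end PureTensor

/-! ### Equivariant maps between irreducible representations -/

section Injectivity

variable {n : ℕ} {lam mu : Fin (n / 2) → ℤ} {V : Irrep.{v} n lam} {W : Irrep.{v} n mu}

/-- The linear maps `(⊗ᵏ ℝⁿ) ⊗ V → W` that commute with the Lie algebra. -/
def IsSoMap (V : Irrep.{v} n lam) (W : Irrep.{v} n mu) {k : ℕ}
    (q : ((Fin k → Fin n) → V.carrier) →ₗ[ℂ] W.carrier) : Prop :=
  ∀ a b T, q ((V.cont.tensor k).lam a b T) = W.cont.lam a b (q T)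

theorem isSoMap_of_mem {p : ((Fin 4 → Fin n) → V.carrier) →ₗ[ℂ] W.carrier}
    (hp : p ∈ equivariantMaps V W) : IsSoMap V W p := by
  refine lam_comm_of_equivariant (V.cont.tensor 4) W.cont p fun A T => (congrArg p ?_).trans (hp A T)
  ext J
  rw [ContRep.tensor_apply]
  rfl

/-- By completeness of the weight basis and cyclicity of `V`, the tensors `b_J ⊗ (word applied to
v)` span. -/
theorem Irrep.induction {v : V.carrier} (hv : IsHWV V.cont.lam (wval lam) v)
    {k : ℕ} (ψ : ((Fin k → Fin n) → V.carrier) →ₗ[ℂ] ℂ)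
    (h : ∀ (J : Fin k → Fin n) l, IsLowering l →
      ψ (pureT (fun s => wb (J s)) (word V.cont.lam v l)) = 0) : ψ = 0 := by
  refine LinearMap.ext fun T => ?_
  rw [eq_sum_pureT T, map_sum, LinearMap.zero_apply]
  refine Finset.sum_eq_zero fun J _ => ?_
  generalize (∑ K, (∏ s, wb (dualIdx (J s)) (K s)) • T K) = x
  have hx : x ∈ cyclic V.cont.lam v := V.cyclic_eq_top hv ▸ Submodule.mem_top
  refine Submodule.span_induction (p := fun x _ => ψ (pureT (fun s => wb (J s)) x) = 0)
    ?_ (by simp [pureT_zero]) (fun x y _ _ hx hy => ?_) (fun c x _ hx => ?_) hx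
  · rintro _ ⟨l, hl, rfl⟩
    exact h J l hl
  · rw [pureT_add, map_add, hx, hy, add_zero]
  · rw [pureT_smul, map_smul, hx, smul_zero]

/-- The top component of a tensor with values in `V`. -/
def topTensor (γ : Fin n) (v : V.carrier) : (Fin 4 → Fin n) → V.carrier :=
  pureT (fun _ => wb γ) v

theorem update_wb {k : ℕ} (J : Fin k → Fin n) (s : Fin k) (α : Fin n) :
    Function.update (fun s => (wb (J s))) s (wb α) = fun t => wb (Function.update J s α t) := by
  ext t i
  by_cases h : t = s
  · subst h; simp
  · simp [h]

variable {γ : Fin n}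

/-- The multiplicity bound. Invariance and the vanishing of `w` on images of lowering operators
allow a lowering operator on the last factor to be traded for its action on the slots, so `w ∘ q` is
determined by its values on `b_J ⊗ v`. That vector has weight `lam + ∑ wt(b_{J s})`, whereas `w`
sees only the weight `lam + 4γ`, which leaves the constant index `J = γ`. -/
theorem eq_zero_of_topTensor (hγ : dualIdx γ ≠ γ) (hm : ∀ α, wval mu α = wval lam α + 4 * wtp α γ)
    {v : V.carrier} (hv : IsHWV V.cont.lam (wval lam) v) {w : W.carrier →ₗ[ℂ] ℂ} (hw0 : w ≠ 0)
    (hw1 : ∀ α β, ht α + ht β < 0 → ∀ z, w (W.cont.lam (wb α) (wb β) z) = 0)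
    (hw2 : ∀ α z, w (W.cont.lam (wb α) (wb (dualIdx α)) z) = (wval mu α : ℂ) * w z)
    {q : ((Fin 4 → Fin n) → V.carrier) →ₗ[ℂ] W.carrier} (hq : IsSoMap V W q)
    (h : w (q (topTensor γ v)) = 0) : q = 0 := by
  have hψ : w ∘ₗ q = 0 := by
    refine Irrep.induction hv _ fun J l hl => ?_
    rw [LinearMap.comp_apply]
    induction l generalizing J with
    | nil =>
      change w (q (pureT _ v)) = 0
      by_cases hJ : ∀ s, J s = γ
      · have : J = fun _ => γ := funext hJ
        rw [this]; exact h
      -- Compare eigenvalues of the Cartan element of `γ`: every slot contributes at most one, with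
      -- equality only for `J s = γ`, while `w` requires a total contribution of four.
      · have e1 := hw2 γ (q (pureT (fun s => wb (J s)) v))
        rw [← hq, V.cont.lam_pureT] at e1
        simp only [wb_dot, hv.cartan, pureT_smul, update_wb] at e1
        have e2 : ∑ s, (((if J s = dualIdx (dualIdx γ) then (1 : ℂ) else 0) •
            pureT (fun t => wb (Function.update J s γ t)) v)
            - (if J s = dualIdx γ then (1 : ℂ) else 0) •
            pureT (fun t => wb (Function.update J s (dualIdx γ) t)) v) =
            ((∑ s, wtp γ (J s) : ℤ) : ℂ) • pureT (fun s => wb (J s)) v := by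
          push_cast
          rw [Finset.sum_smul]
          refine Finset.sum_congr rfl fun s _ => ?_
          rw [dualIdx_dualIdx, wtp]
          push_cast
          rw [sub_smul]
          congr 1
          · split_ifs with hs
            · rw [← hs, Function.update_eq_self]
            · simp
          · split_ifs with hs
            · rw [← hs, Function.update_eq_self]
            · simp
        rw [e2, ← add_smul, map_smul, map_smul, hm, smul_eq_mul] at e1
        have e3 : ((wval lam γ + ∑ s, wtp γ (J s) : ℤ) : ℂ) ≠
            ((wval lam γ + 4 * wtp γ γ : ℤ) : ℂ) := by
          intro h'
          have h2 := Int.cast_injective h'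
          push Not at hJ
          obtain ⟨s, hs⟩ := hJ
          have h3 : ∀ s, wtp γ (J s) ≤ 1 := by
            intro s; unfold wtp; split_ifs <;> simp
          have h4 : wtp γ (J s) < 1 := by
            unfold wtp; rw [if_neg hs]; split_ifs <;> simp
          have h5 : ∑ s, wtp γ (J s) < ∑ s : Fin 4, 1 :=
            Finset.sum_lt_sum (fun s _ => h3 s) ⟨s, Finset.mem_univ s, h4⟩
          have h6 : wtp γ γ = 1 := by
            unfold wtp; rw [if_pos rfl, if_neg (Ne.symm hγ)]; rfl
          rw [h6] at h2
          simp at h5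
          omega
        push_cast at e1 e3
        by_contra h'
        exact e3 (mul_right_cancel₀ h' e1)
    | cons p l ih =>
      have hp : ht p.1 + ht p.2 < 0 := hl p (by simp)
      have ih' := fun J => ih J (fun q' hq' => hl q' (by simp [hq']))
      change w (q (pureT _ (V.cont.lam (wb p.1) (wb p.2) (word V.cont.lam v l)))) = 0
      -- Acting on the whole tensor, the lowering operator is killed by `w` after equivariance. The
      -- compensating terms act on the slots only, so they have a shorter word and another `J`.
      have e1 := (V.cont.lam_pureT (wb p.1) (wb p.2) (fun s => wb (J s)) (word V.cont.lam v l)).symm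
      rw [← eq_sub_iff_add_eq] at e1
      rw [e1, map_sub, map_sub, hq, hw1 _ _ hp, zero_sub, neg_eq_zero, map_sum, map_sum]
      refine Finset.sum_eq_zero fun s _ => ?_
      simp only [update_wb, map_sub, map_smul, ih', smul_zero, sub_zero]
  -- A nonzero `q` would be onto by irreducibility of `W`, and then `w` would vanish.
  have hrange : LinearMap.range q = ⊥ := by
    by_contra hne
    have htop := W.eq_top_of_stable (LinearMap.range q) (fun A => W.cont.stable_of_gen _ (by
      rintro i j _ ⟨T, rfl⟩
      rw [← W.cont.lam_single, ← hq]
      exact ⟨_, rfl⟩) A) hne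
    refine hw0 (LinearMap.ext fun z => ?_)
    obtain ⟨T, rfl⟩ : z ∈ LinearMap.range q := htop ▸ Submodule.mem_top
    exact congrArg (fun f => f T) hψ
  exact LinearMap.range_eq_bot.1 hrange

end Injectivity

/-! ### Natural endomorphisms of tensors -/

section TensorOps

variable {n : ℕ} {V : Type v} [NormedAddCommGroup V] [NormedSpace ℂ V] {k : ℕ}

/-- Permutation of tensor indices. -/
def permT (σ : Equiv.Perm (Fin k)) : Module.End ℂ ((Fin k → Fin n) → V) :=
  LinearMap.funLeft ℂ V fun J => J ∘ σ

theorem permT_apply (σ : Equiv.Perm (Fin k)) (T : (Fin k → Fin n) → V) (J : Fin k → Fin n) :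
    permT σ T J = T (J ∘ σ) := rfl

/-- Contraction of two indices followed by multiplication with the metric. -/
def traceT (s t : Fin k) : Module.End ℂ ((Fin k → Fin n) → V) where
  toFun T J := if J s = J t then ∑ d, T (Function.update (Function.update J s d) t d) else 0
  map_add' T T' := by
    ext J
    simp only [Pi.add_apply, Finset.sum_add_distrib]
    split_ifs <;> simp
  map_smul' c T := by
    ext J
    simp only [Pi.smul_apply, RingHom.id_apply, ← Finset.smul_sum]
    split_ifs <;> simp

theorem traceT_apply (s t : Fin k) (T : (Fin k → Fin n) → V) (J : Fin k → Fin n) :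
    traceT s t T J =
      if J s = J t then ∑ d, T (Function.update (Function.update J s d) t d) else 0 := rfl

variable [FiniteDimensional ℂ V] (ρ : ContRep n V)

/-- The coupling of an index of a tensor with the action on its values. -/
def couple (s : Fin k) : Module.End ℂ ((Fin k → Fin n) → V) where
  toFun T J := ∑ e, ρ.gen (J s) e (T (Function.update J s e))
  map_add' T T' := by
    ext J
    simp only [Pi.add_apply, map_add, Finset.sum_add_distrib]
  map_smul' c T := by
    ext J
    simp only [Pi.smul_apply, map_smul, RingHom.id_apply, Finset.smul_sum]

theorem couple_apply (s : Fin k) (T : (Fin k → Fin n) → V) (J : Fin k → Fin n) :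
    couple ρ s T J = ∑ e, ρ.gen (J s) e (T (Function.update J s e)) := rfl

theorem permT_lam (σ : Equiv.Perm (Fin k)) (a b : Fin n → ℂ) (T : (Fin k → Fin n) → V) :
    permT σ ((ρ.tensor k).lam a b T) = (ρ.tensor k).lam a b (permT σ T) := by
  ext J
  rw [permT_apply, ρ.tensor_lam, ρ.tensor_lam, permT_apply]
  congr 1
  refine Fintype.sum_equiv σ _ _ fun s => Finset.sum_congr rfl fun d _ => ?_
  rw [permT_apply, Function.comp_apply]
  congr 2
  ext t
  simp [Function.update_apply]

/-- Both the contraction and the metric are invariant: the terms from the two metric slots (`e1`)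
and from the two contracted slots (`e2`) vanish separately by skewness, and all other slots are
untouched. -/
theorem traceT_lam {s t : Fin k} (hst : s ≠ t) (a b : Fin n → ℂ) (T : (Fin k → Fin n) → V) :
    traceT s t ((ρ.tensor k).lam a b T) = (ρ.tensor k).lam a b (traceT s t T) := by
  have hsplit : ∀ f : Fin k → V, ∑ r, f r = f s + f t + ∑ r ∈ {s, t}ᶜ, f r := by
    intro f
    rw [← Finset.sum_add_sum_compl {s, t} f, Finset.sum_pair hst]
  ext J
  rw [traceT_apply, ρ.tensor_lam, traceT_apply]
  simp only [ρ.tensor_lam, hsplit]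
  have e1 : ∑ d, (a (J s) * b d - b (J s) * a d) • traceT s t T (Function.update J s d) +
      ∑ d, (a (J t) * b d - b (J t) * a d) • traceT s t T (Function.update J t d) = 0 := by
    have h1 : ∀ d, traceT s t T (Function.update J s d) =
        if d = J t then ∑ d, T (Function.update (Function.update J s d) t d) else 0 := by
      intro d
      rw [traceT_apply, Function.update_self, Function.update_of_ne hst.symm]
      simp only [Function.update_idem]
    have h2 : ∀ d, traceT s t T (Function.update J t d) =
        if d = J s then ∑ d, T (Function.update (Function.update J s d) t d) else 0 := by
      intro d
      rw [traceT_apply, Function.update_self, Function.update_of_ne hst]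
      simp only [Function.update_comm hst.symm, Function.update_idem, eq_comm (a := J s)]
    simp only [h1, h2, smul_ite, smul_zero, Finset.sum_ite_eq', Finset.mem_univ, if_true]
    rw [← add_smul]
    ring_nf
    simp
  have e2 : ∑ x, (∑ d, (a x * b d - b x * a d) • T (Function.update (Function.update J s d) t x) +
      ∑ d, (a x * b d - b x * a d) • T (Function.update (Function.update J s x) t d)) = 0 := by
    rw [Finset.sum_add_distrib]
    rw [Finset.sum_comm, ← Finset.sum_add_distrib]
    refine Finset.sum_eq_zero fun x _ => ?_
    rw [← Finset.sum_add_distrib]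
    refine Finset.sum_eq_zero fun d _ => ?_
    rw [← add_smul]
    ring_nf
    simp
  rw [e1, zero_add]
  have e3 : ∀ r ∈ ({s, t}ᶜ : Finset (Fin k)), ∀ d, traceT s t T (Function.update J r d) =
      if J s = J t then ∑ x, T (Function.update (Function.update (Function.update J s x) t x) r d)
      else 0 := by
    intro r hr d
    simp only [Finset.mem_compl, Finset.mem_insert, Finset.mem_singleton, not_or] at hr
    rw [traceT_apply, Function.update_of_ne (Ne.symm hr.1), Function.update_of_ne (Ne.symm hr.2)]
    split_ifs
    · refine Finset.sum_congr rfl fun x _ => ?_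
      rw [Function.update_comm hr.1, Function.update_comm hr.2]
    · rfl
  have e4 : ∑ r ∈ ({s, t}ᶜ : Finset (Fin k)), ∑ d, (a (J r) * b d - b (J r) * a d) •
      traceT s t T (Function.update J r d) = if J s = J t then
      ∑ x, ∑ r ∈ ({s, t}ᶜ : Finset (Fin k)), ∑ d, (a (J r) * b d - b (J r) * a d) •
        T (Function.update (Function.update (Function.update J s x) t x) r d) else 0 := by
    rw [Finset.sum_congr rfl fun r hr => Finset.sum_congr rfl fun d _ => by rw [e3 r hr d]]
    split_ifs
    · simp only [Finset.smul_sum]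
      symm
      rw [Finset.sum_comm]
      refine Finset.sum_congr rfl fun r _ => ?_
      rw [Finset.sum_comm]
    · simp
  rw [e4]
  split_ifs with h
  · rw [map_sum, ← Finset.sum_add_distrib]
    have e5 : ∀ x, ∑ r ∈ ({s, t}ᶜ : Finset (Fin k)), ∑ d,
        (a (Function.update (Function.update J s x) t x r) * b d -
          b (Function.update (Function.update J s x) t x r) * a d) •
        T (Function.update (Function.update (Function.update J s x) t x) r d) =
        ∑ r ∈ ({s, t}ᶜ : Finset (Fin k)), ∑ d, (a (J r) * b d - b (J r) * a d) •
        T (Function.update (Function.update (Function.update J s x) t x) r d) := by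
      intro x
      refine Finset.sum_congr rfl fun r hr => ?_
      simp only [Finset.mem_compl, Finset.mem_insert, Finset.mem_singleton, not_or] at hr
      rw [Function.update_of_ne hr.2, Function.update_of_ne hr.1]
    simp only [e5, Finset.sum_add_distrib]
    congr 1
    rw [← Finset.sum_add_distrib]
    simp only [Function.update_self, Function.update_of_ne hst, Function.update_idem]
    rw [add_eq_right, ← e2]
    refine Finset.sum_congr rfl fun x _ => ?_
    congr 1
    refine Finset.sum_congr rfl fun d _ => ?_
    rw [Function.update_comm hst, Function.update_idem, Function.update_comm hst.symm]
  · simp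

/-- The slots other than `s` commute with the coupling. For slot `s`, the difference between the
actions before and after coupling is the commutator of generators on the values, as given by
`ContRep.gen_bracket`. -/
theorem couple_gen (s : Fin k) (i j : Fin n) (T : (Fin k → Fin n) → V) :
    couple ρ s ((ρ.tensor k).gen i j T) = (ρ.tensor k).gen i j (couple ρ s T) := by
  have hsplit : ∀ f : Fin k → V, ∑ r, f r = f s + ∑ r ∈ {s}ᶜ, f r := by
    intro f
    rw [← Finset.sum_add_sum_compl {s} f, Finset.sum_singleton]
  ext J
  rw [couple_apply, ρ.tensor_gen, couple_apply]
  simp only [ρ.tensor_gen, hsplit, map_add, Finset.sum_add_distrib]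
  set D : Fin n → Fin n → ℂ := fun a d => (if a = i then (1 : ℂ) else 0) * (if d = j then 1 else 0)
        - (if a = j then 1 else 0) * (if d = i then 1 else 0) with hD
  change _ + (∑ e, ρ.gen (J s) e (∑ d, D (Function.update J s e s) d • _) +
    ∑ e, ρ.gen (J s) e (∑ r ∈ {s}ᶜ, ∑ d, D (Function.update J s e r) d • _)) =
    _ + (∑ d, D (J s) d • _ + ∑ r ∈ {s}ᶜ, ∑ d, D (J r) d • _)
  have e1 : ∑ e, ρ.gen (J s) e (∑ r ∈ {s}ᶜ, ∑ d, D (Function.update J s e r) d •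
      T (Function.update (Function.update J s e) r d)) =
      ∑ r ∈ {s}ᶜ, ∑ d, D (J r) d • couple ρ s T (Function.update J r d) := by
    simp only [couple_apply, map_sum, Finset.smul_sum, map_smul]
    rw [Finset.sum_comm]
    refine Finset.sum_congr rfl fun r hr => ?_
    rw [Finset.sum_comm]
    refine Finset.sum_congr rfl fun d _ => Finset.sum_congr rfl fun e _ => ?_
    have hr' : r ≠ s := by simpa using hr
    rw [Function.update_of_ne hr', Function.update_of_ne (Ne.symm hr'), Function.update_comm hr']
  have e2 : ∑ e, ρ.gen (J s) e (∑ d, D (Function.update J s e s) d •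
      T (Function.update (Function.update J s e) s d)) =
      ∑ e, ∑ d, D d e • ρ.gen (J s) d (T (Function.update J s e)) := by
    simp only [map_sum, map_smul, Function.update_self, Function.update_idem]
    rw [Finset.sum_comm]
  have e3 : ∑ d, D (J s) d • couple ρ s T (Function.update J s d) =
      ∑ e, ∑ d, D (J s) d • ρ.gen d e (T (Function.update J s e)) := by
    simp only [couple_apply, Finset.smul_sum, Function.update_self, Function.update_idem]
    rw [Finset.sum_comm]
  rw [e1, e2, e3, ← add_assoc, ← add_assoc]
  congr 1
  rw [map_sum, ← Finset.sum_add_distrib, ← Finset.sum_add_distrib]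
  refine Finset.sum_congr rfl fun e _ => ?_
  generalize T (Function.update J s e) = x
  have hb := congrArg (fun f : Module.End ℂ V => f x) (ρ.gen_bracket i j (J s) e)
  simp only [LinearMap.sub_apply, LinearMap.add_apply, LinearMap.smul_apply,
    Module.End.mul_apply] at hb
  simp only [hD, sub_smul, mul_smul, ite_smul, one_smul, zero_smul, Finset.sum_sub_distrib]
  rw [sub_eq_iff_eq_add] at hb
  have sk : ∀ a, ρ.gen a (J s) x = - ρ.gen (J s) a x := fun a => by
    rw [ρ.gen_skew (J s) a]; rfl
  simp only [Finset.sum_ite_eq', Finset.mem_univ, if_true, hb, sk, ite_smul, one_smul, zero_smul,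
    eq_comm (b := J s), eq_comm (b := e)]
  simp
  split_ifs <;> abel

end TensorOps

/-! ### The pairing of top components -/

section TopPairing

variable {n : ℕ} {lam mu : Fin (n / 2) → ℤ} {V : Irrep.{v} n lam} {W : Irrep.{v} n mu}
  {γ : Fin n}

/-- A highest weight vector `v` of `V(lam)` and a highest weight functional `w` on `V(mu)`, where
`mu` is `lam` plus four times the weight with index `γ`. -/
structure TopPairing (γ : Fin n) (V : Irrep.{v} n lam) (W : Irrep.{v} n mu) where
  dual_ne : dualIdx γ ≠ γ
  wval_eq : ∀ α, wval mu α = wval lam α + 4 * wtp α γ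
  v : V.carrier
  isHWV : IsHWV V.cont.lam (wval lam) v
  w : W.carrier →ₗ[ℂ] ℂ
  w_ne_zero : w ≠ 0
  w_lower : ∀ α β, ht α + ht β < 0 → ∀ z, w (W.cont.lam (wb α) (wb β) z) = 0
  w_cartan : ∀ α z, w (W.cont.lam (wb α) (wb (dualIdx α)) z) = (wval mu α : ℂ) * w z

theorem TopPairing.nonempty (V : Irrep.{v} n lam) (W : Irrep.{v} n mu) (hγ : dualIdx γ ≠ γ)
    (hm : ∀ α, wval mu α = wval lam α + 4 * wtp α γ) : Nonempty (TopPairing γ V W) := by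
  obtain ⟨v, hv⟩ := V.exists_isHWV
  obtain ⟨u, hu⟩ := W.exists_isHWV
  obtain ⟨w, h1, h2, h3⟩ := hu.exists_functional W.cont.isSoAction (W.cyclic_eq_top hu)
  exact ⟨⟨hγ, hm, v, hv, w, fun h => by simp [h] at h1, h2, h3⟩⟩

variable (P : TopPairing γ V W)
include P

theorem TopPairing.eq_zero {q : ((Fin 4 → Fin n) → V.carrier) →ₗ[ℂ] W.carrier}
    (hq : IsSoMap V W q) (h : P.w (q (topTensor γ P.v)) = 0) : q = 0 :=
  eq_zero_of_topTensor P.dual_ne P.wval_eq P.isHWV P.w_ne_zero P.w_lower P.w_cartan hq h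

omit P in
theorem IsSoMap.sub_smul_comp {p : ((Fin 4 → Fin n) → V.carrier) →ₗ[ℂ] W.carrier}
    (hp : IsSoMap V W p) {q : ((Fin 4 → Fin n) → V.carrier) →ₗ[ℂ] W.carrier}
    (hq : IsSoMap V W q) (c d : ℂ) : IsSoMap V W (c • p - d • q) := by
  intro a b T
  simp only [LinearMap.sub_apply, LinearMap.smul_apply, hp a b T, hq a b T, map_sub, map_smul]

/-- A form of Schur's lemma: `p ∘ τ - c p` is an invariant map that vanishes on the one test tensor.
-/
theorem TopPairing.comp_eq {p : ((Fin 4 → Fin n) → V.carrier) →ₗ[ℂ] W.carrier}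
    (hp : IsSoMap V W p) {τ : Module.End ℂ ((Fin 4 → Fin n) → V.carrier)}
    (hτ : ∀ a b T, τ ((V.cont.tensor 4).lam a b T) = (V.cont.tensor 4).lam a b (τ T)) (c : ℂ)
    (h : P.w (p (τ (topTensor γ P.v))) = c * P.w (p (topTensor γ P.v)))
    (T : (Fin 4 → Fin n) → V.carrier) : p (τ T) = c • p T := by
  have h0 : (1 : ℂ) • (p ∘ₗ τ) - c • p = 0 := by
    refine P.eq_zero (IsSoMap.sub_smul_comp (fun a b T => ?_) hp _ _) ?_
    · simp only [LinearMap.comp_apply, hτ, hp a b]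
    · simp [h]
  have := congrArg (fun f => f T) h0
  simpa [sub_eq_zero] using this

/-- The test tensor is symmetric. -/
theorem TopPairing.perm {p : ((Fin 4 → Fin n) → V.carrier) →ₗ[ℂ] W.carrier}
    (hp : IsSoMap V W p) (σ : Equiv.Perm (Fin 4)) (T : (Fin 4 → Fin n) → V.carrier) :
    p (permT σ T) = p T := by
  rw [P.comp_eq hp (permT_lam V.cont σ) 1, one_smul]
  rw [one_mul]
  congr 2
  ext J
  simp only [permT_apply, topTensor, pureT, Function.comp_apply]
  rw [Equiv.prod_comp σ fun s => wb γ (J s)]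

/-- The vector `b_γ` is null because `γ` is not self-dual, so the test tensor is trace-free. -/
theorem TopPairing.trace {p : ((Fin 4 → Fin n) → V.carrier) →ₗ[ℂ] W.carrier}
    (hp : IsSoMap V W p) {s t : Fin 4} (hst : s ≠ t) (T : (Fin 4 → Fin n) → V.carrier) :
    p (traceT s t T) = 0 := by
  rw [P.comp_eq hp (traceT_lam V.cont hst) 0, zero_smul]
  rw [zero_mul]
  have : traceT s t (topTensor γ P.v) = 0 := by
    ext J
    rw [traceT_apply]
    split_ifs with h
    · have h1 : ∀ d, (topTensor γ P.v) (Function.update (Function.update J s d) t d) =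
          (wb γ d * wb γ d * ∏ r ∈ ({s, t} : Finset (Fin 4))ᶜ, wb γ (J r)) • P.v := by
        intro d
        rw [topTensor, pureT, ← Finset.prod_mul_prod_compl {s, t}, Finset.prod_pair hst]
        congr 2
        · simp [Function.update_of_ne hst]
        · refine Finset.prod_congr rfl fun r hr => ?_
          simp only [Finset.mem_compl, Finset.mem_insert, Finset.mem_singleton, not_or] at hr
          rw [Function.update_of_ne hr.2, Function.update_of_ne hr.1]
      simp only [h1]
      rw [← Finset.sum_smul, ← Finset.sum_mul]
      have h2 := wb_dot γ γ
      rw [if_neg (Ne.symm P.dual_ne), dotProduct] at h2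
      rw [h2]
      simp
    · rfl
  rw [this, map_zero, map_zero]

omit P in
-- The coupling is a contraction with the metric, whose expansion in the weight basis pairs each
-- `b_β` with its dual.
theorem couple_pureT (s : Fin 4) (f : Fin 4 → Fin n → ℂ) (x : V.carrier) :
    couple V.cont s (pureT f x) =
      ∑ β, pureT (Function.update f s (wb (dualIdx β))) (V.cont.lam (wb β) (f s) x) := by
  have h1 : ∀ a, ∑ e, (f s e) • V.cont.gen a e x =
      ∑ β, wb (dualIdx β) a • V.cont.lam (wb β) (f s) x := by
    intro a
    have h2 : V.cont.lam (Pi.single a 1) (f s) x = ∑ e, (f s e) • V.cont.gen a e x := by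
      have h3 : f s = ∑ e, f s e • (Pi.single e 1 : Fin n → ℂ) := by
        ext i; simp [Pi.single_apply]
      conv_lhs => rw [h3]
      simp only [map_sum, map_smul, V.cont.lam_single, LinearMap.sum_apply, LinearMap.smul_apply]
    rw [← h2, eq_sum_wb (Pi.single a 1)]
    simp only [map_sum, map_smul, LinearMap.sum_apply, LinearMap.smul_apply, single_dotProduct,
      one_mul]
  ext J
  rw [couple_apply, Finset.sum_apply]
  simp only [pureT, prod_update_right, prod_update_left, map_smul]
  simp only [mul_comm _ (∏ t ∈ Finset.univ \ {s}, f t (J t)), mul_smul]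
  rw [← Finset.smul_sum, ← Finset.smul_sum, h1]

/-- The scalar by which `couple` acts under a projection onto the top component. -/
def coupleConst (lam : Fin (n / 2) → ℤ) (γ : Fin n) : ℤ :=
  - wval lam γ + (Finset.univ.filter fun β : Fin n => ht β + ht γ < 0 ∧ β ≠ γ).card

/-- On the test tensor the coupling is `∑_β b_β* ⊗ Λ(b_β, b_γ) v`, with `b_β*` in slot `s`.
Operators of positive height kill `v`, the one of height zero gives minus the weight, and each one
of negative height, moved onto the slots, turns `b_β*` back into `b_γ` with coefficient one. Hence
the constant is a weight plus a count of lowering operators. -/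
theorem TopPairing.couple {p : ((Fin 4 → Fin n) → V.carrier) →ₗ[ℂ] W.carrier}
    (hp : IsSoMap V W p) (s : Fin 4) (T : (Fin 4 → Fin n) → V.carrier) :
    p (couple V.cont s T) = (coupleConst lam γ : ℂ) • p T := by
  refine P.comp_eq hp (fun a b T => ?_) _ ?_ T
  · simp only [ContRep.lam_apply, map_sum, map_smul, LinearMap.sum_apply, LinearMap.smul_apply,
      couple_gen]
  · set z := topTensor γ P.v with hz
    have h1 : ∀ β, P.w (p (pureT (Function.update (fun _ => wb γ) s (wb (dualIdx β)))
        (V.cont.lam (wb β) (wb γ) P.v))) =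
        ((if β = dualIdx γ then - (wval lam γ : ℂ) else 0) +
          (if ht β + ht γ < 0 ∧ β ≠ γ then 1 else 0)) * P.w (p z) := by
      intro β
      rcases lt_trichotomy (ht β + ht γ) 0 with h | h | h
      · have hβ : β ≠ dualIdx γ := by
          rintro rfl
          rw [ht_dualIdx] at h
          omega
        have e1 := (V.cont.lam_pureT (wb β) (wb γ)
          (Function.update (fun _ => wb γ) s (wb (dualIdx β))) P.v).symm
        rw [← eq_sub_iff_add_eq] at e1
        rw [e1, map_sub, map_sub, hp, P.w_lower _ _ h, zero_sub,
          Finset.sum_eq_single s]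
        · have e2 : (Function.update (fun _ : Fin 4 => wb γ) s (wb γ)) = fun _ => wb γ := by
            ext t; by_cases ht : t = s <;> simp [ht]
          simp only [Function.update_self, Function.update_idem, wb_dot, if_true, one_smul, e2,
            if_neg hβ, zero_add]
          -- For `β = γ` the two terms in slot `s` cancel, in accordance with `Λ(b_γ, b_γ) = 0`;
          -- this index is excluded from the count.
          by_cases hg : β = γ
          · subst hg
            simp
          · have hg' : ¬ dualIdx β = dualIdx γ := fun hh => hg (by
              rw [← dualIdx_dualIdx β, hh, dualIdx_dualIdx])
            rw [if_neg hg', if_pos ⟨h, hg⟩, zero_smul, zero_sub, one_mul, map_neg, map_neg, neg_neg,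
              hz, topTensor]
        · intro t _ hts
          rw [Function.update_of_ne hts, wb_dot, wb_dot, if_neg (Ne.symm P.dual_ne), if_neg]
          · simp
          · intro hh; exact hβ (by rw [hh, dualIdx_dualIdx])
        · simp
      · have hβ : β = dualIdx γ := ht_injective (by rw [ht_dualIdx]; omega)
        subst hβ
        have e2 : (Function.update (fun _ : Fin 4 => wb γ) s (wb γ)) = fun _ => wb γ := by
          ext t; by_cases ht : t = s <;> simp [ht]
        rw [dualIdx_dualIdx, e2, V.cont.isSoAction.skew_apply (wb γ), P.isHWV.cartan, if_pos rfl,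
          if_neg (by omega), ← neg_smul, pureT_smul, map_smul, map_smul, add_zero, smul_eq_mul, hz,
          topTensor]
      · have hβ : β ≠ dualIdx γ := by
          rintro rfl
          rw [ht_dualIdx] at h
          omega
        rw [P.isHWV.raise _ _ h, pureT_zero, map_zero, map_zero, if_neg hβ, if_neg (by omega)]
        simp
    rw [hz, topTensor, couple_pureT, map_sum, map_sum, Finset.sum_congr rfl fun β _ => h1 β,
      ← Finset.sum_mul, Finset.sum_add_distrib, hz, topTensor]
    congr 1
    simp [coupleConst]

/-- The test tensor is, up to a scalar, the fourth power of the complex covector `a + i b` times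
`v`. If `p` vanished on all real powers, it would vanish on those of `a + t b` for real `t`, hence
by polynomiality also at `t = i`. -/
theorem TopPairing.symbol_ne_zero {p : ((Fin 4 → Fin n) → V.carrier) →ₗ[ℂ] W.carrier}
    (hp : IsSoMap V W p) (hp0 : p ≠ 0) :
    ∃ (xi : Fin n → ℝ) (v : V.carrier), p (fun J => (∏ s, xi (J s)) • v) ≠ 0 := by
  by_contra! hcon
  refine hp0 (P.eq_zero hp ?_)
  obtain ⟨c, a, b, hab⟩ : ∃ (c : ℂ) (a b : Fin n → ℝ), wb γ = fun i => c * ((a i : ℂ) + Complex.I * b i) := by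
    rcases wb_cases γ with ⟨_, _, h⟩ | ⟨_, _, _, h⟩ | ⟨_, _, h⟩
    · refine ⟨((Real.sqrt 2 : ℝ) : ℂ)⁻¹, Pi.single γ 1, - Pi.single (dualIdx γ) 1, ?_⟩
      rw [h]
      ext i
      simp only [Pi.smul_apply, Pi.sub_apply, smul_eq_mul, Pi.single_apply, Pi.neg_apply]
      split_ifs <;> simp [sub_eq_add_neg]
    · refine ⟨1, Pi.single γ 1, 0, ?_⟩
      rw [h]
      ext i
      simp only [Pi.single_apply, Pi.zero_apply]
      split_ifs <;> simp
    · refine ⟨((Real.sqrt 2 : ℝ) : ℂ)⁻¹, Pi.single (dualIdx γ) 1, Pi.single γ 1, ?_⟩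
      rw [h]
      ext i
      simp only [Pi.smul_apply, Pi.add_apply, smul_eq_mul, Pi.single_apply]
      split_ifs <;> simp
  let Q : Polynomial ℂ := ∑ J : Fin 4 → Fin n,
    Polynomial.C (P.w (p (Pi.single J P.v))) *
      ∏ s, (Polynomial.C (a (J s) : ℂ) + Polynomial.X * Polynomial.C (b (J s) : ℂ))
  have hQ : ∀ t : ℂ, Q.eval t = P.w (p (fun J => (∏ s, ((a (J s) : ℂ) + t * b (J s))) • P.v)) := by
    intro t
    have h1 : (fun J : Fin 4 → Fin n => (∏ s, ((a (J s) : ℂ) + t * b (J s))) • P.v) =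
        ∑ J, (∏ s, ((a (J s) : ℂ) + t * b (J s))) • (Pi.single J P.v : (Fin 4 → Fin n) → V.carrier) := by
      ext K
      rw [Finset.sum_apply, Finset.sum_eq_single K]
      · simp
      · intro J _ hJ; simp [Ne.symm hJ]
      · simp
    rw [h1]
    simp only [Q, Polynomial.eval_finsetSum, Polynomial.eval_mul, Polynomial.eval_C,
      Polynomial.eval_prod, Polynomial.eval_add, Polynomial.eval_X, map_sum, map_smul, smul_eq_mul]
    exact Finset.sum_congr rfl fun J _ => mul_comm _ _
  have hQ0 : Q = 0 := by
    refine Polynomial.eq_zero_of_infinite_isRoot Q ?_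
    refine (Set.infinite_range_of_injective Complex.ofReal_injective).mono ?_
    rintro _ ⟨t, rfl⟩
    change Q.eval (t : ℂ) = 0
    rw [hQ]
    have := hcon (fun i => a i + t * b i) P.v
    have h2 : (fun J : Fin 4 → Fin n => (∏ s, ((a (J s) : ℂ) + t * b (J s))) • P.v) =
        fun J => (∏ s, (a (J s) + t * b (J s))) • P.v := by
      ext J
      rw [← Complex.coe_smul]
      push_cast
      rfl
    rw [h2, this, map_zero]
  have h3 := hQ Complex.I
  rw [hQ0, Polynomial.eval_zero] at h3
  have h4 : topTensor γ P.v =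
      c ^ 4 • fun J => (∏ s, ((a (J s) : ℂ) + Complex.I * b (J s))) • P.v := by
    ext J
    rw [topTensor, pureT, hab]
    simp only [Finset.prod_mul_distrib, Finset.prod_const, Finset.card_univ, Fintype.card_fin,
      Pi.smul_apply, smul_smul]
  rw [h4, map_smul, map_smul, ← h3, smul_zero]

/-- Two invariant maps, each scaled by the test value of the other, have the same test value and
therefore coincide. -/
theorem TopPairing.finrank_eq_one {p : ((Fin 4 → Fin n) → V.carrier) →ₗ[ℂ] W.carrier}
    (hp : p ∈ equivariantMaps V W) (hp0 : p ≠ 0) :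
    Module.finrank ℂ (equivariantMaps V W) = 1 := by
  refine _root_.finrank_eq_one (⟨p, hp⟩ : equivariantMaps V W) (by simpa [Subtype.ext_iff] using hp0) ?_
  rintro ⟨q, hq⟩
  have hpz : P.w (p (topTensor γ P.v)) ≠ 0 := fun h => hp0 (P.eq_zero (isSoMap_of_mem hp) h)
  have h := P.eq_zero (IsSoMap.sub_smul_comp (isSoMap_of_mem hp) (isSoMap_of_mem hq)
    (P.w (q (topTensor γ P.v))) (P.w (p (topTensor γ P.v)))) (by simp [mul_comm])
  refine ⟨P.w (q (topTensor γ P.v)) / P.w (p (topTensor γ P.v)), Subtype.ext ?_⟩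
  change (P.w (q (topTensor γ P.v)) / P.w (p (topTensor γ P.v))) • p = q
  rw [div_eq_inv_mul, mul_smul, sub_eq_zero.1 h, smul_smul, inv_mul_cancel₀ hpz, one_smul]

end TopPairing

/-! ### The two weights of interest -/

section Weights

variable {n : ℕ}

theorem dualIdx_posIdx_val (i : Fin (n / 2)) : (dualIdx (posIdx i)).1 = 2 * i.1 + 1 := by
  have := i.2
  rw [dualIdx_val, if_pos (by simp [posIdx]), if_pos (by simp only [posIdx]; omega)]
  rfl

theorem dualIdx_posIdx_ne (i : Fin (n / 2)) : dualIdx (posIdx i) ≠ posIdx i := by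
  intro h
  have := congrArg Fin.val h
  rw [dualIdx_posIdx_val] at this
  simp only [posIdx] at this
  omega

theorem wval_add_single (lam : Fin (n / 2) → ℤ) (i : Fin (n / 2)) (c : ℤ) (α : Fin n) :
    wval (lam + Pi.single i c) α = wval lam α + c * wtp α (posIdx i) := by
  have hα := α.2
  have hi := i.2
  have hw : wtp α (posIdx i) = if α.1 = 2 * i.1 then 1 else if α.1 = 2 * i.1 + 1 then -1 else 0 := by
    have hd : posIdx i = dualIdx α ↔ α = dualIdx (posIdx i) := by
      rw [eq_comm, dualIdx_eq_iff]
    simp only [wtp, hd, Fin.ext_iff, dualIdx_posIdx_val]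
    simp only [posIdx]
    by_cases h1 : α.1 = 2 * i.1
    · simp [h1]
    · simp only [h1, Ne.symm h1, if_false]
      split_ifs <;> rfl
  rw [hw]
  simp only [wval, Pi.add_apply, Pi.single_apply, Fin.ext_iff]
  by_cases h1 : α.1 = 2 * i.1
  · have h2 : α.1 / 2 = i.1 := by omega
    have h3 : α.1 % 2 = 0 := by omega
    simp only [h1, if_true]
    simp
  · by_cases h2 : α.1 = 2 * i.1 + 1
    · have h3 : (2 * i.1 + 1) / 2 = i.1 := by omega
      have h4 : (2 * i.1 + 1) % 2 = 1 := by omega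
      simp only [h2, h3, h4]
      simp
      ring
    · have h3 : ¬ α.1 / 2 = i.1 := by omega
      simp [h1, h2, h3]

theorem wtp_dualIdx (α γ : Fin n) : wtp α (dualIdx γ) = - wtp α γ := by
  unfold wtp
  simp only [dualIdx_eq_iff, dualIdx_dualIdx]
  ring

theorem wval_posIdx (lam : Fin (n / 2) → ℤ) (i : Fin (n / 2)) : wval lam (posIdx i) = lam i := by
  have hi := i.2
  rw [wval, dif_pos (by simp only [posIdx]; omega), if_pos (by simp [posIdx])]
  congr 1
  apply Fin.ext
  simp [posIdx]

theorem wval_dualIdx (lam : Fin (n / 2) → ℤ) (γ : Fin n) :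
    wval lam (dualIdx γ) = - wval lam γ := by
  have hγ := γ.2
  have hd := dualIdx_val γ
  by_cases h1 : γ.1 % 2 = 0
  · by_cases h2 : γ.1 + 1 < n
    · rw [if_pos h1, if_pos h2] at hd
      rw [wval, wval, dif_pos (by omega), dif_pos (by omega), if_pos h1, if_neg (by omega)]
      congr 3
      omega
    · rw [if_pos h1, if_neg h2] at hd
      rw [wval, wval, dif_neg (by omega), dif_neg (by omega)]
      rfl
  · rw [if_neg h1] at hd
    rw [wval, wval, dif_pos (by omega), dif_pos (by omega), if_neg h1, if_pos (by omega), neg_neg]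
    congr 2
    omega

/-- For `γ = e_i` the counted indices are those of the weights `-e_j` with `j < i`. -/
theorem coupleConst_posIdx (lam : Fin (n / 2) → ℤ) (i : Fin (n / 2)) :
    coupleConst lam (posIdx i) = - lam i + i.1 := by
  have hi := i.2
  rw [coupleConst, wval_posIdx]
  congr 2
  have : (Finset.univ.filter fun β : Fin n => ht β + ht (posIdx i) < 0 ∧ β ≠ posIdx i) =
      (Finset.univ : Finset (Fin i.1)).image fun j => ⟨2 * j.1 + 1, by omega⟩ := by
    ext β
    have hβ := β.2
    simp only [Finset.mem_filter, Finset.mem_univ, true_and, Finset.mem_image, ht_posIdx]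
    constructor
    · rintro ⟨h, -⟩
      simp only [ht] at h
      refine ⟨⟨β.1 / 2, ?_⟩, Fin.ext ?_⟩
      · split_ifs at h <;> omega
      · simp only []
        split_ifs at h <;> omega
    · rintro ⟨j, rfl⟩
      have hj := j.2
      refine ⟨?_, fun h => ?_⟩
      · rw [ht, if_neg (by simp only []; omega)]
        simp only []
        omega
      · have := congrArg Fin.val h
        simp only [posIdx] at this
        omega
  rw [this, Finset.card_image_of_injective, Finset.card_univ, Fintype.card_fin]
  intro j k h
  have := congrArg Fin.val h
  simp only [] at this
  apply Fin.ext
  omega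

/-- For `γ = -e_i`, counting from zero, all indices are counted except those of `e_0, …, e_i` and of
`-e_i` itself, which leaves `n - i - 2`. -/
theorem coupleConst_dualIdx (lam : Fin (n / 2) → ℤ) (i : Fin (n / 2)) :
    coupleConst lam (dualIdx (posIdx i)) = lam i + n - 2 - i.1 := by
  have hi := i.2
  rw [coupleConst, wval_dualIdx, wval_posIdx, neg_neg]
  have h1 : (Finset.univ.filter fun β : Fin n => ht β + ht (dualIdx (posIdx i)) < 0 ∧
      β ≠ dualIdx (posIdx i)) = (insert (dualIdx (posIdx i))
      ((Finset.univ : Finset (Fin (i.1 + 1))).image fun j => ⟨2 * j.1, by omega⟩))ᶜ := by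
    ext β
    have hβ := β.2
    simp only [Finset.mem_filter, Finset.mem_univ, true_and, Finset.mem_image, Finset.mem_compl,
      Finset.mem_insert, not_or, ht_dualIdx, ht_posIdx]
    rw [and_comm]
    refine and_congr_right fun _ => ⟨?_, fun h => ?_⟩
    · rintro h ⟨j, rfl⟩
      have hj := j.2
      rw [ht, if_pos (by simp only []; omega), if_pos (by simp only []; omega)] at h
      simp only [] at h
      omega
    · by_contra h2
      simp only [ht] at h2
      refine h ⟨⟨β.1 / 2, ?_⟩, Fin.ext ?_⟩
      · split_ifs at h2 <;> omega
      · simp only []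
        split_ifs at h2 <;> omega
  rw [h1, Finset.card_compl, Fintype.card_fin, Finset.card_insert_of_notMem,
    Finset.card_image_of_injective, Finset.card_univ, Fintype.card_fin]
  · omega
  · intro j k h
    have := congrArg Fin.val h
    simp only [] at this
    apply Fin.ext
    omega
  · simp only [Finset.mem_image, Finset.mem_univ, true_and, not_exists]
    intro j h
    have := congrArg Fin.val h
    rw [dualIdx_posIdx_val] at this
    simp only [] at this
    omega

end Weights

/-! ### Averaging over `SO(n)` -/

section Averaging

variable {n : ℕ} {Z : Type*} [NormedAddCommGroup Z] [NormedSpace ℂ Z] [FiniteDimensional ℂ Z]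
  {Y : Type*} [NormedAddCommGroup Y] [NormedSpace ℂ Y] [FiniteDimensional ℂ Y]

theorem ContRep.continuous_conj (ρ : ContRep n Z) (σ : ContRep n Y) (f : Z →ₗ[ℂ] Y) (z : Z) :
    Continuous fun A : SO n => σ.1 A (f (ρ.1 A⁻¹ z)) := by
  have h1 : Continuous fun A : SO n => σ.ext (ent A.1) :=
    σ.isSmoothRep.contDiff.continuous.comp
      (continuous_pi fun i => continuous_pi fun j => SO.continuous_entry i j)
  have h2 : Continuous fun A : SO n => f (ρ.1 A⁻¹ z) :=
    f.continuous_of_finiteDimensional.comp ((ρ.2 z).comp continuous_inv)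
  exact (h1.clm_apply h2).congr fun A => σ.ext_apply A _

/-- The average of a linear map over the group. -/
def average (ρ : ContRep n Z) (σ : ContRep n Y) (f : Z →ₗ[ℂ] Y) : Z →ₗ[ℂ] Y where
  toFun z := ((SO.haar n).real Set.univ)⁻¹ • ∫ A, σ.1 A (f (ρ.1 A⁻¹ z)) ∂(SO.haar n)
  map_add' z z' := by
    simp only [map_add]
    rw [MeasureTheory.integral_add (SO.integrable (ρ.continuous_conj σ f z))
      (SO.integrable (ρ.continuous_conj σ f z')), smul_add]
  map_smul' c z := by
    simp only [map_smul, RingHom.id_apply]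
    rw [MeasureTheory.integral_smul, smul_comm]

theorem average_apply (ρ : ContRep n Z) (σ : ContRep n Y) (f : Z →ₗ[ℂ] Y) (z : Z) :
    average ρ σ f z = ((SO.haar n).real Set.univ)⁻¹ • ∫ A, σ.1 A (f (ρ.1 A⁻¹ z)) ∂(SO.haar n) :=
  rfl

omit [FiniteDimensional ℂ Z] in
theorem ContRep.mul_inv_apply (ρ : ContRep n Z) (A : SO n) (z : Z) :
    ρ.1 A (ρ.1 A⁻¹ z) = z := by
  rw [← Module.End.mul_apply, ← map_mul, mul_inv_cancel, map_one]; rfl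

omit [FiniteDimensional ℂ Z] in
theorem ContRep.inv_mul_apply (ρ : ContRep n Z) (A : SO n) (z : Z) :
    ρ.1 A⁻¹ (ρ.1 A z) = z := by
  rw [← Module.End.mul_apply, ← map_mul, inv_mul_cancel, map_one]; rfl

theorem average_equivariant (ρ : ContRep n Z) (σ : ContRep n Y) (f : Z →ₗ[ℂ] Y) (B : SO n)
    (z : Z) : average ρ σ f (ρ.1 B z) = σ.1 B (average ρ σ f z) := by
  rw [average_apply, average_apply]
  have h1 : σ.1 B (((SO.haar n).real Set.univ)⁻¹ • ∫ A, σ.1 A (f (ρ.1 A⁻¹ z)) ∂(SO.haar n)) =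
      ((SO.haar n).real Set.univ)⁻¹ • ∫ A, σ.1 B (σ.1 A (f (ρ.1 A⁻¹ z))) ∂(SO.haar n) := by
    simp only [← σ.ext_apply B]
    rw [map_smul, ContinuousLinearMap.integral_comp_comm _
      (SO.integrable (ρ.continuous_conj σ f z))]
  rw [h1, ← MeasureTheory.integral_mul_left_eq_self (μ := SO.haar n)
    (fun A => σ.1 A (f (ρ.1 A⁻¹ (ρ.1 B z)))) B]
  congr 2
  ext A
  simp only [mul_inv_rev, map_mul, Module.End.mul_apply, ρ.inv_mul_apply]

theorem average_eq (ρ : ContRep n Z) (σ : ContRep n Y) (f : Z →ₗ[ℂ] Y) {z : Z} {y : Y}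
    (h : ∀ A, σ.1 A (f (ρ.1 A⁻¹ z)) = y) : average ρ σ f z = y := by
  rw [average_apply]
  simp only [h]
  rw [MeasureTheory.integral_const, smul_smul, inv_mul_cancel₀, one_smul]
  rw [MeasureTheory.measureReal_ne_zero_iff (MeasureTheory.measure_ne_top _ _)]
  exact isOpen_univ.measure_ne_zero _ Set.univ_nonempty

theorem comp_average {X : Type*} [NormedAddCommGroup X] [NormedSpace ℂ X] [FiniteDimensional ℂ X]
    (ρ : ContRep n Z) (σ : ContRep n Y) (f : Z →ₗ[ℂ] Y)
    (r : Y →ₗ[ℂ] X) {z : Z} {x : X} (h : ∀ A, r (σ.1 A (f (ρ.1 A⁻¹ z))) = x) :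
    r (average ρ σ f z) = x := by
  rw [average_apply]
  let r' : Y →L[ℝ] X := (LinearMap.toContinuousLinearMap r).restrictScalars ℝ
  change r' _ = x
  rw [map_smul, ← r'.integral_comp_comm (SO.integrable (ρ.continuous_conj σ f z))]
  have : ∀ A, r' (σ.1 A (f (ρ.1 A⁻¹ z))) = x := h
  simp only [this]
  rw [MeasureTheory.integral_const, smul_smul, inv_mul_cancel₀, one_smul]
  rw [MeasureTheory.measureReal_ne_zero_iff (MeasureTheory.measure_ne_top _ _)]
  exact isOpen_univ.measure_ne_zero _ Set.univ_nonempty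

/-- The product of two representations. -/
def ContRep.prod (ρ : ContRep n Z) (σ : ContRep n Y) : ContRep n (Z × Y) :=
  ⟨{ toFun := fun A => (ρ.1 A).prodMap (σ.1 A)
     map_one' := by ext <;> simp
     map_mul' := fun A B => by ext <;> simp }, fun z => (ρ.2 z.1).prodMk (σ.2 z.2)⟩

theorem ContRep.prod_lam (ρ : ContRep n Z) (σ : ContRep n Y) (a b : Fin n → ℂ) (z : Z × Y) :
    (ρ.prod σ).lam a b z = (ρ.lam a b z.1, σ.lam a b z.2) :=
  Prod.ext
    (lam_comm_of_equivariant (ρ.prod σ) ρ (LinearMap.fst ℂ Z Y) (fun _ _ => rfl) a b z)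
    (lam_comm_of_equivariant (ρ.prod σ) σ (LinearMap.snd ℂ Z Y) (fun _ _ => rfl) a b z)

end Averaging

/-! ### Highest weight vectors in tensor products -/

section Raising

variable {n : ℕ} {Z : Type*} [AddCommGroup Z] [Module ℂ Z]
  (Λ : (Fin n → ℂ) →ₗ[ℂ] (Fin n → ℂ) →ₗ[ℂ] Module.End ℂ Z)

/-- The operator that acts on the defining representation as an elementary matrix in the basis of
positive weight vectors. -/
def unitOp (a b : Fin (n / 2)) : Module.End ℂ Z := Λ (wb (posIdx a)) (wb (dualIdx (posIdx b)))

/-- The coefficients of a highest weight vector in a tensor product with the defining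
representation. -/
def lowerSeq (d : Fin (n / 2) → ℂ) (i : Fin (n / 2)) (v : Z) (j : Fin (n / 2)) : Z :=
  -- The highest weight equations for `∑ b_j ⊗ y_j` are solved from `j = i` downwards; the values
  -- for `j > i` are never used.
  if j < i then -(d j)⁻¹ • ∑ k ∈ (Finset.Ioc j i).attach, unitOp Λ k.1 j (lowerSeq d i v k.1) else v
termination_by i.1 - j.1
decreasing_by
  have := Finset.mem_Ioc.1 k.2
  exact Nat.sub_lt_sub_left (lt_of_lt_of_le this.1 this.2) this.1

variable {Λ} {d : Fin (n / 2) → ℂ} {i : Fin (n / 2)} {v : Z}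

theorem lowerSeq_of_lt {j : Fin (n / 2)} (h : j < i) : lowerSeq Λ d i v j =
    -(d j)⁻¹ • ∑ k ∈ Finset.Ioc j i, unitOp Λ k j (lowerSeq Λ d i v k) := by
  rw [lowerSeq, if_pos h]
  rw [Finset.sum_attach _ fun k => unitOp Λ k j (lowerSeq Λ d i v k)]

theorem lowerSeq_self : lowerSeq Λ d i v i = v := by
  rw [lowerSeq, if_neg (lt_irrefl _)]

theorem downward_induction {P : Fin (n / 2) → Prop} (h0 : P i)
    (h : ∀ j, j < i → (∀ k ∈ Finset.Ioc j i, P k) → P j) : ∀ j ≤ i, P j := by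
  intro j
  induction j using WellFoundedGT.induction with
  | ind j ih =>
    intro hj
    rcases hj.eq_or_lt with rfl | hj
    · exact h0
    · exact h j hj fun k hk => ih k (Finset.mem_Ioc.1 hk).1 (Finset.mem_Ioc.1 hk).2

theorem posIdx_injective : Function.Injective (posIdx (n := n)) := by
  intro a b h
  have := congrArg Fin.val h
  simp only [posIdx] at this
  apply Fin.ext
  omega

theorem posIdx_ne_dualIdx (a b : Fin (n / 2)) : posIdx a ≠ dualIdx (posIdx b) := by
  intro h
  have := congrArg Fin.val h
  rw [dualIdx_posIdx_val] at this
  simp only [posIdx] at this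
  omega

theorem dualIdx_injective : Function.Injective (dualIdx (n := n)) := fun a b h => by
  rw [← dualIdx_dualIdx a, h, dualIdx_dualIdx]

theorem unitOp_bracket (hΛ : IsSoAction Λ) (a b k j : Fin (n / 2)) (z : Z) :
    unitOp Λ a b (unitOp Λ k j z) = unitOp Λ k j (unitOp Λ a b z) +
      ((if k = b then (1 : ℂ) else 0) • unitOp Λ a j z
        - (if j = a then (1 : ℂ) else 0) • unitOp Λ k b z) := by
  unfold unitOp
  rw [hΛ.bracket_wb]
  congr 1
  simp only [dualIdx_dualIdx, posIdx_injective.eq_iff, dualIdx_injective.eq_iff,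
    posIdx_ne_dualIdx, (posIdx_ne_dualIdx _ _).symm, if_false, zero_smul, sub_zero]
  rw [hΛ.skew_apply (wb (posIdx k)), smul_neg, sub_eq_add_neg]

theorem wtp_posIdx_posIdx (a b : Fin (n / 2)) : wtp (posIdx a) (posIdx b) = if b = a then 1 else 0 := by
  simp only [wtp, posIdx_injective.eq_iff, posIdx_ne_dualIdx, if_false, sub_zero]

variable {m : Fin n → ℤ}

/-- Since `unitOp Λ k j` shifts the weight by `e_k - e_j`, all the tensors `b_j ⊗ y_j` have the same
weight `m + e_i`. -/
theorem lowerSeq_cartan (hΛ : IsSoAction Λ) (hv : IsHWV Λ m v) (α : Fin n) : ∀ j ≤ i,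
    Λ (wb α) (wb (dualIdx α)) (lowerSeq Λ d i v j) =
      ((m α + wtp α (posIdx i) - wtp α (posIdx j) : ℤ) : ℂ) • lowerSeq Λ d i v j := by
  refine downward_induction ?_ fun j hj ih => ?_
  · rw [lowerSeq_self, hv.cartan]
    congr 2
    omega
  · have h : ∀ k ∈ Finset.Ioc j i, Λ (wb α) (wb (dualIdx α)) (unitOp Λ k j (lowerSeq Λ d i v k)) =
        ((m α + wtp α (posIdx i) - wtp α (posIdx j) : ℤ) : ℂ) •
          unitOp Λ k j (lowerSeq Λ d i v k) := by
      intro k hk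
      rw [unitOp, hΛ.cartan_bracket, ih k hk, map_smul, ← add_smul, wtp_dualIdx]
      congr 1
      push_cast
      ring
    rw [lowerSeq_of_lt hj, map_smul, map_sum, Finset.sum_congr rfl h, ← Finset.smul_sum, smul_comm]

/-- The raising operators that do not involve the lowest weight vectors. -/
theorem lowerSeq_raise (hΛ : IsSoAction Λ) (hv : IsHWV Λ m v) : ∀ j ≤ i, ∀ α β,
    0 < ht α → 0 < ht α + ht β → - ht (posIdx i) < ht β →
    Λ (wb α) (wb β) (lowerSeq Λ d i v j) = 0 := by
  refine downward_induction ?_ fun j hj ih => ?_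
  · intro α β _ h _
    rw [lowerSeq_self, hv.raise _ _ h]
  · intro α β h1 h2 h3
    rw [lowerSeq_of_lt hj, map_smul, map_sum, Finset.sum_eq_zero, smul_zero]
    intro k hk
    obtain ⟨hjk, hki⟩ := Finset.mem_Ioc.1 hk
    have hik : ht (posIdx i) ≤ ht (posIdx k) := by
      rw [ht_posIdx, ht_posIdx]
      have : k.1 ≤ i.1 := hki
      omega
    have hkj : ht (posIdx k) < ht (posIdx j) := by
      rw [ht_posIdx, ht_posIdx]
      have : j.1 < k.1 := hjk
      omega
    have hi0 : 0 < ht (posIdx i) := by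
      rw [ht_posIdx]
      have := i.2
      omega
    rw [unitOp, hΛ.bracket_wb, ih k hk α β h1 h2 h3, map_zero, zero_add]
    have e1 : posIdx k ≠ dualIdx β := by
      intro h
      have := congrArg ht h
      rw [ht_dualIdx] at this
      omega
    have e2 : posIdx k ≠ dualIdx α := by
      intro h
      have := congrArg ht h
      rw [ht_dualIdx] at this
      omega
    rw [if_neg e1, if_neg e2, zero_smul, zero_smul, sub_zero, zero_sub]
    -- The commutator terms that survive are again raising operators of the admissible kind, covered
    -- by the induction hypothesis.
    have e3 : (if dualIdx (posIdx j) = dualIdx β then (1 : ℂ) else 0) •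
        Λ (wb α) (wb (posIdx k)) (lowerSeq Λ d i v k) = 0 := by
      split_ifs with h
      · rw [ih k hk α (posIdx k) h1 (by omega) (by omega), smul_zero]
      · rw [zero_smul]
    have e4 : (if dualIdx (posIdx j) = dualIdx α then (1 : ℂ) else 0) •
        Λ (wb β) (wb (posIdx k)) (lowerSeq Λ d i v k) = 0 := by
      split_ifs with h
      · rw [hΛ.skew_apply (wb (posIdx k)), ih k hk (posIdx k) β (by omega) (by omega) h3, neg_zero,
          smul_zero]
      · rw [zero_smul]
    rw [e3, e4]
    simp

/-- These equations make `∑ b_j ⊗ y_j` a highest weight vector, because `Λ(b_a, b_b*)` sends `b_b`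
to `b_a`. For `a ≠ j` the commutator terms vanish or cancel in pairs; for `a = j` they add up to a
multiple of `y_b`, and `d j` is chosen to be that multiple. -/
theorem lowerSeq_unitOp (hΛ : IsSoAction Λ) (hv : IsHWV Λ m v)
    (hd : ∀ j, j < i → d j = m (posIdx j) - m (posIdx i) + i.1 - j.1 - 1)
    (hd0 : ∀ j, j < i → d j ≠ 0) : ∀ j ≤ i, ∀ a b, a < b → b ≤ i →
    unitOp Λ a b (lowerSeq Λ d i v j) = -((if a = j then (1 : ℂ) else 0) • lowerSeq Λ d i v b) := by
  refine downward_induction ?_ fun j hj ih => ?_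
  · intro a b hab hb
    have : 0 < ht (posIdx a) + ht (dualIdx (posIdx b)) := by
      rw [ht_dualIdx, ht_posIdx, ht_posIdx]
      have : a.1 < b.1 := hab
      omega
    rw [lowerSeq_self, unitOp, hv.raise _ _ this, if_neg (by omega), zero_smul, neg_zero]
  · intro a b hab hb
    set y := lowerSeq Λ d i v with hy
    have hsum : unitOp Λ a b (y j) = -(d j)⁻¹ • ∑ k ∈ Finset.Ioc j i, (unitOp Λ k j (unitOp Λ a b (y k)) +
      ((if k = b then (1 : ℂ) else 0) • unitOp Λ a j (y k)
        - (if j = a then (1 : ℂ) else 0) • unitOp Λ k b (y k))) := by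
      rw [hy, lowerSeq_of_lt hj, map_smul, map_sum]
      simp only [unitOp_bracket hΛ a b]
    have h1 : ∀ k ∈ Finset.Ioc j i, unitOp Λ k j (unitOp Λ a b (y k)) =
        if a = k then - unitOp Λ k j (y b) else 0 := by
      intro k hk
      rw [ih k hk a b hab hb]
      split_ifs <;> simp
    rw [hsum, Finset.sum_add_distrib, Finset.sum_congr rfl h1, Finset.sum_sub_distrib]
    simp only [Finset.sum_ite_eq, ite_smul, one_smul, zero_smul, Finset.sum_ite_eq']
    rcases lt_trichotomy a j with h | h | h
    · have n1 : a ∉ Finset.Ioc j i := by simp only [Finset.mem_Ioc]; omega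
      have n2 : ¬ j = a := by omega
      have n3 : ¬ a = j := by omega
      simp only [if_neg n1, if_neg n2, if_neg n3, Finset.sum_const_zero, sub_zero, zero_add,
        neg_zero]
      split_ifs with hbm
      · rw [ih b hbm a j h hj.le, if_neg (by omega)]
        simp
      · simp
    · subst h
      rw [if_neg (by simp), if_pos (Finset.mem_Ioc.2 ⟨hab, hb⟩), if_pos rfl, zero_add]
      simp only [if_true]
      have hcart : ∀ c ≤ i, unitOp Λ c c (y b) = ((m (posIdx c) +
          (if i = c then 1 else 0) - (if b = c then 1 else 0) : ℤ) : ℂ) • y b := by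
        intro c _
        rw [unitOp, hy, lowerSeq_cartan hΛ hv _ b hb, wtp_posIdx_posIdx, wtp_posIdx_posIdx]
      have h2 : ∑ k ∈ Finset.Ioo a b, unitOp Λ k b (y k) = -(((b.1 - a.1 - 1 : ℕ) : ℂ) • y b) := by
        have h3 : ∀ k ∈ Finset.Ioo a b, unitOp Λ k b (y k) = - y b := by
          intro k hk
          obtain ⟨hk1, hk2⟩ := Finset.mem_Ioo.1 hk
          rw [ih k (Finset.mem_Ioc.2 ⟨hk1, hk2.le.trans hb⟩) k b hk2 hb]
          simp
        rw [Finset.sum_congr rfl h3, Finset.sum_const, Fin.card_Ioo, ← Nat.cast_smul_eq_nsmul ℂ,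
          smul_neg]
      have h4 : Finset.Ioc a i = insert b (Finset.Ioo a b) ∪ Finset.Ioc b i := by
        ext k
        simp only [Finset.mem_Ioc, Finset.mem_union, Finset.mem_insert, Finset.mem_Ioo]
        omega
      have h5 : Disjoint (insert b (Finset.Ioo a b)) (Finset.Ioc b i) := by
        rw [Finset.disjoint_left]
        intro k
        simp only [Finset.mem_Ioc, Finset.mem_insert, Finset.mem_Ioo]
        omega
      rw [h4, Finset.sum_union h5, Finset.sum_insert (by simp), h2, hcart a hj.le, hcart b hb]
      have hab' : a.1 < b.1 := hab
      have hcast : ((b.1 - a.1 - 1 : ℕ) : ℂ) = b.1 - a.1 - 1 := by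
        rw [Nat.sub_sub, Nat.cast_sub (by omega)]
        push_cast; ring
      rw [hcast]
      rcases hb.eq_or_lt with rfl | hbi
      · rw [Finset.Ioc_self, Finset.sum_empty, add_zero, if_neg (by omega), if_pos rfl]
        have : ((m (posIdx a) + 0 - 0 : ℤ) : ℂ) • y b - (((m (posIdx b) + 1 - 1 : ℤ) : ℂ) • y b +
            -((b.1 - a.1 - 1 : ℂ) • y b)) = d a • y b := by
          rw [hd a hj]
          push_cast
          module
        rw [this, smul_smul, neg_mul, inv_mul_cancel₀ (hd0 a hj), neg_smul, one_smul]
      -- For `b < i` the tail of the sum is the recursion for `y_b` read backwards.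
      · have h6 : ∑ k ∈ Finset.Ioc b i, unitOp Λ k b (y k) = - (d b) • y b := by
          rw [hy, lowerSeq_of_lt hbi, smul_smul, neg_mul_neg, mul_inv_cancel₀ (hd0 b hbi), one_smul]
        rw [h6, if_neg (by omega), if_neg (by omega), if_neg (by omega), if_pos rfl]
        have : ((m (posIdx a) + 0 - 0 : ℤ) : ℂ) • y b - (((m (posIdx b) + 0 - 1 : ℤ) : ℂ) • y b +
            -((b.1 - a.1 - 1 : ℂ) • y b) + -(d b) • y b) = d a • y b := by
          rw [hd a hj, hd b hbi]
          push_cast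
          module
        rw [this, smul_smul, neg_mul, inv_mul_cancel₀ (hd0 a hj), neg_smul, one_smul]
    · have hb' : b ∈ Finset.Ioc j i := Finset.mem_Ioc.2 ⟨h.trans hab, hb⟩
      have n2 : ¬ j = a := by omega
      have n3 : ¬ a = j := by omega
      simp only [if_pos (Finset.mem_Ioc.2 ⟨h, hab.le.trans hb⟩), if_pos hb', if_neg n2, if_neg n3,
        Finset.sum_const_zero, sub_zero, neg_add_cancel, smul_zero, neg_zero]

end Raising

/-! ### Existence of equivariant maps -/

section ConsTensor

variable {n : ℕ} {V : Type v} [NormedAddCommGroup V] [NormedSpace ℂ V] [FiniteDimensional ℂ V]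
  (ρ : ContRep n V) {k : ℕ}

/-- The tensor product of a vector with a tensor. -/
def consT (a : Fin n → ℂ) : ((Fin k → Fin n) → V) →ₗ[ℂ] ((Fin (k + 1) → Fin n) → V) where
  toFun T J := a (J 0) • T (Fin.tail J)
  map_add' T T' := by ext J; simp
  map_smul' c T := by ext J; simp only [Pi.smul_apply, RingHom.id_apply]; rw [smul_comm]

omit [FiniteDimensional ℂ V] in
theorem consT_apply (a : Fin n → ℂ) (T : (Fin k → Fin n) → V) (J : Fin (k + 1) → Fin n) :
    consT a T J = a (J 0) • T (Fin.tail J) := rfl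

theorem ContRep.lam_consT (a b c : Fin n → ℂ) (T : (Fin k → Fin n) → V) :
    (ρ.tensor (k + 1)).lam a b (consT c T) = consT c ((ρ.tensor k).lam a b T) +
      ((b ⬝ᵥ c) • consT a T - (a ⬝ᵥ c) • consT b T) := by
  ext J
  rw [ρ.tensor_lam, Fin.sum_univ_succ]
  simp only [Pi.add_apply, Pi.sub_apply, Pi.smul_apply, consT_apply, Fin.tail_update_zero,
    Fin.tail_update_succ, Function.update_self, ρ.tensor_lam, map_smul, smul_add]
  have e1 : ∑ d, (a (J 0) * b d - b (J 0) * a d) • c d • T (Fin.tail J) =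
      (b ⬝ᵥ c) • a (J 0) • T (Fin.tail J) - (a ⬝ᵥ c) • b (J 0) • T (Fin.tail J) := by
    simp only [smul_smul, dotProduct, ← sub_smul, Finset.sum_mul, ← Finset.sum_sub_distrib,
      Finset.sum_smul]
    refine Finset.sum_congr rfl fun d _ => ?_
    congr 1; ring
  have e2 : ∀ (s : Fin k) (d : Fin n), (Function.update J s.succ d) 0 = J 0 := fun s d =>
    Function.update_of_ne (Fin.succ_ne_zero s).symm _ _
  simp only [e1, e2, Finset.smul_sum]
  rw [add_assoc, add_comm (_ - _)]
  congr 2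
  refine Finset.sum_congr rfl fun s _ => Finset.sum_congr rfl fun d _ => ?_
  rw [smul_comm]
  rfl

variable {ρ} {i : Fin (n / 2)} {m : Fin n → ℤ}

/-- The vector is `∑ b_j ⊗ y_j` over `j ≤ i`, starting from `y_i = v`. The assumption `m_j > m_i`
for `j < i` makes every denominator `d j` at least one. -/
theorem IsHWV.exists_consT {v : (Fin k → Fin n) → V} (hv : IsHWV (ρ.tensor k).lam m v)
    (hm : ∀ j, j < i → m (posIdx i) < m (posIdx j)) :
    ∃ u, IsHWV (ρ.tensor (k + 1)).lam (fun α => m α + wtp α (posIdx i)) u := by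
  have hΛ := (ρ.tensor k).isSoAction
  have hΛ' := (ρ.tensor (k + 1)).isSoAction
  let d : Fin (n / 2) → ℂ := fun j => m (posIdx j) - m (posIdx i) + i.1 - j.1 - 1
  have hd0 : ∀ j, j < i → d j ≠ 0 := by
    intro j hj h
    have h1 : ((m (posIdx j) - m (posIdx i) + i.1 - j.1 - 1 : ℤ) : ℂ) = 0 := by
      rw [← h]; simp [d]
    have h2 := Int.cast_eq_zero.1 h1
    have h3 := hm j hj
    have h4 : j.1 < i.1 := hj
    omega
  set y := lowerSeq (ρ.tensor k).lam d i v with hy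
  have hi0 : 0 < ht (posIdx i) := by
    rw [ht_posIdx]
    have := i.2
    omega
  have hji : ∀ j ≤ i, ht (posIdx i) ≤ ht (posIdx j) := by
    intro j hj
    rw [ht_posIdx, ht_posIdx]
    have : j.1 ≤ i.1 := hj
    omega
  let u : (Fin (k + 1) → Fin n) → V := ∑ j ∈ Finset.Iic i, consT (wb (posIdx j)) (y j)
  have hu : ∀ a b, (ρ.tensor (k + 1)).lam a b u = ∑ j ∈ Finset.Iic i,
      (consT (wb (posIdx j)) ((ρ.tensor k).lam a b (y j)) +
      ((b ⬝ᵥ wb (posIdx j)) • consT a (y j) - (a ⬝ᵥ wb (posIdx j)) • consT b (y j))) := by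
    intro a b
    simp only [u, map_sum, ρ.lam_consT]
  refine ⟨u, ?_, ?_, ?_⟩
  · intro h0
    refine hv.ne_zero (funext fun J => ?_)
    -- Contraction of the first slot with the dual of `b_i` recovers `v`.
    have h1 : ∑ e, wb (dualIdx (posIdx i)) e • u (Fin.cons e J : Fin (k + 1) → Fin n) = v J := by
      simp only [u, Finset.sum_apply, consT_apply, Fin.cons_zero, Fin.tail_cons, Finset.smul_sum]
      rw [Finset.sum_comm]
      have h2 : ∀ j, ∑ e, wb (dualIdx (posIdx i)) e • wb (posIdx j) e • y j J =
          (if j = i then (1 : ℂ) else 0) • y j J := by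
        intro j
        simp only [smul_smul, ← Finset.sum_smul]
        congr 1
        have := wb_dot (dualIdx (posIdx i)) (posIdx j)
        rw [dotProduct] at this
        rw [this]
        simp only [dualIdx_dualIdx, posIdx_injective.eq_iff]
      simp only [h2, ite_smul, one_smul, zero_smul, Finset.sum_ite_eq', Finset.mem_Iic, le_refl,
        if_true]
      rw [hy, lowerSeq_self]
    rw [← h1, h0]
    simp
  · intro α β h
    wlog hαβ : ht β ≤ ht α generalizing α β
    · rw [hΛ'.skew_apply, this β α (by omega) (by omega), neg_zero]
    obtain ⟨a, rfl⟩ := exists_eq_posIdx (α := α) (by omega)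
    rw [hu]
    simp only [wb_dot, (posIdx_ne_dualIdx _ _), if_false, zero_smul, sub_zero]
    -- If `β` lies strictly above `-e_i` in height, every summand is annihilated. Otherwise the
    -- operator is `Λ(b_a, b_b*)` with `a < b ≤ i`, and its action on the slot of `b_b ⊗ y_b`
    -- cancels its action on the factor `y_a` of `b_a ⊗ y_a`.
    by_cases hβ : - ht (posIdx i) < ht β
    · refine Finset.sum_eq_zero fun j hj => ?_
      have hj' := Finset.mem_Iic.1 hj
      rw [hy, lowerSeq_raise hΛ hv j hj' _ _ (by omega) h hβ, map_zero, if_neg, zero_smul, add_zero]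
      intro h1
      have h2 := congrArg ht h1
      rw [ht_dualIdx] at h2
      have := hji j hj'
      omega
    · obtain ⟨b, hb⟩ := exists_eq_posIdx (α := dualIdx β) (by rw [ht_dualIdx]; omega)
      have hβ' : β = dualIdx (posIdx b) := by rw [← hb, dualIdx_dualIdx]
      subst hβ'
      rw [ht_dualIdx, ht_posIdx, ht_posIdx] at h
      rw [ht_dualIdx, ht_posIdx, ht_posIdx] at hβ
      have hab : a < b := Fin.lt_def.2 (by omega)
      have hbi : b ≤ i := Fin.le_def.2 (by omega)
      have h1 : ∀ j ∈ Finset.Iic i, consT (wb (posIdx j))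
          ((ρ.tensor k).lam (wb (posIdx a)) (wb (dualIdx (posIdx b))) (y j)) +
          (if posIdx j = dualIdx (dualIdx (posIdx b)) then (1 : ℂ) else 0) •
            consT (wb (posIdx a)) (y j) =
          (if a = j then - consT (wb (posIdx j)) (y b) else 0) +
          (if j = b then consT (wb (posIdx a)) (y j) else 0) := by
        intro j hj
        have h2 := lowerSeq_unitOp hΛ hv (d := d) (fun j _ => rfl) hd0 j (Finset.mem_Iic.1 hj) a b
          hab hbi
        rw [unitOp] at h2
        rw [hy, h2, dualIdx_dualIdx]
        simp only [posIdx_injective.eq_iff]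
        congr 1
        · split_ifs <;> simp
        · split_ifs <;> simp
      rw [Finset.sum_congr rfl h1, Finset.sum_add_distrib, Finset.sum_ite_eq, Finset.sum_ite_eq',
        if_pos (Finset.mem_Iic.2 hbi), if_pos (Finset.mem_Iic.2 (hab.le.trans hbi)),
        neg_add_cancel]
  · intro α
    rw [hu, Finset.smul_sum]
    refine Finset.sum_congr rfl fun j hj => ?_
    rw [hy, lowerSeq_cartan hΛ hv α j (Finset.mem_Iic.1 hj), map_smul, wb_dot, wb_dot,
      dualIdx_dualIdx]
    have h1 : (if posIdx j = α then (1 : ℂ) else 0) • consT (wb α) (lowerSeq (ρ.tensor k).lam d i v j) =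
        (if posIdx j = α then (1 : ℂ) else 0) •
          consT (wb (posIdx j)) (lowerSeq (ρ.tensor k).lam d i v j) := by
      split_ifs with h
      · rw [h]
      · simp
    have h2 : (if posIdx j = dualIdx α then (1 : ℂ) else 0) •
        consT (wb (dualIdx α)) (lowerSeq (ρ.tensor k).lam d i v j) =
        (if posIdx j = dualIdx α then (1 : ℂ) else 0) •
          consT (wb (posIdx j)) (lowerSeq (ρ.tensor k).lam d i v j) := by
      split_ifs with h
      · rw [h]
      · simp
    rw [h1, h2, ← sub_smul, ← add_smul]
    congr 1
    rw [wtp, wtp]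
    push_cast
    ring

end ConsTensor

section Existence

variable {n : ℕ} {lam mu : Fin (n / 2) → ℤ}

/-- Four applications of `IsHWV.exists_consT`: the gap of more than three keeps `mu_i + r < mu_j` at
the steps `r = 0, …, 3`. -/
theorem Irrep.exists_tensor_isHWV (W : Irrep.{v} n mu) (i : Fin (n / 2))
    (hm : ∀ j, j < i → mu i + 3 < mu j) :
    ∃ u, IsHWV (W.cont.tensor 4).lam (wval (mu + Pi.single i 4)) u := by
  have key : ∀ r : ℕ, r ≤ 4 → ∃ u, IsHWV (W.cont.tensor r).lam
      (fun α => wval mu α + r * wtp α (posIdx i)) u := by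
    intro r
    induction r with
    | zero =>
      intro _
      obtain ⟨w, hw⟩ := W.exists_isHWV
      have h0 : ∀ a b (x : W.carrier), (W.cont.tensor 0).lam a b (fun _ => x) =
          fun _ => W.cont.lam a b x := by
        intro a b x
        ext J
        rw [W.cont.tensor_lam]
        simp
      refine ⟨fun _ => w, fun h => hw.ne_zero (congrFun h Fin.elim0), fun α β h => ?_, fun α => ?_⟩
      · rw [h0, hw.raise α β h]; rfl
      · rw [h0, hw.cartan]; simp; rfl
    | succ r ih =>
      intro hr
      obtain ⟨u, hu⟩ := ih (by omega)
      obtain ⟨u', hu'⟩ := hu.exists_consT (i := i) (fun j hj => by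
        simp only [wval_posIdx, wtp_posIdx_posIdx, if_true]
        rw [if_neg (by omega)]
        have := hm j hj
        have : (r : ℤ) ≤ 3 := by exact_mod_cast (by omega : r ≤ 3)
        omega)
      refine ⟨u', ?_⟩
      convert hu' using 2
      push_cast
      ring
  obtain ⟨u, hu⟩ := key 4 le_rfl
  refine ⟨u, ?_⟩
  convert hu using 1
  ext α
  rw [wval_add_single]
  rfl

theorem word_fst {Z Y : Type*} [NormedAddCommGroup Z] [NormedSpace ℂ Z] [FiniteDimensional ℂ Z]
    [NormedAddCommGroup Y] [NormedSpace ℂ Y] [FiniteDimensional ℂ Y]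
    (ρ : ContRep n Z) (σ : ContRep n Y) (z : Z × Y) (l : List (Fin n × Fin n)) :
    (word (ρ.prod σ).lam z l).1 = word ρ.lam z.1 l := by
  induction l with
  | nil => rfl
  | cons p l ih =>
    change ((ρ.prod σ).lam (wb p.1) (wb p.2) (word (ρ.prod σ).lam z l)).1 =
      ρ.lam (wb p.1) (wb p.2) (word ρ.lam z.1 l)
    rw [ρ.prod_lam, ih]

/-- A representation that contains a highest weight vector of weight `lam` maps onto `V(lam)`. -/
theorem Irrep.exists_equivariant (V : Irrep.{v} n lam) {Z : Type*} [NormedAddCommGroup Z]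
    [NormedSpace ℂ Z] [FiniteDimensional ℂ Z] (ρ : ContRep n Z) {u : Z}
    (hu : IsHWV ρ.lam (wval lam) u) :
    ∃ r : Z →ₗ[ℂ] V.carrier, (∀ A z, r (ρ.1 A z) = V.rep A (r z)) ∧ r ≠ 0 := by
  obtain ⟨v, hv⟩ := V.exists_isHWV
  let τ := ρ.prod V.cont
  have hτ : IsHWV τ.lam (wval lam) (u, v) := by
    refine ⟨fun h => hu.ne_zero (congrArg Prod.fst h), fun α β h => ?_, fun α => ?_⟩
    · rw [ρ.prod_lam, hu.raise _ _ h, hv.raise _ _ h]; rfl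
    · rw [ρ.prod_lam, hu.cartan, hv.cartan]; rfl
  -- The submodule generated by the diagonal vector `(u, v)` will be the graph of a map into `V`.
  set G := cyclic τ.lam (u, v) with hG
  have hGs : ∀ A, ∀ x ∈ G, τ.1 A x ∈ G := fun A => τ.stable_of_gen _ (fun i j w hw => by
    rw [← τ.lam_single]
    exact hτ.cyclic_stable τ.isSoAction _ _ hw) A
  -- If `(0, v)` belonged to it, the first component would place it in the strictly lower part,
  -- although it has the top eigenvalue of `heightOp`.
  have hnot : ((0 : Z), v) ∉ G := by
    intro h
    obtain ⟨c, s, hs, hcs⟩ := cyclic_eq _ h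
    have hs1 : s.1 ∈ cyclicLow ρ.lam u := by
      refine Submodule.span_induction (p := fun s _ => s.1 ∈ cyclicLow ρ.lam u)
        ?_ (Submodule.zero_mem _) (fun x y _ _ hx hy => Submodule.add_mem _ hx hy)
        (fun c x _ hx => Submodule.smul_mem _ c hx) hs
      rintro _ ⟨l, hl, hne, rfl⟩
      exact Submodule.subset_span ⟨l, hl, hne, word_fst _ _ _ _⟩
    have h1 : (0 : Z) = c • u + s.1 := congrArg Prod.fst hcs
    have hc : c = 0 := by
      by_contra hc
      refine hu.notMem_cyclicLow ρ.isSoAction ?_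
      have h2 : u = -c⁻¹ • s.1 := by
        have h3 : s.1 = -(c • u) := (neg_eq_of_add_eq_zero_right h1.symm).symm
        rw [h3, smul_neg, neg_smul, neg_neg, smul_smul, inv_mul_cancel₀ hc, one_smul]
      have h3 := Submodule.smul_mem _ (-c⁻¹) hs1
      rwa [← h2] at h3
    rw [hc, zero_smul, zero_add] at hcs
    have hz := hτ.eq_zero_of_heightOp τ.isSoAction (z := (0, v)) (hcs ▸ hs) (by
      have h4 := hv.heightOp_word V.cont.isSoAction []
      simp only [List.map_nil, List.sum_nil, mul_zero, add_zero] at h4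
      change heightOp V.cont.lam v = _ • v at h4
      refine Prod.ext ?_ ?_
      · simp only [heightOp, LinearMap.sum_apply, LinearMap.smul_apply, Prod.fst_sum, Prod.smul_fst,
          τ, ρ.prod_lam, map_zero, smul_zero, Finset.sum_const_zero]
      · rw [Prod.smul_snd, ← h4]
        simp only [heightOp, LinearMap.sum_apply, LinearMap.smul_apply, Prod.snd_sum, Prod.smul_snd,
          τ, ρ.prod_lam])
    exact hv.ne_zero (congrArg Prod.snd hz)
  -- The fibre over zero is an invariant subspace of `V` that misses `v`, hence zero.
  have hfun : ∀ x ∈ G, x.1 = 0 → x.2 = 0 := by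
    let K : Submodule ℂ V.carrier := G.comap (LinearMap.inr ℂ Z V.carrier)
    have hK : K = ⊥ := by
      by_contra hne
      have := V.eq_top_of_stable K (fun A x hx => by
        have h := hGs A _ hx
        have h1 : τ.1 A (LinearMap.inr ℂ Z V.carrier x) = (0, V.rep A x) := by
          change (ρ.1 A 0, V.rep A x) = _
          rw [map_zero]
        rw [h1] at h
        exact h) hne
      exact hnot (show v ∈ K from this ▸ Submodule.mem_top)
    rintro ⟨x1, x2⟩ hx rfl
    have : x2 ∈ K := hx
    rwa [hK, Submodule.mem_bot] at this
  obtain ⟨r0, hr0⟩ := LinearMap.exists_extend G.toLinearPMap.toFun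
  have hr0' : ∀ x ∈ G, r0 x.1 = x.2 := by
    intro x hx
    have hm : x.1 ∈ G.map (LinearMap.fst ℂ Z V.carrier) := ⟨x, hx, rfl⟩
    have h1 := G.mem_graph_toLinearPMap (fun x hx h => hfun x hx h) ⟨x.1, hm⟩
    have h2 := hfun _ (G.sub_mem hx h1) (sub_self _)
    have h3 : r0 x.1 = G.toLinearPMap ⟨x.1, hm⟩ := congrArg (fun f => f ⟨x.1, hm⟩) hr0
    rw [h3]
    exact (sub_eq_zero.1 h2).symm
  -- A linear extension of the graph map to `Z` need not be equivariant; its average is, and it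
  -- still sends `u` to `v`.
  refine ⟨average ρ V.cont r0, average_equivariant ρ V.cont r0, fun h => hv.ne_zero ?_⟩
  rw [← average_eq ρ V.cont r0 (z := u) (y := v), h, LinearMap.zero_apply]
  intro A
  have h5 : r0 (ρ.1 A⁻¹ u) = V.cont.1 A⁻¹ v :=
    hr0' _ (hGs A⁻¹ _ (mem_cyclic (Λ := τ.lam) (u, v)))
  rw [h5]
  exact V.cont.mul_inv_apply A v

/-- A highest weight vector in `⊗⁴ ⊗ W` gives an equivariant surjection onto `V`. Averaging a linear
section splits it, and as the defining representation is self-dual, contracting the four slots of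
the splitting with the four tensor slots gives a map in the opposite direction. -/
theorem exists_mem_equivariantMaps (V : Irrep.{v} n lam) (W : Irrep.{v} n mu)
    (i : Fin (n / 2)) (hlam : lam = mu + Pi.single i 4) (hm : ∀ j, j < i → mu i + 3 < mu j) :
    (∃ p ∈ equivariantMaps W V, p ≠ 0) ∧ ∃ p ∈ equivariantMaps V W, p ≠ 0 := by
  subst hlam
  obtain ⟨u, hu⟩ := W.exists_tensor_isHWV i hm
  obtain ⟨r, hr, hr0⟩ := V.exists_equivariant (W.cont.tensor 4) hu
  refine ⟨⟨r, fun A T => ?_, hr0⟩, ?_⟩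
  · rw [← hr]
    congr 1
    ext J
    rw [ContRep.tensor_apply]
    rfl
  · have hsurj : LinearMap.range r = ⊤ := by
      refine V.eq_top_of_stable _ ?_ (fun h => hr0 (LinearMap.range_eq_bot.1 h))
      rintro A _ ⟨z, rfl⟩
      exact ⟨_, hr A z⟩
    obtain ⟨f0, hf0⟩ := r.exists_rightInverse_of_surjective hsurj
    let f := average V.cont (W.cont.tensor 4) f0
    have hf : ∀ A x, f (V.rep A x) = (W.cont.tensor 4).1 A (f x) :=
      average_equivariant V.cont (W.cont.tensor 4) f0
    have hrf : ∀ x, r (f x) = x := fun x => by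
      refine comp_average _ _ _ _ fun A => ?_
      rw [hr, show r (f0 (V.cont.1 A⁻¹ x)) = V.cont.1 A⁻¹ x from
        LinearMap.congr_fun hf0 _]
      exact V.cont.mul_inv_apply A x
    let p : ((Fin 4 → Fin n) → V.carrier) →ₗ[ℂ] W.carrier :=
      ∑ J, LinearMap.proj J ∘ₗ f ∘ₗ LinearMap.proj J
    have hp : ∀ T, p T = ∑ J, f (T J) J := fun T => by simp [p]
    refine ⟨p, fun A T => ?_, fun h0 => ?_⟩
    · rw [hp, hp, map_sum]
      have h1 : ∀ J, f (tensorAction V A T J) J =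
          ∑ K, ∑ L, ((∏ s, ent A⁻¹.1 (K s) (J s)) * ∏ s, ent A.1 (J s) (L s)) •
            W.rep A (f (T K) L) := by
        intro J
        have h2 : tensorAction V A T J = ∑ K, ((∏ s, A.1 (J s) (K s) : ℝ) : ℂ) • V.rep A (T K) :=
          Finset.sum_congr rfl fun K _ => (Complex.coe_smul _ _).symm
        rw [h2, map_sum, Finset.sum_apply]
        refine Finset.sum_congr rfl fun K _ => ?_
        rw [map_smul, Pi.smul_apply, hf, ContRep.tensor_apply, Complex.coe_smul, Finset.smul_sum]
        refine Finset.sum_congr rfl fun L _ => ?_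
        rw [smul_smul]
        congr 2
      simp only [h1]
      rw [Finset.sum_comm]
      refine Finset.sum_congr rfl fun K _ => ?_
      rw [Finset.sum_comm]
      -- The matrix coefficients of `A⁻¹` and `A` combine to a Kronecker delta; this is where
      -- orthogonality makes the contraction equivariant.
      simp only [← Finset.sum_smul, sum_prod_mul, inv_mul_cancel, prod_one_apply]
      simp
    · obtain ⟨v, hv⟩ := V.exists_isHWV
      refine hv.ne_zero ?_
      rw [← hrf v]
      have : f v = 0 := by
        ext J
        have := congrArg (fun q => q (Pi.single J v)) h0
        simp only [hp, LinearMap.zero_apply] at this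
        rw [Finset.sum_eq_single J] at this
        · simpa using this
        · intro K _ hK
          simp [hK]
        · simp
      rw [this, map_zero]

end Existence

/-! ### Properties of the projection -/

section Compression

variable {n : ℕ} {lam mu : Fin (n / 2) → ℤ}

/-- The algebraic properties of a projection onto the top component: it is symmetric, kills traces,
and the coupling of an index with the action on `V` acts as a scalar. -/
structure IsTopProjection (V : Irrep.{v} n lam) (W : Irrep.{v} n mu) (c : ℝ)
    (p : ((Fin 4 → Fin n) → V.carrier) →ₗ[ℂ] W.carrier) : Prop where
  equivariant : p ∈ equivariantMaps V W
  perm : ∀ (σ : Equiv.Perm (Fin 4)) T, p (permT σ T) = p T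
  trace : ∀ s t : Fin 4, s ≠ t → ∀ T, p (traceT s t T) = 0
  couple : ∀ (s : Fin 4) T, p (couple V.cont s T) = c • p T

theorem TopPairing.isTopProjection {V : Irrep.{v} n lam} {W : Irrep.{v} n mu} {γ : Fin n}
    (P : TopPairing γ V W) {c : ℝ} (hc : (coupleConst lam γ : ℝ) = c)
    {p : ((Fin 4 → Fin n) → V.carrier) →ₗ[ℂ] W.carrier} (hp : p ∈ equivariantMaps V W) :
    IsTopProjection V W c p where
  equivariant := hp
  perm := P.perm (isSoMap_of_mem hp)
  trace _ _ hst := P.trace (isSoMap_of_mem hp) hst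
  couple s T := by
    rw [P.couple (isSoMap_of_mem hp) s T, ← hc, ← Complex.coe_smul]
    norm_cast

/-- The purely algebraic part of the main theorem. -/
theorem exists_isTopProjection (lam : Fin (n / 2) → ℤ) (i : Fin (n / 2))
    (h1 : IsDominant n (lam + Pi.single i 2))
    (V : Irrep.{v} n (lam + Pi.single i 2)) (W : Irrep.{v} n (lam - Pi.single i 2)) :
    (Module.finrank ℂ (equivariantMaps V W) = 1 ∧
      (∀ p ∈ equivariantMaps V W, p ≠ 0 →
        ∃ (xi : Fin n → ℝ) (v : V.carrier), p (fun J => (∏ s, xi (J s)) • v) ≠ 0) ∧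
      ∀ p ∈ equivariantMaps V W,
        IsTopProjection V W (3 - (-rhoShift n lam i + 2 - (n : ℝ) / 2)) p) ∧
    (Module.finrank ℂ (equivariantMaps W V) = 1 ∧
      (∀ p ∈ equivariantMaps W V, p ≠ 0 →
        ∃ (xi : Fin n → ℝ) (v : W.carrier), p (fun J => (∏ s, xi (J s)) • v) ≠ 0) ∧
      ∀ p ∈ equivariantMaps W V,
        IsTopProjection W V (3 - (rhoShift n lam i + 2 - (n : ℝ) / 2)) p) := by
  have e4 : lam + Pi.single i 2 = lam - Pi.single i 2 + Pi.single i 4 := by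
    ext j
    by_cases h : j = i
    · subst h; simp; ring
    · simp [h]
  have hi : 2 * i.1 + 1 < n := by have := i.2; omega
  -- Dominance of the upper weight gives `λ_j ≥ λ_i + 2 > (λ_i - 2) + 3`, the gap needed for four
  -- steps.
  have hm : ∀ j, j < i → (lam - Pi.single i 2 : Fin (n / 2) → ℤ) i + 3 <
      (lam - Pi.single i 2 : Fin (n / 2) → ℤ) j := by
    intro j hj
    have := h1.1 j i hj
    simp only [Pi.add_apply, Pi.sub_apply, Pi.single_eq_same, Pi.single_eq_of_ne hj.ne] at this ⊢
    have := le_abs_self (lam i + 2)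
    omega
  obtain ⟨⟨p, hp, hp0⟩, ⟨q, hq, hq0⟩⟩ := exists_mem_equivariantMaps V W i e4 hm
  have hw : ∀ α, wval (lam + Pi.single i 2) α =
      wval (lam - Pi.single i 2) α + 4 * wtp α (posIdx i) := by
    intro α
    rw [← wval_add_single, ← e4]
  obtain ⟨P⟩ := TopPairing.nonempty (γ := posIdx i) W V (dualIdx_posIdx_ne i) hw
  obtain ⟨Q⟩ := TopPairing.nonempty (γ := dualIdx (posIdx i)) V W
    (by rw [dualIdx_dualIdx]; exact (dualIdx_posIdx_ne i).symm) (fun α => by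
      rw [hw, wtp_dualIdx]; ring)
  refine ⟨⟨Q.finrank_eq_one hq hq0, fun p hp => Q.symbol_ne_zero (isSoMap_of_mem hp),
    fun p hp => Q.isTopProjection ?_ hp⟩, P.finrank_eq_one hp hp0,
    fun p hp => P.symbol_ne_zero (isSoMap_of_mem hp), fun p hp => P.isTopProjection ?_ hp⟩
  -- With `i` counted from zero the coupling constant is `λ_i + n - i`, which is `3` minus the
  -- density weight: this relation selects the weight.
  · rw [coupleConst_dualIdx, rhoShift]
    simp only [Pi.add_apply, Pi.single_eq_same]
    push_cast
    ring
  -- Here the coupling constant is `2 - λ_i + i`, again `3` minus the density weight.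
  · rw [coupleConst_posIdx, rhoShift]
    simp only [Pi.sub_apply, Pi.single_eq_same]
    push_cast
    ring

end Compression

/-! ### Calculus along vector fields -/

section Calculus

variable {n : ℕ} {M : Type u} [TopologicalSpace M] [ChartedSpace (EuclideanSpace ℝ (Fin n)) M]
  {F : Type*} [NormedAddCommGroup F] [NormedSpace ℝ F]
  {G : Type*} [NormedAddCommGroup G] [NormedSpace ℝ G]

variable (n) in
/-- Smooth functions on a subset of `M`. -/
abbrev IsSmoothFun (f : M → F) (U : Set M) : Prop := ContMDiffOn (𝓡 n) 𝓘(ℝ, F) ∞ f U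

theorem IsSmoothFun.mdifferentiableAt {f : M → F} {U : Set M} (hf : IsSmoothFun n f U)
    (hU : IsOpen U) {x : M} (hx : x ∈ U) : MDifferentiableAt (𝓡 n) 𝓘(ℝ, F) f x :=
  ((hf x hx).contMDiffAt (hU.mem_nhds hx)).mdifferentiableAt (by simp)

/-- A curve through `x` with a given velocity. -/
def curve (x : M) (v : EuclideanSpace ℝ (Fin n)) (t : ℝ) : M :=
  (extChartAt (𝓡 n) x).symm (extChartAt (𝓡 n) x x + t • v)

theorem curve_zero (x : M) (v : EuclideanSpace ℝ (Fin n)) : curve x v 0 = x := by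
  simp [curve]

theorem hasDerivAt_curve_aux {f : M → F} {x : M}
    {L : EuclideanSpace ℝ (Fin n) →L[ℝ] F}
    (hf : HasFDerivAt (f ∘ (extChartAt (𝓡 n) x).symm) L (extChartAt (𝓡 n) x x))
    (v : EuclideanSpace ℝ (Fin n)) :
    HasDerivAt (fun t => f (curve x v t)) (L v) 0 := by
  have h2 : HasDerivAt (fun t : ℝ => extChartAt (𝓡 n) x x + t • v) v 0 := by
    simpa using ((hasDerivAt_id (0 : ℝ)).smul_const v).const_add (extChartAt (𝓡 n) x x)
  have h3 : HasFDerivAt (f ∘ (extChartAt (𝓡 n) x).symm) L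
      (extChartAt (𝓡 n) x x + (0 : ℝ) • v) := by
    rw [zero_smul, add_zero]; exact hf
  exact h3.comp_hasDerivAt 0 h2

/-- Derivatives along coordinate lines compute `mvfderiv`, so the rules of calculus below are
transported from one real variable. -/
theorem hasDerivAt_curve {f : M → F} {x : M} (hf : MDifferentiableAt (𝓡 n) 𝓘(ℝ, F) f x)
    (v : TangentSpace (𝓡 n) x) :
    HasDerivAt (fun t => f (curve x v t)) (mvfderiv (𝓡 n) f x v) 0 := by
  have h1 := hf.hasMFDerivAt.2
  simp only [writtenInExtChartAt, extChartAt_model_space_eq_id, PartialEquiv.refl_coe,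
    Function.id_comp, ModelWithCorners.range_eq_univ] at h1
  exact hasDerivAt_curve_aux (hasFDerivWithinAt_univ.1 h1) v

theorem mvfderiv_eq_of_hasDerivAt {f : M → F} {x : M}
    (hf : MDifferentiableAt (𝓡 n) 𝓘(ℝ, F) f x) {v : TangentSpace (𝓡 n) x} {d : F}
    (h : HasDerivAt (fun t => f (curve x v t)) d 0) : mvfderiv (𝓡 n) f x v = d :=
  (hasDerivAt_curve hf v).unique h

theorem mvfderiv_congr {f g : M → F} {U : Set M} (hU : IsOpen U) {x : M} (hx : x ∈ U)
    (h : ∀ y ∈ U, f y = g y) : mvfderiv (𝓡 n) f x = mvfderiv (𝓡 n) g x := by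
  have h1 : f =ᶠ[nhds x] g := Filter.eventuallyEq_of_mem (hU.mem_nhds hx) h
  unfold mvfderiv
  rw [h1.mfderiv_eq, h x hx]

theorem mvfderiv_clm {f : M → F} {x : M} (hf : MDifferentiableAt (𝓡 n) 𝓘(ℝ, F) f x)
    (L : F →L[ℝ] G) (v : TangentSpace (𝓡 n) x) :
    mvfderiv (𝓡 n) (fun y => L (f y)) x v = L (mvfderiv (𝓡 n) f x v) :=
  mvfderiv_eq_of_hasDerivAt (L.mdifferentiableAt.comp x hf)
    (L.hasFDerivAt.comp_hasDerivAt 0 (hasDerivAt_curve hf v))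

theorem mvfderiv_pi {ι : Type*} [Fintype ι] {f : M → ι → F} {x : M}
    (hf : MDifferentiableAt (𝓡 n) 𝓘(ℝ, ι → F) f x) (v : TangentSpace (𝓡 n) x) (i : ι) :
    mvfderiv (𝓡 n) (fun y => f y i) x v = mvfderiv (𝓡 n) f x v i :=
  mvfderiv_clm hf (ContinuousLinearMap.proj (R := ℝ) (φ := fun _ : ι => F) i) v

theorem IsSmoothFun.clm {f : M → F} {U : Set M} (hf : IsSmoothFun n f U) (L : F →L[ℝ] G) :
    IsSmoothFun n (fun y => L (f y)) U :=
  L.contMDiff.comp_contMDiffOn hf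

theorem isSmoothFun_pi {ι : Type*} [Fintype ι] {f : M → ι → F} {U : Set M} :
    IsSmoothFun n f U ↔ ∀ i, IsSmoothFun n (fun y => f y i) U :=
  contMDiffOn_pi_space

theorem isSmoothFun_rpow {f : M → ℝ} {U : Set M} (hf : IsSmoothFun n f U)
    (h : ∀ x ∈ U, 0 < f x) (s : ℝ) : IsSmoothFun n (fun x => f x ^ s) U := by
  intro x hx
  have h1 : ContDiffAt ℝ ∞ (fun t : ℝ => t ^ s) (f x) :=
    Real.contDiffAt_rpow_const_of_ne (h x hx).ne'
  exact h1.contMDiffAt.comp_contMDiffWithinAt x (hf x hx)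

theorem isSmoothFun_sum {ι : Type*} {s : Finset ι} {f : ι → M → F} {U : Set M}
    (h : ∀ i ∈ s, IsSmoothFun n (f i) U) : IsSmoothFun n (fun y => ∑ i ∈ s, f i y) U :=
  contMDiffOn_finsetSum h

theorem mvfderiv_sum {ι : Type*} (s : Finset ι) {f : ι → M → F} {U : Set M} (hU : IsOpen U) {x : M}
    (hx : x ∈ U) (hf : ∀ i ∈ s, IsSmoothFun n (f i) U) (v : TangentSpace (𝓡 n) x) :
    mvfderiv (𝓡 n) (fun y => ∑ i ∈ s, f i y) x v = ∑ i ∈ s, mvfderiv (𝓡 n) (f i) x v :=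
  mvfderiv_eq_of_hasDerivAt ((isSmoothFun_sum hf).mdifferentiableAt hU hx)
    (HasDerivAt.fun_sum fun i hi => hasDerivAt_curve ((hf i hi).mdifferentiableAt hU hx) v)

theorem mvfderiv_smul_apply {a : M → ℝ} {f : M → F} {U : Set M} (hU : IsOpen U) {x : M}
    (hx : x ∈ U) (ha : IsSmoothFun n a U) (hf : IsSmoothFun n f U) (v : TangentSpace (𝓡 n) x) :
    mvfderiv (𝓡 n) (fun y => a y • f y) x v =
      a x • mvfderiv (𝓡 n) f x v + mvfderiv (𝓡 n) a x v • f x := by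
  have hs : IsSmoothFun n (fun y => a y • f y) U := ContMDiffOn.smul ha hf
  refine mvfderiv_eq_of_hasDerivAt (hs.mdifferentiableAt hU hx) ?_
  have h := (hasDerivAt_curve (ha.mdifferentiableAt hU hx) v).fun_smul
    (hasDerivAt_curve (hf.mdifferentiableAt hU hx) v)
  rw [show curve x v 0 = x from curve_zero x v] at h
  exact h

theorem mvfderiv_add_apply {f g : M → F} {U : Set M} (hU : IsOpen U) {x : M}
    (hx : x ∈ U) (hf : IsSmoothFun n f U) (hg : IsSmoothFun n g U) (v : TangentSpace (𝓡 n) x) :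
    mvfderiv (𝓡 n) (fun y => f y + g y) x v =
      mvfderiv (𝓡 n) f x v + mvfderiv (𝓡 n) g x v :=
  have hs : IsSmoothFun n (fun y => f y + g y) U := ContMDiffOn.add hf hg
  mvfderiv_eq_of_hasDerivAt (hs.mdifferentiableAt hU hx)
    ((hasDerivAt_curve (hf.mdifferentiableAt hU hx) v).fun_add
      (hasDerivAt_curve (hg.mdifferentiableAt hU hx) v))

variable [IsManifold (𝓡 n) ∞ M]

/-- Smooth vector fields on a subset of `M`. -/
abbrev IsSmoothField (X : ∀ x : M, TangentSpace (𝓡 n) x) (U : Set M) : Prop :=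
  ContMDiffOn (𝓡 n) (𝓡 n).tangent ∞ (fun x => (⟨x, X x⟩ : TangentBundle (𝓡 n) M)) U

theorem IsSmoothFun.deriv {f : M → F} {U : Set M} (hU : IsOpen U) (hf : IsSmoothFun n f U)
    {X : ∀ x : M, TangentSpace (𝓡 n) x} (hX : IsSmoothField X U) :
    IsSmoothFun n (fun x => mvfderiv (𝓡 n) f x (X x)) U := by
  have h1 := hf.contMDiffOn_tangentMapWithin (m := ∞) (by simp) hU.uniqueMDiffOn
  have h2 := h1.comp hX (fun x hx => hx)
  have h3 := contMDiff_snd_tangentBundle_modelSpace F 𝓘(ℝ, F) (n := ∞)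
  have h4 := h3.comp_contMDiffOn h2
  refine h4.congr fun x hx => ?_
  change mvfderiv (𝓡 n) f x (X x) = mfderivWithin (𝓡 n) 𝓘(ℝ, F) f U x (X x)
  rw [mfderivWithin_of_isOpen hU hx]
  rfl

theorem IsSmoothField.mdifferentiableAt {X : ∀ x : M, TangentSpace (𝓡 n) x} {U : Set M}
    (hX : IsSmoothField X U) (hU : IsOpen U) {x : M} (hx : x ∈ U) :
    MDifferentiableAt (𝓡 n) (𝓡 n).tangent (fun x => (⟨x, X x⟩ : TangentBundle (𝓡 n) M)) x :=
  ((hX x hx).contMDiffAt (hU.mem_nhds hx)).mdifferentiableAt (by simp)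

theorem IsSmoothField.mlieBracket {X Y : ∀ x : M, TangentSpace (𝓡 n) x} {U : Set M}
    (hU : IsOpen U) (hX : IsSmoothField X U) (hY : IsSmoothField Y U) :
    IsSmoothField (VectorField.mlieBracket (𝓡 n) X Y) U := by
  have : IsManifold (𝓡 n) (((⊤ : ℕ∞) : WithTop ℕ∞) + 1) M := by
    simpa using (inferInstanceAs (IsManifold (𝓡 n) ∞ M))
  have : IsManifold (𝓡 n) (minSmoothness ℝ 2) M := by
    simp only [minSmoothness_of_isRCLikeNormedField]
    exact IsManifold.of_le (n := ∞) ENat.LEInfty.out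
  intro x hx
  exact (((hX x hx).contMDiffAt (hU.mem_nhds hx)).mlieBracket_vectorField (n := ⊤) (m := ⊤)
    ((hY x hx).contMDiffAt (hU.mem_nhds hx)) (by simp)).contMDiffWithinAt

theorem IsSmoothField.smul {X : ∀ x : M, TangentSpace (𝓡 n) x} {U : Set M} {f : M → ℝ}
    (hf : IsSmoothFun n f U) (hX : IsSmoothField X U) : IsSmoothField (fun x => f x • X x) U :=
  ContMDiffOn.smul_section hf hX

theorem IsSmoothField.add {X Y : ∀ x : M, TangentSpace (𝓡 n) x} {U : Set M}
    (hX : IsSmoothField X U) (hY : IsSmoothField Y U) : IsSmoothField (fun x => X x + Y x) U :=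
  ContMDiffOn.add_section hX hY

theorem IsSmoothField.sum {ι : Type*} [DecidableEq ι] {s : Finset ι} {X : ι → ∀ x : M, TangentSpace (𝓡 n) x}
    {U : Set M} (hX : ∀ i, IsSmoothField (X i) U) : IsSmoothField (fun x => ∑ i ∈ s, X i x) U :=
  ContMDiffOn.sum_section fun i _ => hX i

/-- Lie brackets are commutators of derivations. -/
theorem mvfderiv_mlieBracket {X Y Z : ∀ x : M, TangentSpace (𝓡 n) x} {U : Set M} (hU : IsOpen U)
    (hX : IsSmoothField X U) (hY : IsSmoothField Y U) (hZ : IsSmoothField Z U) {f : M → ℝ}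
    (hf : IsSmoothFun n f U) {x : M} (hx : x ∈ U) (hZx : Z x ≠ 0) :
    mvfderiv (𝓡 n) f x (VectorField.mlieBracket (𝓡 n) X Y x) =
      mvfderiv (𝓡 n) (fun y => mvfderiv (𝓡 n) f y (Y y)) x (X x)
      - mvfderiv (𝓡 n) (fun y => mvfderiv (𝓡 n) f y (X y)) x (Y x) := by
  have : IsManifold (𝓡 n) (minSmoothness ℝ 3) M := by
    simp only [minSmoothness_of_isRCLikeNormedField]
    exact IsManifold.of_le (n := ∞) ENat.LEInfty.out
  have two : ∀ {W : ∀ x : M, TangentSpace (𝓡 n) x}, IsSmoothField W U →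
      ContMDiffAt (𝓡 n) (𝓡 n).tangent (minSmoothness ℝ 2)
        (fun x => (⟨x, W x⟩ : TangentBundle (𝓡 n) M)) x := fun hW => by
    simp only [minSmoothness_of_isRCLikeNormedField]
    exact ((hW x hx).contMDiffAt (hU.mem_nhds hx)).of_le ENat.LEInfty.out
  have key : ∀ {V : ∀ x : M, TangentSpace (𝓡 n) x}, IsSmoothField V U → ∀ y ∈ U,
      VectorField.mlieBracket (𝓡 n) V (f • Z) y =
        mvfderiv (𝓡 n) f y (V y) • Z y + f y • VectorField.mlieBracket (𝓡 n) V Z y :=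
    fun hV y hy => VectorField.mlieBracket_smul_right (hf.mdifferentiableAt hU hy)
      (hZ.mdifferentiableAt hU hy)
  have hXY := IsSmoothField.mlieBracket hU hX hY
  have second : ∀ {V W : ∀ x : M, TangentSpace (𝓡 n) x}, IsSmoothField V U → IsSmoothField W U →
      VectorField.mlieBracket (𝓡 n) V (VectorField.mlieBracket (𝓡 n) W (f • Z)) x =
      (mvfderiv (𝓡 n) (fun y => mvfderiv (𝓡 n) f y (W y)) x (V x)) • Z x
      + mvfderiv (𝓡 n) f x (W x) • VectorField.mlieBracket (𝓡 n) V Z x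
      + mvfderiv (𝓡 n) f x (V x) • VectorField.mlieBracket (𝓡 n) W Z x
      + f x • VectorField.mlieBracket (𝓡 n) V (VectorField.mlieBracket (𝓡 n) W Z) x := by
    intro V W hV hW
    have hWf := hf.deriv hU hW
    have hWZ := IsSmoothField.mlieBracket hU hW hZ
    have e1 : VectorField.mlieBracket (𝓡 n) W (f • Z) =ᶠ[nhds x]
        ((fun y => mvfderiv (𝓡 n) f y (W y)) • Z + f • VectorField.mlieBracket (𝓡 n) W Z) :=
      Filter.eventuallyEq_of_mem (hU.mem_nhds hx) fun y hy => key hW y hy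
    rw [Filter.EventuallyEq.mlieBracket_vectorField_eq (Filter.EventuallyEq.refl _ V) e1,
      VectorField.mlieBracket_add_right, VectorField.mlieBracket_smul_right,
      VectorField.mlieBracket_smul_right]
    · abel
    · exact hf.mdifferentiableAt hU hx
    · exact hWZ.mdifferentiableAt hU hx
    · exact hWf.mdifferentiableAt hU hx
    · exact hZ.mdifferentiableAt hU hx
    · exact (IsSmoothField.smul hWf hZ).mdifferentiableAt hU hx
    · exact (IsSmoothField.smul hf hWZ).mdifferentiableAt hU hx
  -- The Jacobi identity for `X`, `Y` and `f Z`, minus `f` times the one for `Z`, leaves the desired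
  -- identity times `Z x`; hence the auxiliary nonvanishing field.
  have jac := VectorField.leibniz_identity_mlieBracket_apply (two hX) (two hY)
    (two (IsSmoothField.smul hf hZ))
  have jac0 := VectorField.leibniz_identity_mlieBracket_apply (two hX) (two hY) (two hZ)
  change VectorField.mlieBracket (𝓡 n) X (VectorField.mlieBracket (𝓡 n) Y (f • Z)) x =
    VectorField.mlieBracket (𝓡 n) (VectorField.mlieBracket (𝓡 n) X Y) (f • Z) x +
    VectorField.mlieBracket (𝓡 n) Y (VectorField.mlieBracket (𝓡 n) X (f • Z)) x at jac
  rw [second hX hY, second hY hX, key hXY x hx, jac0] at jac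
  have h : (mvfderiv (𝓡 n) f x (VectorField.mlieBracket (𝓡 n) X Y x) -
      (mvfderiv (𝓡 n) (fun y => mvfderiv (𝓡 n) f y (Y y)) x (X x)
      - mvfderiv (𝓡 n) (fun y => mvfderiv (𝓡 n) f y (X y)) x (Y x))) • Z x = 0 := by
    rw [sub_smul, sub_smul]
    rw [← sub_eq_zero] at jac
    rw [← neg_eq_zero, ← jac, smul_add]
    abel
  exact sub_eq_zero.1 ((smul_eq_zero.1 h).resolve_right hZx)

end Calculus

/-! ### Orthonormal frames -/

section Frames

variable {n : ℕ} {M : Type u} [TopologicalSpace M] [ChartedSpace (EuclideanSpace ℝ (Fin n)) M]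
  [IsManifold (𝓡 n) ∞ M]

theorem Metric.isSmoothFun_inner (g : Metric n M) {X Y : ∀ x : M, TangentSpace (𝓡 n) x} {U : Set M}
    (hX : IsSmoothField X U) (hY : IsSmoothField Y U) :
    IsSmoothFun n (fun x => g.inner x (X x) (Y x)) U := by
  intro x hx
  have : ContMDiffWithinAt (𝓡 n) ((𝓡 n).prod 𝓘(ℝ)) ∞
      (fun m ↦ Bundle.TotalSpace.mk' ℝ (E := Bundle.Trivial M ℝ) m (g.inner m (X m) (Y m))) U x := by
    apply ContMDiffWithinAt.clm_bundle_apply₂ (F₁ := EuclideanSpace ℝ (Fin n))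
      (F₂ := EuclideanSpace ℝ (Fin n))
    · exact g.contMDiff.contMDiffAt.contMDiffWithinAt
    · exact hX x hx
    · exact hY x hx
  simp only [Bundle.contMDiffWithinAt_totalSpace] at this
  exact this.2

/-- A smooth orthonormal frame on an open set. -/
structure IsFrame (g : Metric n M) (e : Fin n → ∀ x : M, TangentSpace (𝓡 n) x) (U : Set M) :
    Prop where
  isOpen : IsOpen U
  smooth : ∀ i, IsSmoothField (e i) U
  ortho : ∀ x ∈ U, ∀ i j, g.inner x (e i x) (e j x) = if i = j then 1 else 0

theorem orthonormal_linearIndependent (g : Metric n M) {x : M} {u : Fin n → TangentSpace (𝓡 n) x}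
    (h : ∀ i j, g.inner x (u i) (u j) = if i = j then 1 else 0) : LinearIndependent ℝ u := by
  rw [Fintype.linearIndependent_iff]
  intro c hc i
  have h1 := congrArg (fun v => g.inner x v (u i)) hc
  simp only [map_sum, map_smul, sum_apply, smul_apply, h,
    map_zero, zero_apply, smul_eq_mul, mul_ite, mul_one, mul_zero,
    Finset.sum_ite_eq', Finset.mem_univ, if_true] at h1
  exact h1

omit [IsManifold (𝓡 n) ∞ M] in
theorem finrank_tangentSpace (x : M) : Module.finrank ℝ (TangentSpace (𝓡 n) x) = n :=
  finrank_euclideanSpace_fin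

theorem orthonormal_expand (g : Metric n M) {x : M} {u : Fin n → TangentSpace (𝓡 n) x}
    (h : ∀ i j, g.inner x (u i) (u j) = if i = j then 1 else 0) (v : TangentSpace (𝓡 n) x) :
    v = ∑ i, g.inner x v (u i) • u i := by
  have : FiniteDimensional ℝ (TangentSpace (𝓡 n) x) :=
    inferInstanceAs (FiniteDimensional ℝ (EuclideanSpace ℝ (Fin n)))
  have hspan : v ∈ Submodule.span ℝ (Set.range u) := by
    rw [(orthonormal_linearIndependent g h).span_eq_top_of_card_eq_finrank'
      (by rw [finrank_tangentSpace, Fintype.card_fin])]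
    trivial
  obtain ⟨c, rfl⟩ := (Submodule.mem_span_range_iff_exists_fun ℝ).1 hspan
  refine Finset.sum_congr rfl fun i _ => ?_
  congr 1
  simp only [map_sum, map_smul, sum_apply, smul_apply, h,
    smul_eq_mul, mul_ite, mul_one, mul_zero,
    Finset.sum_ite_eq', Finset.mem_univ, if_true]

/-- The derivative in the direction of a frame vector. -/
def dd {F : Type*} [NormedAddCommGroup F] [NormedSpace ℝ F]
    (e : Fin n → ∀ x : M, TangentSpace (𝓡 n) x) (a : Fin n) (f : M → F) (x : M) : F :=
  mvfderiv (𝓡 n) f x (e a x)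

/-- The structure functions `g([e_a, e_b], e_c)`. -/
def struc (g : Metric n M) (e : Fin n → ∀ x : M, TangentSpace (𝓡 n) x) (x : M) (a b c : Fin n) :
    ℝ :=
  g.inner x (VectorField.mlieBracket (𝓡 n) (e a) (e b) x) (e c x)

theorem struc_skew (g : Metric n M) (e : Fin n → ∀ x : M, TangentSpace (𝓡 n) x) (x : M)
    (a b c : Fin n) : struc g e x a b c = - struc g e x b a c := by
  rw [struc, VectorField.mlieBracket_swap_apply, map_neg]
  rfl

theorem conn_torsion (g : Metric n M) (e : Fin n → ∀ x : M, TangentSpace (𝓡 n) x) (x : M)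
    (a b c : Fin n) : conn g e x a b c - conn g e x b a c = struc g e x a b c := by
  change (struc g e x a b c - struc g e x b c a + struc g e x c a b) / 2 -
    (struc g e x b a c - struc g e x a c b + struc g e x c b a) / 2 = _
  rw [struc_skew g e x b a c, struc_skew g e x c b a, struc_skew g e x c a b]
  ring

/-- The connection coefficients are determined by skewness and the absence of torsion. -/
theorem conn_unique (g : Metric n M) (e : Fin n → ∀ x : M, TangentSpace (𝓡 n) x) (x : M)
    (Γ : Fin n → Fin n → Fin n → ℝ) (h1 : ∀ a b c, Γ a c b = - Γ a b c)
    (h2 : ∀ a b c, Γ a b c - Γ b a c = struc g e x a b c) (a b c : Fin n) :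
    conn g e x a b c = Γ a b c := by
  change (struc g e x a b c - struc g e x b c a + struc g e x c a b) / 2 = _
  rw [← h2, ← h2, ← h2]
  linarith [h1 a b c, h1 b c a, h1 c a b]

variable {g : Metric n M} {e : Fin n → ∀ x : M, TangentSpace (𝓡 n) x} {U : Set M}
  {F : Type*} [NormedAddCommGroup F] [NormedSpace ℝ F]

theorem IsFrame.bracket (he : IsFrame g e U) {x : M} (hx : x ∈ U) (a b : Fin n) :
    VectorField.mlieBracket (𝓡 n) (e a) (e b) x = ∑ c, struc g e x a b c • e c x :=
  orthonormal_expand g (he.ortho x hx) _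

theorem IsFrame.isSmoothFun_struc (he : IsFrame g e U) (a b c : Fin n) :
    IsSmoothFun n (fun x => struc g e x a b c) U :=
  g.isSmoothFun_inner (IsSmoothField.mlieBracket he.isOpen (he.smooth a) (he.smooth b)) (he.smooth c)

theorem IsFrame.isSmoothFun_conn (he : IsFrame g e U) (a b c : Fin n) :
    IsSmoothFun n (fun x => conn g e x a b c) U := by
  have h := ((he.isSmoothFun_struc a b c).sub (he.isSmoothFun_struc b c a)).add
    (he.isSmoothFun_struc c a b)
  exact (IsSmoothFun.clm h (ContinuousLinearMap.mul ℝ ℝ (2⁻¹ : ℝ))).congr fun x _ => div_eq_inv_mul _ _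

theorem IsFrame.isSmoothFun_dd (he : IsFrame g e U) {f : M → F} (hf : IsSmoothFun n f U)
    (a : Fin n) : IsSmoothFun n (dd e a f) U :=
  hf.deriv he.isOpen (he.smooth a)

theorem IsFrame.dd_comm (he : IsFrame g e U) {f : M → ℝ} (hf : IsSmoothFun n f U) (a b : Fin n)
    {x : M} (hx : x ∈ U) : dd e a (dd e b f) x - dd e b (dd e a f) x =
      ∑ c, struc g e x a b c * dd e c f x := by
  have hz : e a x ≠ 0 := by
    intro h0
    have := he.ortho x hx a a
    rw [h0] at this
    simp at this
  have h := mvfderiv_mlieBracket he.isOpen (he.smooth a) (he.smooth b) (he.smooth a) hf hx hz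
  rw [he.bracket hx, map_sum] at h
  simp only [map_smul, smul_eq_mul] at h
  exact h.symm

theorem IsFrame.dd_congr (he : IsFrame g e U) {f f' : M → F} (h : ∀ y ∈ U, f y = f' y) (a : Fin n)
    {x : M} (hx : x ∈ U) : dd e a f x = dd e a f' x := by
  rw [dd, mvfderiv_congr he.isOpen hx h, dd]

theorem IsFrame.dd_sum (he : IsFrame g e U) {ι : Type*} {s : Finset ι} {f : ι → M → F}
    (hf : ∀ i ∈ s, IsSmoothFun n (f i) U) (a : Fin n) {x : M} (hx : x ∈ U) :
    dd e a (fun y => ∑ i ∈ s, f i y) x = ∑ i ∈ s, dd e a (f i) x :=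
  mvfderiv_sum s he.isOpen hx hf _

theorem IsFrame.dd_smul (he : IsFrame g e U) {h : M → ℝ} {f : M → F} (hh : IsSmoothFun n h U)
    (hf : IsSmoothFun n f U) (a : Fin n) {x : M} (hx : x ∈ U) :
    dd e a (fun y => h y • f y) x = h x • dd e a f x + dd e a h x • f x :=
  mvfderiv_smul_apply he.isOpen hx hh hf _

theorem IsFrame.dd_mul (he : IsFrame g e U) {h f : M → ℝ} (hh : IsSmoothFun n h U)
    (hf : IsSmoothFun n f U) (a : Fin n) {x : M} (hx : x ∈ U) :
    dd e a (fun y => h y * f y) x = h x * dd e a f x + dd e a h x * f x :=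
  he.dd_smul hh hf a hx

theorem IsFrame.dd_add (he : IsFrame g e U) {f f' : M → F} (hf : IsSmoothFun n f U)
    (hf' : IsSmoothFun n f' U) (a : Fin n) {x : M} (hx : x ∈ U) :
    dd e a (fun y => f y + f' y) x = dd e a f x + dd e a f' x :=
  mvfderiv_add_apply he.isOpen hx hf hf' _

omit [IsManifold (𝓡 n) ∞ M] in
theorem dd_const (c : F) (a : Fin n) (x : M) : dd e a (fun _ => c) x = 0 := by
  simp [dd, mvfderiv_const]

theorem IsFrame.dd_neg (he : IsFrame g e U) {f : M → F} (hf : IsSmoothFun n f U)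
    (a : Fin n) {x : M} (hx : x ∈ U) : dd e a (fun y => - f y) x = - dd e a f x := by
  have h := he.dd_add hf hf.neg a hx
  have h0 : dd e a (fun y => f y + -f y) x = 0 := by
    rw [he.dd_congr (f' := fun _ => (0 : F)) (fun y _ => add_neg_cancel _) a hx, dd_const]
  exact (neg_eq_of_add_eq_zero_right (h.symm.trans h0)).symm

theorem IsFrame.dd_sub (he : IsFrame g e U) {f f' : M → F} (hf : IsSmoothFun n f U)
    (hf' : IsSmoothFun n f' U) (a : Fin n) {x : M} (hx : x ∈ U) :
    dd e a (fun y => f y - f' y) x = dd e a f x - dd e a f' x := by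
  simp only [sub_eq_add_neg]
  rw [he.dd_add hf hf'.neg a hx, he.dd_neg hf' a hx]

omit [IsManifold (𝓡 n) ∞ M] in
/-- The derivative along a frame obtained by a change of frame. -/
theorem dd_change {e' : Fin n → ∀ x : M, TangentSpace (𝓡 n) x} {x : M}
    {B : Fin n → Fin n → ℝ} (h : ∀ b, e' b x = ∑ q, B q b • e q x) (a : Fin n) (f : M → F) :
    dd e' a f x = ∑ q, B q a • dd e q f x := by
  simp only [dd, h, map_sum, map_smul]

omit [IsManifold (𝓡 n) ∞ M] in
theorem mlieBracket_congr (hU : IsOpen U) {X Y Y' : ∀ x : M, TangentSpace (𝓡 n) x} {x : M}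
    (hx : x ∈ U) (h : ∀ y ∈ U, Y y = Y' y) :
    VectorField.mlieBracket (𝓡 n) X Y x = VectorField.mlieBracket (𝓡 n) X Y' x :=
  Filter.EventuallyEq.mlieBracket_vectorField_eq (Filter.EventuallyEq.refl _ X)
    (Filter.eventuallyEq_of_mem (hU.mem_nhds hx) h)

theorem IsFrame.bracket_sum (he : IsFrame g e U) {X : ∀ x : M, TangentSpace (𝓡 n) x}
    {B : Fin n → M → ℝ} (hB : ∀ i, IsSmoothFun n (B i) U) {x : M} (hx : x ∈ U) (s : Finset (Fin n)) :
    VectorField.mlieBracket (𝓡 n) X (fun y => ∑ q ∈ s, B q y • e q y) x =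
      ∑ q ∈ s, (mvfderiv (𝓡 n) (B q) x (X x) • e q x +
        B q x • VectorField.mlieBracket (𝓡 n) X (e q) x) := by
  have hs : ∀ q, IsSmoothField (fun y => B q y • e q y) U := fun q =>
    IsSmoothField.smul (hB q) (he.smooth q)
  induction s using Finset.induction_on with
  | empty =>
    simp only [Finset.sum_empty]
    exact congrFun (VectorField.mlieBracket_zero_right (I := 𝓡 n) (W := X)) x
  | insert i s hi ih =>
    simp only [Finset.sum_insert hi]
    rw [← ih, ← VectorField.mlieBracket_smul_right ((hB i).mdifferentiableAt he.isOpen hx)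
      ((he.smooth i).mdifferentiableAt he.isOpen hx)]
    exact VectorField.mlieBracket_add_right ((hs i).mdifferentiableAt he.isOpen hx)
      ((IsSmoothField.sum (s := s) hs).mdifferentiableAt he.isOpen hx)

theorem IsFrame.bracket_change (he : IsFrame g e U) {e' : Fin n → ∀ x : M, TangentSpace (𝓡 n) x}
    {B : M → Fin n → Fin n → ℝ} (hB : ∀ i j, IsSmoothFun n (fun x => B x i j) U)
    (h : ∀ x ∈ U, ∀ b, e' b x = ∑ q, B x q b • e q x) (a b : Fin n) {x : M} (hx : x ∈ U) :
    VectorField.mlieBracket (𝓡 n) (e' a) (e' b) x =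
      ∑ c, ((∑ p, ∑ q, B x p a * B x q b * struc g e x p q c)
        + dd e' a (fun y => B y c b) x - dd e' b (fun y => B y c a) x) • e c x := by
  have h1 : ∀ q, VectorField.mlieBracket (𝓡 n) (e' a) (e q) x =
      ∑ p, (B x p a • ∑ c, struc g e x p q c • e c x) - ∑ p, dd e q (fun y => B y p a) x • e p x := by
    intro q
    rw [VectorField.mlieBracket_swap_apply,
      mlieBracket_congr he.isOpen hx (fun y hy => h y hy a),
      he.bracket_sum (fun i => hB i a) hx, Finset.sum_add_distrib, neg_add, sub_eq_add_neg, add_comm]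
    congr 1
    rw [← Finset.sum_neg_distrib]
    refine Finset.sum_congr rfl fun p _ => ?_
    rw [VectorField.mlieBracket_swap_apply, he.bracket hx, smul_neg, neg_neg]
  rw [mlieBracket_congr he.isOpen hx (fun y hy => h y hy b),
    he.bracket_sum (fun i => hB i b) hx]
  simp only [h1, dd_change (h x hx) b, smul_eq_mul, Finset.sum_add_distrib, sub_smul, add_smul,
    Finset.sum_smul, Finset.sum_sub_distrib, smul_sub, Finset.smul_sum, smul_smul]
  rw [add_sub_assoc', add_comm (∑ q, mvfderiv (𝓡 n) (fun y => B y q b) x (e' a x) • e q x)]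
  congr 1
  · congr 1
    rw [Finset.sum_comm_cycle]
    refine Finset.sum_congr rfl fun c _ => ?_
    rw [Finset.sum_comm]
    refine Finset.sum_congr rfl fun p _ => Finset.sum_congr rfl fun q _ => ?_
    congr 1; ring
  · rw [Finset.sum_comm]

end Frames

/-! ### Covariant derivatives and changes of frame -/

section Covariant

variable {n : ℕ} {M : Type u} [TopologicalSpace M] [ChartedSpace (EuclideanSpace ℝ (Fin n)) M]
  [IsManifold (𝓡 n) ∞ M] {g : Metric n M} {e : Fin n → ∀ x : M, TangentSpace (𝓡 n) x} {U : Set M}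
  {F : Type*} [NormedAddCommGroup F] [NormedSpace ℝ F] {R : Mat n → F →L[ℝ] F}

/-- The covariant derivative of a section of the bundle associated to `R` in the direction of a
frame vector. -/
def cov (R : Mat n → F →L[ℝ] F) (g : Metric n M) (e : Fin n → ∀ x : M, TangentSpace (𝓡 n) x)
    (T : M → F) (a : Fin n) (x : M) : F :=
  dd e a T x + infMap R (connMatrix g e x a).1 (T x)

theorem IsFrame.isSmoothFun_infMap (he : IsFrame g e U) (R : Mat n → F →L[ℝ] F) (a : Fin n) :
    IsSmoothFun n (fun x => infMap R (connMatrix g e x a).1) U := by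
  have h : IsSmoothFun n (fun x => ent (connMatrix g e x a).1) U :=
    isSmoothFun_pi.2 fun c => isSmoothFun_pi.2 fun b => he.isSmoothFun_conn a b c
  exact h.clm (fderiv ℝ R (ent (1 : SO n).1))

theorem IsFrame.isSmoothFun_cov (he : IsFrame g e U) {T : M → F} (hT : IsSmoothFun n T U)
    (a : Fin n) : IsSmoothFun n (cov R g e T a) U :=
  ContMDiffOn.add (he.isSmoothFun_dd hT a) (ContMDiffOn.clm_apply (he.isSmoothFun_infMap R a) hT)

theorem IsFrame.cov_add (he : IsFrame g e U) {T T' : M → F} (hT : IsSmoothFun n T U)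
    (hT' : IsSmoothFun n T' U) (a : Fin n) {x : M} (hx : x ∈ U) :
    cov R g e (fun y => T y + T' y) a x = cov R g e T a x + cov R g e T' a x := by
  simp only [cov, he.dd_add hT hT' a hx, map_add]
  abel

theorem IsFrame.cov_smul (he : IsFrame g e U) {h : M → ℝ} {T : M → F} (hh : IsSmoothFun n h U)
    (hT : IsSmoothFun n T U) (a : Fin n) {x : M} (hx : x ∈ U) :
    cov R g e (fun y => h y • T y) a x = h x • cov R g e T a x + dd e a h x • T x := by
  simp only [cov, he.dd_smul hh hT a hx, map_smul, smul_add]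
  abel

theorem IsFrame.cov_congr (he : IsFrame g e U) {T T' : M → F} (h : ∀ y ∈ U, T y = T' y)
    (a : Fin n) {x : M} (hx : x ∈ U) : cov R g e T a x = cov R g e T' a x := by
  rw [cov, he.dd_congr h a hx, h x hx, cov]

/-- The covariant derivative of tensors, with the index of the new derivative first. -/
def nab (R : Mat n → F →L[ℝ] F) (g : Metric n M) (e : Fin n → ∀ x : M, TangentSpace (𝓡 n) x)
    {k : ℕ} (T : M → (Fin k → Fin n) → F) (x : M) (J : Fin (k + 1) → Fin n) : F :=
  cov (tens k R) g e T (J 0) x (Fin.tail J)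

theorem IsFrame.isSmoothFun_nab (he : IsFrame g e U) {k : ℕ} {T : M → (Fin k → Fin n) → F}
    (hT : IsSmoothFun n T U) : IsSmoothFun n (nab R g e T) U :=
  isSmoothFun_pi.2 fun J => isSmoothFun_pi.1 (he.isSmoothFun_cov hT (J 0)) (Fin.tail J)

theorem IsFrame.nab_congr (he : IsFrame g e U) {k : ℕ} {T T' : M → (Fin k → Fin n) → F}
    (h : ∀ y ∈ U, T y = T' y) {x : M} (hx : x ∈ U) : nab R g e T x = nab R g e T' x := by
  funext J
  rw [nab, he.cov_congr h _ hx, nab]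

/-- The index corrections in `nabla` are the action of the connection matrix on the tensor slots
(`infMap_tens`, skewness of `conn`). So iterated derivatives are all of the single form `cov`, for
the representation on tensors. -/
theorem IsFrame.nabla_eq [FiniteDimensional ℝ F] (he : IsFrame g e U) (hR : IsSmoothRep R)
    {L : so n → F → F} (hL : ∀ X v, L X v = infMap R X.1 v) {k : ℕ}
    {T T' : M → (Fin k → Fin n) → F} (hT' : IsSmoothFun n T' U) (h : ∀ y ∈ U, T y = T' y)
    {x : M} (hx : x ∈ U) : nabla g e L T x = nab R g e T' x := by
  funext J
  rw [nab, cov, Pi.add_apply, infMap_tens hR, nabla, hL, h x hx, add_sub_assoc]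
  congr 1
  · rw [dd, ← mvfderiv_pi (hT'.mdifferentiableAt he.isOpen hx)]
    rw [mvfderiv_congr he.isOpen hx fun y hy => by rw [h y hy]]
  · rw [sub_eq_add_neg, ← Finset.sum_neg_distrib]
    congr 1
    refine Finset.sum_congr rfl fun s _ => ?_
    rw [← Finset.sum_neg_distrib]
    refine Finset.sum_congr rfl fun d _ => ?_
    rw [← neg_smul, ← conn_skew]
    rfl

theorem tens_succ (k : ℕ) (R : Mat n → F →L[ℝ] F) (B : Mat n) (T : (Fin (k + 1) → Fin n) → F)
    (J : Fin (k + 1) → Fin n) : tens (k + 1) R B T J =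
      ∑ p, B (J 0) p • tens k R B (fun K => T (Fin.cons p K)) (Fin.tail J) := by
  simp only [tens_apply, Finset.smul_sum, smul_smul]
  rw [← Fintype.sum_prod_type', ← (Fin.consEquiv fun _ => Fin n).sum_comp]
  refine Fintype.sum_congr _ _ fun q => ?_
  rw [Fin.prod_univ_succ]
  rfl

/-- A smooth change of orthonormal frames. -/
structure IsGauge (g : Metric n M) (e e' : Fin n → ∀ x : M, TangentSpace (𝓡 n) x) (U : Set M)
    (A : M → SO n) : Prop where
  frame : IsFrame g e U
  frame' : IsFrame g e' U
  smooth : IsSmoothFun n (fun x => ent (A x).1) U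
  change : ∀ x ∈ U, ∀ b, e' b x = ∑ q, ent (A x).1 q b • e q x

variable {e' : Fin n → ∀ x : M, TangentSpace (𝓡 n) x} {A : M → SO n}

theorem IsGauge.isSmoothFun_entry (h : IsGauge g e e' U A) (i j : Fin n) :
    IsSmoothFun n (fun x => ent (A x).1 i j) U :=
  isSmoothFun_pi.1 (isSmoothFun_pi.1 h.smooth i) j

theorem SO.sum_mul_self {n : ℕ} (A : SO n) (b c : Fin n) :
    ∑ d, ent A.1 d b * ent A.1 d c = if b = c then 1 else 0 := by
  have := congrFun (congrFun (SO.transpose_mul A) b) c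
  rw [Matrix.mul_apply, Matrix.one_apply] at this
  exact this

theorem SO.sum_self_mul {n : ℕ} (A : SO n) (b c : Fin n) :
    ∑ d, ent A.1 b d * ent A.1 c d = if b = c then 1 else 0 := by
  have := congrFun (congrFun (SO.mul_transpose A) b) c
  rw [Matrix.mul_apply, Matrix.one_apply] at this
  exact this

theorem IsGauge.sum_dd (h : IsGauge g e e' U A) (a b c : Fin n) {x : M} (hx : x ∈ U)
    (ε : Fin n → ∀ x : M, TangentSpace (𝓡 n) x) (hε : IsFrame g ε U) :
    ∑ d, dd ε a (fun y => ent (A y).1 d c) x * ent (A x).1 d b =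
      - ∑ d, dd ε a (fun y => ent (A y).1 d b) x * ent (A x).1 d c := by
  have h1 : dd ε a (fun y => ∑ d, ent (A y).1 d b * ent (A y).1 d c) x = 0 := by
    rw [hε.dd_congr (fun y _ => SO.sum_mul_self (A y) b c) a hx, dd_const]
  rw [hε.dd_sum (f := fun d y => ent (A y).1 d b * ent (A y).1 d c) (fun d _ => (h.isSmoothFun_entry d b).mul (h.isSmoothFun_entry d c)) a hx] at h1
  rw [← add_eq_zero_iff_eq_neg, ← h1, ← Finset.sum_add_distrib]
  refine Finset.sum_congr rfl fun d _ => ?_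
  rw [hε.dd_mul (h.isSmoothFun_entry d b) (h.isSmoothFun_entry d c) a hx]
  ring

/-- The right-hand side is skew and torsion-free, so `conn_unique` identifies it with the connection
of the new frame. Skewness of its inhomogeneous part is the derivative of orthogonality
(`IsGauge.sum_dd`). -/
theorem IsGauge.conn_eq (h : IsGauge g e e' U A) {x : M} (hx : x ∈ U) (a b c : Fin n) :
    conn g e' x a b c = ∑ p, ent (A x).1 p a * ((∑ q, ∑ r, ent (A x).1 q b * ent (A x).1 r c *
      conn g e x p q r) + ∑ d, dd e p (fun y => ent (A y).1 d b) x * ent (A x).1 d c) := by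
  refine conn_unique g e' x (fun a b c => ∑ p, ent (A x).1 p a * ((∑ q, ∑ r, ent (A x).1 q b *
    ent (A x).1 r c * conn g e x p q r) +
    ∑ d, dd e p (fun y => ent (A y).1 d b) x * ent (A x).1 d c)) ?_ ?_ a b c
  · intro a b c
    rw [← Finset.sum_neg_distrib]
    refine Finset.sum_congr rfl fun p _ => ?_
    rw [h.sum_dd p b c hx e h.frame, ← mul_neg, neg_add]
    congr 2
    rw [Finset.sum_comm, ← Finset.sum_neg_distrib]
    refine Finset.sum_congr rfl fun q _ => ?_
    rw [← Finset.sum_neg_distrib]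
    refine Finset.sum_congr rfl fun r _ => ?_
    rw [conn_skew g e x p q r]
    ring
  · intro a b c
    rw [struc, h.frame.bracket_change (fun i j => h.isSmoothFun_entry i j) h.change a b hx]
    simp only [map_sum, map_smul, sum_apply, smul_apply, h.change x hx c,
      h.frame.ortho x hx, smul_eq_mul, mul_ite, mul_one, mul_zero, 
      Finset.sum_ite_eq', Finset.mem_univ, if_true]
    have e1 : ∀ a b, ∑ p, ent (A x).1 p a * ∑ d, dd e p (fun y => ent (A y).1 d b) x *
        ent (A x).1 d c = ∑ d, dd e' a (fun y => ent (A y).1 d b) x * ent (A x).1 d c := by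
      intro a b
      simp only [dd_change (h.change x hx), smul_eq_mul, Finset.mul_sum, Finset.sum_mul, mul_assoc]
      exact Finset.sum_comm
    have e2 : ∑ p, ent (A x).1 p b * ∑ q, ∑ r, ent (A x).1 q a * ent (A x).1 r c *
        conn g e x p q r = ∑ p, ent (A x).1 p a * ∑ q, ∑ r, ent (A x).1 q b * ent (A x).1 r c *
        conn g e x q p r := by
      simp only [Finset.mul_sum]
      rw [Finset.sum_comm]
      refine Finset.sum_congr rfl fun p _ => Finset.sum_congr rfl fun q _ =>
        Finset.sum_congr rfl fun r _ => by ring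
    simp only [mul_add, Finset.sum_add_distrib, e1, e2]
    rw [add_sub_add_comm, ← Finset.sum_sub_distrib, ← Finset.sum_sub_distrib]
    simp only [← mul_sub, ← Finset.sum_sub_distrib, conn_torsion, ← sub_mul]
    simp only [add_sub_assoc, add_mul, Finset.sum_add_distrib, mul_comm (ent (A x).1 _ c)]
    congr 1
    simp only [Finset.mul_sum, Finset.sum_mul]
    rw [Finset.sum_comm_cycle]
    refine Finset.sum_congr rfl fun r _ => ?_
    refine Finset.sum_congr rfl fun p _ => Finset.sum_congr rfl fun q _ => ?_
    ring

omit [IsManifold (𝓡 n) ∞ M] in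
-- Along a curve from `x` one writes `A⁻¹ T` as `A⁻¹ A(x)` applied to `A(x)⁻¹ T`, so that `R` has to
-- be differentiated only at the identity, where its differential is `infMap`.
theorem dd_comp_rep (hε : IsOpen U) (hR : IsSmoothRep R)
    (hA : IsSmoothFun n (fun x => ent (A x).1) U) {T : M → F} (hT : IsSmoothFun n T U) :
    IsSmoothFun n (fun y => R (ent (A y)⁻¹.1) (T y)) U ∧ ∀ a, ∀ x ∈ U,
    dd e a (fun y => R (ent (A y)⁻¹.1) (T y)) x = R (ent (A x)⁻¹.1) (dd e a T x) +
      infMap R (Matrix.of fun b c => ∑ d, dd e a (fun y => ent (A y).1 d b) x * ent (A x).1 d c)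
        (R (ent (A x)⁻¹.1) (T x)) := by
  have hij : ∀ i j, IsSmoothFun n (fun x => ent (A x).1 i j) U := fun i j =>
    isSmoothFun_pi.1 (isSmoothFun_pi.1 hA i) j
  have hinv : IsSmoothFun n (fun x => ent (A x)⁻¹.1) U := by
    refine isSmoothFun_pi.2 fun i => isSmoothFun_pi.2 fun j => (hij j i).congr fun x _ => ?_
    rw [SO.coe_inv]; rfl
  have hs : IsSmoothFun n (fun y => R (ent (A y)⁻¹.1) (T y)) U :=
    ContMDiffOn.clm_apply (hR.contDiff.contMDiff.comp_contMDiffOn hinv) hT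
  refine ⟨hs, fun a x hx => mvfderiv_eq_of_hasDerivAt (hs.mdifferentiableAt hε hx) ?_⟩
  set γ := curve x (e a x)
  have hγ : γ 0 = x := curve_zero x (e a x)
  have hc : HasDerivAt (fun t => ent ((A (γ t))⁻¹ * A x).1) (ent (Matrix.of fun b c =>
      ∑ d, dd e a (fun y => ent (A y).1 d b) x * ent (A x).1 d c)) 0 := by
    refine hasDerivAt_pi.2 fun b => hasDerivAt_pi.2 fun c => ?_
    have h1 : ∀ t, ent ((A (γ t))⁻¹ * A x).1 b c = ∑ d, ent (A (γ t)).1 d b * ent (A x).1 d c := by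
      intro t
      change ((A (γ t))⁻¹.1 * (A x).1) b c = _
      rw [SO.coe_inv, Matrix.mul_apply]
      rfl
    simp only [h1]
    exact HasDerivAt.fun_sum fun d _ =>
      (hasDerivAt_curve ((hij d b).mdifferentiableAt hε hx) (e a x)).mul_const _
  have hc1 := hR.hasDerivAt_comp hc (by rw [hγ, inv_mul_cancel])
  have h2 := hc1.clm_apply (((R (ent (A x)⁻¹.1)).hasFDerivAt).comp_hasDerivAt 0
    (hasDerivAt_curve (hT.mdifferentiableAt hε hx) (e a x)))
  change HasDerivAt _ (_ + R (ent ((A (γ 0))⁻¹ * A x).1) _) _ at h2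
  rw [hγ, inv_mul_cancel, hR.map_one, add_comm] at h2
  refine (h2.congr_deriv ?_).congr_of_eventuallyEq (.of_forall fun t => ?_)
  · simp only [Function.comp, show curve x (e a x) 0 = x from curve_zero x (e a x)]
    rfl
  · change _ = (R _ * R _) _
    rw [← hR.map_mul, mul_assoc, mul_inv_cancel, mul_one]

theorem IsGauge.isSmoothFun_rep (h : IsGauge g e e' U A) (hR : IsSmoothRep R) {T : M → F}
    (hT : IsSmoothFun n T U) : IsSmoothFun n (fun y => R (ent (A y)⁻¹.1) (T y)) U :=
  (dd_comp_rep (e := e) h.frame.isOpen hR h.smooth hT).1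

/-- Covariance of the covariant derivative under changes of frame. -/
theorem IsGauge.cov_eq (h : IsGauge g e e' U A) (hR : IsSmoothRep R) {T : M → F}
    (hT : IsSmoothFun n T U) (a : Fin n) {x : M} (hx : x ∈ U) :
    cov R g e' (fun y => R (ent (A y)⁻¹.1) (T y)) a x =
      ∑ p, ent (A x).1 p a • R (ent (A x)⁻¹.1) (cov R g e T p x) := by
  -- The gauge transformation law of the connection matrix. Its inhomogeneous term cancels the
  -- derivative of `A⁻¹` from `dd_comp_rep`.
  have hω : (connMatrix g e' x a).1 = ∑ p, ent (A x).1 p a •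
      ((soConj (A x)⁻¹ (connMatrix g e x p)).1 - Matrix.of fun b c =>
        ∑ d, dd e p (fun y => ent (A y).1 d b) x * ent (A x).1 d c) := by
    ext c b
    change conn g e' x a b c = _
    rw [h.conn_eq hx, Matrix.sum_apply]
    refine Finset.sum_congr rfl fun p _ => ?_
    rw [Matrix.smul_apply, smul_eq_mul, Matrix.sub_apply, Matrix.of_apply, sub_eq_add_neg,
      h.sum_dd p c b hx e h.frame]
    congr 2
    · change _ = ((A x)⁻¹.1 * (connMatrix g e x p).1 * (A x)⁻¹.1.transpose) c b
      rw [SO.coe_inv, Matrix.transpose_transpose, Matrix.mul_apply]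
      simp only [Matrix.mul_apply, Finset.sum_mul]
      refine Finset.sum_congr rfl fun q _ => Finset.sum_congr rfl fun r _ => ?_
      change _ = ent (A x).1 r c * conn g e x p q r * ent (A x).1 q b
      ring
  rw [cov, dd_change (h.change x hx), hω, map_sum, sum_apply, ← Finset.sum_add_distrib]
  refine Finset.sum_congr rfl fun p _ => ?_
  rw [map_smul, smul_apply, ← smul_add]
  congr 1
  rw [(dd_comp_rep h.frame.isOpen hR h.smooth hT).2 p x hx, map_sub, ← hR.conj, inv_inv, cov, map_add,
    sub_apply]
  have hinv : R (ent (A x).1) (R (ent (A x)⁻¹.1) (T x)) = T x :=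
    congrArg (fun f : F →L[ℝ] F => f (T x)) (hR.map_mul_inv (A x))
  change _ + (R _ (infMap R _ (R _ (R _ (T x)))) - _) = _
  rw [hinv]
  abel

/-- Covariance of the iterated covariant derivative under changes of frame. -/
theorem IsGauge.nab_eq [FiniteDimensional ℝ F] (h : IsGauge g e e' U A) (hR : IsSmoothRep R) {k : ℕ}
    {T : M → (Fin k → Fin n) → F} (hT : IsSmoothFun n T U) {x : M} (hx : x ∈ U) :
    nab R g e' (fun y => tens k R (ent (A y)⁻¹.1) (T y)) x =
      tens (k + 1) R (ent (A x)⁻¹.1) (nab R g e T x) := by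
  funext J
  rw [nab, h.cov_eq (hR.tens k) hT _ hx, tens_succ, Finset.sum_apply]
  refine Finset.sum_congr rfl fun p _ => ?_
  rw [SO.coe_inv]
  rfl

end Covariant

/-! ### The Ricci identity and the covariance of the curvature -/

section RicciIdentity

variable {n : ℕ} {M : Type u} [TopologicalSpace M] [ChartedSpace (EuclideanSpace ℝ (Fin n)) M]
  [IsManifold (𝓡 n) ∞ M] {g : Metric n M} {e : Fin n → ∀ x : M, TangentSpace (𝓡 n) x} {U : Set M}

/-- The trivial representation. -/
def triv (n : ℕ) : Mat n → ℝ →L[ℝ] ℝ := fun _ => 1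

theorem triv_isSmoothRep : IsSmoothRep (triv n) :=
  ⟨contDiff_const, rfl, fun _ _ => (one_mul 1).symm⟩

theorem infMap_triv (X : Matrix (Fin n) (Fin n) ℝ) : infMap (triv n) X = 0 := by
  change fderiv ℝ (fun _ : Mat n => (1 : ℝ →L[ℝ] ℝ)) _ _ = 0
  simp only [fderiv_fun_const]
  rfl

theorem IsFrame.nab_triv (he : IsFrame g e U) {k : ℕ} {T : M → (Fin k → Fin n) → ℝ}
    (hT : IsSmoothFun n T U) {x : M} (hx : x ∈ U) (J : Fin (k + 1) → Fin n) :
    nab (triv n) g e T x J = dd e (J 0) (fun y => T y (Fin.tail J)) x -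
      ∑ s : Fin k, ∑ d, conn g e x (J 0) (J s.succ) d * T x (Function.update (Fin.tail J) s d) := by
  rw [← he.nabla_eq triv_isSmoothRep (L := fun _ _ => 0) (fun X v => by rw [infMap_triv]; rfl) hT
    (fun _ _ => rfl) hx, nabla, add_zero]
  rfl

theorem IsFrame.nab_one (he : IsFrame g e U) {u : Fin n → M → ℝ} (hu : ∀ c, IsSmoothFun n (u c) U)
    {x : M} (hx : x ∈ U) (J : Fin 2 → Fin n) :
    nab (triv n) g e (fun y (K : Fin 1 → Fin n) => u (K 0) y) x J =
      dd e (J 0) (u (J 1)) x - ∑ d, conn g e x (J 0) (J 1) d * u d x := by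
  rw [he.nab_triv (isSmoothFun_pi.2 fun K => hu (K 0)) hx, Fin.sum_univ_one]
  simp [Fin.tail]

theorem IsFrame.nab_two (he : IsFrame g e U) {u : Fin n → Fin n → M → ℝ}
    (hu : ∀ b c, IsSmoothFun n (u b c) U) {x : M} (hx : x ∈ U) (J : Fin 3 → Fin n) :
    nab (triv n) g e (fun y (K : Fin 2 → Fin n) => u (K 0) (K 1) y) x J =
      dd e (J 0) (u (J 1) (J 2)) x - (∑ d, conn g e x (J 0) (J 1) d * u d (J 2) x +
        ∑ d, conn g e x (J 0) (J 2) d * u (J 1) d x) := by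
  rw [he.nab_triv (isSmoothFun_pi.2 fun K => hu (K 0) (K 1)) hx, Fin.sum_univ_two]
  simp [Fin.tail]

/-- The Ricci identity for one-forms. -/
theorem IsFrame.ricci_identity (he : IsFrame g e U) {u : Fin n → M → ℝ}
    (hu : ∀ c, IsSmoothFun n (u c) U) {x : M} (hx : x ∈ U) (a b c : Fin n) :
    nab (triv n) g e (nab (triv n) g e (fun y (K : Fin 1 → Fin n) => u (K 0) y)) x ![a, b, c] -
    nab (triv n) g e (nab (triv n) g e (fun y (K : Fin 1 → Fin n) => u (K 0) y)) x ![b, a, c] =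
      - ∑ d, curvature g e x a b c d * u d x := by
  have hw : ∀ b c d, IsSmoothFun n (fun y => conn g e y b c d * u d y) U := fun b c d =>
    (he.isSmoothFun_conn b c d).mul (hu d)
  have hv : ∀ b c, IsSmoothFun n (fun y => dd e b (u c) y - ∑ d, conn g e y b c d * u d y) U :=
    fun b c => (he.isSmoothFun_dd (hu c) b).sub (isSmoothFun_sum fun d _ => hw b c d)
  have key : ∀ a b c, nab (triv n) g e (nab (triv n) g e
      (fun y (K : Fin 1 → Fin n) => u (K 0) y)) x ![a, b, c] =
      dd e a (dd e b (u c)) x - (∑ d, (conn g e x b c d * dd e a (u d) x +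
        dd e a (fun y => conn g e y b c d) x * u d x)) -
      ((∑ d, conn g e x a b d * dd e d (u c) x -
        ∑ k, ∑ d, conn g e x a b k * conn g e x k c d * u d x) +
        (∑ d, conn g e x a c d * dd e b (u d) x -
        ∑ k, ∑ d, conn g e x a c k * conn g e x b k d * u d x)) := by
    intro a b c
    rw [he.nab_congr (T' := fun y (K : Fin 2 → Fin n) => dd e (K 0) (u (K 1)) y -
      ∑ d, conn g e y (K 0) (K 1) d * u d y) (fun y hy => funext fun K => he.nab_one hu hy K) hx,
      he.nab_two hv hx]
    simp only [Matrix.cons_val]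
    rw [he.dd_sub (he.isSmoothFun_dd (hu c) b) (isSmoothFun_sum fun d _ => hw b c d) a hx,
      he.dd_sum (f := fun d y => conn g e y b c d * u d y) (fun d _ => hw b c d) a hx]
    simp only [he.dd_mul (he.isSmoothFun_conn _ _ _) (hu _) a hx, mul_sub, Finset.sum_sub_distrib,
      Finset.mul_sum, mul_assoc]
  rw [key, key]
  have hcomm := he.dd_comm (hu c) a b hx
  rw [sub_eq_iff_eq_add.1 hcomm]
  simp only [← conn_torsion, curvature, add_mul, sub_mul, Finset.sum_add_distrib,
    Finset.sum_sub_distrib, Finset.sum_mul]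
  have hc : ∀ f : Fin n → Fin n → ℝ, ∑ d, ∑ k, f k d = ∑ k, ∑ d, f k d := fun f => Finset.sum_comm
  rw [hc fun k d => conn g e x b c k * conn g e x a k d * u d x,
    hc fun k d => conn g e x a c k * conn g e x b k d * u d x,
    hc fun k d => conn g e x a b k * conn g e x k c d * u d x,
    hc fun k d => conn g e x b a k * conn g e x k c d * u d x]
  simp only [dd]
  ring

variable {e' : Fin n → ∀ x : M, TangentSpace (𝓡 n) x} {A : M → SO n}

theorem tens_triv_three (B : Mat n) (T : (Fin 3 → Fin n) → ℝ) (J : Fin 3 → Fin n) :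
    tens 3 (triv n) B T J = ∑ p, ∑ q, ∑ r, B (J 0) p * B (J 1) q * B (J 2) r * T ![p, q, r] := by
  rw [tens_succ]
  refine Finset.sum_congr rfl fun p _ => ?_
  rw [tens_succ, Finset.smul_sum]
  refine Finset.sum_congr rfl fun q _ => ?_
  rw [tens_succ, Finset.smul_sum, Finset.smul_sum]
  refine Finset.sum_congr rfl fun r _ => ?_
  rw [tens_apply, Fintype.sum_unique]
  simp only [Finset.univ_eq_empty, Finset.prod_empty, smul_eq_mul, one_mul, triv,
    one_apply_eq_self, ← mul_assoc]
  rfl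

/-- Tensoriality is not checked on the coordinate formula but read off from the Ricci identity:
second covariant derivatives of one-forms transform tensorially by `IsGauge.nab_eq`, hence so does
their commutator. -/
theorem IsGauge.curvature_eq (h : IsGauge g e e' U A) {x : M} (hx : x ∈ U) (a b c d : Fin n) :
    curvature g e' x a b c d = ∑ p, ∑ q, ∑ r, ∑ s, ent (A x).1 p a * ent (A x).1 q b *
      ent (A x).1 r c * ent (A x).1 s d * curvature g e x p q r s := by
  have key : ∀ s, ∑ t, curvature g e' x a b c t * ent (A x).1 s t =
      ∑ p, ∑ q, ∑ r, ent (A x).1 p a * ent (A x).1 q b * ent (A x).1 r c *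
        curvature g e x p q r s := by
    intro s
    -- The one-form dual to the frame vector `e_s`; in the frame `e'` its components form the `s`-th
    -- row of the transition matrix.
    let u : Fin n → M → ℝ := fun c _ => if c = s then 1 else 0
    have hu : ∀ c, IsSmoothFun n (u c) U := fun c => contMDiffOn_const
    let u' : Fin n → M → ℝ := fun c y => ent (A y).1 s c
    have hu' : ∀ c, IsSmoothFun n (u' c) U := fun c => h.isSmoothFun_entry s c
    let T : M → (Fin 1 → Fin n) → ℝ := fun y K => u (K 0) y
    have hT : IsSmoothFun n T U := isSmoothFun_pi.2 fun K => hu (K 0)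
    have hT' : ∀ y, (fun (K : Fin 1 → Fin n) => u' (K 0) y) =
        tens 1 (triv n) (ent (A y)⁻¹.1) (T y) := by
      intro y
      funext K
      rw [tens_succ, SO.coe_inv]
      simp only [tens_apply, Fintype.sum_unique, Finset.univ_eq_empty, Finset.prod_empty, triv,
        one_apply_eq_self, T, u, Fin.cons_zero, smul_eq_mul, mul_ite, mul_one,
        mul_zero, Finset.sum_ite_eq', Finset.mem_univ, if_true]
      rfl
    have h1 : ∀ J, nab (triv n) g e' (nab (triv n) g e' fun y K => u' (K 0) y) x J =
        tens 3 (triv n) (ent (A x)⁻¹.1) (nab (triv n) g e (nab (triv n) g e T) x) J := by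
      intro J
      rw [← h.nab_eq triv_isSmoothRep (h.frame.isSmoothFun_nab hT) hx]
      refine congrFun (h.frame'.nab_congr (fun y hy => ?_) hx) J
      rw [← h.nab_eq triv_isSmoothRep hT hy]
      exact h.frame'.nab_congr (fun z _ => hT' z) hy
    have h2 := h.frame'.ricci_identity hu' hx a b c
    rw [h1, h1, tens_triv_three, tens_triv_three, SO.coe_inv, neg_eq_iff_eq_neg.symm] at h2
    rw [← h2]
    have e1 : ∑ p, ∑ q, ∑ r, ent (A x).1.transpose (![b, a, c] 0) p *
        ent (A x).1.transpose (![b, a, c] 1) q * ent (A x).1.transpose (![b, a, c] 2) r *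
        nab (triv n) g e (nab (triv n) g e T) x ![p, q, r] = ∑ p, ∑ q, ∑ r,
        ent (A x).1 p a * ent (A x).1 q b * ent (A x).1 r c *
        nab (triv n) g e (nab (triv n) g e T) x ![q, p, r] := by
      rw [Finset.sum_comm]
      refine Finset.sum_congr rfl fun p _ => Finset.sum_congr rfl fun q _ =>
        Finset.sum_congr rfl fun r _ => ?_
      change ent (A x).1 q b * ent (A x).1 p a * ent (A x).1 r c * _ = _
      ring
    rw [e1, ← Finset.sum_sub_distrib, ← Finset.sum_neg_distrib]
    refine Finset.sum_congr rfl fun p _ => ?_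
    rw [← Finset.sum_sub_distrib, ← Finset.sum_neg_distrib]
    refine Finset.sum_congr rfl fun q _ => ?_
    rw [← Finset.sum_sub_distrib, ← Finset.sum_neg_distrib]
    refine Finset.sum_congr rfl fun r _ => ?_
    have h4 := h.frame.ricci_identity hu hx p q r
    simp only [u, mul_ite, mul_one, mul_zero, Finset.sum_ite_eq', Finset.mem_univ, if_true] at h4
    rw [← neg_eq_iff_eq_neg] at h4
    rw [← h4]
    change -(ent (A x).1 p a * ent (A x).1 q b * ent (A x).1 r c * _ - _) = _
    rw [← mul_sub, ← mul_neg]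
  have h3 : ∑ s, ent (A x).1 s d * ∑ t, curvature g e' x a b c t * ent (A x).1 s t =
      curvature g e' x a b c d := by
    simp only [Finset.mul_sum]
    rw [Finset.sum_comm]
    have : ∀ t, ∑ s, ent (A x).1 s d * (curvature g e' x a b c t * ent (A x).1 s t) =
        curvature g e' x a b c t * if d = t then 1 else 0 := by
      intro t
      rw [← SO.sum_mul_self, Finset.mul_sum]
      exact Finset.sum_congr rfl fun s _ => by ring
    simp [this]
  rw [← h3]
  simp only [key, Finset.mul_sum]
  rw [Finset.sum_comm]
  refine Finset.sum_congr rfl fun p _ => ?_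
  rw [Finset.sum_comm]
  refine Finset.sum_congr rfl fun q _ => ?_
  rw [Finset.sum_comm]
  refine Finset.sum_congr rfl fun r _ => Finset.sum_congr rfl fun s _ => ?_
  ring

end RicciIdentity

/-! ### The fourth-order expression -/

section Expression

variable {n : ℕ} {F : Type*} [NormedAddCommGroup F] [NormedSpace ℝ F]

/-- The splitting of an index tuple into its first `m` and its last `k` entries. -/
def blockEquiv (m k : ℕ) : Fin m ⊕ Fin k ≃ Fin (k + m) :=
  finSumFinEquiv.trans (finCongr (add_comm m k))

/-- The tensor product of a scalar-valued tensor with a vector-valued tensor. -/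
def mulT {m k : ℕ} (h : (Fin m → Fin n) → ℝ) (T : (Fin k → Fin n) → F) (J : Fin (k + m) → Fin n) :
    F :=
  h (J ∘ blockEquiv m k ∘ Sum.inl) • T (J ∘ blockEquiv m k ∘ Sum.inr)

theorem tens_mulT {m k : ℕ} (R : Mat n → F →L[ℝ] F) (B : Mat n) (h : (Fin m → Fin n) → ℝ)
    (T : (Fin k → Fin n) → F) :
    tens (k + m) R B (mulT h T) = mulT (tens m (triv n) B h) (tens k R B T) := by
  funext J
  simp only [mulT, tens_apply, triv, one_apply_eq_self, Finset.sum_smul, Finset.smul_sum]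
  rw [Finset.sum_comm, ← Fintype.sum_prod_type', ← (((blockEquiv m k).symm.arrowCongr (Equiv.refl (Fin n))).trans
    (Equiv.sumArrowEquivProdArrow _ _ _)).sum_comp]
  refine Fintype.sum_congr _ _ fun K => ?_
  rw [← (blockEquiv m k).prod_comp, Fintype.prod_sum_type, mul_smul, map_smul, smul_smul, smul_smul,
    smul_smul, smul_eq_mul, mul_right_comm]
  rfl

section

variable {M : Type u} [TopologicalSpace M] [ChartedSpace (EuclideanSpace ℝ (Fin n)) M]
  [IsManifold (𝓡 n) ∞ M] {g : Metric n M} {e : Fin n → ∀ x : M, TangentSpace (𝓡 n) x} {U : Set M}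
  {R : Mat n → F →L[ℝ] F}

omit [IsManifold (𝓡 n) ∞ M] in
theorem isSmoothFun_mulT {m k : ℕ} {h : M → (Fin m → Fin n) → ℝ} {T : M → (Fin k → Fin n) → F}
    (hh : IsSmoothFun n h U) (hT : IsSmoothFun n T U) : IsSmoothFun n (fun x => mulT (h x) (T x)) U :=
  isSmoothFun_pi.2 fun _ => ContMDiffOn.smul (isSmoothFun_pi.1 hh _) (isSmoothFun_pi.1 hT _)

theorem IsFrame.isSmoothFun_schouten (he : IsFrame g e U) : IsSmoothFun n (schouten g e) U := by
  have hc : ∀ a b c d, IsSmoothFun n (fun x => curvature g e x a b c d) U := by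
    intro a b c d
    refine ContMDiffOn.sub (ContMDiffOn.add (ContMDiffOn.sub
      (he.isSmoothFun_dd (he.isSmoothFun_conn b c d) a)
      (he.isSmoothFun_dd (he.isSmoothFun_conn a c d) b))
      (isSmoothFun_sum fun k _ => ContMDiffOn.sub
        ((he.isSmoothFun_conn _ _ _).mul (he.isSmoothFun_conn _ _ _))
        ((he.isSmoothFun_conn _ _ _).mul (he.isSmoothFun_conn _ _ _))))
      (isSmoothFun_sum fun k _ => ContMDiffOn.mul
        ((he.isSmoothFun_conn _ _ _).sub (he.isSmoothFun_conn _ _ _)) (he.isSmoothFun_conn _ _ _))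
  have hr : ∀ b c, IsSmoothFun n (fun x => ricci g e x b c) U := fun b c =>
    isSmoothFun_sum fun a _ => hc a b c a
  refine isSmoothFun_pi.2 fun J => ?_
  have h1 : IsSmoothFun n (fun x => (ricci g e x (J 0) (J 1) - (∑ c, ricci g e x c c) *
      ((2 * ((n : ℝ) - 1))⁻¹ * if J 0 = J 1 then 1 else 0)) * ((n : ℝ) - 2)⁻¹) U :=
    ContMDiffOn.mul (ContMDiffOn.sub (hr _ _) (ContMDiffOn.mul
      (isSmoothFun_sum fun c _ => hr c c) contMDiffOn_const)) contMDiffOn_const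
  refine h1.congr fun x _ => ?_
  rw [schouten, div_eq_mul_inv, div_eq_mul_inv, mul_assoc (∑ c, ricci g e x c c)]

variable {e' : Fin n → ∀ x : M, TangentSpace (𝓡 n) x} {A : M → SO n}

theorem IsGauge.ricci_eq (h : IsGauge g e e' U A) {x : M} (hx : x ∈ U) (b c : Fin n) :
    ricci g e' x b c = ∑ q, ∑ r, ent (A x).1 q b * ent (A x).1 r c * ricci g e x q r := by
  simp only [ricci, h.curvature_eq hx, Finset.mul_sum]
  have h1 : ∀ p q r s, ∑ a, ent (A x).1 p a * ent (A x).1 q b * ent (A x).1 r c *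
      ent (A x).1 s a * curvature g e x p q r s = (if p = s then 1 else 0) *
      (ent (A x).1 q b * ent (A x).1 r c * curvature g e x p q r s) := by
    intro p q r s
    rw [← SO.sum_self_mul (A x), Finset.sum_mul]
    exact Finset.sum_congr rfl fun a _ => by ring
  rw [Finset.sum_comm, Finset.sum_congr rfl fun p _ => Finset.sum_comm]
  rw [Finset.sum_congr rfl fun p _ => Finset.sum_congr rfl fun q _ => Finset.sum_comm]
  rw [Finset.sum_congr rfl fun p _ => Finset.sum_congr rfl fun q _ => Finset.sum_congr rfl
    fun r _ => Finset.sum_comm]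
  simp only [h1, ite_mul, one_mul, zero_mul, Finset.sum_ite_eq, Finset.mem_univ, if_true]
  rw [Finset.sum_comm]
  exact Finset.sum_congr rfl fun q _ => Finset.sum_comm

theorem tens_triv_two (B : Mat n) (T : (Fin 2 → Fin n) → ℝ) (J : Fin 2 → Fin n) :
    tens 2 (triv n) B T J = ∑ q, ∑ r, B (J 0) q * B (J 1) r * T ![q, r] := by
  rw [tens_succ]
  refine Finset.sum_congr rfl fun p _ => ?_
  rw [tens_succ, Finset.smul_sum]
  refine Finset.sum_congr rfl fun r _ => ?_
  rw [tens_apply, Fintype.sum_unique]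
  simp only [Finset.univ_eq_empty, Finset.prod_empty, smul_eq_mul, one_mul, triv,
    one_apply_eq_self, ← mul_assoc]
  rfl

theorem IsGauge.schouten_eq (h : IsGauge g e e' U A) {x : M} (hx : x ∈ U) :
    schouten g e' x = tens 2 (triv n) (ent (A x)⁻¹.1) (schouten g e x) := by
  funext J
  have htr : ∑ c, ricci g e' x c c = ∑ c, ricci g e x c c := by
    simp only [h.ricci_eq hx]
    rw [Finset.sum_comm, Finset.sum_congr rfl fun p _ => Finset.sum_comm]
    simp only [← Finset.sum_mul, SO.sum_self_mul, ite_mul, one_mul, zero_mul, Finset.sum_ite_eq,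
      Finset.mem_univ, if_true]
  rw [tens_triv_two, SO.coe_inv, schouten, htr, h.ricci_eq hx]
  change _ = ∑ q, ∑ r, ent (A x).1 q (J 0) * ent (A x).1 r (J 1) * schouten g e x ![q, r]
  have hs : ∀ q r, schouten g e x ![q, r] = (ricci g e x q r - (∑ c, ricci g e x c c) /
      (2 * ((n : ℝ) - 1)) * (if q = r then 1 else 0)) / ((n : ℝ) - 2) := fun _ _ => rfl
  simp only [hs, mul_div_assoc', mul_sub, ← Finset.sum_div, Finset.sum_sub_distrib]
  congr 2
  simp only [mul_ite, mul_one, mul_zero, Finset.sum_ite_eq, Finset.mem_univ, if_true]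
  rw [← Finset.sum_mul, SO.sum_mul_self, ite_mul, one_mul, zero_mul]

/-- The fourth-order expression for a section of the bundle associated to `R`. -/
def quartic (R : Mat n → F →L[ℝ] F) (g : Metric n M)
    (e : Fin n → ∀ x : M, TangentSpace (𝓡 n) x) (f : M → (Fin 0 → Fin n) → F) (x : M) :
    (Fin 4 → Fin n) → F :=
  nab R g e (nab R g e (nab R g e (nab R g e f))) x
    + (10 : ℝ) • (mulT (schouten g e x) (nab R g e (nab R g e f) x) : (Fin 4 → Fin n) → F)
    + (10 : ℝ) • (mulT (nab (triv n) g e (schouten g e) x) (nab R g e f x) : (Fin 4 → Fin n) → F)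
    + (3 : ℝ) • (mulT (nab (triv n) g e (nab (triv n) g e (schouten g e)) x) (f x) :
        (Fin 4 → Fin n) → F)
    + (9 : ℝ) • (mulT (schouten g e x) (mulT (schouten g e x) (f x)) : (Fin 4 → Fin n) → F)

/-- Passage from the expression in the statement to iterated `nab`. The equalities are known only on
the open set `U`, which suffices because derivatives are local. -/
theorem IsFrame.fourthOrder_eq {lam : Fin (n / 2) → ℤ} {V : Irrep.{v} n lam}
    {R : Mat n → V.carrier →L[ℝ] V.carrier} (he : IsFrame g e U) (hR : IsSmoothRep R)
    (hL : ∀ X v, infAction V.rep X v = infMap R X.1 v) {f : M → V.carrier}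
    (hf : IsSmoothFun n f U) {x : M} (hx : x ∈ U) :
    fourthOrder V g e f x = quartic R g e (fun y _ => f y) x := by
  have hfin : FiniteDimensional ℝ V.carrier := FiniteDimensional.complexToReal V.carrier
  have h0 : IsSmoothFun n (fun y (_ : Fin 0 → Fin n) => f y) U := isSmoothFun_pi.2 fun _ => hf
  have hP := he.isSmoothFun_schouten
  have t0 : ∀ (X : so n) (v : ℝ), (0 : ℝ) = infMap (triv n) X.1 v := fun X v => by
    rw [infMap_triv]; rfl
  have d1 := fun y hy => he.nabla_eq hR hL h0 (fun _ _ => rfl) (x := y) hy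
  have d2 := fun y hy => he.nabla_eq hR hL (he.isSmoothFun_nab h0) d1 (x := y) hy
  have d3 := fun y hy => he.nabla_eq hR hL (he.isSmoothFun_nab (he.isSmoothFun_nab h0)) d2
    (x := y) hy
  have d4 := he.nabla_eq hR hL (he.isSmoothFun_nab (he.isSmoothFun_nab (he.isSmoothFun_nab h0))) d3
    hx
  have p1 := fun y hy => he.nabla_eq triv_isSmoothRep t0 hP (fun _ _ => rfl) (x := y) hy
  have p2 := he.nabla_eq triv_isSmoothRep t0 (he.isSmoothFun_nab hP) p1 hx
  funext J
  rw [fourthOrder, d4, d2 x hx, d1 x hx, p2, p1 x hx]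
  have i1 : J ∘ blockEquiv 2 2 ∘ Sum.inl = ![J 0, J 1] := by funext i; fin_cases i <;> rfl
  have i2 : J ∘ blockEquiv 2 2 ∘ Sum.inr = ![J 2, J 3] := by funext i; fin_cases i <;> rfl
  have i3 : J ∘ blockEquiv 3 1 ∘ Sum.inl = ![J 0, J 1, J 2] := by funext i; fin_cases i <;> rfl
  have i4 : J ∘ blockEquiv 3 1 ∘ Sum.inr = ![J 3] := by funext i; fin_cases i; rfl
  have i5 : J ∘ blockEquiv 4 0 ∘ Sum.inl = J := by funext i; fin_cases i <;> rfl
  have i6 : (J ∘ blockEquiv 2 2 ∘ Sum.inr) ∘ blockEquiv 2 0 ∘ Sum.inl = ![J 2, J 3] := by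
    funext i; fin_cases i <;> rfl
  simp only [quartic, Pi.add_apply, Pi.smul_apply, mulT, smul_smul, mul_assoc]
  rw [i6, i1, i2, i3, i4, i5]

theorem IsGauge.nab_eq_of_eq [FiniteDimensional ℝ F] (h : IsGauge g e e' U A) (hR : IsSmoothRep R)
    {k : ℕ} {T T' : M → (Fin k → Fin n) → F} (hT : IsSmoothFun n T U)
    (hT' : ∀ y ∈ U, T' y = tens k R (ent (A y)⁻¹.1) (T y)) :
    ∀ y ∈ U, nab R g e' T' y = tens (k + 1) R (ent (A y)⁻¹.1) (nab R g e T y) := by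
  intro y hy
  rw [← h.nab_eq hR hT hy]
  exact h.frame'.nab_congr hT' hy

/-- Each building block and each product transforms as a tensor. -/
theorem IsGauge.quartic_eq [FiniteDimensional ℝ F] (h : IsGauge g e e' U A) (hR : IsSmoothRep R)
    {f : M → (Fin 0 → Fin n) → F} (hf : IsSmoothFun n f U) {x : M} (hx : x ∈ U) :
    quartic R g e' (fun y => tens 0 R (ent (A y)⁻¹.1) (f y)) x =
      tens 4 R (ent (A x)⁻¹.1) (quartic R g e f x) := by
  have hP := h.frame.isSmoothFun_schouten
  have s1 := h.frame.isSmoothFun_nab (R := R) hf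
  have s2 := h.frame.isSmoothFun_nab (R := R) s1
  have s3 := h.frame.isSmoothFun_nab (R := R) s2
  have d1 := h.nab_eq_of_eq hR hf fun _ _ => rfl
  have d2 := h.nab_eq_of_eq hR s1 d1
  have d3 := h.nab_eq_of_eq hR s2 d2
  have d4 := h.nab_eq_of_eq hR s3 d3
  have p0 := fun y hy => h.schouten_eq (x := y) hy
  have p1 := h.nab_eq_of_eq triv_isSmoothRep hP p0
  have p2 := h.nab_eq_of_eq triv_isSmoothRep (h.frame.isSmoothFun_nab hP) p1
  rw [quartic, d4 x hx, d2 x hx, d1 x hx, p0 x hx, p1 x hx, p2 x hx]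
  simp only [quartic, map_add, map_smul]
  rw [← tens_mulT, ← tens_mulT, ← tens_mulT, ← tens_mulT, ← tens_mulT]

end

end Expression

/-! ### Conformal rescaling of metrics -/

section Rescaling

variable {n : ℕ} {M : Type u} [TopologicalSpace M] [ChartedSpace (EuclideanSpace ℝ (Fin n)) M]
  [IsManifold (𝓡 n) ∞ M]

/-- A metric `g' = Ω² g` and a `g`-orthonormal frame, rescaled to a `g'`-orthonormal one. -/
structure IsRescaling (g g' : Metric n M) (e e' : Fin n → ∀ x : M, TangentSpace (𝓡 n) x)
    (U : Set M) (Ω : M → ℝ) : Prop where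
  frame : IsFrame g e U
  smooth : IsSmoothFun n Ω U
  pos : ∀ x ∈ U, 0 < Ω x
  metric : ∀ x ∈ U, ∀ v w, g'.inner x v w = Ω x ^ 2 * g.inner x v w
  change : ∀ x ∈ U, ∀ b, e' b x = (Ω x)⁻¹ • e b x

variable {g g' : Metric n M} {e e' : Fin n → ∀ x : M, TangentSpace (𝓡 n) x} {U : Set M} {Ω : M → ℝ}
  {F : Type*} [NormedAddCommGroup F] [NormedSpace ℝ F] {R : Mat n → F →L[ℝ] F}

/-- The logarithmic derivatives of the conformal factor. -/
def logd (e : Fin n → ∀ x : M, TangentSpace (𝓡 n) x) (Ω : M → ℝ) (a : Fin n) (x : M) : ℝ :=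
  (Ω x)⁻¹ * dd e a Ω x

theorem ite_eq_symm (a b : Fin n) :
    (if a = b then (1 : ℝ) else 0) = if b = a then 1 else 0 := by
  simp only [eq_comm]

theorem IsRescaling.isSmoothFun_rpow (h : IsRescaling g g' e e' U Ω) (s : ℝ) :
    IsSmoothFun n (fun x => Ω x ^ s) U :=
  ConformalOp.isSmoothFun_rpow h.smooth h.pos s

theorem IsRescaling.isSmoothFun_inv (h : IsRescaling g g' e e' U Ω) :
    IsSmoothFun n (fun x => (Ω x)⁻¹) U :=
  (h.isSmoothFun_rpow (-1)).congr fun _ _ => (Real.rpow_neg_one _).symm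

theorem IsRescaling.isSmoothFun_logd (h : IsRescaling g g' e e' U Ω) (a : Fin n) :
    IsSmoothFun n (logd e Ω a) U :=
  h.isSmoothFun_inv.mul (h.frame.isSmoothFun_dd h.smooth a)

theorem IsRescaling.dd_rpow (h : IsRescaling g g' e e' U Ω) (s : ℝ) (a : Fin n) {x : M}
    (hx : x ∈ U) : dd e a (fun y => Ω y ^ s) x = s * Ω x ^ s * logd e Ω a x := by
  refine mvfderiv_eq_of_hasDerivAt
    ((h.isSmoothFun_rpow s).mdifferentiableAt h.frame.isOpen hx) ?_
  have h0 : curve x (e a x) 0 = x := curve_zero x (e a x)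
  have h1 := (hasDerivAt_curve (h.smooth.mdifferentiableAt h.frame.isOpen hx) (e a x)).rpow_const
    (p := s) (Or.inl (by rw [h0]; exact (h.pos x hx).ne'))
  rw [h0] at h1
  refine h1.congr_deriv ?_
  rw [Real.rpow_sub (h.pos x hx), Real.rpow_one, logd, dd]
  ring

theorem IsRescaling.dd_inv (h : IsRescaling g g' e e' U Ω) (a : Fin n) {x : M} (hx : x ∈ U) :
    dd e a (fun y => (Ω y)⁻¹) x = - (Ω x)⁻¹ * logd e Ω a x := by
  have := h.dd_rpow (-1) a hx
  simp only [Real.rpow_neg_one] at this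
  rw [this]
  ring

theorem IsRescaling.dd_eq (h : IsRescaling g g' e e' U Ω) (a : Fin n) {x : M} (hx : x ∈ U)
    (f : M → F) : dd e' a f x = (Ω x)⁻¹ • dd e a f x := by
  simp only [dd, h.change x hx, map_smul]

theorem IsRescaling.frame' (h : IsRescaling g g' e e' U Ω) : IsFrame g' e' U where
  isOpen := h.frame.isOpen
  smooth i := (IsSmoothField.smul h.isSmoothFun_inv (h.frame.smooth i)).congr fun x hx => by
    rw [h.change x hx]
  ortho x hx i j := by
    rw [h.change x hx, h.change x hx, h.metric x hx]
    simp only [map_smul, smul_apply, h.frame.ortho x hx, smul_eq_mul]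
    have := (h.pos x hx).ne'
    split_ifs <;> field_simp

/-- The right-hand side is skew, and its torsion matches the brackets of the rescaled frame, so
`conn_unique` applies. -/
theorem IsRescaling.conn_eq (h : IsRescaling g g' e e' U Ω) {x : M} (hx : x ∈ U) (a b c : Fin n) :
    conn g' e' x a b c = (Ω x)⁻¹ * (conn g e x a b c +
      (logd e Ω b x * (if a = c then 1 else 0) - logd e Ω c x * (if a = b then 1 else 0))) := by
  refine conn_unique g' e' x (fun a b c => (Ω x)⁻¹ * (conn g e x a b c +
    (logd e Ω b x * (if a = c then 1 else 0) - logd e Ω c x * (if a = b then 1 else 0)))) ?_ ?_ a b c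
  · intro a b c
    simp only [conn_skew g e x a b c]
    ring
  · intro a b c
    have hB : ∀ i j : Fin n, IsSmoothFun n (fun x => if i = j then (Ω x)⁻¹ else 0) U := by
      intro i j
      by_cases hij : i = j
      · simp only [if_pos hij]; exact h.isSmoothFun_inv
      · simp only [if_neg hij]; exact contMDiffOn_const
    have hd : ∀ a c b : Fin n, dd e' a (fun y => if c = b then (Ω y)⁻¹ else 0) x =
        - ((Ω x)⁻¹ * (Ω x)⁻¹) * logd e Ω a x * if c = b then 1 else 0 := by
      intro a c b
      by_cases hcb : c = b
      · simp only [if_pos hcb, h.dd_eq a hx, h.dd_inv a hx, smul_eq_mul]; ring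
      · simp only [if_neg hcb, dd_const]; ring
    rw [struc, h.frame.bracket_change (e' := e') hB (fun y hy b => by
      simp only [ite_smul, zero_smul, Finset.sum_ite_eq', Finset.mem_univ, if_true, h.change y hy])
      a b hx, h.metric x hx, h.change x hx c]
    simp only [map_sum, map_smul, sum_apply, smul_apply, h.frame.ortho x hx, smul_eq_mul, mul_ite,
      mul_one, mul_zero, ite_mul, zero_mul, Finset.sum_ite_eq', Finset.mem_univ, if_true, hd]
    rw [← conn_torsion]
    have := (h.pos x hx).ne'
    simp only [eq_comm (a := c) (b := a), eq_comm (a := c) (b := b), eq_comm (a := b) (b := a)]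
    split_ifs <;> field_simp <;> ring

/-- The correction to the Schouten tensor. -/
def schoutenCorr (g : Metric n M) (e : Fin n → ∀ x : M, TangentSpace (𝓡 n) x) (Ω : M → ℝ) (x : M)
    (a c : Fin n) : ℝ :=
  dd e a (logd e Ω c) x - (∑ k, conn g e x a c k * logd e Ω k x) - logd e Ω a x * logd e Ω c x
    + (∑ k, logd e Ω k x * logd e Ω k x) / 2 * (if a = c then 1 else 0)

/-- The curvature changes by the Kulkarni–Nomizu product of the metric with the single tensor
`schoutenCorr`. -/
theorem IsRescaling.curvature_eq (h : IsRescaling g g' e e' U Ω) {x : M} (hx : x ∈ U)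
    (a b c d : Fin n) : curvature g' e' x a b c d = ((Ω x)⁻¹ * (Ω x)⁻¹) * (curvature g e x a b c d +
      ((if b = d then 1 else 0) * schoutenCorr g e Ω x a c
      - (if b = c then 1 else 0) * schoutenCorr g e Ω x a d
      - (if a = d then 1 else 0) * schoutenCorr g e Ω x b c
      + (if a = c then 1 else 0) * schoutenCorr g e Ω x b d)) := by
  have hS : ∀ (b c d : Fin n), IsSmoothFun n (fun y => logd e Ω c y * (if b = d then 1 else 0) -
      logd e Ω d y * (if b = c then 1 else 0)) U := fun b c d =>
    ContMDiffOn.sub (ContMDiffOn.mul (h.isSmoothFun_logd c) contMDiffOn_const)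
      (ContMDiffOn.mul (h.isSmoothFun_logd d) contMDiffOn_const)
  have hm : ∀ a c (t : ℝ), dd e a (fun y => logd e Ω c y * t) x = dd e a (logd e Ω c) x * t := by
    intro a c t
    rw [h.frame.dd_mul (h.isSmoothFun_logd c) contMDiffOn_const a hx, dd_const]
    ring
  have hd : ∀ a b c d, dd e' a (fun y => conn g' e' y b c d) x = (Ω x)⁻¹ * (Ω x)⁻¹ *
      (dd e a (fun y => conn g e y b c d) x + (dd e a (logd e Ω c) x * (if b = d then 1 else 0) -
        dd e a (logd e Ω d) x * (if b = c then 1 else 0)) - logd e Ω a x * (conn g e x b c d +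
      (logd e Ω c x * (if b = d then 1 else 0) - logd e Ω d x * (if b = c then 1 else 0)))) := by
    intro a b c d
    rw [h.dd_eq a hx, h.frame.dd_congr (fun y hy => h.conn_eq hy b c d) a hx,
      h.frame.dd_mul (f := fun y => conn g e y b c d + (logd e Ω c y * (if b = d then 1 else 0) -
      logd e Ω d y * (if b = c then 1 else 0))) h.isSmoothFun_inv ((h.frame.isSmoothFun_conn b c d).add (hS b c d)) a hx,
      h.frame.dd_add (h.frame.isSmoothFun_conn b c d) (hS b c d) a hx,
      h.frame.dd_sub (f := fun y => logd e Ω c y * _) (f' := fun y => logd e Ω d y * _) ((h.isSmoothFun_logd c).mul contMDiffOn_const)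
        ((h.isSmoothFun_logd d).mul contMDiffOn_const) a hx, hm, hm, h.dd_inv a hx, smul_eq_mul]
    ring
  change dd e' a (fun y => conn g' e' y b c d) x - dd e' b (fun y => conn g' e' y a c d) x + _ - _ =
    _ * (dd e a (fun y => conn g e y b c d) x - dd e b (fun y => conn g e y a c d) x + _ - _ + _)
  rw [hd, hd]
  simp only [h.conn_eq hx]
  -- Products of connection coefficients are expanded and the Kronecker deltas summed; `e2` does the
  -- same for the torsion term.
  have e1 : ∀ (a b c d : Fin n), ∑ k, (Ω x)⁻¹ * (conn g e x b c k +
      (logd e Ω c x * (if b = k then 1 else 0) - logd e Ω k x * (if b = c then 1 else 0))) *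
      ((Ω x)⁻¹ * (conn g e x a k d +
      (logd e Ω k x * (if a = d then 1 else 0) - logd e Ω d x * (if a = k then 1 else 0)))) =
      (Ω x)⁻¹ * (Ω x)⁻¹ * (∑ k, conn g e x b c k * conn g e x a k d +
        (if a = d then 1 else 0) * (∑ k, conn g e x b c k * logd e Ω k x) -
        conn g e x b c a * logd e Ω d x + logd e Ω c x * conn g e x a b d +
        (if b = c then 1 else 0) * (∑ k, conn g e x a d k * logd e Ω k x) +
        logd e Ω c x * logd e Ω b x * (if a = d then 1 else 0)
        - logd e Ω c x * logd e Ω d x * (if a = b then 1 else 0)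
        - (∑ k, logd e Ω k x * logd e Ω k x) * (if b = c then 1 else 0) * (if a = d then 1 else 0)
        + logd e Ω a x * logd e Ω d x * (if b = c then 1 else 0)) := by
    intro a b c d
    have : ∀ k, (Ω x)⁻¹ * (conn g e x b c k +
      (logd e Ω c x * (if b = k then 1 else 0) - logd e Ω k x * (if b = c then 1 else 0))) *
      ((Ω x)⁻¹ * (conn g e x a k d +
      (logd e Ω k x * (if a = d then 1 else 0) - logd e Ω d x * (if a = k then 1 else 0)))) =
      (Ω x)⁻¹ * (Ω x)⁻¹ * (conn g e x b c k * conn g e x a k d +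
        (if a = d then 1 else 0) * (conn g e x b c k * logd e Ω k x) -
        (if a = k then conn g e x b c k * logd e Ω d x else 0) +
        (if b = k then logd e Ω c x * conn g e x a k d else 0) +
        (if b = c then 1 else 0) * (conn g e x a d k * logd e Ω k x) +
        (if b = k then logd e Ω c x * logd e Ω k x * (if a = d then 1 else 0) else 0)
        - (if b = k then logd e Ω c x * logd e Ω d x * (if a = k then 1 else 0) else 0)
        - (logd e Ω k x * logd e Ω k x) * (if b = c then 1 else 0) * (if a = d then 1 else 0)
        + (if a = k then logd e Ω k x * logd e Ω d x * (if b = c then 1 else 0) else 0)) := by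
      intro k
      rw [conn_skew g e x a k d]
      split_ifs <;> ring
    simp only [this, ← Finset.mul_sum, Finset.sum_add_distrib, Finset.sum_sub_distrib,
      Finset.sum_ite_eq, Finset.mem_univ, if_true, ← Finset.sum_mul]
  have e2 : ∀ (a b c d : Fin n), ∑ k, ((Ω x)⁻¹ * (conn g e x a b k +
      (logd e Ω b x * (if a = k then 1 else 0) - logd e Ω k x * (if a = b then 1 else 0))) -
      (Ω x)⁻¹ * (conn g e x b a k +
      (logd e Ω a x * (if b = k then 1 else 0) - logd e Ω k x * (if b = a then 1 else 0)))) *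
      ((Ω x)⁻¹ * (conn g e x k c d +
      (logd e Ω c x * (if k = d then 1 else 0) - logd e Ω d x * (if k = c then 1 else 0)))) =
      (Ω x)⁻¹ * (Ω x)⁻¹ * (∑ k, (conn g e x a b k - conn g e x b a k) * conn g e x k c d +
        logd e Ω c x * (conn g e x a b d - conn g e x b a d) -
        logd e Ω d x * (conn g e x a b c - conn g e x b a c) +
        logd e Ω b x * (conn g e x a c d +
          (logd e Ω c x * (if a = d then 1 else 0) - logd e Ω d x * (if a = c then 1 else 0))) -
        logd e Ω a x * (conn g e x b c d +
          (logd e Ω c x * (if b = d then 1 else 0) - logd e Ω d x * (if b = c then 1 else 0)))) := by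
    intro a b c d
    have : ∀ k, ((Ω x)⁻¹ * (conn g e x a b k +
      (logd e Ω b x * (if a = k then 1 else 0) - logd e Ω k x * (if a = b then 1 else 0))) -
      (Ω x)⁻¹ * (conn g e x b a k +
      (logd e Ω a x * (if b = k then 1 else 0) - logd e Ω k x * (if b = a then 1 else 0)))) *
      ((Ω x)⁻¹ * (conn g e x k c d +
      (logd e Ω c x * (if k = d then 1 else 0) - logd e Ω d x * (if k = c then 1 else 0)))) =
      (Ω x)⁻¹ * (Ω x)⁻¹ * ((conn g e x a b k - conn g e x b a k) * conn g e x k c d +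
        (if k = d then logd e Ω c x * (conn g e x a b k - conn g e x b a k) else 0) -
        (if k = c then logd e Ω d x * (conn g e x a b k - conn g e x b a k) else 0) +
        (if a = k then logd e Ω b x * (conn g e x k c d +
          (logd e Ω c x * (if k = d then 1 else 0) - logd e Ω d x * (if k = c then 1 else 0)))
          else 0) -
        (if b = k then logd e Ω a x * (conn g e x k c d +
          (logd e Ω c x * (if k = d then 1 else 0) - logd e Ω d x * (if k = c then 1 else 0)))
          else 0)) := by
      intro k
      rw [ite_eq_symm b a]
      split_ifs <;> ring
    simp only [this, ← Finset.mul_sum, Finset.sum_add_distrib, Finset.sum_sub_distrib,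
      Finset.sum_ite_eq, Finset.sum_ite_eq', Finset.mem_univ, if_true]
  rw [e2, Finset.sum_sub_distrib, e1, e1, Finset.sum_sub_distrib]
  simp only [schoutenCorr]
  rw [conn_skew g e x b a c, conn_skew g e x a b c, ite_eq_symm b a]
  ring

/-- Contraction changes the Ricci tensor by `(n - 2) C + (tr C) g`, with `C = schoutenCorr`, and the
normalisation of the Schouten tensor is the one for which the trace drops out. Dividing by `n - 2`
uses `3 ≤ n`. -/
theorem IsRescaling.schouten_eq (hn : 3 ≤ n) (h : IsRescaling g g' e e' U Ω) {x : M} (hx : x ∈ U)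
    (J : Fin 2 → Fin n) : schouten g' e' x J =
      (Ω x)⁻¹ * (Ω x)⁻¹ * (schouten g e x J - schoutenCorr g e Ω x (J 0) (J 1)) := by
  have hr : ∀ b c, ricci g' e' x b c = (Ω x)⁻¹ * (Ω x)⁻¹ * (ricci g e x b c -
      ((n : ℝ) - 2) * schoutenCorr g e Ω x b c -
      (if b = c then 1 else 0) * ∑ a, schoutenCorr g e Ω x a a) := by
    intro b c
    simp only [ricci, h.curvature_eq hx, ← Finset.mul_sum, Finset.sum_add_distrib,
      Finset.sum_sub_distrib, ite_mul, one_mul, zero_mul, Finset.sum_ite_eq, Finset.sum_ite_eq',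
      Finset.mem_univ, if_true, Finset.sum_const, Finset.card_univ, Fintype.card_fin, nsmul_eq_mul]
    by_cases hbc : b = c
    · simp only [if_pos hbc]; ring
    · simp only [if_neg hbc, Finset.sum_const_zero]; ring
  have hn' : (3 : ℝ) ≤ n := by exact_mod_cast hn
  have h1 : (n : ℝ) - 2 ≠ 0 := by linarith
  have h2 : (n : ℝ) - 1 ≠ 0 := by linarith
  have hs : ∑ c, ricci g' e' x c c = (Ω x)⁻¹ * (Ω x)⁻¹ * (∑ c, ricci g e x c c -
      2 * ((n : ℝ) - 1) * ∑ a, schoutenCorr g e Ω x a a) := by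
    simp only [hr, ← Finset.mul_sum, Finset.sum_sub_distrib, if_true, one_mul, Finset.sum_const,
      Finset.card_univ, Fintype.card_fin, nsmul_eq_mul]
    ring
  rw [schouten, hs, hr, schouten]
  generalize (if J 0 = J 1 then (1 : ℝ) else 0) = t
  field_simp
  ring

end Rescaling

/-! ### Calculus modulo the kernel of the projection -/

section TensorIdeals

variable {n : ℕ} {V : Type v} [NormedAddCommGroup V] [NormedSpace ℂ V] [FiniteDimensional ℂ V]

theorem ContRep.infMap_tensor_ext (ρ : ContRep n V) (k : ℕ) (X : so n) (T : (Fin k → Fin n) → V) :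
    infMap (ρ.tensor k).ext X.1 T = infMap (tens k ρ.ext) X.1 T := by
  have hfin : FiniteDimensional ℝ V := FiniteDimensional.complexToReal V
  have h1 := ((ρ.tensor k).isSmoothRep.hasDerivAt_soExp X).clm_apply (hasDerivAt_const (0 : ℝ) T)
  have h2 := ((ρ.isSmoothRep.tens k).hasDerivAt_soExp X).clm_apply (hasDerivAt_const (0 : ℝ) T)
  simp only [map_zero, add_zero] at h1 h2
  refine h1.unique (h2.congr_of_eventuallyEq (.of_forall fun t => ?_))
  simp only [ContRep.ext_apply]
  rfl

/-- A subspace of tensors modulo which tensors are symmetric, trace-free, and the coupling with the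
action on the values is a scalar. -/
structure IsGood (ρ : ContRep n V) (c : ℝ) {k : ℕ} (N : Submodule ℂ ((Fin k → Fin n) → V)) :
    Prop where
  stable : ∀ a b, ∀ T ∈ N, (ρ.tensor k).lam a b T ∈ N
  perm : ∀ (σ : Equiv.Perm (Fin k)) T, permT σ T - T ∈ N
  trace : ∀ s t : Fin k, s ≠ t → ∀ T, traceT s t T ∈ N
  couple : ∀ (s : Fin k) T, couple ρ s T - c • T ∈ N

/-- The tensors whose products with all covectors belong to `N`. -/
def divideT {k : ℕ} (N : Submodule ℂ ((Fin (k + 1) → Fin n) → V)) :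
    Submodule ℂ ((Fin k → Fin n) → V) :=
  ⨅ a : Fin n → ℂ, N.comap (consT a)

omit [FiniteDimensional ℂ V] in
theorem mem_divideT {k : ℕ} {N : Submodule ℂ ((Fin (k + 1) → Fin n) → V)}
    {T : (Fin k → Fin n) → V} : T ∈ divideT N ↔ ∀ a, consT a T ∈ N := by
  simp [divideT, Submodule.mem_iInf]

/-- Permutations, traces and couplings in degree `k` are those in degree `k + 1` that avoid the
first slot, so they commute with `consT`. For the Lie algebra, the extra terms acting on the first
slot are again products with covectors. -/
theorem IsGood.divideT {ρ : ContRep n V} {c : ℝ} {k : ℕ}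
    {N : Submodule ℂ ((Fin (k + 1) → Fin n) → V)} (h : IsGood ρ c N) :
    IsGood ρ c (divideT N) where
  stable a b T hT := by
    rw [mem_divideT] at hT ⊢
    intro a'
    have h1 := h.stable a b _ (hT a')
    rw [ρ.lam_consT] at h1
    exact (Submodule.add_mem_iff_left _ (N.sub_mem (N.smul_mem _ (hT a))
      (N.smul_mem _ (hT b)))).1 h1
  perm σ T := by
    rw [mem_divideT]
    intro a
    -- This permutation fixes the first slot and acts as `σ` on the others.
    have h1 := h.perm (Equiv.Perm.decomposeFin.symm (0, σ)) (consT a T)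
    have h2 : permT (Equiv.Perm.decomposeFin.symm (0, σ)) (consT a T) = consT a (permT σ T) := by
      ext J
      rw [permT_apply, consT_apply, consT_apply, permT_apply, Function.comp_apply,
        Equiv.Perm.decomposeFin_symm_apply_zero]
      congr 2
    rwa [h2, ← map_sub] at h1
  trace s t hst T := by
    rw [mem_divideT]
    intro a
    have h1 := h.trace s.succ t.succ (fun h => hst (Fin.succ_injective _ h)) (consT a T)
    have h2 : traceT s.succ t.succ (consT a T) = consT a (traceT s t T) := by
      ext J
      rw [traceT_apply, consT_apply, traceT_apply, smul_ite, smul_zero, Finset.smul_sum]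
      refine if_congr Iff.rfl (Finset.sum_congr rfl fun d _ => ?_) rfl
      rw [consT_apply, Fin.tail_update_succ, Fin.tail_update_succ,
        Function.update_of_ne (Fin.succ_ne_zero _).symm,
        Function.update_of_ne (Fin.succ_ne_zero _).symm]
    rwa [h2] at h1
  couple s T := by
    rw [mem_divideT]
    intro a
    have h1 := h.couple s.succ (consT a T)
    have h2 : ConformalOp.couple ρ s.succ (consT a T) = consT a (ConformalOp.couple ρ s T) := by
      ext J
      rw [couple_apply, consT_apply, couple_apply, Finset.smul_sum]
      refine Finset.sum_congr rfl fun d _ => ?_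
      rw [consT_apply, Fin.tail_update_succ, Function.update_of_ne (Fin.succ_ne_zero _).symm,
        map_smul]
      rfl
    have h3 : c • consT a T = consT a (c • T) := by
      rw [← Complex.coe_smul, ← Complex.coe_smul, map_smul]
    rwa [h2, h3, ← map_sub] at h1

theorem IsGood.top (ρ : ContRep n V) (c : ℝ) (k : ℕ) :
    IsGood ρ c (⊤ : Submodule ℂ ((Fin k → Fin n) → V)) :=
  ⟨fun _ _ _ _ => trivial, fun _ _ => trivial, fun _ _ _ _ => trivial, fun _ _ => trivial⟩

theorem IsTopProjection.isGood {lam mu : Fin (n / 2) → ℤ} {V : Irrep.{v} n lam} {W : Irrep.{v} n mu}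
    {c : ℝ} {p : ((Fin 4 → Fin n) → V.carrier) →ₗ[ℂ] W.carrier} (h : IsTopProjection V W c p) :
    IsGood V.cont c (LinearMap.ker p) where
  stable a b T hT := by
    rw [LinearMap.mem_ker] at hT ⊢
    rw [isSoMap_of_mem h.equivariant, hT, map_zero]
  perm σ T := by rw [LinearMap.mem_ker, map_sub, h.perm, sub_self]
  trace s t hst T := h.trace s t hst T
  couple s T := by
    rw [LinearMap.mem_ker, map_sub, h.couple, ← Complex.coe_smul, ← Complex.coe_smul, map_smul,
      sub_self]

/-- The family of subspaces of tensors of all degrees generated by a subspace in degree four. -/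
def idealOf (N : Submodule ℂ ((Fin 4 → Fin n) → V)) : ∀ k, Submodule ℂ ((Fin k → Fin n) → V)
  | 0 => divideT (divideT (divideT (divideT N)))
  | 1 => divideT (divideT (divideT N))
  | 2 => divideT (divideT N)
  | 3 => divideT N
  | 4 => N
  -- Degrees above four are never used; the whole space makes all conditions vacuous.
  | _ + 5 => ⊤

/-- A family of good subspaces that is stable under products with covectors. -/
structure IsTensorIdeal (ρ : ContRep n V) (c : ℝ) (N : ∀ k, Submodule ℂ ((Fin k → Fin n) → V)) :
    Prop where
  good : ∀ k, IsGood ρ c (N k)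
  cons : ∀ k, ∀ T ∈ N k, ∀ a, consT a T ∈ N (k + 1)

theorem IsGood.isTensorIdeal {ρ : ContRep n V} {c : ℝ} {N : Submodule ℂ ((Fin 4 → Fin n) → V)}
    (h : IsGood ρ c N) : IsTensorIdeal ρ c (idealOf N) where
  good
    | 0 => h.divideT.divideT.divideT.divideT
    | 1 => h.divideT.divideT.divideT
    | 2 => h.divideT.divideT
    | 3 => h.divideT
    | 4 => h
    | _ + 5 => IsGood.top ρ c _
  cons
    | 0 => fun _ hT => mem_divideT.1 hT
    | 1 => fun _ hT => mem_divideT.1 hT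
    | 2 => fun _ hT => mem_divideT.1 hT
    | 3 => fun _ hT => mem_divideT.1 hT
    | 4 => fun _ _ _ => trivial
    | _ + 5 => fun _ _ _ => trivial

variable {ρ : ContRep n V} {c : ℝ} {N : ∀ k, Submodule ℂ ((Fin k → Fin n) → V)}

theorem IsGood.infMap_mem {k : ℕ} {N : Submodule ℂ ((Fin k → Fin n) → V)} (h : IsGood ρ c N)
    (X : so n) {T : (Fin k → Fin n) → V} (hT : T ∈ N) : infMap (tens k ρ.ext) X.1 T ∈ N := by
  rw [← ρ.infMap_tensor_ext, ContRep.infMap_eq_sum]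
  refine N.smul_of_tower_mem _ (N.sum_mem fun i _ => N.sum_mem fun j _ =>
    N.smul_of_tower_mem _ ?_)
  rw [← ContRep.lam_single]
  exact h.stable _ _ T hT

omit [FiniteDimensional ℂ V] in
theorem mulT_succ {m k : ℕ} (h : (Fin (m + 1) → Fin n) → ℝ) (T : (Fin k → Fin n) → V) :
    (mulT (m := m + 1) (k := k) h T) =
      ∑ a, consT (Pi.single a 1) (mulT (fun K => h (Fin.cons a K)) T) := by
  funext J
  rw [Finset.sum_apply]
  simp only [consT_apply, Pi.single_apply, ite_smul, one_smul, zero_smul,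
    Finset.sum_ite_eq, Finset.mem_univ, if_true]
  rw [mulT, mulT]
  congr 2
  · funext i
    refine Fin.cases rfl (fun i => ?_) i
    exact congrArg J (Fin.ext rfl)
  · funext i
    exact congrArg J (Fin.ext (by simp [blockEquiv]; omega))

omit [FiniteDimensional ℂ V] in
theorem mulT_zero {k : ℕ} (h : (Fin 0 → Fin n) → ℝ) (T : (Fin k → Fin n) → V) :
    (mulT h T : (Fin k → Fin n) → V) = h Fin.elim0 • T := by
  funext J
  rw [mulT, Pi.smul_apply]
  congr 2
  · funext i; exact i.elim0
  · funext i
    exact congrArg J (Fin.ext (by simp [blockEquiv]))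

theorem IsTensorIdeal.mulT_mem (hN : IsTensorIdeal ρ c N) {k : ℕ} {T : (Fin k → Fin n) → V}
    (hT : T ∈ N k) : ∀ {m : ℕ} (h : (Fin m → Fin n) → ℝ), mulT h T ∈ N (k + m)
  | 0, h => by
    rw [show (mulT h T : (Fin (k + 0) → Fin n) → V) = _ from mulT_zero h T]
    exact (N k).smul_of_tower_mem _ hT
  | m + 1, h => by
    have := (N (k + m + 1)).sum_mem (t := Finset.univ) fun a _ =>
      hN.cons (k + m) _ (IsTensorIdeal.mulT_mem hN hT (fun K => h (Fin.cons a K))) (Pi.single a 1)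
    rwa [← mulT_succ] at this

/-- Taking the trace in the two metric slots multiplies `g ⊗ T` by `n`, and traces belong to the
ideal. -/
theorem IsTensorIdeal.metric_mem (hN : IsTensorIdeal ρ c N) {k : ℕ} (T : (Fin k → Fin n) → V) :
    mulT (fun K : Fin 2 → Fin n => if K 0 = K 1 then 1 else 0) T ∈ N (k + 2) := by
  by_cases hn : n = 0
  · subst hn
    have : mulT (fun K : Fin 2 → Fin 0 => if K 0 = K 1 then 1 else 0) T = 0 := by
      funext J; exact (J 0).elim0
    rw [this]; exact Submodule.zero_mem _
  have h1 := (hN.good (k + 2)).trace 0 1 (by simp)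
    (mulT (fun K : Fin 2 → Fin n => if K 0 = K 1 then 1 else 0) T)
  have h2 : traceT 0 1 (mulT (fun K : Fin 2 → Fin n => if K 0 = K 1 then 1 else 0) T) =
      (n : ℝ) • mulT (fun K : Fin 2 → Fin n => if K 0 = K 1 then 1 else 0) T := by
    funext J
    have hl0 : blockEquiv 2 k (Sum.inl 0) = 0 := rfl
    have hl1 : blockEquiv 2 k (Sum.inl 1) = 1 := Fin.ext (by simp [blockEquiv])
    have hr : ∀ d, Function.update (Function.update J 0 d) 1 d ∘ blockEquiv 2 k ∘ Sum.inr =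
        J ∘ blockEquiv 2 k ∘ Sum.inr := by
      intro d
      funext i
      simp only [Function.comp_apply]
      rw [Function.update_of_ne, Function.update_of_ne]
      · rw [← hl0]; exact fun h => Sum.inr_ne_inl ((blockEquiv 2 k).injective h)
      · rw [← hl1]; exact fun h => Sum.inr_ne_inl ((blockEquiv 2 k).injective h)
    have h01 : (0 : Fin (k + 2)) ≠ 1 := by simp
    rw [traceT_apply, Pi.smul_apply]
    simp only [mulT, hr, Function.comp_apply, hl0, hl1, Function.update_self,
      Function.update_of_ne h01, if_true, one_smul, Finset.sum_const, Finset.card_univ,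
      Fintype.card_fin]
    split_ifs
    · rw [one_smul, Nat.cast_smul_eq_nsmul]
    · rw [zero_smul, smul_zero]
  rw [h2] at h1
  have h3 := (N (k + 2)).smul_of_tower_mem ((n : ℝ)⁻¹) h1
  rwa [smul_smul, inv_mul_cancel₀ (by exact_mod_cast hn), one_smul] at h3

/-- Tensors obtained from one another by a permutation of the indices agree modulo the ideal. -/
theorem IsTensorIdeal.reindex (hN : IsTensorIdeal ρ c N) {k : ℕ} {ι : Type*} (Φ : (ι → Fin n) → V)
    (ε ε' : ι ≃ Fin k) : (fun J => Φ (J ∘ ε)) - (fun J => Φ (J ∘ ε')) ∈ N k := by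
  have h1 := (hN.good k).perm (ε'.symm.trans ε) fun J => Φ (J ∘ ε')
  have h2 : permT (ε'.symm.trans ε) (fun J => Φ (J ∘ ε')) = fun J => Φ (J ∘ ε) := by
    funext J
    rw [permT_apply]
    congr 1
    funext i
    simp
  rwa [h2] at h1

/-! ### Covariant derivatives and conformal changes modulo the ideal -/

section Manifold

variable {M : Type u} [TopologicalSpace M] [ChartedSpace (EuclideanSpace ℝ (Fin n)) M]
  [IsManifold (𝓡 n) ∞ M] {g g' : Metric n M} {e e' : Fin n → ∀ x : M, TangentSpace (𝓡 n) x}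
  {U : Set M} {Ω : M → ℝ}

/-- A function with values in a subspace is fixed by a linear projection onto it, and linear maps
commute with derivatives. -/
theorem IsFrame.dd_mem {F : Type*} [NormedAddCommGroup F] [NormedSpace ℝ F] [FiniteDimensional ℝ F]
    (he : IsFrame g e U) {E : M → F} (hE : IsSmoothFun n E U) (P : Submodule ℝ F)
    (h : ∀ x ∈ U, E x ∈ P) (a : Fin n) {x : M} (hx : x ∈ U) : dd e a E x ∈ P := by
  obtain ⟨q, hq⟩ := P.subtype.exists_leftInverse_of_injective P.ker_subtype
  let L : F →L[ℝ] F := LinearMap.toContinuousLinearMap (P.subtype ∘ₗ q)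
  have h1 : ∀ y ∈ U, E y = L (E y) := fun y hy =>
    (congrArg (fun f : P →ₗ[ℝ] P => (f ⟨E y, h y hy⟩ : F)) hq).symm
  rw [he.dd_congr h1 a hx, dd, mvfderiv_clm (hE.mdifferentiableAt he.isOpen hx)]
  exact (q _).2

/-- Partial derivatives and the connection term both preserve the ideal, so `nab` descends to the
quotient. -/
theorem IsTensorIdeal.nab_mem (hN : IsTensorIdeal ρ c N) (he : IsFrame g e U) {k : ℕ}
    {E : M → (Fin k → Fin n) → V} (hE : IsSmoothFun n E U) (h : ∀ x ∈ U, E x ∈ N k) {x : M}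
    (hx : x ∈ U) : nab ρ.ext g e E x ∈ N (k + 1) := by
  have hfin : FiniteDimensional ℝ V := FiniteDimensional.complexToReal V
  have h1 : nab ρ.ext g e E x =
      ∑ a, consT (Pi.single a 1) (cov (tens k ρ.ext) g e E a x) := by
    funext J
    simp only [Finset.sum_apply, consT_apply, Pi.single_apply, ite_smul, one_smul, zero_smul,
      Finset.sum_ite_eq, Finset.mem_univ, if_true]
    rfl
  rw [h1]
  refine Submodule.sum_mem _ fun a _ => hN.cons k _ ?_ _
  exact (N k).add_mem (he.dd_mem hE ((N k).restrictScalars ℝ) h a hx)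
    ((hN.good k).infMap_mem _ (h x hx))

/-- The logarithmic derivative of the conformal factor, as a one-form. -/
def logForm (e : Fin n → ∀ x : M, TangentSpace (𝓡 n) x) (Ω : M → ℝ) (x : M) (K : Fin 1 → Fin n) :
    ℝ :=
  logd e Ω (K 0) x

omit [FiniteDimensional ℂ V] in
theorem mulT_one {k : ℕ} (h : (Fin 1 → Fin n) → ℝ) (T : (Fin k → Fin n) → V)
    (J : Fin (k + 1) → Fin n) : mulT h T J = h (fun _ => J 0) • T (Fin.tail J) := by
  rw [mulT]
  congr 2
  · funext i; fin_cases i; rfl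
  · funext i
    exact congrArg J (Fin.ext (by simp [blockEquiv]))

/-- The generator acts on the values, which is the coupling and contributes `c`, and on each of the
`k` slots, where it is a trace minus a transposition with the new index and contributes `-1`. The
total is `c - k`. -/
theorem IsTensorIdeal.gen_mem (hN : IsTensorIdeal ρ c N) {k : ℕ} (u : Fin n → ℝ)
    (T : (Fin k → Fin n) → V) :
    (fun J : Fin (k + 1) → Fin n => ∑ b, u b • (ρ.tensor k).gen (J 0) b T (Fin.tail J)) -
      (c - k) • mulT (fun K : Fin 1 → Fin n => u (K 0)) T ∈ N (k + 1) := by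
  set S : (Fin (k + 1) → Fin n) → V := mulT (fun K : Fin 1 → Fin n => u (K 0)) T with hS
  have hS1 : ∀ J, S J = u (J 0) • T (Fin.tail J) := mulT_one _ _
  have hG := hN.good (k + 1)
  have key : (fun J : Fin (k + 1) → Fin n =>
      ∑ b, u b • (ρ.tensor k).gen (J 0) b T (Fin.tail J)) = couple ρ 0 S +
      ∑ s : Fin k, (traceT 0 s.succ S - permT (Equiv.swap 0 s.succ) S) := by
    funext J
    simp only [ρ.tensor_gen, smul_add, Finset.sum_add_distrib, Pi.add_apply, Finset.sum_apply,
      Pi.sub_apply, couple_apply, hS1, Function.update_self, Fin.tail_update_zero]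
    congr 1
    · exact Finset.sum_congr rfl fun b _ => (LinearMap.map_smul_of_tower _ _ _).symm
    simp only [Finset.smul_sum]
    rw [Finset.sum_comm]
    refine Finset.sum_congr rfl fun s _ => ?_
    rw [Finset.sum_comm, traceT_apply, permT_apply, hS1]
    have hs : Fin.tail (J ∘ Equiv.swap 0 s.succ) = Function.update (Fin.tail J) s (J 0) := by
      funext t
      by_cases hts : t = s
      · subst hts; simp [Fin.tail]
      · rw [Function.update_of_ne hts, Fin.tail, Function.comp_apply,
          Equiv.swap_apply_of_ne_of_ne (Fin.succ_ne_zero t)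
            (fun h => hts (Fin.succ_injective _ h))]
        rfl
    have ht : ∀ d, S (Function.update (Function.update J 0 d) s.succ d) =
        u d • T (Function.update (Fin.tail J) s d) := by
      intro d
      rw [hS1, Fin.tail_update_succ, Fin.tail_update_zero,
        Function.update_of_ne (Fin.succ_ne_zero s).symm, Function.update_self]
    simp only [ht, hs, Function.comp_apply, Equiv.swap_apply_left]
    have h1 : ∀ d b, u b • ((if Fin.tail J s = J 0 then (1 : ℂ) else 0) * (if d = b then 1 else 0)
        - (if Fin.tail J s = b then 1 else 0) * (if d = J 0 then 1 else 0)) •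
        T (Function.update (Fin.tail J) s d) =
        (if d = b then (if J 0 = J s.succ then u b • T (Function.update (Fin.tail J) s d) else 0)
          else 0) - (if d = J 0 then (if J s.succ = b then
            u b • T (Function.update (Fin.tail J) s d) else 0) else 0) := by
      intro d b
      have hsym : (J 0 = J s.succ) = (J s.succ = J 0) := propext eq_comm
      simp only [show Fin.tail J s = J s.succ from rfl, hsym]
      split_ifs <;> simp
    simp only [h1, Finset.sum_sub_distrib, Finset.sum_ite_eq, Finset.mem_univ, if_true]
    congr 1
    · split_ifs
      · rfl
      · exact Finset.sum_const_zero
    · rw [Finset.sum_comm]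
      simp only [Finset.sum_ite_eq', Finset.sum_ite_eq, Finset.mem_univ, if_true]
  have e1 : (fun J : Fin (k + 1) → Fin n =>
      ∑ b, u b • (ρ.tensor k).gen (J 0) b T (Fin.tail J)) - (c - k) • S =
      (couple ρ 0 S - c • S) +
      ∑ s : Fin k, (traceT 0 s.succ S - (permT (Equiv.swap 0 s.succ) S - S)) := by
    rw [key]
    simp only [Finset.sum_sub_distrib, Finset.sum_const, Finset.card_univ, Fintype.card_fin, sub_smul,
      Nat.cast_smul_eq_nsmul]
    abel
  rw [e1]
  exact Submodule.add_mem _ (hG.couple 0 S) (Submodule.sum_mem _ fun s _ => Submodule.sub_mem _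
    (hG.trace 0 s.succ (Fin.succ_ne_zero s).symm S) (hG.perm _ S))

theorem IsRescaling.connMatrix_eq (h : IsRescaling g g' e e' U Ω) {x : M} (hx : x ∈ U)
    (a : Fin n) : (connMatrix g' e' x a).1 =
      (Ω x)⁻¹ • ((connMatrix g e x a).1 + ∑ b, logd e Ω b x • (wedge a b).1) := by
  ext c b
  change conn g' e' x a b c = _
  rw [h.conn_eq hx, Matrix.smul_apply, Matrix.add_apply, Matrix.sum_apply, smul_eq_mul]
  congr 2
  simp only [wedge_val, Matrix.smul_apply, Matrix.sub_apply, Matrix.single_apply, smul_eq_mul,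
    mul_sub, mul_ite, mul_one, mul_zero, Finset.sum_sub_distrib]
  congr 1
  · simp [ite_and]
  · simp [ite_and]

/-- The conformal variation of the covariant derivative, modulo the ideal. -/
theorem IsTensorIdeal.nab_rescaling (hN : IsTensorIdeal ρ c N) (h : IsRescaling g g' e e' U Ω)
    {k : ℕ} {T : M → (Fin k → Fin n) → V} (hT : IsSmoothFun n T U) (s : ℝ) {x : M} (hx : x ∈ U) :
    nab ρ.ext g' e' (fun y => Ω y ^ s • T y) x - Ω x ^ (s - 1) • (nab ρ.ext g e T x +
      (s + c - k) • mulT (logForm e Ω x) (T x)) ∈ N (k + 1) := by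
  have hpow : Ω x ^ (s - 1) = Ω x ^ s * (Ω x)⁻¹ := by
    rw [Real.rpow_sub (h.pos x hx), Real.rpow_one, div_eq_mul_inv]
  -- The derivative of `Ω^s` contributes `s` times the logarithmic derivative; the change of
  -- connection contributes the expression treated in `gen_mem`.
  have key : nab ρ.ext g' e' (fun y => Ω y ^ s • T y) x = Ω x ^ (s - 1) • (nab ρ.ext g e T x +
      s • mulT (logForm e Ω x) (T x) + fun J : Fin (k + 1) → Fin n =>
        ∑ b, logd e Ω b x • (ρ.tensor k).gen (J 0) b (T x) (Fin.tail J)) := by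
    have hc : ∀ a, cov (tens k ρ.ext) g' e' (fun y => Ω y ^ s • T y) a x = Ω x ^ (s - 1) •
        (cov (tens k ρ.ext) g e T a x + (s * logd e Ω a x) • T x +
          ∑ b, logd e Ω b x • (ρ.tensor k).gen a b (T x)) := by
      intro a
      rw [cov, h.dd_eq a hx, h.frame.dd_smul (h.isSmoothFun_rpow s) hT a hx, h.dd_rpow s a hx,
        h.connMatrix_eq hx, cov, hpow]
      simp only [map_smul, map_add, map_sum, smul_apply, add_apply, sum_apply,
        ContRep.gen_apply, ρ.infMap_tensor_ext]
      module
    funext J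
    rw [nab, hc]
    simp only [Pi.smul_apply, Pi.add_apply, Finset.sum_apply, mulT_one, logForm, mul_smul]
    rfl
  rw [key, ← smul_sub]
  refine (N (k + 1)).smul_of_tower_mem _ ?_
  have h2 := hN.gen_mem (fun b => logd e Ω b x) (T x)
  convert h2 using 1
  change _ = _ - (c - k) • mulT (logForm e Ω x) (T x)
  module

end Manifold

end TensorIdeals

/-! ### The operator identity behind conformal invariance -/

/-- An identity for operators `d`, `a`, `P` such that `b = [d, a]`, `a` and `P` commute. -/
theorem quartic_operator_identity {Q₀ Q₁ Q₂ Q₃ Q₄ : Type*} [AddCommGroup Q₀] [AddCommGroup Q₁]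
    [AddCommGroup Q₂] [AddCommGroup Q₃] [AddCommGroup Q₄] [Module ℝ Q₀] [Module ℝ Q₁] [Module ℝ Q₂]
    [Module ℝ Q₃] [Module ℝ Q₄]
    (d₀ a₀ : Q₀ →ₗ[ℝ] Q₁) (d₁ a₁ : Q₁ →ₗ[ℝ] Q₂) (d₂ a₂ : Q₂ →ₗ[ℝ] Q₃) (d₃ a₃ : Q₃ →ₗ[ℝ] Q₄)
    (b₀ P₀ : Q₀ →ₗ[ℝ] Q₂) (b₁ P₁ : Q₁ →ₗ[ℝ] Q₃) (b₂ P₂ : Q₂ →ₗ[ℝ] Q₄)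
    (p₀ : Q₀ →ₗ[ℝ] Q₃) (p₁ : Q₁ →ₗ[ℝ] Q₄) (q₀ : Q₀ →ₗ[ℝ] Q₄)
    (da₀ : ∀ x, d₁ (a₀ x) = a₁ (d₀ x) + b₀ x) (da₁ : ∀ x, d₂ (a₁ x) = a₂ (d₁ x) + b₁ x)
    (da₂ : ∀ x, d₃ (a₂ x) = a₃ (d₂ x) + b₂ x)
    (ba₀ : ∀ x, b₁ (a₀ x) = a₂ (b₀ x)) (ba₁ : ∀ x, b₂ (a₁ x) = a₃ (b₁ x))
    (Pa₀ : ∀ x, P₁ (a₀ x) = a₂ (P₀ x)) (Pa₁ : ∀ x, P₂ (a₁ x) = a₃ (P₁ x))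
    (bP : ∀ x, b₂ (P₀ x) = P₂ (b₀ x))
    (dP₀ : ∀ x, d₂ (P₀ x) = P₁ (d₀ x) + p₀ x) (dP₁ : ∀ x, d₃ (P₁ x) = P₂ (d₁ x) + p₁ x)
    (dp₀ : ∀ x, d₃ (p₀ x) = p₁ (d₀ x) + q₀ x) (f : Q₀) :
    (d₃ + (-3 : ℝ) • a₃) ((d₂ + (-1 : ℝ) • a₂) ((d₁ + (1 : ℝ) • a₁) ((d₀ + (3 : ℝ) • a₀) f)))
      + (3 : ℝ) • (P₂ - b₂ + a₃ ∘ₗ a₂) ((d₁ + (1 : ℝ) • a₁) ((d₀ + (3 : ℝ) • a₀) f))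
      + (4 : ℝ) • (d₃ + (-3 : ℝ) • a₃) ((P₁ - b₁ + a₂ ∘ₗ a₁) ((d₀ + (3 : ℝ) • a₀) f))
      + (3 : ℝ) • (d₃ + (-3 : ℝ) • a₃) ((d₂ + (-1 : ℝ) • a₂) ((P₀ - b₀ + a₁ ∘ₗ a₀) f))
      + (9 : ℝ) • (P₂ - b₂ + a₃ ∘ₗ a₂) ((P₀ - b₀ + a₁ ∘ₗ a₀) f) =
    d₃ (d₂ (d₁ (d₀ f))) + (10 : ℝ) • P₂ (d₁ (d₀ f)) + (10 : ℝ) • p₁ (d₀ f) + (3 : ℝ) • q₀ f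
      + (9 : ℝ) • P₂ (P₀ f) := by
  -- Names for the iterated commutators of `d` and `b`, so that every term can be brought to normal
  -- order with the derivatives on the right; what remains is a comparison of coefficients. The
  -- shifts `3, 1, -1, -3` and the coefficients `j (4 - j) = 3, 4, 3` and `9 = 3 · 3` are those for
  -- which all terms in `a` and `b` cancel, and by the Leibniz rule `10 = 3 + 4 + 3 = 4 + 2 · 3`.
  let c₀ : Q₀ →ₗ[ℝ] Q₃ := d₂ ∘ₗ b₀ - b₁ ∘ₗ d₀
  let c₁ : Q₁ →ₗ[ℝ] Q₄ := d₃ ∘ₗ b₁ - b₂ ∘ₗ d₁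
  let s₀ : Q₀ →ₗ[ℝ] Q₄ := d₃ ∘ₗ c₀ - c₁ ∘ₗ d₀
  have db₀ : ∀ x, d₂ (b₀ x) = b₁ (d₀ x) + c₀ x := fun x => by simp [c₀]
  have db₁ : ∀ x, d₃ (b₁ x) = b₂ (d₁ x) + c₁ x := fun x => by simp [c₁]
  have dc₀ : ∀ x, d₃ (c₀ x) = c₁ (d₀ x) + s₀ x := fun x => by simp [s₀]
  simp only [LinearMap.sub_apply, LinearMap.add_apply, LinearMap.smul_apply, LinearMap.comp_apply,
    map_add, map_sub, map_smul, da₀, da₁, da₂, ba₀, ba₁, Pa₀, Pa₁, bP, dP₀, dP₁, dp₀, db₀, db₁, dc₀]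
  module

/-! ### Commutativity of products and the Leibniz rule modulo the ideal -/

section Leibniz

variable {n : ℕ} {V : Type v} [NormedAddCommGroup V] [NormedSpace ℂ V] [FiniteDimensional ℂ V]
  {ρ : ContRep n V} {c : ℝ} {N : ∀ k, Submodule ℂ ((Fin k → Fin n) → V)}

theorem infMap_mulT {F : Type*} [NormedAddCommGroup F] [NormedSpace ℝ F] [FiniteDimensional ℝ F]
    {R : Mat n → F →L[ℝ] F} (hR : IsSmoothRep R) (X : so n) {m k : ℕ} (h : (Fin m → Fin n) → ℝ)
    (T : (Fin k → Fin n) → F) : infMap (tens (k + m) R) X.1 (mulT h T) =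
      mulT (infMap (tens m (triv n)) X.1 h) T + mulT h (infMap (tens k R) X.1 T) := by
  funext J
  have h1 := hasDerivAt_pi.1 (((hR.tens (k + m)).hasDerivAt_soExp X).clm_apply
    (hasDerivAt_const (0 : ℝ) (mulT h T))) J
  have h2 := hasDerivAt_pi.1 (((triv_isSmoothRep (n := n).tens m).hasDerivAt_soExp X).clm_apply
    (hasDerivAt_const (0 : ℝ) h)) (J ∘ blockEquiv m k ∘ Sum.inl)
  have h3 := hasDerivAt_pi.1 (((hR.tens k).hasDerivAt_soExp X).clm_apply
    (hasDerivAt_const (0 : ℝ) T)) (J ∘ blockEquiv m k ∘ Sum.inr)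
  simp only [map_zero, add_zero] at h1 h2 h3
  have h4 := h2.fun_smul h3
  refine h1.unique ((h4.congr_deriv ?_).congr_of_eventuallyEq (.of_forall fun t => ?_))
  · rw [zero_smul, soExp_zero, (triv_isSmoothRep (n := n).tens m).map_one, (hR.tens k).map_one,
      add_comm]
    rfl
  · simp only [tens_mulT]
    rfl

/-- Tensor products commute modulo the ideal. -/
theorem IsTensorIdeal.mulT_comm (hN : IsTensorIdeal ρ c N) {m m' k : ℕ} (h : (Fin m → Fin n) → ℝ)
    (h' : (Fin m' → Fin n) → ℝ) (T : (Fin k → Fin n) → V) :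
    mulT h (mulT h' T) - (fun J => mulT h' (mulT h T) (J ∘ finCongr (add_right_comm k m m'))) ∈
      N (k + m' + m) := by
  have key := hN.reindex (fun L : Fin m ⊕ (Fin m' ⊕ Fin k) → Fin n => h (L ∘ Sum.inl) •
    h' (L ∘ Sum.inr ∘ Sum.inl) • T (L ∘ Sum.inr ∘ Sum.inr))
    ((Equiv.sumCongr (Equiv.refl _) (blockEquiv m' k)).trans (blockEquiv m (k + m')))
    ((((Equiv.sumAssoc _ _ _).symm.trans ((Equiv.sumCongr (Equiv.sumComm _ _) (Equiv.refl _)).trans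
      (Equiv.sumAssoc _ _ _))).trans ((Equiv.sumCongr (Equiv.refl _) (blockEquiv m k)).trans
      (blockEquiv m' (k + m)))).trans (finCongr (add_right_comm k m m')))
  convert key using 1
  refine congrArg₂ _ rfl ?_
  funext J
  rw [mulT, mulT, smul_comm]
  rfl

variable {M : Type u} [TopologicalSpace M] [ChartedSpace (EuclideanSpace ℝ (Fin n)) M]
  [IsManifold (𝓡 n) ∞ M] {g : Metric n M} {e : Fin n → ∀ x : M, TangentSpace (𝓡 n) x}
  {U : Set M}

theorem IsFrame.dd_apply {F : Type*} [NormedAddCommGroup F] [NormedSpace ℝ F] {ι : Type*} [Fintype ι]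
    (he : IsFrame g e U) {T : M → ι → F} (hT : IsSmoothFun n T U) (a : Fin n) {x : M} (hx : x ∈ U)
    (i : ι) : dd e a T x i = dd e a (fun y => T y i) x :=
  (mvfderiv_pi (hT.mdifferentiableAt he.isOpen hx) _ i).symm

/-- The index equivalence for the second term of the Leibniz rule. -/
def leibnizEquiv (m k : ℕ) : Fin m ⊕ Fin (k + 1) ≃ Fin (k + m + 1) :=
  ((Equiv.sumCongr (Equiv.refl _) ((finSuccEquiv k).trans (Equiv.optionEquivSumPUnit.{0} _))).trans
    ((Equiv.sumAssoc _ _ _).symm.trans (Equiv.sumCongr (blockEquiv m k) (Equiv.refl _)))).trans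
    ((Equiv.optionEquivSumPUnit.{0} _).symm.trans (finSuccEquiv (k + m)).symm)

theorem leibnizEquiv_succ (m k : ℕ) (i : Fin k) :
    leibnizEquiv m k (Sum.inr i.succ) = (blockEquiv m k (Sum.inr i)).succ := by
  simp [leibnizEquiv]

/-- The Leibniz rule modulo the ideal. -/
theorem IsTensorIdeal.nab_mulT (hN : IsTensorIdeal ρ c N) (he : IsFrame g e U) {m k : ℕ}
    {h : M → (Fin m → Fin n) → ℝ} {T : M → (Fin k → Fin n) → V} (hh : IsSmoothFun n h U)
    (hT : IsSmoothFun n T U) {x : M} (hx : x ∈ U) :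
    nab ρ.ext g e (fun y => mulT (h y) (T y)) x - (mulT (m := m + 1) (nab (triv n) g e h x) (T x) +
      fun J => mulT (h x) (nab ρ.ext g e T x) (J ∘ finCongr (add_right_comm k 1 m))) ∈
      N (k + m + 1) := by
  have hfin : FiniteDimensional ℝ V := FiniteDimensional.complexToReal V
  -- In the second term of the Leibniz rule the derivative index stands in front of the indices of
  -- `h` instead of behind them; modulo the ideal the order is irrelevant.
  have key := hN.reindex (fun L : Fin m ⊕ Fin (k + 1) → Fin n => h x (L ∘ Sum.inl) •
    nab ρ.ext g e T x (L ∘ Sum.inr)) (leibnizEquiv m k)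
    ((blockEquiv m (k + 1)).trans (finCongr (add_right_comm k 1 m)))
  convert key using 1
  rw [← sub_sub]
  refine congrArg₂ _ ?_ rfl
  rw [sub_eq_iff_eq_add]
  funext J
  have hl : ∀ i, J (blockEquiv (m + 1) k (Sum.inl i)) =
      (Fin.cons (J 0) (Fin.tail J ∘ blockEquiv m k ∘ Sum.inl) : Fin (m + 1) → Fin n) i := by
    intro i
    refine Fin.cases rfl (fun i => ?_) i
    exact congrArg J (Fin.ext rfl)
  have hr : J ∘ blockEquiv (m + 1) k ∘ Sum.inr = Fin.tail J ∘ blockEquiv m k ∘ Sum.inr := by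
    funext i
    exact congrArg J (Fin.ext (by simp [blockEquiv]; omega))
  have hl' : J ∘ blockEquiv (m + 1) k ∘ Sum.inl =
      (Fin.cons (J 0) (Fin.tail J ∘ blockEquiv m k ∘ Sum.inl) : Fin (m + 1) → Fin n) := funext hl
  have hL : (J ∘ leibnizEquiv m k) ∘ Sum.inl = Fin.tail J ∘ blockEquiv m k ∘ Sum.inl := rfl
  have hR : (J ∘ leibnizEquiv m k) ∘ Sum.inr =
      (Fin.cons (J 0) (Fin.tail J ∘ blockEquiv m k ∘ Sum.inr) : Fin (k + 1) → Fin n) := by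
    funext i
    refine Fin.cases rfl (fun i => ?_) i
    simp [leibnizEquiv_succ, Fin.tail]
  have hm := isSmoothFun_mulT hh hT
  change _ = h x ((J ∘ leibnizEquiv m k) ∘ Sum.inl) • nab ρ.ext g e T x
    ((J ∘ leibnizEquiv m k) ∘ Sum.inr) + nab (triv n) g e h x (J ∘ blockEquiv (m + 1) k ∘ Sum.inl) •
      T x (J ∘ blockEquiv (m + 1) k ∘ Sum.inr)
  rw [hl', hr, hL, hR]
  simp only [nab, cov, Fin.cons_zero, Fin.tail_cons, Pi.add_apply, infMap_mulT ρ.isSmoothRep,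
    he.dd_apply hm _ hx, he.dd_apply hh _ hx, he.dd_apply hT _ hx]
  simp only [mulT]
  rw [he.dd_smul (isSmoothFun_pi.1 hh _) (isSmoothFun_pi.1 hT _) _ hx, smul_add, add_smul]
  abel

end Leibniz

/-! ### The fourth-order expression modulo an ideal -/

section Quotients

variable {n : ℕ} {V : Type v} [NormedAddCommGroup V] [NormedSpace ℂ V] [FiniteDimensional ℂ V]
  {ρ : ContRep n V} {c : ℝ} {N : ∀ k, Submodule ℂ ((Fin k → Fin n) → V)}
  {M : Type u} [TopologicalSpace M] [ChartedSpace (EuclideanSpace ℝ (Fin n)) M]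

theorem IsSmoothFun.const_smul {F : Type*} [NormedAddCommGroup F] [NormedSpace ℝ F] {f : M → F}
    {U : Set M} (hf : IsSmoothFun n f U) (a : ℝ) : IsSmoothFun n (fun x => a • f x) U :=
  hf.clm (a • ContinuousLinearMap.id ℝ F)

theorem IsSmoothFun.congr_on {F : Type*} [NormedAddCommGroup F] [NormedSpace ℝ F] {f f' : M → F}
    {U : Set M} (hf : IsSmoothFun n f U) (h : ∀ x ∈ U, f' x = f x) : IsSmoothFun n f' U :=
  ContMDiffOn.congr hf h

variable (V) in
/-- The smooth tensors on `U`. -/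
def smoothTensors (U : Set M) (k : ℕ) : Submodule ℝ (M → (Fin k → Fin n) → V) where
  carrier := {T | IsSmoothFun n T U}
  add_mem' hT hT' := ContMDiffOn.add hT hT'
  zero_mem' := contMDiffOn_const
  smul_mem' a _ hT := IsSmoothFun.const_smul hT a

omit [FiniteDimensional ℂ V] in
theorem smoothTensors_smooth {U : Set M} {k : ℕ} (T : smoothTensors (n := n) V U k) :
    IsSmoothFun n T.1 U := T.2

/-- The smooth tensors on `U` with values in an ideal. -/
def idealTensors (N : ∀ k, Submodule ℂ ((Fin k → Fin n) → V)) (U : Set M) (k : ℕ) :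
    Submodule ℝ (smoothTensors (n := n) V U k) where
  carrier := {T | ∀ x ∈ U, T.1 x ∈ N k}
  add_mem' hT hT' x hx := (N k).add_mem (hT x hx) (hT' x hx)
  zero_mem' _ _ := (N k).zero_mem
  smul_mem' a _ hT x hx := (N k).smul_of_tower_mem a (hT x hx)

variable [IsManifold (𝓡 n) ∞ M] {g g' : Metric n M} {e e' : Fin n → ∀ x : M, TangentSpace (𝓡 n) x}
  {U : Set M} {Ω : M → ℝ}

theorem IsFrame.nab_add (he : IsFrame g e U) {F : Type*} [NormedAddCommGroup F] [NormedSpace ℝ F]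
    {R : Mat n → F →L[ℝ] F} {k : ℕ} {T T' : M → (Fin k → Fin n) → F}
    (hT : IsSmoothFun n T U) (hT' : IsSmoothFun n T' U) {x : M} (hx : x ∈ U) :
    nab R g e (fun y => T y + T' y) x = nab R g e T x + nab R g e T' x := by
  funext J
  simp only [nab, he.cov_add hT hT' _ hx, Pi.add_apply]

theorem IsFrame.nab_smul (he : IsFrame g e U) {F : Type*} [NormedAddCommGroup F] [NormedSpace ℝ F]
    {R : Mat n → F →L[ℝ] F} {k : ℕ} {T : M → (Fin k → Fin n) → F}
    (hT : IsSmoothFun n T U) (a : ℝ) {x : M} (hx : x ∈ U) :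
    nab R g e (fun y => a • T y) x = a • nab R g e T x := by
  funext J
  simp only [nab, he.cov_smul (contMDiffOn_const (c := a)) hT _ hx, dd_const, zero_smul, add_zero,
    Pi.smul_apply]

/-- The covariant derivative as a linear map; off `U`, where it is of no interest, it is zero. -/
def nabL (ρ : ContRep n V) (he : IsFrame g e U) (k : ℕ) :
    smoothTensors (n := n) V U k →ₗ[ℝ] smoothTensors (n := n) V U (k + 1) where
  toFun T := ⟨U.indicator (nab ρ.ext g e T.1), IsSmoothFun.congr_on
    (he.isSmoothFun_nab (smoothTensors_smooth T)) fun _ hx => Set.indicator_of_mem hx _⟩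
  map_add' T T' := by
    refine Subtype.ext (funext fun x => ?_)
    change U.indicator (nab ρ.ext g e fun y => T.1 y + T'.1 y) x =
      U.indicator (nab ρ.ext g e T.1) x + U.indicator (nab ρ.ext g e T'.1) x
    by_cases hx : x ∈ U
    · simp only [Set.indicator_of_mem hx]
      exact he.nab_add (smoothTensors_smooth T) (smoothTensors_smooth T') hx
    · simp only [Set.indicator_of_notMem hx, add_zero]
  map_smul' a T := by
    refine Subtype.ext (funext fun x => ?_)
    change U.indicator (nab ρ.ext g e fun y => a • T.1 y) x = a • U.indicator (nab ρ.ext g e T.1) x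
    by_cases hx : x ∈ U
    · simp only [Set.indicator_of_mem hx]
      exact he.nab_smul (smoothTensors_smooth T) a hx
    · simp only [Set.indicator_of_notMem hx, smul_zero]

theorem nabL_apply (he : IsFrame g e U) {k : ℕ} (T : smoothTensors (n := n) V U k) {x : M}
    (hx : x ∈ U) : (nabL ρ he k T).1 x = nab ρ.ext g e T.1 x :=
  Set.indicator_of_mem hx _

omit [FiniteDimensional ℂ V] in
theorem mulT_add {m k : ℕ} (h : (Fin m → Fin n) → ℝ) (T T' : (Fin k → Fin n) → V) :
    mulT h (T + T') = mulT h T + mulT h T' :=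
  funext fun _ => smul_add _ _ _

omit [FiniteDimensional ℂ V] in
theorem mulT_smul {m k : ℕ} (h : (Fin m → Fin n) → ℝ) (a : ℝ) (T : (Fin k → Fin n) → V) :
    mulT h (a • T) = a • mulT h T :=
  funext fun _ => smul_comm _ _ _

variable (V) in
/-- Multiplication by a scalar-valued tensor as a linear map. -/
def mulL {m : ℕ} {h : M → (Fin m → Fin n) → ℝ} (hh : IsSmoothFun n h U) (k : ℕ) :
    smoothTensors (n := n) V U k →ₗ[ℝ] smoothTensors (n := n) V U (k + m) where
  toFun T := ⟨fun x => mulT (h x) (T.1 x), isSmoothFun_mulT hh (smoothTensors_smooth T)⟩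
  map_add' _ _ := Subtype.ext (funext fun _ => mulT_add _ _ _)
  map_smul' _ _ := Subtype.ext (funext fun _ => mulT_smul _ _ _)

/-- The covariant derivative on tensors modulo the ideal. -/
def nabQ (hN : IsTensorIdeal ρ c N) (he : IsFrame g e U) (k : ℕ) :
    smoothTensors V U k ⧸ idealTensors N U k →ₗ[ℝ]
      smoothTensors V U (k + 1) ⧸ idealTensors N U (k + 1) :=
  (idealTensors N U k).mapQ _ (nabL ρ he k) fun T hT x hx => by
    rw [nabL_apply he T hx]
    exact hN.nab_mem he (smoothTensors_smooth T) hT hx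

/-- Multiplication on tensors modulo the ideal. -/
def mulQ (hN : IsTensorIdeal ρ c N) {m : ℕ} {h : M → (Fin m → Fin n) → ℝ}
    (hh : IsSmoothFun n h U) (k : ℕ) :
    smoothTensors V U k ⧸ idealTensors N U k →ₗ[ℝ]
      smoothTensors V U (k + m) ⧸ idealTensors N U (k + m) :=
  (idealTensors N U k).mapQ _ (mulL V hh k) fun _ hT x hx => hN.mulT_mem (hT x hx) (h x)

/-- The covariant derivative, shifted by a multiple of a one-form. -/
def weylNab (ρ : ContRep n V) (g : Metric n M) (e : Fin n → ∀ x : M, TangentSpace (𝓡 n) x)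
    (Y : M → (Fin 1 → Fin n) → ℝ) (σ : ℝ) {k : ℕ} (T : M → (Fin k → Fin n) → V) (x : M) :
    (Fin (k + 1) → Fin n) → V :=
  nab ρ.ext g e T x + σ • mulT (Y x) (T x)

/-- Multiplication with the Schouten tensor, shifted by a one-form. -/
def weylSchouten (g : Metric n M) (e : Fin n → ∀ x : M, TangentSpace (𝓡 n) x)
    (Y : M → (Fin 1 → Fin n) → ℝ) {k : ℕ} (T : M → (Fin k → Fin n) → V) (x : M) :
    (Fin (k + 2) → Fin n) → V :=
  mulT (schouten g e x) (T x) - mulT (m := 2) (nab (triv n) g e Y x) (T x)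
    + mulT (m := 1) (k := k + 1) (Y x) (mulT (Y x) (T x))

/-- The quartic expression in the shifted operators. -/
def weylQuartic (ρ : ContRep n V) (g : Metric n M) (e : Fin n → ∀ x : M, TangentSpace (𝓡 n) x)
    (Y : M → (Fin 1 → Fin n) → ℝ) (f : M → (Fin 0 → Fin n) → V) (x : M) : (Fin 4 → Fin n) → V :=
  weylNab ρ g e Y (-3) (weylNab ρ g e Y (-1) (weylNab ρ g e Y 1 (weylNab ρ g e Y 3 f))) x
    + (3 : ℝ) • weylSchouten g e Y (weylNab ρ g e Y 1 (weylNab ρ g e Y 3 f)) x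
    + (4 : ℝ) • weylNab ρ g e Y (-3) (weylSchouten g e Y (weylNab ρ g e Y 3 f)) x
    + (3 : ℝ) • weylNab ρ g e Y (-3) (weylNab ρ g e Y (-1) (weylSchouten g e Y f)) x
    + (9 : ℝ) • weylSchouten g e Y (weylSchouten g e Y f) x

theorem IsFrame.isSmoothFun_weylNab (he : IsFrame g e U) {Y : M → (Fin 1 → Fin n) → ℝ}
    (hY : IsSmoothFun n Y U) (σ : ℝ) {k : ℕ} {T : M → (Fin k → Fin n) → V}
    (hT : IsSmoothFun n T U) : IsSmoothFun n (weylNab ρ g e Y σ T) U :=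
  ContMDiffOn.add (he.isSmoothFun_nab hT) ((isSmoothFun_mulT hY hT).const_smul σ)

omit [FiniteDimensional ℂ V] in
theorem IsFrame.isSmoothFun_weylSchouten (he : IsFrame g e U) {Y : M → (Fin 1 → Fin n) → ℝ}
    (hY : IsSmoothFun n Y U) {k : ℕ} {T : M → (Fin k → Fin n) → V}
    (hT : IsSmoothFun n T U) : IsSmoothFun n (weylSchouten g e Y T) U :=
  ContMDiffOn.add (ContMDiffOn.sub (isSmoothFun_mulT he.isSmoothFun_schouten hT)
    (isSmoothFun_mulT (m := 2) (he.isSmoothFun_nab hY) hT))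
    (isSmoothFun_mulT (m := 1) (k := k + 1) hY (isSmoothFun_mulT hY hT))

theorem nabL_mulL (hN : IsTensorIdeal ρ c N) (he : IsFrame g e U) {m k : ℕ}
    {h : M → (Fin m → Fin n) → ℝ} (hh : IsSmoothFun n h U)
    (T : smoothTensors V U k) {x : M} (hx : x ∈ U) :
    (nabL ρ he (k + m) (mulL V hh k T)).1 x - ((fun J =>
      mulT (h x) ((nabL ρ he k T).1 x) (J ∘ finCongr (add_right_comm k 1 m))) +
      mulT (m := m + 1) (nab (triv n) g e h x) (T.1 x)) ∈ N (k + m + 1) := by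
  rw [nabL_apply he _ hx, nabL_apply he _ hx]
  have key := hN.nab_mulT he hh (smoothTensors_smooth T) hx
  rw [add_comm (mulT (m := m + 1) (nab (triv n) g e h x) (T.1 x))] at key
  exact key

/-- Holds for an arbitrary one-form `Y`: on tensors modulo the ideal, multiplications commute and
the covariant derivative obeys an exact Leibniz rule, which are the hypotheses of
`quartic_operator_identity`. -/
theorem IsTensorIdeal.weylQuartic_sub_mem (hN : IsTensorIdeal ρ c N) (he : IsFrame g e U)
    {Y : M → (Fin 1 → Fin n) → ℝ} (hY : IsSmoothFun n Y U) {f : M → (Fin 0 → Fin n) → V}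
    (hf : IsSmoothFun n f U) {x : M} (hx : x ∈ U) :
    weylQuartic ρ g e Y f x - quartic ρ.ext g e f x ∈ N 4 := by
  have hP := he.isSmoothFun_schouten
  have hH := he.isSmoothFun_nab (R := triv n) hY
  have hP1 := he.isSmoothFun_nab (R := triv n) hP
  have hP2 := he.isSmoothFun_nab (R := triv n) hP1
  have leib : ∀ k (q : smoothTensors V U k ⧸ idealTensors N U k), nabQ hN he (k + 1)
      (mulQ hN hY k q) = mulQ hN hY (k + 1) (nabQ hN he k q) + mulQ (m := 2) hN hH k q := by
    intro k q
    obtain ⟨T, rfl⟩ := Submodule.mkQ_surjective _ q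
    exact (Submodule.Quotient.eq _).2 fun x hx => nabL_mulL hN he hY T hx
  have leib' : ∀ k (q : smoothTensors V U k ⧸ idealTensors N U k), nabQ hN he (k + 2)
      (mulQ hN hP k q) = mulQ hN hP (k + 1) (nabQ hN he k q) + mulQ (m := 3) hN hP1 k q := by
    intro k q
    obtain ⟨T, rfl⟩ := Submodule.mkQ_surjective _ q
    exact (Submodule.Quotient.eq _).2 fun x hx => nabL_mulL hN he hP T hx
  have leib'' : ∀ (q : smoothTensors V U 0 ⧸ idealTensors N U 0), nabQ hN he 3
      (mulQ (m := 3) hN hP1 0 q) = mulQ (m := 3) hN hP1 1 (nabQ hN he 0 q) +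
      mulQ (m := 4) hN hP2 0 q := by
    intro q
    obtain ⟨T, rfl⟩ := Submodule.mkQ_surjective _ q
    exact (Submodule.Quotient.eq _).2 fun x hx => nabL_mulL hN he (m := 3) hP1 T hx
  have comm : ∀ {h : M → (Fin 2 → Fin n) → ℝ} (hh : IsSmoothFun n h U) (k : ℕ)
      (q : smoothTensors V U k ⧸ idealTensors N U k),
      mulQ hN hh (k + 1) (mulQ hN hY k q) = mulQ hN hY (k + 2) (mulQ hN hh k q) := by
    intro h hh k q
    obtain ⟨T, rfl⟩ := Submodule.mkQ_surjective _ q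
    exact (Submodule.Quotient.eq _).2 fun x hx => hN.mulT_comm (h x) (Y x) (T.1 x)
  have comm' : ∀ (q : smoothTensors V U 0 ⧸ idealTensors N U 0),
      mulQ (m := 2) hN hH 2 (mulQ hN hP 0 q) = mulQ hN hP 2 (mulQ (m := 2) hN hH 0 q) := by
    intro q
    obtain ⟨T, rfl⟩ := Submodule.mkQ_surjective _ q
    exact (Submodule.Quotient.eq _).2 fun x hx =>
      hN.mulT_comm (m := 2) (k := 0) _ (schouten g e x) (T.1 x)
  -- Here `d` is the covariant derivative, `a`, `b` and `P` are multiplication by `Y`, by its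
  -- derivative and by the Schouten tensor, and `p`, `q` are multiplication by the derivatives of
  -- the Schouten tensor.
  have key := quartic_operator_identity (nabQ hN he 0) (mulQ hN hY 0) (nabQ hN he 1) (mulQ hN hY 1)
    (nabQ hN he 2) (mulQ hN hY 2) (nabQ hN he 3) (mulQ hN hY 3)
    (mulQ (m := 2) hN hH 0) (mulQ hN hP 0) (mulQ (m := 2) hN hH 1) (mulQ hN hP 1)
    (mulQ (m := 2) hN hH 2) (mulQ hN hP 2) (mulQ (m := 3) hN hP1 0) (mulQ (m := 3) hN hP1 1)
    (mulQ (m := 4) hN hP2 0) (leib 0) (leib 1) (leib 2) (comm hH 0) (comm hH 1) (comm hP 0)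
    (comm hP 1) comm' (leib' 0) (leib' 1) leib'' (Submodule.Quotient.mk ⟨f, hf⟩)
  -- The linear maps are cut off outside `U`, so they are matched with the unrestricted expressions
  -- on `U` only.
  have hE : ∀ {k} (T : smoothTensors V U k) (T' : M → (Fin k → Fin n) → V),
      (∀ y ∈ U, T.1 y = T' y) → ∀ y ∈ U, (nabL ρ he k T).1 y = nab ρ.ext g e T' y := by
    intro k T T' h y hy
    rw [nabL_apply he T hy, he.nab_congr h hy]
  have hD : ∀ (σ : ℝ) {k} (T : smoothTensors V U k) (T' : M → (Fin k → Fin n) → V),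
      (∀ y ∈ U, T.1 y = T' y) → ∀ y ∈ U,
      ((nabL ρ he k + σ • mulL V hY k) T).1 y = weylNab ρ g e Y σ T' y := by
    intro σ k T T' h y hy
    change (nabL ρ he k T).1 y + σ • mulT (Y y) (T.1 y) = _
    rw [hE T T' h y hy, h y hy, weylNab]
  have hS : ∀ {k} (T : smoothTensors V U k) (T' : M → (Fin k → Fin n) → V),
      (∀ y ∈ U, T.1 y = T' y) → ∀ y ∈ U,
      ((mulL V hP k - mulL (m := 2) V hH k + mulL V hY (k + 1) ∘ₗ mulL V hY k :
        _ →ₗ[ℝ] smoothTensors V U (k + 2)) T).1 y = weylSchouten g e Y T' y := by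
    intro k T T' h y hy
    change mulT (schouten g e y) (T.1 y) - mulT (m := 2) (nab (triv n) g e Y y) (T.1 y) +
      mulT (m := 1) (k := k + 1) (Y y) (mulT (Y y) (T.1 y)) = _
    rw [h y hy, weylSchouten]
  let F : smoothTensors V U 0 := ⟨f, hf⟩
  have hF : ∀ y ∈ U, F.1 y = f y := fun _ _ => rfl
  have h1 := (Submodule.Quotient.eq _).1 key x hx
  have d1 := hE F f hF
  have d2 := hE _ _ d1
  have d3 := hE _ _ d2
  have d4 := hE _ _ d3 x hx
  have w1 := hD 3 F f hF
  have w2 := hD 1 _ _ w1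
  have w3 := hD (-1) _ _ w2
  have w4 := hD (-3) _ _ w3 x hx
  have s1 := hS _ _ w2 x hx
  have s2 := hD (-3) _ _ (hS _ _ w1) x hx
  have s3 := hS F f hF
  have s4 := hD (-3) _ _ (hD (-1) _ _ s3) x hx
  have s5 := hS _ _ s3 x hx
  rw [weylQuartic, ← w4, ← s1, ← s2, ← s4, ← s5, quartic, ← d4, ← d2 x hx, ← d1 x hx]
  exact h1

end Quotients

/-! ### Conformal covariance of the fourth-order expression -/

section Invariance

variable {n : ℕ} {V : Type v} [NormedAddCommGroup V] [NormedSpace ℂ V] [FiniteDimensional ℂ V]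
  {ρ : ContRep n V} {c : ℝ} {N : ∀ k, Submodule ℂ ((Fin k → Fin n) → V)}
  {M : Type u} [TopologicalSpace M] [ChartedSpace (EuclideanSpace ℝ (Fin n)) M]

/-- The tensors `T'` and `Ω ^ s T` are smooth and agree modulo the ideal. -/
structure IsRescaledTo (N : ∀ k, Submodule ℂ ((Fin k → Fin n) → V)) (U : Set M) (Ω : M → ℝ)
    (s : ℝ) {k : ℕ} (T' T : M → (Fin k → Fin n) → V) : Prop where
  smooth' : IsSmoothFun n T' U
  smooth : IsSmoothFun n T U
  sub_mem : ∀ x ∈ U, T' x - Ω x ^ s • T x ∈ N k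

variable [IsManifold (𝓡 n) ∞ M] {g g' : Metric n M} {e e' : Fin n → ∀ x : M, TangentSpace (𝓡 n) x}
  {U : Set M} {Ω : M → ℝ}

theorem IsRescaling.isSmoothFun_logForm (h : IsRescaling g g' e e' U Ω) :
    IsSmoothFun n (logForm e Ω) U :=
  isSmoothFun_pi.2 fun K => h.isSmoothFun_logd (K 0)

omit [FiniteDimensional ℂ V] [TopologicalSpace M] [ChartedSpace (EuclideanSpace ℝ (Fin n)) M]
  [IsManifold (𝓡 n) ∞ M] in
theorem zero_mulT {m k : ℕ} (T : (Fin k → Fin n) → V) :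
    mulT (0 : (Fin m → Fin n) → ℝ) T = 0 := by
  funext J
  simp [mulT]

theorem nab_zero {F : Type*} [NormedAddCommGroup F] [NormedSpace ℝ F] {R : Mat n → F →L[ℝ] F}
    {k : ℕ} (x : M) : nab R g e (0 : M → (Fin k → Fin n) → F) x = 0 := by
  funext J
  have : (0 : M → (Fin k → Fin n) → F) = fun _ => 0 := rfl
  simp [nab, cov, this, dd_const, infMap]

theorem weylNab_zero (σ : ℝ) {k : ℕ} (T : M → (Fin k → Fin n) → V) (x : M) :
    weylNab ρ g e 0 σ T x = nab ρ.ext g e T x := by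
  rw [weylNab, Pi.zero_apply, zero_mulT, smul_zero, add_zero]

omit [FiniteDimensional ℂ V] in
theorem weylSchouten_zero {k : ℕ} (T : M → (Fin k → Fin n) → V) (x : M) :
    weylSchouten g e 0 T x = mulT (schouten g e x) (T x) := by
  rw [weylSchouten, nab_zero, Pi.zero_apply, zero_mulT, zero_mulT, sub_zero, add_zero]

/-- The error term stays in the ideal because `nab` preserves it. Each derivative lowers the weight
`s` by one and raises the degree `k` by one, so the shift `s + c - k` drops by two. -/
theorem IsRescaledTo.weylNab (hN : IsTensorIdeal ρ c N) (h : IsRescaling g g' e e' U Ω) {s : ℝ}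
    {k : ℕ} {T' T : M → (Fin k → Fin n) → V} (hT : IsRescaledTo N U Ω s T' T) (σ : ℝ)
    {s' : ℝ} (hs : s' = s - 1) (hσ : σ = s + c - k) :
    IsRescaledTo N U Ω s' (weylNab ρ g' e' 0 σ T') (weylNab ρ g e (logForm e Ω) σ T) where
  smooth' := h.frame'.isSmoothFun_weylNab contMDiffOn_const σ hT.smooth'
  smooth := h.frame.isSmoothFun_weylNab h.isSmoothFun_logForm σ hT.smooth
  sub_mem x hx := by
    subst hs hσ
    have hfin : FiniteDimensional ℝ V := FiniteDimensional.complexToReal V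
    have hr : IsSmoothFun n (fun y => Ω y ^ s • T y) U :=
      ContMDiffOn.smul (h.isSmoothFun_rpow s) hT.smooth
    have h1 := hN.nab_mem h.frame' (ContMDiffOn.sub hT.smooth' hr) hT.sub_mem hx
    have h2 : nab ρ.ext g' e' T' x = nab ρ.ext g' e' (fun y => T' y - Ω y ^ s • T y) x +
        nab ρ.ext g' e' (fun y => Ω y ^ s • T y) x := by
      rw [← h.frame'.nab_add (ContMDiffOn.sub hT.smooth' hr) hr hx]
      simp
    rw [weylNab_zero, h2, add_sub_assoc]
    exact (N (k + 1)).add_mem h1 (hN.nab_rescaling h hT.smooth s hx)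

/-- The change of the Schouten tensor is `-∇Y + Y Y` up to a multiple of the metric, and the metric
vanishes modulo the ideal. Weight and degree change by two each. -/
theorem IsRescaledTo.weylSchouten (hn : 3 ≤ n) (hN : IsTensorIdeal ρ c N)
    (h : IsRescaling g g' e e' U Ω) {s : ℝ}
    {k : ℕ} {T' T : M → (Fin k → Fin n) → V} (hT : IsRescaledTo N U Ω s T' T)
    {s' : ℝ} (hs : s' = s - 2) :
    IsRescaledTo N U Ω s' (weylSchouten g' e' 0 T') (weylSchouten g e (logForm e Ω) T) where
  smooth' := h.frame'.isSmoothFun_weylSchouten contMDiffOn_const hT.smooth'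
  smooth := h.frame.isSmoothFun_weylSchouten h.isSmoothFun_logForm hT.smooth
  sub_mem x hx := by
    subst hs
    have hpow : Ω x ^ (s - 2) = (Ω x)⁻¹ * (Ω x)⁻¹ * Ω x ^ s := by
      rw [Real.rpow_sub (h.pos x hx), Real.rpow_two, div_eq_mul_inv, sq, mul_inv, mul_comm]
    have h1 := hN.mulT_mem (hT.sub_mem x hx) (schouten g' e' x)
    -- The trace part `-|Y|²/2 g` of the conformal change.
    have h2 := (N (k + 2)).smul_of_tower_mem (-(Ω x ^ (s - 2) * ((∑ a, logd e Ω a x *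
      logd e Ω a x) / 2))) (hN.metric_mem (T x))
    rw [weylSchouten_zero]
    convert (N (k + 2)).add_mem h1 h2 using 1
    have hnab : ∀ J, nab (triv n) g e (logForm e Ω) x J = dd e (J 0) (logd e Ω (J 1)) x -
        ∑ d, conn g e x (J 0) (J 1) d * logd e Ω d x :=
      fun J => h.frame.nab_one (fun c => h.isSmoothFun_logd c) hx J
    have hcorr : ∀ J : Fin 2 → Fin n, schouten g' e' x J = (Ω x)⁻¹ * (Ω x)⁻¹ *
        (schouten g e x J - nab (triv n) g e (logForm e Ω) x J + logd e Ω (J 0) x *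
        logd e Ω (J 1) x - (∑ a, logd e Ω a x * logd e Ω a x) / 2 *
        (if J 0 = J 1 then 1 else 0)) := by
      intro J
      rw [h.schouten_eq hn hx, hnab, schoutenCorr]
      ring
    have hYY : mulT (m := 1) (k := k + 1) (logForm e Ω x) (mulT (logForm e Ω x) (T x)) =
        mulT (fun J : Fin 2 → Fin n => logd e Ω (J 0) x * logd e Ω (J 1) x) (T x) := by
      funext J
      rw [mulT_one (k := k + 1), mulT_one, smul_smul, mulT]
      refine congrArg₂ _ rfl (congrArg _ (funext fun i => congrArg J (Fin.ext ?_)))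
      simp [blockEquiv]
    rw [ConformalOp.weylSchouten, hYY]
    funext J
    simp only [mulT, Pi.sub_apply, Pi.add_apply, Pi.smul_apply, hcorr, hpow, smul_sub, smul_add]
    module

/-- The quartic expression is conformally covariant modulo the ideal. -/
theorem IsTensorIdeal.quartic_rescaling (hn : 3 ≤ n) (hN : IsTensorIdeal ρ c N)
    (h : IsRescaling g g' e e' U Ω) {w : ℝ} (hw : w + c = 3) {f : M → (Fin 0 → Fin n) → V}
    (hf : IsSmoothFun n f U) {x : M} (hx : x ∈ U) :
    quartic ρ.ext g' e' (fun y => Ω y ^ w • f y) x - Ω x ^ (w - 4) • quartic ρ.ext g e f x ∈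
      N 4 := by
  have hfin : FiniteDimensional ℝ V := FiniteDimensional.complexToReal V
  have hf' : IsSmoothFun n (fun y => Ω y ^ w • f y) U :=
    ContMDiffOn.smul (h.isSmoothFun_rpow w) hf
  have r0 : IsRescaledTo N U Ω w (fun y => Ω y ^ w • f y) f :=
    ⟨hf', hf, fun y _ => by rw [sub_self]; exact Submodule.zero_mem _⟩
  -- The shift starts at `w + c = 3`, drops by two with each derivative and by four with each
  -- Schouten factor; so every arrangement of factors meets the same sequence `3, 1, -1, -3`.
  have r1 := r0.weylNab hN h 3 (s' := w - 1) rfl (by push_cast; linarith)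
  have r2 := r1.weylNab hN h 1 (s' := w - 2) (by ring) (by push_cast; linarith)
  have r3 := r2.weylNab hN h (-1) (s' := w - 3) (by ring) (by push_cast; linarith)
  have t1 := (r3.weylNab hN h (-3) (s' := w - 4) (by ring) (by push_cast; linarith)).sub_mem x hx
  have t2 := (r2.weylSchouten hn hN h (s' := w - 4) (by ring)).sub_mem x hx
  have t3 := ((r1.weylSchouten hn hN h (s' := w - 3) (by ring)).weylNab hN h (-3) (s' := w - 4)
    (by ring) (by push_cast; linarith)).sub_mem x hx
  have q0 := r0.weylSchouten hn hN h (s' := w - 2) rfl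
  have t4 := ((q0.weylNab hN h (-1) (s' := w - 3)
    (by ring) (by push_cast; linarith)).weylNab hN h (-3) (s' := w - 4)
    (by ring) (by push_cast; linarith)).sub_mem x hx
  have t5 := (q0.weylSchouten hn hN h (s' := w - 4) (by ring)).sub_mem x hx
  -- The unshifted quartic for `g'` corresponds to `Y = 0`, the shifted one for `g` to `Y = d log
  -- Ω`; modulo the ideal both equal the plain quartics of their metrics.
  have a1 := hN.weylQuartic_sub_mem h.frame' (Y := 0) contMDiffOn_const hf' hx
  have a2 := hN.weylQuartic_sub_mem h.frame h.isSmoothFun_logForm hf hx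
  have key := (N 4).add_mem ((N 4).add_mem ((N 4).add_mem ((N 4).add_mem t1
    ((N 4).smul_of_tower_mem (3 : ℝ) t2)) ((N 4).smul_of_tower_mem (4 : ℝ) t3))
    ((N 4).smul_of_tower_mem (3 : ℝ) t4)) ((N 4).smul_of_tower_mem (9 : ℝ) t5)
  have b := (N 4).sub_mem ((N 4).add_mem key ((N 4).smul_of_tower_mem (Ω x ^ (w - 4)) a2)) a1
  convert b using 1
  simp only [weylQuartic]
  module

end Invariance

/-! ### Oriented orthonormal frames -/

section Frames

variable {n : ℕ} {M : Type u} [TopologicalSpace M] [ChartedSpace (EuclideanSpace ℝ (Fin n)) M]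

theorem IsPositiveBasis.change {x : M} {o : Orientation ℝ (TangentSpace (𝓡 n) x) (Fin n)}
    {u u' : Fin n → TangentSpace (𝓡 n) x} (hu : IsPositiveBasis o u)
    {A : Matrix (Fin n) (Fin n) ℝ} (hA : 0 < A.det) (h : ∀ j, u' j = ∑ i, A i j • u i) :
    IsPositiveBasis o u' := by
  obtain ⟨b, hb, rfl⟩ := hu
  have hfin : FiniteDimensional ℝ (TangentSpace (𝓡 n) x) :=
    inferInstanceAs (FiniteDimensional ℝ (EuclideanSpace ℝ (Fin n)))
  have hdet : LinearMap.det (Matrix.toLin b b A) = A.det := LinearMap.det_toLin b A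
  let F : TangentSpace (𝓡 n) x ≃ₗ[ℝ] TangentSpace (𝓡 n) x :=
    LinearMap.equivOfDetNeZero (Matrix.toLin b b A) (by rw [hdet]; exact hA.ne')
  refine ⟨b.map F, fun j => ?_, (b.orientation_comp_linearEquiv_eq_iff_det_pos F).2 ?_⟩
  · rw [Module.Basis.map_apply, h]
    simp only [← hb]
    exact Matrix.toLin_self b b A j
  · exact hA.trans_eq hdet.symm

theorem IsPositiveBasis.det_pos {x : M} {o : Orientation ℝ (TangentSpace (𝓡 n) x) (Fin n)}
    {u u' : Fin n → TangentSpace (𝓡 n) x} (hu : IsPositiveBasis o u) (hu' : IsPositiveBasis o u')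
    {A : Matrix (Fin n) (Fin n) ℝ} (h : ∀ j, u' j = ∑ i, A i j • u i) : 0 < A.det := by
  obtain ⟨b, hb, hbo⟩ := hu
  obtain ⟨b', hb', hbo'⟩ := hu'
  have h1 := (b.orientation_eq_iff_det_pos b').1 (hbo.trans hbo'.symm)
  have h2 : b.toMatrix b' = A := by
    ext i j
    rw [Module.Basis.toMatrix_apply, hb', h]
    simp only [← hb, map_sum, map_smul, Module.Basis.repr_self, Finsupp.coe_finsetSum,
      Finset.sum_apply, Finsupp.smul_apply, Finsupp.single_apply, smul_eq_mul, mul_ite, mul_one,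
      mul_zero, Finset.sum_ite_eq', Finset.mem_univ, if_true]
  rwa [Module.Basis.det_apply, h2] at h1

variable [IsManifold (𝓡 n) ∞ M] {g g₀ g' : Metric n M} {o : ManifoldOrientation n M} {U : Set M}

/-- One step of the Gram–Schmidt process. -/
theorem exists_orthonormalize_step {f : Fin n → ∀ x : M, TangentSpace (𝓡 n) x}
    (hf : IsSmoothOn f U) (hb : ∀ y ∈ U, IsPositiveBasis (o.orient y) (fun i => f i y))
    (k : Fin n) (hk : ∀ y ∈ U, ∀ i < k, ∀ j, g.inner y (f i y) (f j y) = if i = j then 1 else 0) :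
    ∃ f' : Fin n → ∀ x : M, TangentSpace (𝓡 n) x, IsSmoothOn f' U ∧
      (∀ y ∈ U, IsPositiveBasis (o.orient y) (fun i => f' i y)) ∧
      ∀ y ∈ U, ∀ i ≤ k, ∀ j, g.inner y (f' i y) (f' j y) = if i = j then 1 else 0 := by
  have hpos : ∀ y ∈ U, 0 < g.inner y (f k y) (f k y) := by
    intro y hy
    obtain ⟨b, hb, -⟩ := hb y hy
    exact g.pos y _ fun h0 => b.ne_zero k ((hb k).trans h0)
  let q : M → ℝ := fun y => g.inner y (f k y) (f k y)
  -- The `k`-th vector is normalised, and its component is removed from all other vectors at once.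
  -- Thus finished vectors are orthogonal to the whole frame and are left unchanged by later steps.
  let r : Fin n → M → ℝ := fun j y =>
    if j = k then q y ^ (-(1 / 2) : ℝ) else -(g.inner y (f k y) (f j y)) * q y ^ (-1 : ℝ)
  have hq : IsSmoothFun n q U := g.isSmoothFun_inner (hf k) (hf k)
  have hr : ∀ j, IsSmoothFun n (r j) U := by
    intro j
    by_cases h : j = k
    · simp only [r, h, if_true]
      exact isSmoothFun_rpow hq hpos _
    · simp only [r, h, if_false]
      exact (g.isSmoothFun_inner (hf k) (hf j)).neg.mul (isSmoothFun_rpow hq hpos _)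
  have hrk : ∀ y ∈ U, 0 < r k y := fun y hy => by
    simp only [r, if_true]; exact Real.rpow_pos_of_pos (hpos y hy) _
  have hrk2 : ∀ y ∈ U, r k y * r k y * q y = 1 := fun y hy => by
    simp only [r, if_true]
    rw [← Real.rpow_add (hpos y hy), ← Real.rpow_add_one (hpos y hy).ne']
    norm_num
  have hrj : ∀ y ∈ U, ∀ j, j ≠ k → r j y * q y = -(g.inner y (f k y) (f j y)) := fun y hy j hj => by
    simp only [r, hj, if_false]
    rw [mul_assoc, ← Real.rpow_add_one (hpos y hy).ne']
    norm_num
  have hr0 : ∀ y ∈ U, ∀ j < k, r j y = 0 := fun y hy j hj => by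
    simp only [r, hj.ne, if_false]
    rw [g.symm, hk y hy j hj k, if_neg hj.ne, neg_zero, zero_mul]
  let f' : Fin n → ∀ x : M, TangentSpace (𝓡 n) x := fun j y =>
    (if j = k then (0 : ℝ) else 1) • f j y + r j y • f k y
  refine ⟨f', fun j => IsSmoothField.add (IsSmoothField.smul contMDiffOn_const (hf j))
    (IsSmoothField.smul (hr j) (hf k)), fun y hy => ?_, fun y hy i hi j => ?_⟩
  · refine (hb y hy).change (A := (1 : Matrix (Fin n) (Fin n) ℝ).updateRow k fun j => r j y) ?_
      fun j => ?_
    · have h := LinearMap.congr_fun (Matrix.cramer_one (n := Fin n) (α := ℝ)) (fun j => r j y)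
      have h2 := congrFun h k
      rw [Matrix.cramer_apply] at h2
      have h3 := Matrix.det_transpose ((1 : Matrix (Fin n) (Fin n) ℝ).updateRow k fun j => r j y)
      rw [← Matrix.updateCol_transpose, Matrix.transpose_one, h2] at h3
      rw [← h3]
      exact hrk y hy
    · rw [← Finset.add_sum_erase _ _ (Finset.mem_univ k), Matrix.updateRow_self, add_comm]
      refine congrArg (fun v => v + r j y • f k y) ?_
      by_cases h : j = k
      · subst h
        rw [if_pos rfl, zero_smul, eq_comm]
        refine Finset.sum_eq_zero fun i hi => ?_
        rw [Matrix.updateRow_ne (Finset.ne_of_mem_erase hi), Matrix.one_apply_ne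
          (Finset.ne_of_mem_erase hi), zero_smul]
      · rw [if_neg h, one_smul, Finset.sum_eq_single_of_mem j
          (Finset.mem_erase.2 ⟨h, Finset.mem_univ j⟩), Matrix.updateRow_ne h, Matrix.one_apply_eq,
          one_smul]
        intro i hi hij
        rw [Matrix.updateRow_ne (Finset.ne_of_mem_erase hi), Matrix.one_apply_ne hij, zero_smul]
  · have expand : g.inner y (f' i y) (f' j y) =
        (if i = k then 0 else 1) * (if j = k then 0 else 1) * g.inner y (f i y) (f j y) +
        (if i = k then 0 else 1) * r j y * g.inner y (f i y) (f k y) +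
        r i y * (if j = k then 0 else 1) * g.inner y (f k y) (f j y) + r i y * r j y * q y := by
      simp only [f', map_add, map_smul, add_apply, smul_apply, smul_eq_mul]
      ring
    rw [expand]
    rcases hi.lt_or_eq with h | h
    · rw [hr0 y hy i h, if_neg h.ne, hk y hy i h k, if_neg h.ne, hk y hy i h j]
      by_cases hj : j = k
      · subst hj; simp [h.ne]
      · simp [hj]
    · subst h
      by_cases hj : j = i
      · subst hj
        simp [hrk2 y hy]
      · have := hrj y hy j hj
        have h2 : r i y * r j y * q y = r i y * (r j y * q y) := by ring
        rw [h2, this]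
        simp [hj, Ne.symm hj]

theorem exists_orthoFrame (g : Metric n M) (o : ManifoldOrientation n M) (x : M) :
    ∃ (U : Set M) (e : Fin n → ∀ x : M, TangentSpace (𝓡 n) x), IsOpen U ∧ x ∈ U ∧
      IsOrthoFrameOn g o e U := by
  obtain ⟨U, hU, hx, e, he, hb⟩ := o.exists_frame x
  have key : ∀ k ≤ n, ∃ f : Fin n → ∀ x : M, TangentSpace (𝓡 n) x, IsSmoothOn f U ∧
      (∀ y ∈ U, IsPositiveBasis (o.orient y) (fun i => f i y)) ∧
      ∀ y ∈ U, ∀ i : Fin n, i.1 < k → ∀ j,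
        g.inner y (f i y) (f j y) = if i = j then 1 else 0 := by
    intro k
    induction k with
    | zero => exact fun _ => ⟨e, he, hb, fun _ _ _ h => absurd h (Nat.not_lt_zero _)⟩
    | succ k ih =>
      intro hk
      obtain ⟨f, h1, h2, h3⟩ := ih (Nat.le_of_succ_le hk)
      obtain ⟨f', h1', h2', h3'⟩ := exists_orthonormalize_step (g := g) h1 h2 ⟨k, hk⟩
        fun y hy i hi => h3 y hy i hi
      exact ⟨f', h1', h2', fun y hy i hi => h3' y hy i (Nat.le_of_lt_succ hi)⟩
  obtain ⟨f, h1, h2, h3⟩ := key n le_rfl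
  exact ⟨U, f, hU, hx, h1, fun y hy => ⟨h2 y hy, fun i => h3 y hy i i.2⟩⟩

theorem IsOrthoFrameOn.isFrame {e : Fin n → ∀ x : M, TangentSpace (𝓡 n) x}
    (h : IsOrthoFrameOn g o e U) (hU : IsOpen U) : IsFrame g e U :=
  ⟨hU, h.1, fun x hx => (h.2 x hx).2⟩

theorem IsOrthoFrameOn.isConfFrame {e : Fin n → ∀ x : M, TangentSpace (𝓡 n) x}
    (h : IsOrthoFrameOn g o e U) (hg : IsConformalTo g₀ g) {x : M} (hx : x ∈ U) :
    IsConfFrame g₀ o x (fun i => e i x) := by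
  obtain ⟨Ω, -, hΩ, hm⟩ := hg
  refine ⟨(h.2 x hx).1, (Ω x)⁻¹, inv_pos.2 (hΩ x), fun i j => ?_⟩
  have h1 := hm x (e i x) (e j x)
  rw [(h.2 x hx).2 i j] at h1
  have h2 := (hΩ x).ne'
  by_cases hij : i = j
  · rw [if_pos hij] at h1 ⊢
    field_simp
    rw [mul_comm]; exact h1.symm
  · rw [if_neg hij] at h1 ⊢
    exact (mul_eq_zero.1 h1.symm).resolve_left (pow_ne_zero 2 h2)

/-- The transition matrix from an orthonormal frame to a frame that is orthonormal up to scale. -/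
theorem exists_transition {x : M} {u u' : Fin n → TangentSpace (𝓡 n) x}
    (hu : IsPositiveBasis (o.orient x) u) (hu' : IsPositiveBasis (o.orient x) u')
    (h : ∀ i j, g.inner x (u i) (u j) = if i = j then 1 else 0) {r : ℝ} (hr : 0 < r)
    (h' : ∀ i j, g.inner x (u' i) (u' j) = if i = j then r ^ 2 else 0) :
    ∃ A : SO n, (∀ i j, ent A.1 i j = r⁻¹ * g.inner x (u' j) (u i)) ∧
      ∀ j, u' j = r • ∑ i, A.1 i j • u i := by
  let B : Matrix (Fin n) (Fin n) ℝ := Matrix.of fun i j => r⁻¹ * g.inner x (u' j) (u i)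
  have hB : ∀ j, u' j = r • ∑ i, B i j • u i := by
    intro j
    have h1 : ∀ i, r • B i j • u i = g.inner x (u' j) (u i) • u i := fun i => by
      rw [smul_smul]
      exact congrArg (· • u i) (mul_inv_cancel_left₀ hr.ne' (g.inner x (u' j) (u i)))
    rw [Finset.smul_sum, Finset.sum_congr rfl fun i _ => h1 i]
    exact orthonormal_expand g h (u' j)
  have hdet : 0 < (r • B).det := hu.det_pos hu' fun j => by
    rw [hB, Finset.smul_sum]
    exact Finset.sum_congr rfl fun i _ => by rw [smul_smul]; rfl
  have hdet' : 0 < B.det := by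
    rw [Matrix.det_smul] at hdet
    exact (mul_pos_iff_of_pos_left (pow_pos hr _)).1 hdet
  have hBB : B.transpose * B = 1 := by
    ext i j
    have h1 := h' i j
    rw [hB i, hB j] at h1
    simp only [map_smul, map_sum, smul_apply, sum_apply, h, smul_eq_mul, mul_ite, mul_one,
      mul_zero, Finset.sum_ite_eq', Finset.mem_univ, if_true] at h1
    rw [Matrix.mul_apply, Matrix.one_apply]
    simp only [Matrix.transpose_apply]
    have h2 : r ^ 2 * ∑ k, B k i * B k j = r ^ 2 * if i = j then 1 else 0 := by
      rw [mul_ite, mul_one, mul_zero, ← h1, Finset.mul_sum, Finset.mul_sum]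
      exact Finset.sum_congr rfl fun k _ => by ring
    exact mul_left_cancel₀ (pow_ne_zero 2 hr.ne') h2
  have hdet1 : B.det = 1 := by
    have h1 := congrArg Matrix.det hBB
    rw [Matrix.det_mul, Matrix.det_transpose, Matrix.det_one] at h1
    nlinarith
  refine ⟨⟨B, Matrix.mem_specialOrthogonalGroup_iff.2
    ⟨(Matrix.mem_orthogonalGroup_iff' _ _).2 hBB, hdet1⟩⟩, fun i j => rfl, hB⟩

omit [IsManifold (𝓡 n) ∞ M] in
-- Columns of an orthogonal matrix have unit length, which recovers the scale; a first column exists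
-- because `0 < n`.
theorem transition_unique {x : M} {u : Fin n → TangentSpace (𝓡 n) x} (hn : 0 < n)
    (h : LinearIndependent ℝ u) {r r' : ℝ} (hr : 0 < r) (hr' : 0 < r') {A A' : SO n}
    (hA : ∀ j, r • ∑ i, A.1 i j • u i = r' • ∑ i, A'.1 i j • u i) : r = r' ∧ A = A' := by
  have h1 : ∀ i j, r * A.1 i j = r' * A'.1 i j := by
    intro i j
    have h2 := hA j
    simp only [Finset.smul_sum, smul_smul] at h2
    exact congrFun (h.fintypeLinearCombination_injective h2) i
  have h2 : r ^ 2 = r' ^ 2 := by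
    have a1 := SO.sum_mul_self A ⟨0, hn⟩ ⟨0, hn⟩
    have a2 := SO.sum_mul_self A' ⟨0, hn⟩ ⟨0, hn⟩
    rw [if_pos rfl] at a1 a2
    have a3 : ∀ i, r ^ 2 * (ent A.1 i ⟨0, hn⟩ * ent A.1 i ⟨0, hn⟩) =
        r' ^ 2 * (ent A'.1 i ⟨0, hn⟩ * ent A'.1 i ⟨0, hn⟩) := fun i => by
      have := h1 i ⟨0, hn⟩
      change r * ent A.1 i ⟨0, hn⟩ = r' * ent A'.1 i ⟨0, hn⟩ at this
      calc _ = (r * ent A.1 i ⟨0, hn⟩) * (r * ent A.1 i ⟨0, hn⟩) := by ring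
        _ = _ := by rw [this]; ring
    rw [← mul_one (r ^ 2), ← a1, Finset.mul_sum, Finset.sum_congr rfl fun i _ => a3 i,
      ← Finset.mul_sum, a2, mul_one]
  have h3 : r = r' := by nlinarith
  refine ⟨h3, Subtype.ext (Matrix.ext fun i j => ?_)⟩
  have := h1 i j
  rw [← h3] at this
  exact mul_left_cancel₀ hr.ne' this

end Frames

/-! ### The fourth-order expression in different metrics and frames -/

section Operator

variable {n : ℕ} {M : Type u} [TopologicalSpace M] [ChartedSpace (EuclideanSpace ℝ (Fin n)) M]
  [IsManifold (𝓡 n) ∞ M] {g₀ g g' : Metric n M} {o : ManifoldOrientation n M} {U : Set M}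
  {e e' : Fin n → ∀ x : M, TangentSpace (𝓡 n) x}

theorem IsFrame.mono (he : IsFrame g e U) {U' : Set M} (hU : IsOpen U') (h : U' ⊆ U) :
    IsFrame g e U' :=
  ⟨hU, fun i => (he.smooth i).mono h, fun x hx => he.ortho x (h hx)⟩

theorem IsFrame.quartic_congr {F : Type*} [NormedAddCommGroup F] [NormedSpace ℝ F]
    {R : Mat n → F →L[ℝ] F} (he : IsFrame g e U) {f f' : M → (Fin 0 → Fin n) → F}
    (h : ∀ y ∈ U, f y = f' y) {x : M} (hx : x ∈ U) : quartic R g e f x = quartic R g e f' x := by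
  have h1 := fun y hy => he.nab_congr (R := R) h (x := y) hy
  have h2 := fun y hy => he.nab_congr (R := R) h1 (x := y) hy
  have h3 := fun y hy => he.nab_congr (R := R) h2 (x := y) hy
  rw [quartic, he.nab_congr h3 hx, h2 x hx, h1 x hx, h x hx, quartic]

theorem tens_eq_tensorAction {lam : Fin (n / 2) → ℤ} (V : Irrep.{v} n lam) (A : SO n)
    (T : (Fin 4 → Fin n) → V.carrier) : tens 4 V.cont.ext (ent A.1) T = tensorAction V A T := by
  funext J
  rw [tens_apply, tensorAction]
  exact Finset.sum_congr rfl fun K _ => by rw [V.cont.ext_apply]; rfl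

theorem IsConformalTo.exists_factor (hg : IsConformalTo g₀ g) (hg' : IsConformalTo g₀ g') :
    ∃ Ω : M → ℝ, ContMDiff (𝓡 n) 𝓘(ℝ, ℝ) ∞ Ω ∧ (∀ x, 0 < Ω x) ∧
      ∀ x (a b : TangentSpace (𝓡 n) x), g'.inner x a b = Ω x ^ 2 * g.inner x a b := by
  obtain ⟨Ω, h1, h2, h3⟩ := hg
  obtain ⟨Ω', h1', h2', h3'⟩ := hg'
  refine ⟨fun x => Ω' x * (Ω x)⁻¹, ?_, fun x => mul_pos (h2' x) (inv_pos.2 (h2 x)),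
    fun x a b => ?_⟩
  · refine h1'.mul (contMDiffOn_univ.1 ?_)
    exact (isSmoothFun_rpow h1.contMDiffOn (fun x _ => h2 x) (-1)).congr
      fun x _ => (Real.rpow_neg_one _).symm
  · rw [h3', h3]
    have := (h2 x).ne'
    field_simp

theorem IsConformalTo.refl (g₀ : Metric n M) : IsConformalTo g₀ g₀ :=
  ⟨fun _ => 1, contMDiff_const, fun _ => one_pos, fun x a b => by rw [one_pow, one_mul]⟩

variable {lam mu : Fin (n / 2) → ℤ} {V : Irrep.{v} n lam} {W : Irrep.{v} n mu} {w : ℝ}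
  {p : ((Fin 4 → Fin n) → V.carrier) →ₗ[ℂ] W.carrier}

theorem weightedSections_smooth (hg : IsConformalTo g₀ g) (he : IsOrthoFrameOn g o e U)
    (hU : IsOpen U) (φ : weightedSections g₀ o w V) :
    IsSmoothFun n (fun y => φ.1 y (fun i => e i y)) U :=
  φ.2.2.2 U e hU he.1 fun _ hx => he.isConfFrame hg hx

theorem isSmoothFun_fourthOrder (hg : IsConformalTo g₀ g) (he : IsOrthoFrameOn g o e U)
    (hU : IsOpen U) (φ : weightedSections g₀ o w V) :
    IsSmoothFun n (fun x => fourthOrder V g e (fun y => φ.1 y (fun i => e i y)) x) U := by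
  have hfin : FiniteDimensional ℝ V.carrier := FiniteDimensional.complexToReal V.carrier
  have hf := weightedSections_smooth hg he hU φ
  have hF := he.isFrame hU
  have h0 : IsSmoothFun n (fun y (_ : Fin 0 → Fin n) => φ.1 y (fun i => e i y)) U :=
    isSmoothFun_pi.2 fun _ => hf
  have h1 := hF.isSmoothFun_nab (R := V.cont.ext) h0
  have h2 := hF.isSmoothFun_nab (R := V.cont.ext) h1
  have h4 := hF.isSmoothFun_nab (R := V.cont.ext) (hF.isSmoothFun_nab (R := V.cont.ext) h2)
  have p0 := hF.isSmoothFun_schouten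
  have p1 := hF.isSmoothFun_nab (R := triv n) p0
  have p2 := hF.isSmoothFun_nab (R := triv n) p1
  refine IsSmoothFun.congr_on (f := quartic V.cont.ext g e
    (fun y _ => φ.1 y (fun i => e i y))) ?_ fun x hx =>
    hF.fourthOrder_eq V.cont.isSmoothRep V.cont.infAction_eq hf hx
  exact ContMDiffOn.add (ContMDiffOn.add (ContMDiffOn.add (ContMDiffOn.add h4
    ((isSmoothFun_mulT p0 h2).const_smul 10)) ((isSmoothFun_mulT (m := 3) p1 h1).const_smul 10))
    ((isSmoothFun_mulT (m := 4) p2 h0).const_smul 3))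
    ((isSmoothFun_mulT p0 (isSmoothFun_mulT p0 h0)).const_smul 9)

/-- The fourth-order expressions formed with two metrics of the conformal class and two
orthonormal frames. -/
theorem IsTopProjection.fourthOrder_eq (hn : 3 ≤ n) (hp : IsTopProjection V W (3 - w) p)
    (hg : IsConformalTo g₀ g) (hg' : IsConformalTo g₀ g') {U' : Set M} (hU : IsOpen U)
    (hU' : IsOpen U') (he : IsOrthoFrameOn g o e U) (he' : IsOrthoFrameOn g' o e' U')
    (φ : weightedSections g₀ o w V) {x : M} (hx : x ∈ U) (hx' : x ∈ U') {r : ℝ} (hr : 0 < r)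
    {A : SO n} (hA : ∀ j, e' j x = r • ∑ i, A.1 i j • e i x) :
    p (fourthOrder V g' e' (fun y => φ.1 y (fun i => e' i y)) x) =
      r ^ (-(w - 4)) • W.rep A⁻¹ (p (fourthOrder V g e (fun y => φ.1 y (fun i => e i y)) x)) := by
  have hfin : FiniteDimensional ℝ V.carrier := FiniteDimensional.complexToReal V.carrier
  obtain ⟨Ω, hΩ, hpos, hmet⟩ := hg.exists_factor hg'
  have hUU := hU.inter hU'
  have hf := (weightedSections_smooth hg he hU φ).mono (Set.inter_subset_left (t := U'))
  have hf' := (weightedSections_smooth hg' he' hU' φ).mono (Set.inter_subset_right (s := U))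
  have hF := (he.isFrame hU).mono hUU Set.inter_subset_left
  have hF' := (he'.isFrame hU').mono hUU Set.inter_subset_right
  -- Outside the overlap the transition matrix gets the default value `1`.
  have htrans : ∀ y, ∃ B : SO n, y ∈ U ∩ U' →
      (∀ i j, ent B.1 i j = (Ω y)⁻¹⁻¹ * g.inner y (e' j y) (e i y)) ∧
      ∀ j, e' j y = (Ω y)⁻¹ • ∑ i, B.1 i j • e i y := by
    intro y
    by_cases hy : y ∈ U ∩ U'
    · obtain ⟨B, hB⟩ := exists_transition (g := g) (o := o) (he.2 y hy.1).1 (he'.2 y hy.2).1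
        (he.2 y hy.1).2 (inv_pos.2 (hpos y)) fun i j => by
          have h1 := hmet y (e' i y) (e' j y)
          rw [(he'.2 y hy.2).2 i j] at h1
          have h2 := (hpos y).ne'
          by_cases hij : i = j
          · rw [if_pos hij] at h1 ⊢
            field_simp
            rw [mul_comm]; exact h1.symm
          · rw [if_neg hij] at h1 ⊢
            exact (mul_eq_zero.1 h1.symm).resolve_left (pow_ne_zero 2 h2)
      exact ⟨B, fun _ => hB⟩
    · exact ⟨1, fun h => absurd h hy⟩
  choose B hB using htrans
  have hBs : IsSmoothFun n (fun y => ent (B y).1) (U ∩ U') := by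
    refine isSmoothFun_pi.2 fun i => isSmoothFun_pi.2 fun j => ?_
    refine IsSmoothFun.congr_on (f := fun y => Ω y * g.inner y (e' j y) (e i y)) ?_ fun y hy => ?_
    · exact ContMDiffOn.mul hΩ.contMDiffOn (g.isSmoothFun_inner (hF'.smooth j) (hF.smooth i))
    · rw [(hB y hy).1, inv_inv]
  -- The change from `e` to `e'` is factored through a `g`-orthonormal frame: first a rotation with
  -- `g` fixed, then a rescaling of metric and frame.
  let e₁ : Fin n → ∀ y : M, TangentSpace (𝓡 n) y := fun b y => ∑ q, ent (B y).1 q b • e q y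
  have he₁ : ∀ y ∈ U ∩ U', ∀ b, e' b y = (Ω y)⁻¹ • e₁ b y := fun y hy b => (hB y hy).2 b
  have hG : IsGauge g e e₁ (U ∩ U') B :=
    { frame := hF
      frame' :=
        { isOpen := hUU
          smooth := fun b => IsSmoothField.sum fun q =>
            IsSmoothField.smul (isSmoothFun_pi.1 (isSmoothFun_pi.1 hBs q) b) (hF.smooth q)
          ortho := fun y hy i j => by
            simp only [e₁, map_sum, map_smul, sum_apply, smul_apply, hF.ortho y hy, smul_eq_mul,
              mul_ite, mul_one, mul_zero, Finset.sum_ite_eq', Finset.mem_univ,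
              if_true]
            rw [← SO.sum_mul_self (B y)]
            refine Finset.sum_congr rfl fun k _ => ?_
            ring }
      smooth := hBs
      change := fun _ _ _ => rfl }
  have hR : IsRescaling g g' e₁ e' (U ∩ U') Ω :=
    { frame := hG.frame'
      smooth := hΩ.contMDiffOn
      pos := fun y _ => hpos y
      metric := fun y _ => hmet y
      change := he₁ }
  -- The given scale and rotation at `x` must be `Ω⁻¹` and the value of `B` there.
  have hrA := transition_unique (by omega) (orthonormal_linearIndependent g (he.2 x hx).2) hr
    (inv_pos.2 (hpos x)) (A := A) (A' := B x) fun j => by rw [← hA, (hB x ⟨hx, hx'⟩).2]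
  have hphi : ∀ y ∈ U ∩ U', φ.1 y (fun i => e' i y) =
      Ω y ^ w • V.rep (B y)⁻¹ (φ.1 y (fun i => e i y)) := by
    intro y hy
    rw [φ.2.2.1 y _ _ (he.isConfFrame hg hy.1) (Ω y)⁻¹ (B y) (inv_pos.2 (hpos y))
      (fun j => (hB y hy).2 j), Real.inv_rpow (hpos y).le, ← Real.rpow_neg (hpos y).le, neg_neg]
  have hf0 : IsSmoothFun n (fun y (_ : Fin 0 → Fin n) => φ.1 y (fun i => e i y)) (U ∩ U') :=
    isSmoothFun_pi.2 fun _ => hf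
  have hf1 := hG.isSmoothFun_rep (V.cont.isSmoothRep.tens 0) hf0
  have hN := hp.isGood.isTensorIdeal
  have hxx : x ∈ U ∩ U' := ⟨hx, hx'⟩
  -- Density weight and coupling constant add up to three.
  have hmem := hN.quartic_rescaling hn hR (w := w) (by ring) hf1 hxx
  have hker : ∀ T, T ∈ idealOf (LinearMap.ker p) 4 → p T = 0 := fun T hT => hT
  have h1 := hker _ hmem
  rw [map_sub, sub_eq_zero, LinearMap.map_smul_of_tower,
    hG.quartic_eq V.cont.isSmoothRep hf0 hxx, tens_eq_tensorAction, hp.equivariant] at h1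
  rw [hF.fourthOrder_eq V.cont.isSmoothRep V.cont.infAction_eq hf hxx,
    hF'.fourthOrder_eq V.cont.isSmoothRep V.cont.infAction_eq hf' hxx, hrA.2, hrA.1,
    Real.inv_rpow (hpos x).le, ← Real.rpow_neg (hpos x).le, neg_neg, ← h1]
  refine congrArg p (hF'.quartic_congr (fun y hy => ?_) hxx)
  funext J
  rw [hphi y hy, Pi.smul_apply, tens_apply, Fintype.sum_unique, V.cont.ext_apply]
  simp
  rfl

end Operator

/-! ### The invariant operator -/

section Operator

variable {n : ℕ} {M : Type u} [TopologicalSpace M] [ChartedSpace (EuclideanSpace ℝ (Fin n)) M]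
  [IsManifold (𝓡 n) ∞ M] {g₀ : Metric n M} {o : ManifoldOrientation n M} {U : Set M}
  {e : Fin n → ∀ x : M, TangentSpace (𝓡 n) x}

/-- The tuple `u` at `x` is written as `r e A` in terms of a local orthonormal frame `e`. -/
structure IsFrameData (g₀ : Metric n M) (o : ManifoldOrientation n M) (x : M)
    (u : Fin n → TangentSpace (𝓡 n) x) (U : Set M)
    (e : Fin n → ∀ x : M, TangentSpace (𝓡 n) x) (r : ℝ) (A : SO n) : Prop where
  isOpen : IsOpen U
  mem : x ∈ U
  ortho : IsOrthoFrameOn g₀ o e U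
  pos : 0 < r
  change : ∀ j, u j = r • ∑ i, A.1 i j • e i x

theorem IsConfFrame.exists_frameData {x : M} {u : Fin n → TangentSpace (𝓡 n) x}
    (hu : IsConfFrame g₀ o x u) : ∃ U e r A, IsFrameData g₀ o x u U e r A := by
  obtain ⟨U, e, hU, hx, he⟩ := exists_orthoFrame g₀ o x
  obtain ⟨hb, r, hr, h⟩ := hu
  obtain ⟨A, -, hA⟩ := exists_transition (he.2 x hx).1 hb (he.2 x hx).2 hr h
  exact ⟨U, e, r, A, hU, hx, he, hr, hA⟩

theorem IsFrameData.isConfFrame {x : M} {u : Fin n → TangentSpace (𝓡 n) x} {r : ℝ} {A : SO n}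
    (h : IsFrameData g₀ o x u U e r A) : IsConfFrame g₀ o x u := by
  have hb := (h.ortho.2 x h.mem).1
  have he := (h.ortho.2 x h.mem).2
  refine ⟨hb.change (A := r • A.1) ?_ fun j => ?_, r, h.pos, fun i j => ?_⟩
  · rw [Matrix.det_smul, (Matrix.mem_specialOrthogonalGroup_iff.1 A.2).2, mul_one]
    exact pow_pos h.pos _
  · rw [h.change, Finset.smul_sum]
    exact Finset.sum_congr rfl fun i _ => by rw [smul_smul]; rfl
  · rw [h.change, h.change]
    simp only [map_smul, map_sum, smul_apply, sum_apply, he, smul_eq_mul, mul_ite, mul_one,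
      mul_zero, Finset.sum_ite_eq', Finset.mem_univ, if_true]
    have h1 := SO.sum_mul_self A i j
    have h2 : (if i = j then r ^ 2 else 0) = r ^ 2 * if i = j then 1 else 0 := by
      rw [mul_ite, mul_one, mul_zero]
    rw [h2, ← h1, Finset.mul_sum, Finset.mul_sum]
    exact Finset.sum_congr rfl fun k _ => by rw [ent, ent]; ring

theorem IsFrameData.trans {x : M} {u u' : Fin n → TangentSpace (𝓡 n) x} {r : ℝ} {A : SO n}
    (h : IsFrameData g₀ o x u U e r A) {s : ℝ} {B : SO n} (hs : 0 < s)
    (h' : ∀ j, u' j = s • ∑ i, B.1 i j • u i) : IsFrameData g₀ o x u' U e (s * r) (A * B) where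
  isOpen := h.isOpen
  mem := h.mem
  ortho := h.ortho
  pos := mul_pos hs h.pos
  change j := by
    rw [h', mul_smul]
    refine congrArg (s • ·) ?_
    have h1 : ∀ i, (A * B : SO n).1 i j = ∑ k, A.1 i k * B.1 k j := fun i => Matrix.mul_apply
    simp only [h.change, h1, Finset.smul_sum, Finset.sum_smul]
    rw [Finset.sum_comm]
    exact Finset.sum_congr rfl fun k _ => Finset.sum_congr rfl fun i _ => by
      rw [smul_smul, smul_smul, smul_smul]
      congr 1
      ring

variable {lam mu : Fin (n / 2) → ℤ} {V : Irrep.{v} n lam} {W : Irrep.{v} n mu} {w : ℝ}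
  {p : ((Fin 4 → Fin n) → V.carrier) →ₗ[ℂ] W.carrier}

/-- The value of the operator on the frame `r e A`. -/
def frameValue (p : ((Fin 4 → Fin n) → V.carrier) →ₗ[ℂ] W.carrier) (g₀ : Metric n M) (w' : ℝ)
    (e : Fin n → ∀ x : M, TangentSpace (𝓡 n) x) (r : ℝ) (A : SO n)
    (φ : ∀ x : M, (Fin n → TangentSpace (𝓡 n) x) → V.carrier) (x : M) : W.carrier :=
  r ^ (-w') • W.rep A⁻¹ (p (fourthOrder V g₀ e (fun y => φ y (fun i => e i y)) x))

/-- Independence of the local frame is the covariance of the expression for `g = g' = g₀`, where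
only a rotation and a constant scale at `x` intervene. -/
theorem IsTopProjection.frameValue_eq (hn : 3 ≤ n) (hp : IsTopProjection V W (3 - w) p) {x : M}
    {u : Fin n → TangentSpace (𝓡 n) x} {r r' : ℝ} {A A' : SO n} {U' : Set M}
    {e' : Fin n → ∀ x : M, TangentSpace (𝓡 n) x} (h : IsFrameData g₀ o x u U e r A)
    (h' : IsFrameData g₀ o x u U' e' r' A') (φ : weightedSections g₀ o w V) :
    frameValue p g₀ (w - 4) e' r' A' φ.1 x = frameValue p g₀ (w - 4) e r A φ.1 x := by
  have h1 : IsFrameData g₀ o x (fun j => e' j x) U e (r'⁻¹ * r) (A * A'⁻¹) :=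
    h.trans (inv_pos.2 h'.pos) fun j => by
      have h2 : ∀ i j, (A'⁻¹ : SO n).1 i j = A'.1 j i := fun i j => by rw [SO.coe_inv]; rfl
      have h3 : ∀ k, ∑ i, A'.1 j i * A'.1 k i = if j = k then 1 else 0 := SO.sum_self_mul A' j
      simp only [h'.change, h2, smul_comm _ r', ← Finset.smul_sum]
      rw [smul_smul, mul_inv_cancel₀ h'.pos.ne', one_smul]
      simp only [Finset.smul_sum, smul_smul]
      rw [Finset.sum_comm]
      simp only [← Finset.sum_smul, h3, ite_smul, one_smul, zero_smul, Finset.sum_ite_eq,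
        Finset.mem_univ, if_true]
  have key := hp.fourthOrder_eq hn (IsConformalTo.refl g₀) (IsConformalTo.refl g₀) h.isOpen
    h'.isOpen h.ortho h'.ortho φ h.mem h'.mem h1.pos h1.change
  rw [frameValue, frameValue, key, LinearMap.map_smul_of_tower, smul_smul, ← Module.End.mul_apply,
    ← map_mul, mul_inv_rev, inv_inv, inv_mul_cancel_left, ← Real.mul_rpow h'.pos.le h1.pos.le,
    mul_inv_cancel_left₀ h'.pos.ne']

/-- The invariant operator, on functions on frames. -/
def operatorFun (p : ((Fin 4 → Fin n) → V.carrier) →ₗ[ℂ] W.carrier) (g₀ : Metric n M)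
    (o : ManifoldOrientation n M) (w' : ℝ)
    (φ : ∀ x : M, (Fin n → TangentSpace (𝓡 n) x) → V.carrier) (x : M)
    (u : Fin n → TangentSpace (𝓡 n) x) : W.carrier :=
  open Classical in
  if h : IsConfFrame g₀ o x u then
    frameValue p g₀ w' h.exists_frameData.choose_spec.choose
      h.exists_frameData.choose_spec.choose_spec.choose
      h.exists_frameData.choose_spec.choose_spec.choose_spec.choose φ x
  else 0

theorem IsTopProjection.operatorFun_eq (hn : 3 ≤ n) (hp : IsTopProjection V W (3 - w) p) {x : M}
    {u : Fin n → TangentSpace (𝓡 n) x} {r : ℝ} {A : SO n} (h : IsFrameData g₀ o x u U e r A)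
    (φ : weightedSections g₀ o w V) :
    operatorFun p g₀ o (w - 4) φ.1 x u = frameValue p g₀ (w - 4) e r A φ.1 x := by
  have hu := h.isConfFrame
  rw [operatorFun, dif_pos hu]
  exact hp.frameValue_eq hn h hu.exists_frameData.choose_spec.choose_spec.choose_spec.choose_spec φ

theorem IsTopProjection.operatorFun_mem (hn : 3 ≤ n) (hp : IsTopProjection V W (3 - w) p)
    (φ : weightedSections g₀ o w V) :
    operatorFun p g₀ o (w - 4) φ.1 ∈ weightedSections g₀ o (w - 4) W := by
  refine ⟨fun x u hu => dif_neg hu, fun x u u' hu s B hs h => ?_, fun U e hU he hc => ?_⟩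
  · obtain ⟨U, e, r, A, hd⟩ := hu.exists_frameData
    rw [hp.operatorFun_eq hn hd, hp.operatorFun_eq hn (hd.trans hs h), frameValue, frameValue,
      LinearMap.map_smul_of_tower, smul_smul, ← Module.End.mul_apply, ← map_mul, mul_inv_rev,
      Real.mul_rpow hs.le hd.pos.le]
  · intro x hx
    have hfinV : FiniteDimensional ℝ V.carrier := FiniteDimensional.complexToReal V.carrier
    have hfinW : FiniteDimensional ℝ W.carrier := FiniteDimensional.complexToReal W.carrier
    obtain ⟨U', ε, hU', hx', hε⟩ := exists_orthoFrame g₀ o x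
    have hUU := hU.inter hU'
    have hF := (hε.isFrame hU').mono hUU Set.inter_subset_right
    let i₀ : Fin n := ⟨0, by omega⟩
    have he' : ∀ i, IsSmoothField (e i) (U ∩ U') := fun i => (he i).mono Set.inter_subset_left
    -- The squared scale of the conformal frame, read off from one frame vector so that it is
    -- visibly smooth; its square root is the factor relating the frame to an orthonormal one.
    let q : M → ℝ := fun y => g₀.inner y (e i₀ y) (e i₀ y)
    have hq : IsSmoothFun n q (U ∩ U') := g₀.isSmoothFun_inner (he' i₀) (he' i₀)
    have hscale : ∀ y ∈ U ∩ U', 0 < q y ∧ ∀ i j, g₀.inner y (e i y) (e j y) =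
        if i = j then (q y ^ (1 / 2 : ℝ)) ^ 2 else 0 := by
      intro y hy
      obtain ⟨-, r, hr, h⟩ := hc y hy.1
      have h1 : q y = r ^ 2 := by simpa using h i₀ i₀
      have h2 : 0 < q y := h1 ▸ pow_pos hr 2
      refine ⟨h2, fun i j => ?_⟩
      rw [h i j, ← h1, ← Real.rpow_mul_natCast h2.le]
      norm_num
    have hr : ∀ s : ℝ, IsSmoothFun n (fun y => q y ^ s) (U ∩ U') :=
      isSmoothFun_rpow hq fun y hy => (hscale y hy).1
    have htrans : ∀ y, ∃ B : SO n, y ∈ U ∩ U' →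
        (∀ i j, ent B.1 i j = (q y ^ (1 / 2 : ℝ))⁻¹ * g₀.inner y (e j y) (ε i y)) ∧
        ∀ j, e j y = q y ^ (1 / 2 : ℝ) • ∑ i, B.1 i j • ε i y := by
      intro y
      by_cases hy : y ∈ U ∩ U'
      · obtain ⟨B, hB⟩ := exists_transition (hε.2 y hy.2).1 (hc y hy.1).1 (hε.2 y hy.2).2
          (Real.rpow_pos_of_pos (hscale y hy).1 _) (hscale y hy).2
        exact ⟨B, fun _ => hB⟩
      · exact ⟨1, fun h => absurd h hy⟩
    choose B hB using htrans
    have hBs : IsSmoothFun n (fun y => ent (B y)⁻¹.1) (U ∩ U') := by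
      refine isSmoothFun_pi.2 fun i => isSmoothFun_pi.2 fun j => ?_
      refine IsSmoothFun.congr_on (f := fun y => q y ^ (-(1 / 2) : ℝ) *
        g₀.inner y (e i y) (ε j y)) ?_ fun y hy => ?_
      · exact ContMDiffOn.mul (hr _) (g₀.isSmoothFun_inner (he' i) (hF.smooth j))
      · rw [SO.coe_inv, Real.rpow_neg (hscale y hy).1.le, ← (hB y hy).1]
        rfl
    have h4 := (isSmoothFun_fourthOrder (IsConformalTo.refl g₀) hε hU' φ).mono
      (Set.inter_subset_right (s := U))
    have h5 := IsSmoothFun.clm h4 (LinearMap.toContinuousLinearMap (p.restrictScalars ℝ))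
    have h6 : IsSmoothFun n (fun y => W.cont.ext (ent (B y)⁻¹.1)) (U ∩ U') :=
      (W.cont.isSmoothRep.contDiff.contMDiff).comp_contMDiffOn hBs
    have h7 := (hr (1 / 2 * -(w - 4))).smul (h6.clm_apply h5)
    refine ((h7.congr fun y hy => ?_) x ⟨hx, hx'⟩ |>.contMDiffAt (hUU.mem_nhds ⟨hx, hx'⟩)
      ).contMDiffWithinAt
    rw [hp.operatorFun_eq hn (⟨hU', hy.2, hε, Real.rpow_pos_of_pos (hscale y hy).1 _,
      (hB y hy).2⟩ : IsFrameData g₀ o y (fun i => e i y) U' ε _ (B y)), frameValue,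
      ← Real.rpow_mul (hscale y hy).1.le]
    exact congrArg (q y ^ (1 / 2 * -(w - 4)) • ·) (W.cont.ext_apply _ _).symm

/-- Complex linearity is not automatic, since `nab` is built from real-linear maps; for the
connection term it rests on `ContRep.infMap_smul`. -/
theorem IsFrame.nab_csmul (he : IsFrame g₀ e U) {F : Type v} [NormedAddCommGroup F]
    [NormedSpace ℂ F] [FiniteDimensional ℂ F] (ρ : ContRep n F) (c : ℂ) {k : ℕ}
    {T : M → (Fin k → Fin n) → F} (hT : IsSmoothFun n T U) {x : M} (hx : x ∈ U) :
    nab ρ.ext g₀ e (fun y => c • T y) x = c • nab ρ.ext g₀ e T x := by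
  have h1 : ∀ a, cov (tens k ρ.ext) g₀ e (fun y => c • T y) a x =
      c • cov (tens k ρ.ext) g₀ e T a x := fun a => by
    rw [cov, cov, ← ρ.infMap_tensor_ext, ← ρ.infMap_tensor_ext, ContRep.infMap_smul, smul_add]
    refine congrArg (· + _) ?_
    exact mvfderiv_clm (hT.mdifferentiableAt he.isOpen hx)
      (c • ContinuousLinearMap.id ℝ ((Fin k → Fin n) → F)) (e a x)
  funext J
  rw [nab, h1]
  rfl

theorem mulT_csmul {F : Type*} [NormedAddCommGroup F] [NormedSpace ℂ F] {m k : ℕ}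
    (h : (Fin m → Fin n) → ℝ) (c : ℂ) (T : (Fin k → Fin n) → F) :
    mulT h (c • T) = c • mulT h T :=
  funext fun _ => smul_comm _ _ _

theorem IsFrame.quartic_add (he : IsFrame g₀ e U) {F : Type v} [NormedAddCommGroup F]
    [NormedSpace ℂ F] [FiniteDimensional ℂ F] (ρ : ContRep n F)
    {f f' : M → (Fin 0 → Fin n) → F} (hf : IsSmoothFun n f U) (hf' : IsSmoothFun n f' U) {x : M}
    (hx : x ∈ U) : quartic ρ.ext g₀ e (fun y => f y + f' y) x =
      quartic ρ.ext g₀ e f x + quartic ρ.ext g₀ e f' x := by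
  have hfin : FiniteDimensional ℝ F := FiniteDimensional.complexToReal F
  have s1 := he.isSmoothFun_nab (R := ρ.ext) hf
  have s1' := he.isSmoothFun_nab (R := ρ.ext) hf'
  have s2 := he.isSmoothFun_nab (R := ρ.ext) s1
  have s2' := he.isSmoothFun_nab (R := ρ.ext) s1'
  have h1 := fun y hy => he.nab_add (R := ρ.ext) hf hf' (x := y) hy
  have h2 := fun y hy => (he.nab_congr h1 hy).trans (he.nab_add (R := ρ.ext) s1 s1' (x := y) hy)
  have h3 := fun y hy => (he.nab_congr h2 hy).trans (he.nab_add (R := ρ.ext) s2 s2' (x := y) hy)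
  rw [quartic, he.nab_congr h3 hx, h2 x hx, h1 x hx, he.nab_add (he.isSmoothFun_nab s2)
    (he.isSmoothFun_nab s2') hx, quartic, quartic]
  simp only [mulT_add, smul_add]
  abel

theorem IsFrame.quartic_csmul (he : IsFrame g₀ e U) {F : Type v} [NormedAddCommGroup F]
    [NormedSpace ℂ F] [FiniteDimensional ℂ F] (ρ : ContRep n F) (c : ℂ)
    {f : M → (Fin 0 → Fin n) → F} (hf : IsSmoothFun n f U) {x : M}
    (hx : x ∈ U) : quartic ρ.ext g₀ e (fun y => c • f y) x = c • quartic ρ.ext g₀ e f x := by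
  have hfin : FiniteDimensional ℝ F := FiniteDimensional.complexToReal F
  have s1 := he.isSmoothFun_nab (R := ρ.ext) hf
  have s2 := he.isSmoothFun_nab (R := ρ.ext) s1
  have h1 := fun y hy => he.nab_csmul ρ c hf (x := y) hy
  have h2 := fun y hy => (he.nab_congr h1 hy).trans (he.nab_csmul ρ c s1 (x := y) hy)
  have h3 := fun y hy => (he.nab_congr h2 hy).trans (he.nab_csmul ρ c s2 (x := y) hy)
  rw [quartic, he.nab_congr h3 hx, h2 x hx, h1 x hx, he.nab_csmul ρ c (he.isSmoothFun_nab s2) hx,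
    quartic]
  simp only [mulT_csmul, smul_add, smul_comm _ c]

theorem frameValue_eq_quartic (w' r : ℝ) (A : SO n) (hU : IsOpen U) (he : IsOrthoFrameOn g₀ o e U)
    (φ : weightedSections g₀ o w V) {x : M} (hx : x ∈ U) :
    frameValue p g₀ w' e r A φ.1 x =
      r ^ (-w') • W.rep A⁻¹ (p (quartic V.cont.ext g₀ e (fun y _ => φ.1 y (fun i => e i y)) x)) := by
  have hfin : FiniteDimensional ℝ V.carrier := FiniteDimensional.complexToReal V.carrier
  rw [frameValue, (he.isFrame hU).fourthOrder_eq V.cont.isSmoothRep V.cont.infAction_eq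
    (weightedSections_smooth (IsConformalTo.refl g₀) he hU φ) hx]

theorem frameValue_add (w' r : ℝ) (A : SO n) (hU : IsOpen U) (he : IsOrthoFrameOn g₀ o e U)
    (φ ψ : weightedSections g₀ o w V) {x : M} (hx : x ∈ U) :
    frameValue p g₀ w' e r A (φ + ψ).1 x =
      frameValue p g₀ w' e r A φ.1 x + frameValue p g₀ w' e r A ψ.1 x := by
  have hf := fun ψ : weightedSections g₀ o w V => (isSmoothFun_pi (ι := Fin 0 → Fin n)).2 fun _ =>
    weightedSections_smooth (IsConformalTo.refl g₀) he hU ψ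
  rw [frameValue_eq_quartic w' r A hU he _ hx, frameValue_eq_quartic w' r A hU he _ hx,
    frameValue_eq_quartic w' r A hU he _ hx, ← smul_add, ← map_add, ← map_add,
    ← (he.isFrame hU).quartic_add V.cont (hf φ) (hf ψ) hx]
  rfl

theorem frameValue_smul (w' r : ℝ) (A : SO n) (hU : IsOpen U) (he : IsOrthoFrameOn g₀ o e U)
    (c : ℂ) (φ : weightedSections g₀ o w V) {x : M} (hx : x ∈ U) :
    frameValue p g₀ w' e r A (c • φ).1 x = c • frameValue p g₀ w' e r A φ.1 x := by
  have hf := (isSmoothFun_pi (ι := Fin 0 → Fin n)).2 fun _ =>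
    weightedSections_smooth (IsConformalTo.refl g₀) he hU φ
  rw [frameValue_eq_quartic w' r A hU he _ hx, frameValue_eq_quartic w' r A hU he _ hx,
    smul_comm c, ← LinearMap.map_smul _ c, ← LinearMap.map_smul _ c, ← (he.isFrame hU).quartic_csmul V.cont c hf hx]
  rfl

theorem IsTopProjection.isInvariantOperator (hn : 3 ≤ n) (hp : IsTopProjection V W (3 - w) p) :
    IsInvariantOperator g₀ o V W w (w - 4) p := by
  have hlin : ∀ (x : M) (u : Fin n → TangentSpace (𝓡 n) x), ¬ IsConfFrame g₀ o x u →
      ∀ φ : weightedSections g₀ o w V, operatorFun p g₀ o (w - 4) φ.1 x u = 0 :=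
    fun x u hu φ => dif_neg hu
  refine ⟨{ toFun := fun φ => ⟨operatorFun p g₀ o (w - 4) φ.1, hp.operatorFun_mem hn φ⟩
            map_add' := fun φ ψ => Subtype.ext (funext fun x => funext fun u => ?_)
            map_smul' := fun c φ => Subtype.ext (funext fun x => funext fun u => ?_) },
    fun g hg U e hU he φ x hx => ?_, fun D hD => ?_⟩
  · by_cases hu : IsConfFrame g₀ o x u
    · obtain ⟨U, e, r, A, h⟩ := hu.exists_frameData
      change operatorFun p g₀ o (w - 4) (φ + ψ).1 x u = operatorFun p g₀ o (w - 4) φ.1 x u +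
        operatorFun p g₀ o (w - 4) ψ.1 x u
      rw [hp.operatorFun_eq hn h, hp.operatorFun_eq hn h, hp.operatorFun_eq hn h,
        frameValue_add _ _ _ h.isOpen h.ortho _ _ h.mem]
    · change operatorFun p g₀ o (w - 4) (φ + ψ).1 x u = operatorFun p g₀ o (w - 4) φ.1 x u +
        operatorFun p g₀ o (w - 4) ψ.1 x u
      rw [hlin x u hu, hlin x u hu, hlin x u hu, add_zero]
  · by_cases hu : IsConfFrame g₀ o x u
    · obtain ⟨U, e, r, A, h⟩ := hu.exists_frameData
      change operatorFun p g₀ o (w - 4) (c • φ).1 x u = c • operatorFun p g₀ o (w - 4) φ.1 x u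
      rw [hp.operatorFun_eq hn h, hp.operatorFun_eq hn h,
        frameValue_smul _ _ _ h.isOpen h.ortho _ _ h.mem]
    · change operatorFun p g₀ o (w - 4) (c • φ).1 x u = c • operatorFun p g₀ o (w - 4) φ.1 x u
      rw [hlin x u hu, hlin x u hu, smul_zero]
  -- The operator is built with `g₀`; for another metric of the class its orthonormal frame is a
  -- conformal frame for `g₀`, and the covariance formula compares the two expressions.
  · obtain ⟨U', ε, r, A, h⟩ := (he.isConfFrame hg hx).exists_frameData
    change operatorFun p g₀ o (w - 4) φ.1 x _ = _
    rw [hp.operatorFun_eq hn h, hp.fourthOrder_eq hn (IsConformalTo.refl g₀) hg h.isOpen hU h.ortho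
      he φ h.mem hx h.pos h.change, frameValue]
  -- Uniqueness: `g₀`-orthonormal frames exist near every point, homogeneity fixes the value on all
  -- conformal frames, and elsewhere sections are zero by convention.
  · refine LinearMap.ext fun φ => Subtype.ext (funext fun x => funext fun u => ?_)
    change (D φ).1 x u = operatorFun p g₀ o (w - 4) φ.1 x u
    by_cases hu : IsConfFrame g₀ o x u
    · obtain ⟨U, e, r, A, h⟩ := hu.exists_frameData
      rw [hp.operatorFun_eq hn h, frameValue, ← hD g₀ (IsConformalTo.refl g₀) U e h.isOpen h.ortho φ
        x h.mem]
      exact (D φ).2.2.1 x _ u (h.ortho.isConfFrame (IsConformalTo.refl g₀) h.mem) r A h.pos h.change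
    · rw [hlin x u hu]
      exact (D φ).2.1 x u hu

end Operator

/-! ### Conformal invariance of the compression -/

theorem compressionIsInvariant {n : ℕ} (hn : 3 ≤ n) (lam : Fin (n / 2) → ℤ) (i : Fin (n / 2))
    (h : IsDominant n (lam + Pi.single i 2)) (V : Irrep.{v} n (lam + Pi.single i 2))
    (W : Irrep.{v} n (lam - Pi.single i 2)) :
    CompressionIsInvariant.{u} V W (-rhoShift n lam i + 2 - (n : ℝ) / 2)
      (-rhoShift n lam i - 2 - (n : ℝ) / 2) ∧
    CompressionIsInvariant.{u} W V (rhoShift n lam i + 2 - (n : ℝ) / 2)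
      (rhoShift n lam i - 2 - (n : ℝ) / 2) := by
  obtain ⟨⟨a1, a2, a3⟩, b1, b2, b3⟩ := exists_isTopProjection lam i h V W
  have e1 : -rhoShift n lam i - 2 - (n : ℝ) / 2 = -rhoShift n lam i + 2 - (n : ℝ) / 2 - 4 := by
    ring
  have e2 : rhoShift n lam i - 2 - (n : ℝ) / 2 = rhoShift n lam i + 2 - (n : ℝ) / 2 - 4 := by ring
  refine ⟨⟨a1, a2, ?_⟩, b1, b2, ?_⟩
  · intro M _ _ _ g₀ o p hp
    rw [e1]
    exact (a3 p hp).isInvariantOperator hn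
  · intro M _ _ _ g₀ o p hp
    rw [e2]
    exact (b3 p hp).isInvariantOperator hn

/-- The weights enter through equations, so that the literal forms of dimension four can be supplied
without rewriting inside the types of `V` and `W`. -/
theorem compressionIsInvariant_of_eq {n : ℕ} (hn : 3 ≤ n) (lam : Fin (n / 2) → ℤ) (i : Fin (n / 2))
    {mu nu : Fin (n / 2) → ℤ} (hmu : mu = lam + Pi.single i 2) (hnu : nu = lam - Pi.single i 2)
    (h : IsDominant n mu) {r w₁ w₂ w₃ w₄ : ℝ} (hr : rhoShift n lam i = r)
    (h₁ : w₁ = -r + 2 - (n : ℝ) / 2) (h₂ : w₂ = -r - 2 - (n : ℝ) / 2)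
    (h₃ : w₃ = r + 2 - (n : ℝ) / 2) (h₄ : w₄ = r - 2 - (n : ℝ) / 2)
    (V : Irrep.{v} n mu) (W : Irrep.{v} n nu) :
    CompressionIsInvariant.{u} V W w₁ w₂ ∧ CompressionIsInvariant.{u} W V w₃ w₄ := by
  subst hmu hnu hr h₁ h₂ h₃ h₄
  exact compressionIsInvariant hn lam i h V W

/-! ### Weights in dimension four -/

theorem isDominant_four {a b : ℤ} (h : |b| ≤ a) : IsDominant 4 ![a, b] := by
  refine ⟨fun i j hij => ?_, fun ho => absurd ho (by decide)⟩
  have hi : i = 0 := by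
    have h1 : i.1 < j.1 := hij
    have h2 : j.1 < 2 := j.2
    exact Fin.ext (by change i.1 = 0; omega)
  have hj : j = 1 := by
    have h1 : i.1 < j.1 := hij
    have h2 : j.1 < 2 := j.2
    exact Fin.ext (by change j.1 = 1; omega)
  subst hi hj
  exact h

theorem rhoShift_four_zero (a b : ℤ) : rhoShift 4 ![a, b] 0 = a + 1 := by
  rw [rhoShift]
  norm_num

theorem rhoShift_four_one (a b : ℤ) : rhoShift 4 ![a, b] 1 = b := by
  rw [rhoShift]
  norm_num

theorem four_add_single_zero (a b c : ℤ) :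
    (![a + c, b] : Fin (4 / 2) → ℤ) = ![a, b] + Pi.single 0 c := by
  funext i
  fin_cases i <;> simp

theorem four_add_single_one (a b c : ℤ) :
    (![a, b + c] : Fin (4 / 2) → ℤ) = ![a, b] + Pi.single 1 c := by
  funext i
  fin_cases i <;> simp

theorem four_sub_single_zero (a b c : ℤ) :
    (![a - c, b] : Fin (4 / 2) → ℤ) = ![a, b] - Pi.single 0 c := by
  funext i
  fin_cases i <;> simp

theorem four_sub_single_one (a b c : ℤ) :
    (![a, b - c] : Fin (4 / 2) → ℤ) = ![a, b] - Pi.single 1 c := by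
  funext i
  fin_cases i <;> simp

end ConformalOp

end

theorem theorem1 :
    -- all dimensions `n ≥ 3`
    (∀ (n : ℕ), 3 ≤ n → ∀ (lam : Fin (n / 2) → ℤ) (i : Fin (n / 2)),
      ConformalOp.IsDominant n (lam + Pi.single i 2) →
      ConformalOp.IsDominant n (lam - Pi.single i 2) →
      ∀ (V : ConformalOp.Irrep.{v} n (lam + Pi.single i 2))
        (W : ConformalOp.Irrep.{v} n (lam - Pi.single i 2)),
        ConformalOp.CompressionIsInvariant.{u} V W
          (-ConformalOp.rhoShift n lam i + 2 - (n : ℝ) / 2)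
          (-ConformalOp.rhoShift n lam i - 2 - (n : ℝ) / 2) ∧
        ConformalOp.CompressionIsInvariant.{u} W V
          (ConformalOp.rhoShift n lam i + 2 - (n : ℝ) / 2)
          (ConformalOp.rhoShift n lam i - 2 - (n : ℝ) / 2)) ∧
    -- dimension four
    (∀ a b : ℤ, |b| + 2 ≤ a →
      (∀ (V : ConformalOp.Irrep.{v} 4 ![a + 2, b]) (W : ConformalOp.Irrep.{v} 4 ![a - 2, b]),
        ConformalOp.CompressionIsInvariant.{u} V W (-((a : ℝ) + 1)) (-((a : ℝ) + 1) - 4) ∧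
        ConformalOp.CompressionIsInvariant.{u} W V ((a : ℝ) + 1) ((a : ℝ) + 1 - 4)) ∧
      (∀ (V : ConformalOp.Irrep.{v} 4 ![a, b + 2]) (W : ConformalOp.Irrep.{v} 4 ![a, b - 2]),
        ConformalOp.CompressionIsInvariant.{u} V W (-(b : ℝ)) (-(b : ℝ) - 4) ∧
        ConformalOp.CompressionIsInvariant.{u} W V (b : ℝ) ((b : ℝ) - 4))) ∧
    -- algebraic Weyl tensor densities in dimension four
    (∀ (V : ConformalOp.Irrep.{v} 4 ![2, 2]) (W : ConformalOp.Irrep.{v} 4 ![2, -2]),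
      ConformalOp.CompressionIsInvariant.{u} V W 0 (-4) ∧
      ConformalOp.CompressionIsInvariant.{u} W V 0 (-4)) := by
  open ConformalOp in
  refine ⟨fun n hn lam i h _ V W => compressionIsInvariant hn lam i h V W,
    fun a b hab => ⟨?_, ?_⟩, ?_⟩
  · exact compressionIsInvariant_of_eq (by norm_num) ![a, b] 0 (four_add_single_zero a b 2)
      (four_sub_single_zero a b 2) (isDominant_four (by linarith)) (rhoShift_four_zero a b)
      (by push_cast; ring) (by push_cast; ring) (by push_cast; ring) (by push_cast; ring)
  · exact compressionIsInvariant_of_eq (by norm_num) ![a, b] 1 (four_add_single_one a b 2)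
      (four_sub_single_one a b 2) (isDominant_four ((abs_add_le b 2).trans (by simpa using hab)))
      (rhoShift_four_one a b)
      (by push_cast; ring) (by push_cast; ring) (by push_cast; ring) (by push_cast; ring)
  -- Take `λ = (2, 0)` and the second coordinate: the shifted entry is zero, so both operators go
  -- from weight `0` to weight `-4`.
  · exact compressionIsInvariant_of_eq (by norm_num) ![2, 0] 1 (four_add_single_one 2 0 2)
      (four_sub_single_one 2 0 2) (isDominant_four (by norm_num)) (rhoShift_four_one 2 0)
      (by push_cast; ring) (by push_cast; ring) (by push_cast; ring) (by push_cast; ring)
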